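/- Let $T>0$, $H\in(1/2,1)$, $d\in\mathbb N$, $1<p<\infty$ and $n,m\in\mathbb R$. Let $(\beta^k)_{k\ge1}$ be a sequence of independent fractional Brownian motions $(\beta^k_t)_{t\in[0,T]}$ of index $H$ on a probability space $(\Omega,\mathcal F,P)$. Put $\alpha_H=H(2H-1)$. *Sobolev spaces.* $H_p^n=\{u: (1-\Delta)^{n/2}u\in L_p(\mathbb R^d)\}$, for real tempered distributions $u$ on $\mathbb R^d$, with $\|u\|_{H_p^n}=\|(1-\Delta)^{n/2}u\|_{L_p}$. For $v=(v^k)_k$ with $v^k\in H_p^n$, $\|v\|_{H_p^n(l_2)}=\big\|\,|((1-\Delta)^{n/2}v^k)_k|_{l_2}\big\|_{L_p}$. Write $(u,\phi)$ for the pairing with $\phi\in C_0^\infty(\mathbb R^d)$. *Malliavin derivative.* For a normed space $V$, let $\|\phi\|_{|\mathcal H_V|}^2=\alpha_H\int_{[0,T]^2}\|\phi(t)\|\,\|\phi(s)\|\,|t-s|^{2H-2}\,ds\,dt$, and $\|\psi\|^2_{|\mathcal H|\otimes|\mathcal H_V|}=\alpha_H^2\int_{[0,T]^4}\|\psi(t,\theta)\|\,\|\psi(s,\eta)\|\,|t-s|^{2H-2}|\theta-\eta|^{2H-2}\,d\theta\,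 d\eta\, ds\, dt$; $|\mathcal H|=|\mathcal H_{\mathbb R}|$ is the space of functions of finite norm. For a fractional Brownian motion $\beta$ let $\mathcal S_\beta$ be the set of $F=f(\beta(\phi_1),\dots,\beta(\phi_r))$ with $f\in C_b^\infty(\mathbb R^r)$ and $\phi_i\in|\mathcal H|$ (where $\beta(\phi)$ is the Wiener integral), and $D^\beta_\theta F=\sum_i\partial_if(\beta(\phi_1),\dots,\beta(\phi_r))\,\phi_i(\theta)$. For $C\subseteq V$ let $\mathcal S_\beta(\mathcal E_C)$ be the set of processes $\sum_{i=1}^rF_i1_{(t_{i-1},t_i]}(t)\,v_i$ with $F_i\in\mathcal S_\beta$, $0\le t_0<\dots<t_r\le T$ and $v_i\in C$, and let $D^\beta$ act on the $F_i$. $\mathbb D_\beta^{1,p}(|\mathcal H_V|)$ is the closure of $\mathcal S_\beta(\mathcal E_V)$ in the norm given by $\|g\|^p=E\|g\|_{|\mathcal H_V|}^p+E\|D^\beta g\|^p_{|\mathcal H|\otimes|\mathcal H_V|}$, and $D^\beta$ is extended to it by continuity. *The space of coefficients.* $\mathbb L_H^{1,p}(H_p^n,l_2)$ is the set of $g=(g^k)_k$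 with $g^k\in\mathbb D_{\beta^k}^{1,p}(|\mathcal H_{H_p^n}|)$ for all $k$ and finite norm, where, with $D_\theta g=(D_\theta^{\beta^k}g^k)_k$, $$\|g\|^p_{\mathbb L_H^{1,p}(H_p^n,l_2)}=E\int_0^T\|g(s)\|^p_{H_p^n(l_2)}ds+E\int_0^T\Big(\int_0^T\|D_\theta g(s)\|_{H_p^n(l_2)}^{1/H}d\theta\Big)^{pH}ds .$$ $\widetilde{\mathbb L}_H^{1,p}(H_p^n,l_2)$ is the set of its elements that are limits, in this norm, of elements $g_j$ of $\mathbb L_H^{1,p}(H_p^n,l_2)$ such that, for some $K_j$, $g_j^k\in\mathcal S_{\beta^k}(\mathcal E_{C_0^\infty})$ for $k\le K_j$ and $g_j^k=0$ for $k>K_j$. *The solution space.* Let $p\ge2$ and $\mathbb H_p^n=L_p(\Omega\times[0,T];H_p^n)$. $\mathcal H_{p,H}^n$ is the set of random processes $u=(u(t,\cdot))_{t\in[0,T]}$ with values in the real tempered distributions such that $u(0,\cdot)\in L_p(\Omega;H_p^{n-2/p})$, $u\in\mathbb H_p^n$, all $\partial_i\partial_ju\in\mathbb H_p^{n-2}$,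 and there are $f\in\mathbb H_p^{n-2}$ and $g\in\widetilde{\mathbb L}_H^{1,p}(H_p^{n-1},l_2)$ such that for every $\phi\in C_0^\infty(\mathbb R^d)$, almost surely, for all $t\in[0,T]$, $$(u(t,\cdot),\phi)=(u(0,\cdot),\phi)+\int_0^t(f(s,\cdot),\phi)\,ds+\sum_{k=1}^\infty\int_0^t(g^k(s,\cdot),\phi)\,\delta\beta^k_s ,$$ where the integrals on the right are Skorohod integrals, and the series converges in $L_2(\Omega)$ and is taken in a version that is almost surely continuous in $t$. Its norm is $$\|u\|_{\mathcal H_{p,H}^n}=\big(E\|u(0,\cdot)\|^p_{H_p^{n-2/p}}\big)^{1/p}+\sum_{i,j}\|\partial_i\partial_ju\|_{\mathbb H_p^{n-2}}+\|f\|_{\mathbb H_p^{n-2}}+\|g\|_{\mathbb L_H^{1,p}(H_p^{n-1},l_2)} .$$ **Proposition.** (a) The operator $(1-\Delta)^{m/2}$ maps $\widetilde{\mathbb L}_H^{1,p}(H_p^n,l_2)$ isometrically onto $\widetilde{\mathbb L}_H^{1,p}(H_p^{n-m},l_2)$. (b) If $p\ge2$, it maps $\mathcal H_{p,H}^n$ isometrically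 onto $\mathcal H_{p,H}^{n-m}$. -/

import Mathlib

open MeasureTheory ProbabilityTheory Filter Topology Set
open scoped ENNReal SchwartzMap LineDeriv FourierTransform ComplexConjugate

noncomputable section

namespace FracHeat

abbrev Rd (d : ℕ) := EuclideanSpace ℝ (Fin d)

/-- Real-valued Schwartz functions on `ℝ^d`. -/
abbrev Schw (d : ℕ) := 𝓢(Rd d, ℝ)

/-- Real-valued tempered distributions on `ℝ^d`. -/
abbrev Dist (d : ℕ) := 𝓢(Rd d, ℝ) →L[ℝ] ℝ

/-- The symbol of `(1 - Δ)^{s/2}` for the Fourier transform `∫ e^{-2πi x·ξ} φ(x) dx`. -/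
def symb (d : ℕ) (s : ℝ) (ξ : Rd d) : ℂ :=
  (((1 + (2 * Real.pi) ^ 2 * ‖ξ‖ ^ 2) ^ (s / 2) : ℝ) : ℂ)

/-- `(1 - Δ)^{s/2}` on real Schwartz functions. The Fourier multiplier is applied to the
complexification; its value is real by `ofReal_besselSchw`. -/
def besselSchw (d : ℕ) (s : ℝ) : Schw d →L[ℝ] Schw d :=
  (SchwartzMap.postcompCLM (𝕜 := ℝ) Complex.reCLM).comp
    (((SchwartzMap.fourierMultiplierCLM ℂ (symb d s)).restrictScalars ℝ).comp
      (SchwartzMap.postcompCLM (𝕜 := ℝ) Complex.ofRealCLM))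

theorem symb_temperate (d : ℕ) (s : ℝ) : (symb d s).HasTemperateGrowth := by
  have h : (fun ξ : Rd d => (1 + ‖(2 * Real.pi) • ξ‖ ^ 2) ^ (s / 2)).HasTemperateGrowth := by
    have h1 : (fun x : Rd d => (1 + ‖x‖ ^ 2) ^ (s / 2)).HasTemperateGrowth := by fun_prop
    have h2 : (fun x : Rd d => (2 * Real.pi) • x).HasTemperateGrowth := by fun_prop
    exact h1.comp h2
  have h3 : symb d s =
      fun ξ : Rd d => (((1 + ‖(2 * Real.pi) • ξ‖ ^ 2) ^ (s / 2) : ℝ) : ℂ) := by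
    funext ξ
    simp only [symb, norm_smul, mul_pow, Real.norm_eq_abs, sq_abs]
  rw [h3]
  fun_prop

theorem symb_mul (d : ℕ) (a b : ℝ) : symb d a * symb d b = symb d (a + b) := by
  funext ξ
  have : (0 : ℝ) < 1 + (2 * Real.pi) ^ 2 * ‖ξ‖ ^ 2 := by positivity
  simp only [Pi.mul_apply, symb, ← Complex.ofReal_mul, ← Real.rpow_add this]
  congr 2
  ring

theorem multiplier_real (d : ℕ) (s : ℝ) (φ : Schw d) (x : Rd d) :
    conj (SchwartzMap.fourierMultiplierCLM ℂ (symb d s)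
      (SchwartzMap.postcompCLM (𝕜 := ℝ) Complex.ofRealCLM φ) x) =
    SchwartzMap.fourierMultiplierCLM ℂ (symb d s)
      (SchwartzMap.postcompCLM (𝕜 := ℝ) Complex.ofRealCLM φ) x := by
  set ψ : 𝓢(Rd d, ℂ) := SchwartzMap.postcompCLM (𝕜 := ℝ) Complex.ofRealCLM φ with hψ
  have h0 : ∀ ξ, conj ((𝓕 ψ) ξ) = (𝓕 ψ) (-ξ) := by
    intro ξ
    rw [SchwartzMap.fourier_coe, Real.fourier_eq', Real.fourier_eq', ← integral_conj]
    congr 1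
    funext v
    simp only [smul_eq_mul, map_mul, ← Complex.exp_conj, inner_neg_right]
    congr 1
    · congr 1
      simp [Complex.conj_ofNat]
    · simp [hψ]
  rw [SchwartzMap.fourierMultiplierCLM_apply, SchwartzMap.fourierInv_coe, Real.fourierInv_eq',
    ← integral_conj, ← integral_neg_eq_self]
  congr 1
  funext v
  rw [SchwartzMap.smulLeftCLM_apply_apply (symb_temperate d s),
    SchwartzMap.smulLeftCLM_apply_apply (symb_temperate d s)]
  simp only [smul_eq_mul, map_mul, ← Complex.exp_conj, h0, neg_neg, inner_neg_left]
  congr 1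
  · congr 1
    simp [Complex.conj_ofNat]
  · congr 1
    simp [symb]

theorem ofReal_besselSchw (d : ℕ) (s : ℝ) (φ : Schw d) :
    SchwartzMap.postcompCLM (𝕜 := ℝ) Complex.ofRealCLM (besselSchw d s φ) =
      SchwartzMap.fourierMultiplierCLM ℂ (symb d s)
        (SchwartzMap.postcompCLM (𝕜 := ℝ) Complex.ofRealCLM φ) := by
  ext x
  exact Complex.conj_eq_iff_re.mp (multiplier_real d s φ x)

theorem besselSchw_besselSchw (d : ℕ) (a b : ℝ) (φ : Schw d) :
    besselSchw d a (besselSchw d b φ) = besselSchw d (a + b) φ := by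
  change SchwartzMap.postcompCLM (𝕜 := ℝ) Complex.reCLM
    (SchwartzMap.fourierMultiplierCLM ℂ (symb d a)
      (SchwartzMap.postcompCLM (𝕜 := ℝ) Complex.ofRealCLM (besselSchw d b φ))) = _
  rw [ofReal_besselSchw, SchwartzMap.fourierMultiplierCLM_fourierMultiplierCLM_apply
    (symb_temperate d a) (symb_temperate d b), symb_mul]
  rfl

theorem besselSchw_zero (d : ℕ) (φ : Schw d) : besselSchw d 0 φ = φ := by
  have h : symb d 0 = fun _ => 1 := by
    funext ξ
    simp [symb]
  ext x
  change Complex.re (SchwartzMap.fourierMultiplierCLM ℂ (symb d 0)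
      (SchwartzMap.postcompCLM (𝕜 := ℝ) Complex.ofRealCLM φ) x) = _
  rw [h]
  simp

/-- `(1 - Δ)^{s/2}` on tempered distributions, by transposition. -/
def bessel (d : ℕ) (s : ℝ) : Dist d →ₗ[ℝ] Dist d where
  toFun u := u.comp (besselSchw d s)
  map_add' _ _ := rfl
  map_smul' _ _ := rfl

theorem bessel_bessel (d : ℕ) (a b : ℝ) (u : Dist d) :
    bessel d a (bessel d b u) = bessel d (a + b) u := by
  ext φ
  change u (besselSchw d b (besselSchw d a φ)) = u (besselSchw d (a + b) φ)
  rw [besselSchw_besselSchw, add_comm]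

theorem bessel_zero (d : ℕ) (u : Dist d) : bessel d 0 u = u := by
  ext φ
  change u (besselSchw d 0 φ) = u φ
  rw [besselSchw_zero]

/-- `∂_i ∂_j` on tempered distributions. -/
def distDeriv2 (d : ℕ) (i j : Fin d) (u : Dist d) : Dist d :=
  u.comp ((LineDeriv.lineDerivOpCLM ℝ (Schw d) (EuclideanSpace.single i (1 : ℝ))).comp
    (LineDeriv.lineDerivOpCLM ℝ (Schw d) (EuclideanSpace.single j (1 : ℝ))))

section Sobolev

variable (d : ℕ) (p : ℝ≥0∞) [Fact (1 ≤ p)]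

theorem integrable_mul_schw (f : Lp ℝ p (volume : Measure (Rd d))) (φ : Schw d) :
    Integrable (fun x => f x * φ x) := by
  have hpq : ENNReal.HolderConjugate p (1 - p⁻¹)⁻¹ :=
    ENNReal.HolderConjugate.inv_one_sub_inv' (Fact.out : 1 ≤ p)
  exact MemLp.integrable_mul (Lp.memLp f) (φ.memLp (1 - p⁻¹)⁻¹)

theorem lp_eq_of_pairing (f g : Lp ℝ p (volume : Measure (Rd d)))
    (h : ∀ φ : Schw d, ∫ x, f x * φ x = ∫ x, g x * φ x) : f = g := by
  apply Lp.ext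
  apply ae_eq_of_integral_contDiff_smul_eq
  · exact (Lp.memLp f).locallyIntegrable Fact.out
  · exact (Lp.memLp g).locallyIntegrable Fact.out
  · intro φ hφ hc
    simpa [mul_comm] using h (hc.toSchwartzMap hφ)

/-- `H_p^n(ℝ^d)`: the tempered distributions `u` such that `(1 - Δ)^{n/2} u` is (integration
against) a function in `L_p(ℝ^d)`. -/
def sobolevSubmodule (n : ℝ) : Submodule ℝ (Dist d) where
  carrier := {u | ∃ f : Lp ℝ p (volume : Measure (Rd d)),
    ∀ φ : Schw d, bessel d n u φ = ∫ x, f x * φ x}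
  zero_mem' := ⟨0, fun φ => by
    rw [map_zero, integral_congr_ae (g := fun _ => 0)]
    · simp
    · filter_upwards [Lp.coeFn_zero ℝ p (volume : Measure (Rd d))] with x hx
      rw [hx, Pi.zero_apply, zero_mul]⟩
  add_mem' := by
    rintro u v ⟨f, hf⟩ ⟨g, hg⟩
    refine ⟨f + g, fun φ => ?_⟩
    rw [map_add, add_apply, hf, hg,
      ← integral_add (integrable_mul_schw d p f φ) (integrable_mul_schw d p g φ)]
    apply integral_congr_ae
    filter_upwards [Lp.coeFn_add f g] with x hx
    rw [hx, Pi.add_apply, add_mul]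
  smul_mem' := by
    rintro c u ⟨f, hf⟩
    refine ⟨c • f, fun φ => ?_⟩
    rw [map_smul, smul_apply, hf, smul_eq_mul, ← integral_const_mul]
    apply integral_congr_ae
    filter_upwards [Lp.coeFn_smul c f] with x hx
    rw [hx, Pi.smul_apply, smul_eq_mul, mul_assoc]

/-- The space `H_p^n(ℝ^d)` as a type, normed by `‖u‖ = ‖(1 - Δ)^{n/2} u‖_{L_p}`. -/
def Sob (n : ℝ) : Type := sobolevSubmodule d p n

namespace Sob

variable {d p} {n : ℝ}

instance : AddCommGroup (Sob d p n) := inferInstanceAs (AddCommGroup (sobolevSubmodule d p n))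

instance : Module ℝ (Sob d p n) := inferInstanceAs (Module ℝ (sobolevSubmodule d p n))

/-- The tempered distribution underlying an element of `H_p^n`. -/
def toDist : Sob d p n →ₗ[ℝ] Dist d := (sobolevSubmodule d p n).subtype

theorem exists_lp (u : Sob d p n) : ∃ f : Lp ℝ p (volume : Measure (Rd d)),
    ∀ φ : Schw d, bessel d n (toDist u) φ = ∫ x, f x * φ x :=
  u.2

/-- The function `(1 - Δ)^{n/2} u ∈ L_p(ℝ^d)`, for `u ∈ H_p^n`. -/
def toLp : Sob d p n →ₗ[ℝ] Lp ℝ p (volume : Measure (Rd d)) where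
  toFun u := (exists_lp u).choose
  map_add' u v := lp_eq_of_pairing d p _ _ fun φ => by
    rw [← (exists_lp (u + v)).choose_spec φ, map_add, map_add, add_apply,
      (exists_lp u).choose_spec φ, (exists_lp v).choose_spec φ,
      ← integral_add (integrable_mul_schw d p _ φ) (integrable_mul_schw d p _ φ)]
    apply integral_congr_ae
    filter_upwards [Lp.coeFn_add (exists_lp u).choose (exists_lp v).choose] with x hx
    rw [hx, Pi.add_apply, add_mul]
  map_smul' c u := lp_eq_of_pairing d p _ _ fun φ => by
    rw [← (exists_lp (c • u)).choose_spec φ, map_smul, map_smul, smul_apply,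
      (exists_lp u).choose_spec φ, smul_eq_mul, ← integral_const_mul]
    apply integral_congr_ae
    filter_upwards [Lp.coeFn_smul c (exists_lp u).choose] with x hx
    rw [RingHom.id_apply, hx, Pi.smul_apply, smul_eq_mul, mul_assoc]

theorem bessel_toDist (u : Sob d p n) (φ : Schw d) :
    bessel d n (toDist u) φ = ∫ x, toLp u x * φ x :=
  (exists_lp u).choose_spec φ

theorem toLp_injective : Function.Injective (toLp : Sob d p n →ₗ[ℝ] _) := by
  intro u v h
  have h1 : bessel d n (toDist u) = bessel d n (toDist v) := by
    ext φ
    rw [bessel_toDist, bessel_toDist, h]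
  have h2 := congrArg (bessel d (-n)) h1
  rw [bessel_bessel, bessel_bessel, neg_add_cancel, bessel_zero, bessel_zero] at h2
  exact Subtype.ext h2

instance : NormedAddCommGroup (Sob d p n) :=
  NormedAddCommGroup.induced (Sob d p n) (Lp ℝ p (volume : Measure (Rd d))) toLp toLp_injective

instance : NormedSpace ℝ (Sob d p n) := NormedSpace.induced ℝ (Sob d p n) _ toLp

theorem norm_def (u : Sob d p n) : ‖u‖ = ‖toLp u‖ := rfl

/-- `(1 - Δ)^{m/2} : H_p^n → H_p^{n-m}`. -/
def besselSob (m : ℝ) : Sob d p n →ₗ[ℝ] Sob d p (n - m) where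
  toFun u := ⟨bessel d m (toDist u), toLp u, fun φ => by
    rw [bessel_bessel, sub_add_cancel, bessel_toDist]⟩
  map_add' u v := Subtype.ext (by
    change bessel d m (toDist (u + v)) = bessel d m (toDist u) + bessel d m (toDist v)
    rw [map_add, map_add])
  map_smul' c u := Subtype.ext (by
    change bessel d m (toDist (c • u)) = c • bessel d m (toDist u)
    rw [map_smul, map_smul])

end Sob

/-- The elements of `H_p^n` that are given by functions in `C_0^∞(ℝ^d)`. -/
def testSob (n : ℝ) : Set (Sob d p n) :=
  {u | ∃ φ : Schw d, HasCompactSupport φ ∧ ∀ ψ : Schw d, u.toDist ψ = ∫ x, φ x * ψ x}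

/-- The norm of `H_p^n` on all tempered distributions, `∞` outside of `H_p^n`. -/
def sobNorm (n : ℝ) (u : Dist d) : ℝ≥0∞ :=
  ⨅ (v : Sob d p n) (_ : v.toDist = u), ‖v‖ₑ

/-- The norm of `H_p^n(l_2)`: the `L_p` norm of `x ↦ |((1 - Δ)^{n/2} v^k (x))_k|_{l_2}`. -/
def l2Norm {n : ℝ} (v : ℕ → Sob d p n) : ℝ≥0∞ :=
  eLpNorm (fun x => (∑' k, ‖(v k).toLp x‖ₑ ^ (2 : ℝ)) ^ (1 / 2 : ℝ)) p
    (volume : Measure (Rd d))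

end Sobolev

section Deterministic

variable {V : Type*} [NormedAddCommGroup V] [NormedSpace ℝ V]

/-- The kernel `α_H |t - s|^{2H-2}`, `α_H = H (2H - 1)`. -/
def kernelH (H t s : ℝ) : ℝ := H * (2 * H - 1) * |t - s| ^ (2 * H - 2)

/-- Lebesgue measure on `[0,T]`. -/
def leb (T : ℝ) : Measure ℝ := volume.restrict (Icc 0 T)

/-- The norm of `|𝓗_V|`. -/
def absNorm (H T : ℝ) (φ : ℝ → V) : ℝ≥0∞ :=
  (∫⁻ t, ∫⁻ s, ‖φ t‖ₑ * ‖φ s‖ₑ * ENNReal.ofReal (kernelH H t s) ∂leb T ∂leb T) ^ (1 / 2 : ℝ)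

/-- The norm of `|𝓗| ⊗ |𝓗_V|`. -/
def absNorm2 (H T : ℝ) (ψ : ℝ → ℝ → V) : ℝ≥0∞ :=
  (∫⁻ t, ∫⁻ θ, ∫⁻ s, ∫⁻ η, ‖ψ t θ‖ₑ * ‖ψ s η‖ₑ * ENNReal.ofReal (kernelH H t s) *
    ENNReal.ofReal (kernelH H θ η) ∂leb T ∂leb T ∂leb T ∂leb T) ^ (1 / 2 : ℝ)

/-- The inner product of `𝓗`, for functions in `|𝓗|`. -/
def innerH (H T : ℝ) (φ ψ : ℝ → ℝ) : ℝ :=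
  ∫ t, ∫ s, φ t * ψ s * kernelH H t s ∂leb T ∂leb T

/-- A grid `0 ≤ t_0 < ⋯ < t_m ≤ T`. -/
structure Grid (T : ℝ) where
  m : ℕ
  t : Fin (m + 1) → ℝ
  strictMono : StrictMono t
  mem : ∀ i, t i ∈ Icc 0 T

/-- The indicator function of `(t_{i-1}, t_i]`. -/
def Grid.ind {T : ℝ} (π : Grid T) (i : Fin π.m) (s : ℝ) : ℝ :=
  (Ioc (π.t i.castSucc) (π.t i.succ)).indicator (fun _ => 1) s

end Deterministic

section Malliavin

variable {Ω : Type*} [MeasurableSpace Ω]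

/-- `(β_t)_{t ∈ [0,T]}` is a fractional Brownian motion of index `H`. -/
structure IsFBM (H T : ℝ) (P : Measure Ω) (β : ℝ → Ω → ℝ) : Prop where
  measurable : ∀ t ∈ Icc 0 T, Measurable (β t)
  gaussian : IsGaussianProcess (fun (t : Icc (0 : ℝ) T) ω => β t ω) P
  centered : ∀ t ∈ Icc 0 T, ∫ ω, β t ω ∂P = 0
  covariance : ∀ t ∈ Icc 0 T, ∀ s ∈ Icc 0 T,
    ∫ ω, β t ω * β s ω ∂P = (t ^ (2 * H) + s ^ (2 * H) - |t - s| ^ (2 * H)) / 2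

/-- `φ ∈ |𝓗|` and `X = β(φ)`: the map `1_{(a,b]} ↦ β_b - β_a`, extended linearly to step
functions and by continuity to `|𝓗|`, with values in `L_2(Ω)`. -/
def IsWienerIntegral (H T : ℝ) (P : Measure Ω) (β : ℝ → Ω → ℝ) (φ : ℝ → ℝ) (X : Ω → ℝ) : Prop :=
  AEStronglyMeasurable φ (leb T) ∧ absNorm H T φ < ∞ ∧ MemLp X 2 P ∧
  ∃ (π : ℕ → Grid T) (c : ∀ j, Fin (π j).m → ℝ),
    Tendsto (fun j => absNorm H T fun s => φ s - ∑ i, c j i * (π j).ind i s) atTop (𝓝 0) ∧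
    Tendsto (fun j => eLpNorm (fun ω => X ω - ∑ i, c j i *
      (β ((π j).t i.succ) ω - β ((π j).t i.castSucc) ω)) 2 P) atTop (𝓝 0)

/-- A smooth cylindrical random variable `F = f(β(φ_1), …, β(φ_n))`, with `f ∈ C_b^∞(ℝ^n)`. -/
structure Cyl (H T : ℝ) (P : Measure Ω) (β : ℝ → Ω → ℝ) where
  n : ℕ
  f : (Fin n → ℝ) → ℝ
  smooth : ContDiff ℝ (⊤ : ℕ∞) f
  bounded : ∀ k : ℕ, ∃ C : ℝ, ∀ x, ‖iteratedFDeriv ℝ k f x‖ ≤ C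
  φ : Fin n → ℝ → ℝ
  X : Fin n → Ω → ℝ
  wiener : ∀ i, IsWienerIntegral H T P β (φ i) (X i)

variable {H T : ℝ} {P : Measure Ω} {β : ℝ → Ω → ℝ}

/-- The random variable `F`. -/
def Cyl.val (F : Cyl H T P β) (ω : Ω) : ℝ := F.f fun i => F.X i ω

/-- The Malliavin derivative `D_θ F = ∑_i ∂_i f(β(φ_1), …, β(φ_n)) φ_i(θ)`. -/
def Cyl.deriv (F : Cyl H T P β) (ω : Ω) (θ : ℝ) : ℝ :=
  ∑ i, fderiv ℝ F.f (fun i => F.X i ω) (Pi.single i 1) * F.φ i θ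

variable {V : Type*} [NormedAddCommGroup V] [NormedSpace ℝ V]

/-- A smooth elementary process `∑_i F_i 1_{(t_{i-1},t_i]} v_i` with `F_i` smooth cylindrical and
`v_i ∈ C ⊆ V`. -/
structure SmoothElem (H T : ℝ) (P : Measure Ω) (β : ℝ → Ω → ℝ) (C : Set V) where
  π : Grid T
  F : Fin π.m → Cyl H T P β
  v : Fin π.m → V
  mem : ∀ i, v i ∈ C

/-- The value at `(ω, s)`. -/
def SmoothElem.val {C : Set V} (G : SmoothElem H T P β C) (ω : Ω) (s : ℝ) : V :=
  ∑ i, ((G.F i).val ω * G.π.ind i s) • G.v i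

/-- The Malliavin derivative `D_θ G_s`, at `(ω, θ, s)`. -/
def SmoothElem.deriv {C : Set V} (G : SmoothElem H T P β C) (ω : Ω) (θ s : ℝ) : V :=
  ∑ i, ((G.F i).deriv ω θ * G.π.ind i s) • G.v i

/-- `g ∈ 𝔻_β^{1,p}(|𝓗_V|)`, with Malliavin derivative `h = (D_θ g_s)`: the closure of the smooth
elementary processes in the norm `(E‖g‖_{|𝓗_V|}^p + E‖D g‖_{|𝓗| ⊗ |𝓗_V|}^p)^{1/p}`. -/
def IsMalliavinDeriv (H T : ℝ) (P : Measure Ω) (β : ℝ → Ω → ℝ) (p : ℝ≥0∞)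
    (g : Ω → ℝ → V) (h : Ω → ℝ → ℝ → V) : Prop :=
  AEStronglyMeasurable (fun z : Ω × ℝ => g z.1 z.2) (P.prod (leb T)) ∧
  AEStronglyMeasurable (fun z : Ω × ℝ × ℝ => h z.1 z.2.1 z.2.2)
    (P.prod ((leb T).prod (leb T))) ∧
  ∫⁻ ω, absNorm H T (g ω) ^ p.toReal ∂P < ∞ ∧
  ∫⁻ ω, absNorm2 H T (h ω) ^ p.toReal ∂P < ∞ ∧
  ∃ G : ℕ → SmoothElem H T P β (univ : Set V),
    Tendsto (fun j => ∫⁻ ω, absNorm H T (fun s => g ω s - (G j).val ω s) ^ p.toReal ∂P)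
      atTop (𝓝 0) ∧
    Tendsto (fun j => ∫⁻ ω, absNorm2 H T
      (fun θ s => h ω θ s - (G j).deriv ω θ s) ^ p.toReal ∂P) atTop (𝓝 0)

/-- `X = ∫_0^T U_s δβ_s`: the adjoint of the Malliavin derivative, in `L_2(Ω, σ(β), P)`, applied
to a process `U ∈ L_2(Ω; |𝓗|)`. -/
def IsSkorohodIntegral (H T : ℝ) (P : Measure Ω) (β : ℝ → Ω → ℝ) (U : Ω → ℝ → ℝ) (X : Ω → ℝ) :
    Prop :=
  AEStronglyMeasurable (fun z : Ω × ℝ => U z.1 z.2) (P.prod (leb T)) ∧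
  ∫⁻ ω, absNorm H T (U ω) ^ (2 : ℝ) ∂P < ∞ ∧
  MemLp X 2 P ∧
  AEStronglyMeasurable[⨆ t : Icc (0 : ℝ) T, MeasurableSpace.comap (β t) inferInstance] X P ∧
  ∀ F : Cyl H T P β, ∫ ω, F.val ω * X ω ∂P = ∫ ω, innerH H T (F.deriv ω) (U ω) ∂P

/-- `X_t = ∑_k ∫_0^t u_s^k δβ_s^k` for `t ∈ [0,T]`, the series converging in `L_2(Ω)`, and `X` has
almost surely continuous paths. -/
def IsSkorohodSeries (H T : ℝ) (P : Measure Ω) (β : ℕ → ℝ → Ω → ℝ) (u : ℕ → Ω → ℝ → ℝ)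
    (X : ℝ → Ω → ℝ) : Prop :=
  (∀ᵐ ω ∂P, ContinuousOn (fun t => X t ω) (Icc 0 T)) ∧
  ∀ t ∈ Icc 0 T, AEStronglyMeasurable (X t) P ∧ ∃ Y : ℕ → Ω → ℝ,
    (∀ k, IsSkorohodIntegral H T P (β k) (fun ω s => (Icc 0 t).indicator (u k ω) s) (Y k)) ∧
    Tendsto (fun N => eLpNorm (fun ω => X t ω - ∑ k ∈ Finset.range N, Y k ω) 2 P) atTop (𝓝 0)

end Malliavin

section Spaces

variable {Ω : Type*} [MeasurableSpace Ω] (H T : ℝ) (P : Measure Ω) (β : ℕ → ℝ → Ω → ℝ)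
variable {d : ℕ} {p : ℝ≥0∞} [Fact (1 ≤ p)]

/-- The norm of `𝕃_H^{1,p}(H_p^n, l_2)` of a process `g = (g^k)` with derivative
`h = (D^{β^k} g^k)`. -/
def LNormWith {n : ℝ} (g : ℕ → Ω → ℝ → Sob d p n) (h : ℕ → Ω → ℝ → ℝ → Sob d p n) : ℝ≥0∞ :=
  (∫⁻ ω, ∫⁻ s, l2Norm d p (fun k => g k ω s) ^ p.toReal ∂leb T ∂P +
    ∫⁻ ω, ∫⁻ s, (∫⁻ θ, l2Norm d p (fun k => h k ω θ s) ^ (1 / H) ∂leb T) ^ (p.toReal * H)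
      ∂leb T ∂P) ^ (1 / p.toReal)

/-- The norm of `𝕃_H^{1,p}(H_p^n, l_2)`. (The Malliavin derivative `h` is almost everywhere
unique, so the infimum is over a single value.) -/
def LNorm {n : ℝ} (g : ℕ → Ω → ℝ → Sob d p n) : ℝ≥0∞ :=
  ⨅ (h : ℕ → Ω → ℝ → ℝ → Sob d p n) (_ : ∀ k, IsMalliavinDeriv H T P (β k) p (g k) (h k)),
    LNormWith H T P g h

/-- `g ∈ 𝕃_H^{1,p}(H_p^n, l_2)`, with Malliavin derivative `h = (D^{β^k} g^k)`. -/
def MemLWith {n : ℝ} (g : ℕ → Ω → ℝ → Sob d p n) (h : ℕ → Ω → ℝ → ℝ → Sob d p n) : Prop :=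
  (∀ k, IsMalliavinDeriv H T P (β k) p (g k) (h k)) ∧ LNormWith H T P g h < ∞

/-- The space `𝕃̃_H^{1,p}(H_p^n, l_2)`: the `g ∈ 𝕃_H^{1,p}(H_p^n, l_2)` that are limits, in the norm
of this space, of elements `g_j` such that `g_j^k` is a smooth elementary process with values
in `C_0^∞` for `k < K_j`, and `g_j^k = 0` for `k ≥ K_j`. -/
def tildeL (d : ℕ) (p : ℝ≥0∞) [Fact (1 ≤ p)] (n : ℝ) : Set (ℕ → Ω → ℝ → Sob d p n) :=
  {g | ∃ h, MemLWith H T P β g h ∧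
    ∃ (K : ℕ → ℕ) (G : ∀ _j k : ℕ, SmoothElem H T P (β k) (testSob d p n))
      (gj : ℕ → ℕ → Ω → ℝ → Sob d p n) (hj : ℕ → ℕ → Ω → ℝ → ℝ → Sob d p n),
      (∀ j k, gj j k = if k < K j then (G j k).val else 0) ∧
      (∀ j k, hj j k = if k < K j then (G j k).deriv else 0) ∧
      (∀ j, MemLWith H T P β (gj j) (hj j)) ∧
      Tendsto (fun j => LNormWith H T P (gj j - g) (hj j - h)) atTop (𝓝 0)}

/-- The distribution-valued `w` belongs to `L_p(μ; H_p^n)`. -/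
def MemLpSob {α : Type*} [MeasurableSpace α] (p : ℝ≥0∞) [Fact (1 ≤ p)] (n : ℝ) (μ : Measure α)
    (w : α → Dist d) : Prop :=
  ∃ W : α → Sob d p n, MemLp W p μ ∧ ∀ᵐ a ∂μ, (W a).toDist = w a

/-- The norm of `L_p(μ; H_p^n)`. -/
def lpSobNorm {α : Type*} [MeasurableSpace α] (p : ℝ≥0∞) [Fact (1 ≤ p)] (n : ℝ) (μ : Measure α)
    (w : α → Dist d) : ℝ≥0∞ :=
  (∫⁻ a, sobNorm d p n (w a) ^ p.toReal ∂μ) ^ (1 / p.toReal)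

/-- `d u = f dt + ∑_k g^k δβ_t^k` on `[0,T]`: for each `φ ∈ C_0^∞`, almost surely, for all
`t ∈ [0,T]`,
`(u(t), φ) = (u(0), φ) + ∫_0^t (f(s), φ) ds + ∑_k ∫_0^t (g^k(s), φ) δβ_s^k`. -/
def HasStochDiff {a b : ℝ} (u : ℝ → Ω → Dist d) (f : Ω → ℝ → Sob d p a)
    (g : ℕ → Ω → ℝ → Sob d p b) : Prop :=
  ∀ φ : Schw d, HasCompactSupport φ →
    ∃ X : ℝ → Ω → ℝ,
      IsSkorohodSeries H T P β (fun k ω s => (g k ω s).toDist φ) X ∧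
      ∀ᵐ ω ∂P, ∀ t ∈ Icc 0 T,
        u t ω φ = u 0 ω φ + (∫ s in (0 : ℝ)..t, (f ω s).toDist φ) + X t ω

/-- The pairs `(f, g) = (𝐃u, 𝐒u)`, with `f ∈ ℍ_p^{n-2}` and `g ∈ 𝕃̃_H^{1,p}(H_p^{n-1}, l_2)`. -/
def IsDS (n : ℝ) (u : ℝ → Ω → Dist d) (f : Ω → ℝ → Sob d p (n - 2))
    (g : ℕ → Ω → ℝ → Sob d p (n - 1)) : Prop :=
  MemLp (fun z : Ω × ℝ => f z.1 z.2) p (P.prod (leb T)) ∧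
  g ∈ tildeL H T P β d p (n - 1) ∧
  HasStochDiff H T P β u f g

/-- The space `𝓗_{p,H}^n` of distribution-valued processes on `[0,T]`. -/
def calH (d : ℕ) (p : ℝ≥0∞) [Fact (1 ≤ p)] (n : ℝ) : Set (ℝ → Ω → Dist d) :=
  {u | (∀ t ∈ Icc 0 T, ∀ φ : Schw d, HasCompactSupport φ → Measurable fun ω => u t ω φ) ∧
    MemLpSob p (n - 2 / p.toReal) P (u 0) ∧
    MemLpSob p n (P.prod (leb T)) (fun z => u z.2 z.1) ∧
    (∀ i j, MemLpSob p (n - 2) (P.prod (leb T)) fun z => distDeriv2 d i j (u z.2 z.1)) ∧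
    ∃ (f : Ω → ℝ → Sob d p (n - 2)) (g : ℕ → Ω → ℝ → Sob d p (n - 1)), IsDS H T P β n u f g}

/-- The norm of `𝓗_{p,H}^n`. (The pair `(f, g) = (𝐃u, 𝐒u)` is determined by `u`, so the infimum is
over a single value.) -/
def calHNorm (p : ℝ≥0∞) [Fact (1 ≤ p)] (n : ℝ) (u : ℝ → Ω → Dist d) : ℝ≥0∞ :=
  lpSobNorm p (n - 2 / p.toReal) P (u 0) +
  (∑ i, ∑ j, lpSobNorm p (n - 2) (P.prod (leb T)) fun z => distDeriv2 d i j (u z.2 z.1)) +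
  ⨅ (f : Ω → ℝ → Sob d p (n - 2)) (g : ℕ → Ω → ℝ → Sob d p (n - 1))
    (_ : IsDS H T P β n u f g),
    (eLpNorm (fun z : Ω × ℝ => f z.1 z.2) p (P.prod (leb T)) + LNorm H T P β g)

end Spaces

end FracHeat

end

noncomputable section

namespace FracHeat

theorem exists_compactSupport_tendsto {d : ℕ} (φ : Schw d) :
    ∃ ψ : ℕ → Schw d, (∀ j, HasCompactSupport (ψ j)) ∧ Tendsto ψ atTop (𝓝 φ) := by
  let b : ContDiffBump (0 : Rd d) := ⟨1, 2, one_pos, one_lt_two⟩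
  have hbs : HasCompactSupport (b : Rd d → ℝ) := b.hasCompactSupport
  have hbc : ContDiff ℝ (⊤ : ℕ∞) (b : Rd d → ℝ) := b.contDiff
  let B : Schw d := hbs.toSchwartzMap hbc
  let L : ℕ → (Rd d →L[ℝ] Rd d) := fun j => ((j : ℝ) + 1)⁻¹ • ContinuousLinearMap.id ℝ (Rd d)
  have hL : ∀ j, ‖L j‖ ≤ 1 := fun j => by
    refine ContinuousLinearMap.opNorm_le_bound _ zero_le_one fun x => ?_
    have : ((j : ℝ) + 1)⁻¹ ≤ 1 := inv_le_one_of_one_le₀ (by linarith [j.cast_nonneg (α := ℝ)])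
    have h0 : 0 ≤ ((j : ℝ) + 1)⁻¹ := by positivity
    simp only [L, _root_.smul_apply, ContinuousLinearMap.id_apply, norm_smul,
      Real.norm_eq_abs, abs_of_nonneg h0]
    gcongr
  let c : ℕ → Rd d → ℝ := fun j x => B (L j x)
  have hcs : ∀ j, ContDiff ℝ (⊤ : ℕ∞) (c j) := fun j => (B.smooth _).comp (L j).contDiff
  have hcc : ∀ j, HasCompactSupport (c j) := fun j => by
    have hne : ((j : ℝ) + 1)⁻¹ ≠ 0 := by positivity
    exact hbs.comp_homeomorph (Homeomorph.smulOfNeZero _ hne)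
  have hct : ∀ j, (c j).HasTemperateGrowth := fun j => (hcc j).hasTemperateGrowth (hcs j)
  have hcb : ∀ i j x, ‖iteratedFDeriv ℝ i (c j) x‖ ≤ SchwartzMap.seminorm ℝ 0 i B := by
    intro i j x
    have := (L j).iteratedFDeriv_comp_right (B.smooth (⊤ : ℕ∞)) x (i := i)
      (by exact_mod_cast le_top)
    rw [show c j = (B : Rd d → ℝ) ∘ L j from rfl, this]
    refine (ContinuousMultilinearMap.norm_compContinuousLinearMap_le _ _).trans ?_
    refine (mul_le_of_le_one_right (norm_nonneg _) ?_).trans (B.norm_iteratedFDeriv_le_seminorm ℝ i _)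
    exact Finset.prod_le_one (fun _ _ => norm_nonneg _) (fun _ _ => hL j)
  refine ⟨fun j => SchwartzMap.smulLeftCLM ℝ (c j) φ, fun j => ?_, ?_⟩
  · rw [SchwartzMap.smulLeftCLM_apply (hct j)]
    exact (hcc j).smul_right
  · rw [(schwartz_withSeminorms ℝ (Rd d) ℝ).tendsto_nhds _ φ]
    rintro ⟨k, n⟩ ε hε
    let M : ℝ := SchwartzMap.seminorm ℝ (k + 1) n φ + ∑ i ∈ Finset.range (n + 1),
      (n.choose i : ℝ) * SchwartzMap.seminorm ℝ 0 i B * SchwartzMap.seminorm ℝ (k + 1) (n - i) φ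
    have hM : 0 ≤ M := by positivity
    have key : ∀ j : ℕ, SchwartzMap.seminorm ℝ k n (SchwartzMap.smulLeftCLM ℝ (c j) φ - φ) ≤
        ((j : ℝ) + 1)⁻¹ * M := by
      intro j
      have hj : (0 : ℝ) < j + 1 := by positivity
      refine SchwartzMap.seminorm_le_bound ℝ k n _ (by positivity) fun x => ?_
      have hfun : ((SchwartzMap.smulLeftCLM ℝ (c j) φ - φ : Schw d) : Rd d → ℝ) =
          (fun y => c j y • φ y) - φ := by
        funext y
        simp [SchwartzMap.smulLeftCLM_apply_apply (hct j)]
      rw [hfun]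
      by_cases hx : ‖x‖ < j + 1
      · have : ((fun y => c j y • φ y) - (φ : Rd d → ℝ)) =ᶠ[𝓝 x] fun _ => 0 := by
          filter_upwards [(isOpen_lt continuous_norm continuous_const).mem_nhds hx] with y hy
          have : c j y = 1 := by
            apply b.one_of_mem_closedBall
            simp only [L, mem_closedBall_zero_iff, _root_.smul_apply,
              ContinuousLinearMap.id_apply, norm_smul, Real.norm_eq_abs]
            rw [abs_of_pos (by positivity), inv_mul_le_one₀ hj]
            exact hy.le
          simp [this]
        rw [(this.iteratedFDeriv ℝ n).eq_of_nhds]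
        have h0 : iteratedFDeriv ℝ n (fun _ : Rd d => (0 : ℝ)) x = 0 := by
          simp [iteratedFDeriv_fun_zero]
        rw [h0, norm_zero, mul_zero]
        positivity
      · push Not at hx
        have hsm : ContDiff ℝ n (fun y => c j y • φ y) :=
          ((hcs j).of_le (by exact_mod_cast le_top)).smul (φ.smooth n)
        have hxk : ‖x‖ ^ k ≤ ((j : ℝ) + 1)⁻¹ * ‖x‖ ^ (k + 1) := by
          rw [pow_succ, ← div_eq_inv_mul, le_div_iff₀ hj]
          gcongr
        have e1 : iteratedFDeriv ℝ n ((fun y => c j y • φ y) - (φ : Rd d → ℝ)) x =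
            iteratedFDeriv ℝ n (fun y => c j y • φ y) x - iteratedFDeriv ℝ n φ x :=
          iteratedFDeriv_sub_apply hsm.contDiffAt (φ.smooth n).contDiffAt
        have e2 : ‖iteratedFDeriv ℝ n (fun y => c j y • φ y) x‖ ≤ ∑ i ∈ Finset.range (n + 1),
            (n.choose i : ℝ) * SchwartzMap.seminorm ℝ 0 i B * ‖iteratedFDeriv ℝ (n - i) φ x‖ := by
          refine (norm_iteratedFDeriv_smul_le ((hcs j).of_le (by exact_mod_cast le_top) :
            ContDiff ℝ n (c j)) (φ.smooth n) x le_rfl).trans ?_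
          gcongr with i hi
          exact hcb i j x
        rw [e1]
        calc ‖x‖ ^ k * ‖iteratedFDeriv ℝ n (fun y => c j y • φ y) x - iteratedFDeriv ℝ n φ x‖
            ≤ (((j : ℝ) + 1)⁻¹ * ‖x‖ ^ (k + 1)) * (‖iteratedFDeriv ℝ n φ x‖ +
              ∑ i ∈ Finset.range (n + 1), (n.choose i : ℝ) * SchwartzMap.seminorm ℝ 0 i B *
                ‖iteratedFDeriv ℝ (n - i) φ x‖) := by
              gcongr
              refine (norm_sub_le _ _).trans ?_
              rw [add_comm]
              gcongr
          _ = ((j : ℝ) + 1)⁻¹ * (‖x‖ ^ (k + 1) * ‖iteratedFDeriv ℝ n φ x‖ +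
              ∑ i ∈ Finset.range (n + 1), (n.choose i : ℝ) * SchwartzMap.seminorm ℝ 0 i B *
                (‖x‖ ^ (k + 1) * ‖iteratedFDeriv ℝ (n - i) φ x‖)) := by
              rw [mul_assoc, mul_add, Finset.mul_sum]
              congr 3
              funext i
              ring
          _ ≤ ((j : ℝ) + 1)⁻¹ * M := by
              refine mul_le_mul_of_nonneg_left (add_le_add (φ.le_seminorm ℝ _ _ x)
                (Finset.sum_le_sum fun i _ => ?_)) (by positivity)
              exact mul_le_mul_of_nonneg_left (φ.le_seminorm ℝ _ _ x) (by positivity)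
    have h0 : Tendsto (fun j : ℕ => ((j : ℝ) + 1)⁻¹ * M) atTop (𝓝 0) := by
      have := (tendsto_one_div_add_atTop_nhds_zero_nat (𝕜 := ℝ)).mul_const M
      simpa using this
    filter_upwards [h0.eventually (gt_mem_nhds hε)] with j hj
    exact (key j).trans_lt hj

section Multiplier

variable {d : ℕ}

theorem lineDeriv_symb_comm (m : Rd d) (s : ℝ) (f : 𝓢(Rd d, ℂ)) :
    ∂_{m} (SchwartzMap.fourierMultiplierCLM ℂ (symb d s) f) =
      SchwartzMap.fourierMultiplierCLM ℂ (symb d s) (∂_{m} f) := by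
  have h : (fun x : Rd d => RCLike.ofReal (K := ℂ) (inner ℝ x m : ℝ)).HasTemperateGrowth := by
    change (fun x : Rd d => ((inner ℝ x m : ℝ) : ℂ)).HasTemperateGrowth
    fun_prop
  have h' : (fun x : Rd d => (inner ℝ x m : ℝ)).HasTemperateGrowth := by fun_prop
  rw [SchwartzMap.lineDeriv_eq_fourierMultiplierCLM, SchwartzMap.lineDeriv_eq_fourierMultiplierCLM,
    map_smul]
  congr 1
  rw [← SchwartzMap.fourierMultiplierCLM_ofReal ℂ h', ← SchwartzMap.fourierMultiplierCLM_ofReal ℂ h',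
    SchwartzMap.fourierMultiplierCLM_fourierMultiplierCLM_apply h (symb_temperate d s),
    SchwartzMap.fourierMultiplierCLM_fourierMultiplierCLM_apply (symb_temperate d s) h, mul_comm]

theorem lineDeriv_postcomp {E F : Type*} [NormedAddCommGroup E] [NormedSpace ℝ E]
    [NormedAddCommGroup F] [NormedSpace ℝ F] (A : E →L[ℝ] F) (m : Rd d) (f : 𝓢(Rd d, E)) :
    ∂_{m} (SchwartzMap.postcompCLM (𝕜 := ℝ) A f) =
      SchwartzMap.postcompCLM (𝕜 := ℝ) A (∂_{m} f) := by
  ext x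
  rw [SchwartzMap.postcompCLM_apply, SchwartzMap.lineDerivOp_apply_eq_fderiv,
    SchwartzMap.lineDerivOp_apply_eq_fderiv]
  have : (SchwartzMap.postcompCLM (𝕜 := ℝ) A f : Rd d → F) = A ∘ f := rfl
  rw [this, fderiv_comp x A.differentiableAt f.differentiableAt, A.fderiv]
  rfl

theorem lineDeriv_besselSchw (m : Rd d) (s : ℝ) (φ : Schw d) :
    ∂_{m} (besselSchw d s φ) = besselSchw d s (∂_{m} φ) := by
  change ∂_{m} (SchwartzMap.postcompCLM (𝕜 := ℝ) Complex.reCLM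
    (SchwartzMap.fourierMultiplierCLM ℂ (symb d s)
      (SchwartzMap.postcompCLM (𝕜 := ℝ) Complex.ofRealCLM φ))) = _
  rw [lineDeriv_postcomp, lineDeriv_symb_comm, lineDeriv_postcomp]
  rfl

theorem distDeriv2_bessel (i j : Fin d) (s : ℝ) (u : Dist d) :
    distDeriv2 d i j (bessel d s u) = bessel d s (distDeriv2 d i j u) := by
  ext φ
  change u (besselSchw d s (∂_{EuclideanSpace.single i (1 : ℝ)}
    (∂_{EuclideanSpace.single j (1 : ℝ)} φ))) = u (∂_{EuclideanSpace.single i (1 : ℝ)}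
    (∂_{EuclideanSpace.single j (1 : ℝ)} (besselSchw d s φ)))
  rw [lineDeriv_besselSchw, lineDeriv_besselSchw]

theorem fourier_symb_fourierInv (s : ℝ) (g : 𝓢(Rd d, ℂ)) :
    𝓕 (SchwartzMap.smulLeftCLM ℂ (symb d s) (𝓕⁻ g)) =
      𝓕⁻ (SchwartzMap.smulLeftCLM ℂ (symb d s) (𝓕 g)) := by
  ext x
  rw [SchwartzMap.fourier_coe, SchwartzMap.fourierInv_coe, Real.fourierInv_eq_fourier_neg,
    Real.fourier_eq', Real.fourier_eq', ← integral_neg_eq_self]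
  congr 1
  funext v
  rw [SchwartzMap.smulLeftCLM_apply_apply (symb_temperate d s),
    SchwartzMap.smulLeftCLM_apply_apply (symb_temperate d s), SchwartzMap.fourierInv_coe,
    SchwartzMap.fourier_coe, Real.fourierInv_eq_fourier_neg, neg_neg, inner_neg_left,
    inner_neg_right]
  simp [symb]

theorem integral_multiplier_symm (s : ℝ) (f g : 𝓢(Rd d, ℂ)) :
    ∫ x, SchwartzMap.fourierMultiplierCLM ℂ (symb d s) f x * g x =
      ∫ x, f x * SchwartzMap.fourierMultiplierCLM ℂ (symb d s) g x := by
  rw [SchwartzMap.fourierMultiplierCLM_apply, SchwartzMap.fourierMultiplierCLM_apply,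
    SchwartzMap.integral_fourierInv_mul_eq, ← fourier_symb_fourierInv,
    ← SchwartzMap.integral_fourier_mul_eq]
  congr 1
  funext x
  rw [SchwartzMap.smulLeftCLM_apply_apply (symb_temperate d s),
    SchwartzMap.smulLeftCLM_apply_apply (symb_temperate d s)]
  simp only [smul_eq_mul]
  ring

theorem integral_besselSchw_symm (s : ℝ) (φ ψ : Schw d) :
    ∫ x, besselSchw d s φ x * ψ x = ∫ x, φ x * besselSchw d s ψ x := by
  have h := integral_multiplier_symm s (SchwartzMap.postcompCLM (𝕜 := ℝ) Complex.ofRealCLM φ)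
    (SchwartzMap.postcompCLM (𝕜 := ℝ) Complex.ofRealCLM ψ)
  rw [← ofReal_besselSchw, ← ofReal_besselSchw] at h
  simp only [SchwartzMap.postcompCLM_apply, Complex.ofRealCLM_apply, ← Complex.ofReal_mul] at h
  rw [integral_complex_ofReal, integral_complex_ofReal] at h
  exact_mod_cast h

end Multiplier

namespace Sob

variable {d : ℕ} {p : ℝ≥0∞} [Fact (1 ≤ p)] {n n' : ℝ}

theorem toDist_injective : Function.Injective (toDist : Sob d p n →ₗ[ℝ] Dist d) :=
  Subtype.val_injective

theorem toDist_apply (u : Sob d p n) (χ : Schw d) :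
    u.toDist χ = ∫ x, toLp u x * besselSchw d (-n) χ x := by
  rw [← bessel_toDist]
  change _ = u.toDist (besselSchw d n (besselSchw d (-n) χ))
  rw [besselSchw_besselSchw, add_neg_cancel, besselSchw_zero]

theorem toLp_eq_of (u : Sob d p n) (f : Lp ℝ p (volume : Measure (Rd d)))
    (h : ∀ φ : Schw d, bessel d n (toDist u) φ = ∫ x, f x * φ x) : toLp u = f :=
  lp_eq_of_pairing d p _ _ fun φ => by rw [← bessel_toDist, h]

/-- `(1 - Δ)^{m/2}` as an isometric isomorphism of `H_p^n` with `H_p^{n'}`, `n' = n - m`. -/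
def besselIso (m : ℝ) (h : n' = n - m) : Sob d p n ≃ₗᵢ[ℝ] Sob d p n' where
  toFun u := ⟨bessel d m (toDist u), toLp u, fun φ => by
    rw [bessel_bessel, h, sub_add_cancel, bessel_toDist]⟩
  invFun u := ⟨bessel d (-m) (toDist u), toLp u, fun φ => by
    rw [bessel_bessel, show n + -m = n' by linarith, bessel_toDist]⟩
  map_add' u v := Subtype.ext (by
    change bessel d m (toDist (u + v)) = bessel d m (toDist u) + bessel d m (toDist v)
    rw [map_add, map_add])
  map_smul' c u := Subtype.ext (by
    change bessel d m (toDist (c • u)) = c • bessel d m (toDist u)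
    rw [map_smul, map_smul])
  left_inv u := Subtype.ext (by
    change bessel d (-m) (bessel d m (toDist u)) = toDist u
    rw [bessel_bessel, neg_add_cancel, bessel_zero])
  right_inv u := Subtype.ext (by
    change bessel d m (bessel d (-m) (toDist u)) = toDist u
    rw [bessel_bessel, add_neg_cancel, bessel_zero])
  norm_map' u := by
    rw [norm_def, norm_def]
    congr 1
    refine toLp_eq_of _ _ fun φ => ?_
    change bessel d n' (bessel d m (toDist u)) φ = _
    rw [bessel_bessel, h, sub_add_cancel, bessel_toDist]

theorem toDist_besselIso (m : ℝ) (h : n' = n - m) (u : Sob d p n) :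
    (besselIso m h u).toDist = bessel d m u.toDist := rfl

theorem toLp_besselIso (m : ℝ) (h : n' = n - m) (u : Sob d p n) :
    toLp (besselIso m h u) = toLp u := by
  refine toLp_eq_of _ _ fun φ => ?_
  rw [toDist_besselIso, bessel_bessel, h, sub_add_cancel, bessel_toDist]

theorem besselIso_besselIso (m m' : ℝ) (h : n' = n - m) (h' : n = n' - m') (u : Sob d p n) :
    besselIso m' h' (besselIso m h u) = u := by
  apply toDist_injective
  rw [toDist_besselIso, toDist_besselIso, bessel_bessel, show m' + m = 0 by linarith, bessel_zero]

/-- A Schwartz function as an element of `H_p^n`. -/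
def ofSchw (n : ℝ) : Schw d →ₗ[ℝ] Sob d p n where
  toFun φ := ⟨(SchwartzMap.integralCLM ℝ (volume : Measure (Rd d))).comp
      (SchwartzMap.pairing (ContinuousLinearMap.mul ℝ ℝ) φ),
    SchwartzMap.toLpCLM ℝ ℝ p (volume : Measure (Rd d)) (besselSchw d n φ), fun ψ => by
      change SchwartzMap.integralCLM ℝ (volume : Measure (Rd d))
        (SchwartzMap.pairing (ContinuousLinearMap.mul ℝ ℝ) φ (besselSchw d n ψ)) = _
      rw [SchwartzMap.integralCLM_apply]
      simp only [SchwartzMap.pairing_apply_apply, ContinuousLinearMap.mul_apply']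
      rw [← integral_besselSchw_symm]
      apply integral_congr_ae
      filter_upwards [(besselSchw d n φ).coeFn_toLp p (volume : Measure (Rd d))] with x hx
      rw [SchwartzMap.toLpCLM_apply, hx]⟩
  map_add' φ ψ := Subtype.ext (by
    ext χ
    change SchwartzMap.integralCLM ℝ (volume : Measure (Rd d))
        (SchwartzMap.pairing (ContinuousLinearMap.mul ℝ ℝ) (φ + ψ) χ) = 
      SchwartzMap.integralCLM ℝ (volume : Measure (Rd d))
        (SchwartzMap.pairing (ContinuousLinearMap.mul ℝ ℝ) φ χ) +
      SchwartzMap.integralCLM ℝ (volume : Measure (Rd d))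
        (SchwartzMap.pairing (ContinuousLinearMap.mul ℝ ℝ) ψ χ)
    rw [map_add, add_apply, map_add])
  map_smul' c φ := Subtype.ext (by
    ext χ
    change SchwartzMap.integralCLM ℝ (volume : Measure (Rd d))
        (SchwartzMap.pairing (ContinuousLinearMap.mul ℝ ℝ) (c • φ) χ) = 
      c • SchwartzMap.integralCLM ℝ (volume : Measure (Rd d))
        (SchwartzMap.pairing (ContinuousLinearMap.mul ℝ ℝ) φ χ)
    rw [map_smul, smul_apply, map_smul])

theorem toDist_ofSchw (φ ψ : Schw d) :
    (ofSchw n φ : Sob d p n).toDist ψ = ∫ x, φ x * ψ x := by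
  change SchwartzMap.integralCLM ℝ (volume : Measure (Rd d))
    (SchwartzMap.pairing (ContinuousLinearMap.mul ℝ ℝ) φ ψ) = _
  rw [SchwartzMap.integralCLM_apply]
  simp only [SchwartzMap.pairing_apply_apply, ContinuousLinearMap.mul_apply']

theorem toLp_ofSchw (φ : Schw d) : toLp (ofSchw n φ : Sob d p n) =
    SchwartzMap.toLpCLM ℝ ℝ p (volume : Measure (Rd d)) (besselSchw d n φ) := by
  refine toLp_eq_of _ _ fun ψ => ?_
  change (ofSchw n φ : Sob d p n).toDist (besselSchw d n ψ) = _
  rw [toDist_ofSchw, ← integral_besselSchw_symm]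
  apply integral_congr_ae
  filter_upwards [(besselSchw d n φ).coeFn_toLp p (volume : Measure (Rd d))] with x hx
  rw [SchwartzMap.toLpCLM_apply, hx]

theorem exists_testSob_near (φ : Schw d) {ε : ℝ} (hε : 0 < ε) :
    ∃ w ∈ testSob d p n, ‖w - ofSchw n φ‖ < ε := by
  obtain ⟨ψ, hψ, hlim⟩ := exists_compactSupport_tendsto φ
  have h1 : Tendsto (fun j => ‖(ofSchw n (ψ j) : Sob d p n) - ofSchw n φ‖) atTop (𝓝 0) := by
    have h2 : Tendsto (fun j => ‖SchwartzMap.toLpCLM ℝ ℝ p (volume : Measure (Rd d))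
        (besselSchw d n (ψ j - φ))‖) atTop (𝓝 0) := by
      have h3 : Tendsto (fun j => ψ j - φ) atTop (𝓝 0) := by
        simpa using hlim.sub_const φ
      have h4 : Continuous fun χ : Schw d => ‖SchwartzMap.toLpCLM ℝ ℝ p
          (volume : Measure (Rd d)) (besselSchw d n χ)‖ := by fun_prop
      have := (h4.tendsto 0).comp h3
      rwa [map_zero, map_zero, norm_zero] at this
    refine h2.congr fun j => ?_
    rw [← map_sub, norm_def, toLp_ofSchw]
  obtain ⟨j, hj⟩ := (h1.eventually (gt_mem_nhds hε)).exists
  exact ⟨_, ⟨ψ j, hψ j, fun χ => toDist_ofSchw _ _⟩, hj⟩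

/-- The image of a test function under `(1 - Δ)^{m/2}` is a limit of test functions. -/
theorem exists_testSob_approx (m : ℝ) (h : n' = n - m) {v : Sob d p n} (hv : v ∈ testSob d p n)
    {ε : ℝ} (hε : 0 < ε) :
    ∃ w ∈ testSob d p n', ‖w - besselIso m h v‖ ≤ ε * ‖besselIso m h v‖ := by
  by_cases h0 : besselIso m h v = 0
  · refine ⟨0, ⟨0, HasCompactSupport.zero, fun ψ => ?_⟩, by simp [h0]⟩
    simp
  · obtain ⟨φ, hφ, hv⟩ := hv
    have hv' : v = ofSchw n φ := toDist_injective (by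
      ext ψ
      rw [hv, toDist_ofSchw])
    have : besselIso m h v = ofSchw n' (besselSchw d m φ) := toDist_injective (by
      ext ψ
      rw [toDist_ofSchw, toDist_besselIso, integral_besselSchw_symm, ← hv]
      rfl)
    obtain ⟨w, hw, hlt⟩ := exists_testSob_near (p := p) (n := n') (besselSchw d m φ)
      (mul_pos hε (norm_pos_iff.mpr h0))
    exact ⟨w, hw, by rw [this] at hlt ⊢; exact hlt.le⟩

end Sob

section Norms

variable {d : ℕ} {p : ℝ≥0∞} [Fact (1 ≤ p)] {n n' : ℝ}

theorem sobNorm_bessel (m : ℝ) (h : n' = n - m) (u : Dist d) :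
    sobNorm d p n' (bessel d m u) = sobNorm d p n u := by
  apply le_antisymm
  · refine le_iInf₂ fun v hv => iInf₂_le_of_le (Sob.besselIso m h v) ?_ ?_
    · rw [Sob.toDist_besselIso, hv]
    · rw [LinearIsometryEquiv.enorm_map]
  · refine le_iInf₂ fun v hv => iInf₂_le_of_le ((Sob.besselIso m h).symm v) ?_ ?_
    · have : Sob.toDist ((Sob.besselIso m h).symm v) = bessel d (-m) v.toDist := rfl
      rw [this, hv, bessel_bessel, neg_add_cancel, bessel_zero]
    · rw [LinearIsometryEquiv.enorm_map]

theorem l2Norm_besselIso (m : ℝ) (h : n' = n - m) (v : ℕ → Sob d p n) :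
    l2Norm d p (fun k => Sob.besselIso m h (v k)) = l2Norm d p v := by
  simp only [l2Norm, Sob.toLp_besselIso]

theorem lpSobNorm_bessel {α : Type*} [MeasurableSpace α] (m : ℝ) (h : n' = n - m) (μ : Measure α)
    (w : α → Dist d) :
    lpSobNorm p n' μ (fun a => bessel d m (w a)) = lpSobNorm p n μ w := by
  simp only [lpSobNorm, sobNorm_bessel m h]

theorem MemLpSob.bessel {α : Type*} [MeasurableSpace α] (m : ℝ) (h : n' = n - m) {μ : Measure α}
    {w : α → Dist d} (hw : MemLpSob p n μ w) :
    MemLpSob p n' μ (fun a => FracHeat.bessel d m (w a)) := by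
  obtain ⟨W, hW, hae⟩ := hw
  refine ⟨fun a => Sob.besselIso m h (W a),
    (Sob.besselIso (d := d) (p := p) m h).toContinuousLinearEquiv.toContinuousLinearMap.comp_memLp'
      hW, ?_⟩
  filter_upwards [hae] with a ha
  rw [Sob.toDist_besselIso, ha]

end Norms

instance (T : ℝ) : IsFiniteMeasure (leb T) := by
  unfold leb
  infer_instance

theorem ENNReal_add_rpow_le (a b : ℝ≥0∞) {r : ℝ} (hr : 0 ≤ r) :
    (a + b) ^ r ≤ 2 ^ r * (a ^ r + b ^ r) := by
  have h : a + b ≤ 2 * max a b := by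
    rw [two_mul]
    exact add_le_add (le_max_left _ _) (le_max_right _ _)
  calc (a + b) ^ r ≤ (2 * max a b) ^ r := ENNReal.rpow_le_rpow h hr
    _ = 2 ^ r * (max a b) ^ r := ENNReal.mul_rpow_of_nonneg _ _ hr
    _ ≤ 2 ^ r * (a ^ r + b ^ r) := by
      gcongr
      rcases max_choice a b with h | h <;> rw [h]
      · exact le_self_add
      · exact le_add_self

theorem aemeasurable_section {α β : Type*} [MeasurableSpace α] [MeasurableSpace β] {μ : Measure α}
    {ν : Measure β} [SFinite ν] {f : α × β → ℝ≥0∞} (hf : AEMeasurable f (μ.prod ν)) :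
    ∀ᵐ x ∂μ, AEMeasurable (fun y => f (x, y)) ν := by
  filter_upwards [hf.aestronglyMeasurable.prodMk_left] with x hx using hx.aemeasurable

section MixNorm

variable {Ω : Type*} [MeasurableSpace Ω] (H T : ℝ) (P : Measure Ω)

/-- The mixed norm underlying the norm of `𝕃_H^{1,r}`. -/
def mixNorm (r : ℝ) (l : Ω → ℝ → ℝ≥0∞) (m : Ω → ℝ → ℝ → ℝ≥0∞) : ℝ≥0∞ :=
  (∫⁻ ω, ∫⁻ s, l ω s ^ r ∂leb T ∂P +
    ∫⁻ ω, ∫⁻ s, (∫⁻ θ, m ω θ s ^ (1 / H) ∂leb T) ^ (r * H) ∂leb T ∂P) ^ (1 / r)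

variable {H T P} {r : ℝ}

theorem mixNorm_mono (hH : 0 < H) (hr : 0 < r) {l l' : Ω → ℝ → ℝ≥0∞} {m m' : Ω → ℝ → ℝ → ℝ≥0∞}
    (hl : ∀ ω s, l ω s ≤ l' ω s) (hm : ∀ ω θ s, m ω θ s ≤ m' ω θ s) :
    mixNorm H T P r l m ≤ mixNorm H T P r l' m' := by
  unfold mixNorm
  gcongr with ω s ω s θ
  · exact hl ω s
  · exact hm ω θ s

theorem mixNorm_const_mul (hH : 0 < H) (hr : 0 < r) {c : ℝ≥0∞} (hc : c ≠ ∞)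
    (l : Ω → ℝ → ℝ≥0∞) (m : Ω → ℝ → ℝ → ℝ≥0∞) :
    mixNorm H T P r (fun ω s => c * l ω s) (fun ω θ s => c * m ω θ s) =
      c * mixNorm H T P r l m := by
  have h1 : c ^ (1 / H) ≠ ∞ := ENNReal.rpow_ne_top_of_nonneg (by positivity) hc
  have h2 : c ^ r ≠ ∞ := ENNReal.rpow_ne_top_of_nonneg (by positivity) hc
  have h3 : ∀ x : ℝ≥0∞, (c ^ (1 / H) * x) ^ (r * H) = c ^ r * x ^ (r * H) := fun x => by
    rw [ENNReal.mul_rpow_of_nonneg _ _ (by positivity), ← ENNReal.rpow_mul]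
    congr 2
    field_simp
  unfold mixNorm
  simp_rw [ENNReal.mul_rpow_of_nonneg _ _ hr.le, ENNReal.mul_rpow_of_nonneg _ _
    (show 0 ≤ 1 / H by positivity), lintegral_const_mul' _ _ h1, h3, lintegral_const_mul' _ _ h2]
  rw [← mul_add, ENNReal.mul_rpow_of_nonneg _ _ (by positivity), ← ENNReal.rpow_mul]
  congr 1
  rw [mul_one_div_cancel hr.ne', ENNReal.rpow_one]

theorem aemeasurable_inner_lintegral [SFinite P] {m : Ω → ℝ → ℝ → ℝ≥0∞}
    (hm : AEMeasurable (fun z : Ω × ℝ × ℝ => m z.1 z.2.1 z.2.2) (P.prod ((leb T).prod (leb T)))) :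
    AEMeasurable (fun z : Ω × ℝ => ∫⁻ θ, m z.1 θ z.2 ∂leb T) (P.prod (leb T)) := by
  have hmp := ((MeasurePreserving.id P).prod
    (Measure.measurePreserving_swap (μ := leb T) (ν := leb T))).comp
    (measurePreserving_prodAssoc P (leb T) (leb T))
  exact AEMeasurable.lintegral_prod_right' (μ := P.prod (leb T)) (ν := leb T)
    (f := fun z : (Ω × ℝ) × ℝ => m z.1.1 z.2 z.1.2)
    (hm.comp_quasiMeasurePreserving hmp.quasiMeasurePreserving)

theorem lintegral_prod_add_le [SFinite P] {F G : Ω → ℝ → ℝ≥0∞}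
    (hF : AEMeasurable (fun z : Ω × ℝ => F z.1 z.2) (P.prod (leb T))) :
    ∫⁻ ω, ∫⁻ s, (F ω s + G ω s) ∂leb T ∂P =
      ∫⁻ ω, ∫⁻ s, F ω s ∂leb T ∂P + ∫⁻ ω, ∫⁻ s, G ω s ∂leb T ∂P := by
  rw [← lintegral_add_left' hF.lintegral_prod_right']
  apply lintegral_congr_ae
  filter_upwards [aemeasurable_section hF] with ω hω
  exact lintegral_add_left' hω _

theorem mixNorm_add_le [SFinite P] (hH : 0 < H) (hH' : H < 1) (hr : 1 ≤ r)
    {l l' : Ω → ℝ → ℝ≥0∞} {m m' : Ω → ℝ → ℝ → ℝ≥0∞}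
    (hl : AEMeasurable (fun z : Ω × ℝ => l z.1 z.2) (P.prod (leb T)))
    (hm : AEMeasurable (fun z : Ω × ℝ × ℝ => m z.1 z.2.1 z.2.2)
      (P.prod ((leb T).prod (leb T)))) :
    mixNorm H T P r (fun ω s => l ω s + l' ω s) (fun ω θ s => m ω θ s + m' ω θ s) ≤
      8 * (mixNorm H T P r l m + mixNorm H T P r l' m') := by
  have hr0 : 0 < r := by linarith
  have h2 : (1 : ℝ≥0∞) ≤ 2 := by norm_num
  have htop : ∀ x : ℝ, 0 ≤ x → (2 : ℝ≥0∞) ^ x ≠ ∞ := fun x hx =>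
    ENNReal.rpow_ne_top_of_nonneg hx (by simp)
  have e1 : ∫⁻ ω, ∫⁻ s, (l ω s + l' ω s) ^ r ∂leb T ∂P ≤ 2 ^ (2 * r) *
      (∫⁻ ω, ∫⁻ s, l ω s ^ r ∂leb T ∂P + ∫⁻ ω, ∫⁻ s, l' ω s ^ r ∂leb T ∂P) := by
    rw [← lintegral_prod_add_le (hl.pow_const r)]
    simp_rw [← lintegral_const_mul' _ _ (htop (2 * r) (by positivity))]
    refine lintegral_mono fun ω => lintegral_mono fun s => ?_
    refine (ENNReal_add_rpow_le _ _ hr0.le).trans ?_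
    gcongr
    linarith
  have e2 : ∫⁻ ω, ∫⁻ s, (∫⁻ θ, (m ω θ s + m' ω θ s) ^ (1 / H) ∂leb T) ^ (r * H) ∂leb T ∂P ≤
      2 ^ (2 * r) * (∫⁻ ω, ∫⁻ s, (∫⁻ θ, m ω θ s ^ (1 / H) ∂leb T) ^ (r * H) ∂leb T ∂P +
        ∫⁻ ω, ∫⁻ s, (∫⁻ θ, m' ω θ s ^ (1 / H) ∂leb T) ^ (r * H) ∂leb T ∂P) := by
    have hmH := hm.pow_const (1 / H)
    have hi := aemeasurable_inner_lintegral (m := fun ω θ s => m ω θ s ^ (1 / H)) hmH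
    rw [← lintegral_prod_add_le (hi.pow_const (r * H))]
    simp_rw [← lintegral_const_mul' _ _ (htop (2 * r) (by positivity))]
    apply lintegral_mono_ae
    filter_upwards [aemeasurable_section hmH] with ω hω
    apply lintegral_mono_ae
    filter_upwards [aemeasurable_section hω.prod_swap] with s hs
    calc (∫⁻ θ, (m ω θ s + m' ω θ s) ^ (1 / H) ∂leb T) ^ (r * H)
        ≤ (2 ^ (1 / H) * (∫⁻ θ, m ω θ s ^ (1 / H) ∂leb T +
            ∫⁻ θ, m' ω θ s ^ (1 / H) ∂leb T)) ^ (r * H) := by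
          gcongr
          dsimp only [Prod.swap_prod_mk] at hs
          rw [← lintegral_add_left' hs, ← lintegral_const_mul' _ _ (htop _ (by positivity))]
          exact lintegral_mono fun θ => ENNReal_add_rpow_le _ _ (by positivity)
      _ ≤ 2 ^ r * (2 ^ r * ((∫⁻ θ, m ω θ s ^ (1 / H) ∂leb T) ^ (r * H) +
            (∫⁻ θ, m' ω θ s ^ (1 / H) ∂leb T) ^ (r * H))) := by
          rw [ENNReal.mul_rpow_of_nonneg _ _ (by positivity), ← ENNReal.rpow_mul,
            show 1 / H * (r * H) = r by field_simp]
          gcongr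
          refine (ENNReal_add_rpow_le _ _ (by positivity)).trans ?_
          gcongr
          nlinarith
      _ = _ := by
          rw [← mul_assoc, ← ENNReal.rpow_add _ _ (by simp) (by simp), two_mul]
  unfold mixNorm
  set A := ∫⁻ ω, ∫⁻ s, l ω s ^ r ∂leb T ∂P
  set A' := ∫⁻ ω, ∫⁻ s, l' ω s ^ r ∂leb T ∂P
  set B := ∫⁻ ω, ∫⁻ s, (∫⁻ θ, m ω θ s ^ (1 / H) ∂leb T) ^ (r * H) ∂leb T ∂P
  set B' := ∫⁻ ω, ∫⁻ s, (∫⁻ θ, m' ω θ s ^ (1 / H) ∂leb T) ^ (r * H) ∂leb T ∂P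
  have hr1 : 1 / r ≤ 1 := by rw [div_le_one hr0]; exact hr
  calc _ ≤ (2 ^ (2 * r) * ((A + B) + (A' + B'))) ^ (1 / r) := by
        gcongr
        refine (add_le_add e1 e2).trans_eq ?_
        ring
    _ = 4 * ((A + B) + (A' + B')) ^ (1 / r) := by
        rw [ENNReal.mul_rpow_of_nonneg _ _ (by positivity), ← ENNReal.rpow_mul,
          show 2 * r * (1 / r) = (2 : ℕ) by field_simp; norm_num, ENNReal.rpow_natCast]
        norm_num
    _ ≤ 4 * (2 ^ (1 : ℝ) * ((A + B) ^ (1 / r) + (A' + B') ^ (1 / r))) := by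
        gcongr
        refine (ENNReal_add_rpow_le _ _ (by positivity)).trans ?_
        gcongr
    _ = _ := by
        rw [ENNReal.rpow_one, ← mul_assoc]
        norm_num

end MixNorm

theorem Lp_coeFn_sum {α ι E : Type*} [MeasurableSpace α] {μ : Measure α} [NormedAddCommGroup E]
    {p : ℝ≥0∞} (s : Finset ι) (f : ι → Lp E p μ) :
    ∀ᵐ x ∂μ, (∑ i ∈ s, f i : Lp E p μ) x = ∑ i ∈ s, f i x := by
  classical
  induction s using Finset.induction_on with
  | empty =>
    filter_upwards [Lp.coeFn_zero E p μ] with x hx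
    simpa using hx
  | insert a s ha ih =>
    rw [Finset.sum_insert ha]
    filter_upwards [ih, Lp.coeFn_add (f a) (∑ i ∈ s, f i)] with x hx hx'
    rw [hx', Pi.add_apply, hx, Finset.sum_insert ha]

section L2Norm

variable {d : ℕ} {p : ℝ≥0∞} [Fact (1 ≤ p)] {n : ℝ}

/-- `f ↦ f e_k`, from `L_p(ℝ^d)` to `L_p(ℝ^d; ℝ^K)`. -/
def coordLp (d : ℕ) (p : ℝ≥0∞) [Fact (1 ≤ p)] (K : ℕ) (k : Fin K) :
    Lp ℝ p (volume : Measure (Rd d)) →L[ℝ]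
      Lp (EuclideanSpace ℝ (Fin K)) p (volume : Measure (Rd d)) :=
  (ContinuousLinearMap.toSpanSingleton ℝ (EuclideanSpace.single k (1 : ℝ))).compLpL p volume

/-- The first `K` components of a sequence in `H_p^n`, as an element of `L_p(ℝ^d; ℝ^K)`. -/
def truncLp (K : ℕ) (v : ℕ → Sob d p n) :
    Lp (EuclideanSpace ℝ (Fin K)) p (volume : Measure (Rd d)) :=
  ∑ k : Fin K, coordLp d p K k (v k).toLp

theorem truncLp_add (K : ℕ) (v w : ℕ → Sob d p n) :
    truncLp K (v + w) = truncLp K v + truncLp K w := by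
  simp [truncLp, Finset.sum_add_distrib]

theorem coeFn_truncLp (K : ℕ) (v : ℕ → Sob d p n) : ∀ᵐ x ∂(volume : Measure (Rd d)),
    ∀ k : Fin K, truncLp K v x k = (v k).toLp x := by
  have h : ∀ k : Fin K, ∀ᵐ x ∂(volume : Measure (Rd d)),
      coordLp d p K k (v k).toLp x = (v k).toLp x • EuclideanSpace.single k (1 : ℝ) := fun k =>
    ContinuousLinearMap.coeFn_compLpL _ _
  filter_upwards [ae_all_iff.2 h, Lp_coeFn_sum Finset.univ
    fun k : Fin K => coordLp d p K k (v k).toLp] with x hx hs k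
  rw [truncLp, hs]
  simp only [hx]
  simp [Finset.sum_apply, Pi.single_apply]

theorem enorm_truncLp_apply (K : ℕ) (v : ℕ → Sob d p n) : ∀ᵐ x ∂(volume : Measure (Rd d)),
    ‖truncLp K v x‖ₑ = (∑ k ∈ Finset.range K, ‖(v k).toLp x‖ₑ ^ (2 : ℝ)) ^ (1 / 2 : ℝ) := by
  filter_upwards [coeFn_truncLp K v] with x hx
  have h0 : ∀ r : ℝ, ‖r‖ₑ ^ (2 : ℝ) = ENNReal.ofReal (‖r‖ ^ 2) := fun r => by
    rw [← ofReal_norm, ENNReal.ofReal_rpow_of_nonneg (norm_nonneg _) (by norm_num)]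
    norm_num
  rw [← ofReal_norm, EuclideanSpace.norm_eq, Finset.sum_range]
  simp only [hx, h0]
  rw [← ENNReal.ofReal_sum_of_nonneg (fun _ _ => by positivity),
    ENNReal.ofReal_rpow_of_nonneg (by positivity) (by norm_num), Real.sqrt_eq_rpow]

theorem enorm_truncLp (K : ℕ) (v : ℕ → Sob d p n) : ‖truncLp K v‖ₑ =
    eLpNorm (fun x => (∑ k ∈ Finset.range K, ‖(v k).toLp x‖ₑ ^ (2 : ℝ)) ^ (1 / 2 : ℝ)) p
      (volume : Measure (Rd d)) := by
  rw [Lp.enorm_def]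
  refine eLpNorm_congr_enorm_ae ?_
  filter_upwards [enorm_truncLp_apply K v] with x hx
  rw [hx]
  rfl

theorem enorm_truncLp_le (K : ℕ) (v : ℕ → Sob d p n) : ‖truncLp K v‖ₑ ≤ l2Norm d p v := by
  rw [enorm_truncLp]
  refine eLpNorm_mono_enorm fun x => ?_
  simp only [enorm_eq_self]
  gcongr
  exact ENNReal.sum_le_tsum _

theorem tendsto_enorm_truncLp (hp' : p ≠ ∞) (v : ℕ → Sob d p n) :
    Tendsto (fun K => ‖truncLp K v‖ₑ) atTop (𝓝 (l2Norm d p v)) := by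
  have hp0 : p ≠ 0 := (zero_lt_one.trans_le (Fact.out : 1 ≤ p)).ne'
  simp only [enorm_truncLp, l2Norm]
  simp only [eLpNorm_eq_lintegral_rpow_enorm_toReal hp0 hp', enorm_eq_self]
  refine (ENNReal.continuous_rpow_const.tendsto _).comp ?_
  apply lintegral_tendsto_of_tendsto_of_monotone
  · intro K
    refine AEMeasurable.pow_const (AEMeasurable.pow_const ?_ _) _
    exact Finset.aemeasurable_fun_sum _ fun k _ =>
      ((Lp.aestronglyMeasurable _).enorm.pow_const _)
  · refine .of_forall fun x K L hKL => ?_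
    dsimp only
    gcongr
  · refine .of_forall fun x => ?_
    refine (ENNReal.continuous_rpow_const.tendsto _).comp ?_
    refine (ENNReal.continuous_rpow_const.tendsto _).comp ?_
    exact ENNReal.summable.hasSum.tendsto_sum_nat

theorem l2Norm_add_le (hp' : p ≠ ∞) (v w : ℕ → Sob d p n) :
    l2Norm d p (v + w) ≤ l2Norm d p v + l2Norm d p w := by
  refine le_of_tendsto (tendsto_enorm_truncLp hp' (v + w)) (.of_forall fun K => ?_)
  rw [truncLp_add]
  exact (enorm_add_le _ _).trans (add_le_add (enorm_truncLp_le K v) (enorm_truncLp_le K w))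

theorem aemeasurable_l2Norm (hp' : p ≠ ∞) {α : Type*} [MeasurableSpace α] {μ : Measure α}
    {g : ℕ → α → Sob d p n} (hg : ∀ k, AEStronglyMeasurable (g k) μ) :
    AEMeasurable (fun a => l2Norm d p fun k => g k a) μ := by
  refine aemeasurable_of_tendsto_metrizable_ae' (f := fun K a => ‖truncLp K fun k => g k a‖ₑ)
    (fun K => ?_) (.of_forall fun a => tendsto_enorm_truncLp hp' _)
  have hc : Continuous (Sob.toLp : Sob d p n →ₗ[ℝ] _) :=
    AddMonoidHomClass.continuous_of_bound (Sob.toLp : Sob d p n →ₗ[ℝ] _) 1 fun u => by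
      rw [one_mul, Sob.norm_def]
  refine AEStronglyMeasurable.enorm ?_
  exact Finset.aestronglyMeasurable_fun_sum _ fun k _ =>
    ((coordLp d p K k).continuous.comp hc).comp_aestronglyMeasurable (hg k)

theorem enorm_le_l2Norm (v : ℕ → Sob d p n) (k : ℕ) : ‖v k‖ₑ ≤ l2Norm d p v := by
  have : ‖v k‖ₑ = ‖(v k).toLp‖ₑ := rfl
  rw [this, Lp.enorm_def]
  refine eLpNorm_mono_enorm fun x => ?_
  rw [enorm_eq_self]
  calc ‖(v k).toLp x‖ₑ = (‖(v k).toLp x‖ₑ ^ (2 : ℝ)) ^ (1 / 2 : ℝ) := by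
        rw [← ENNReal.rpow_mul]; norm_num
    _ ≤ _ := by
        gcongr
        exact ENNReal.le_tsum k

theorem l2Norm_le_sum (hp' : p ≠ ∞) (v : ℕ → Sob d p n) {K : ℕ} (hv : ∀ k, K ≤ k → v k = 0) :
    l2Norm d p v ≤ ∑ k ∈ Finset.range K, ‖v k‖ₑ := by
  refine le_of_tendsto (tendsto_enorm_truncLp hp' v) ?_
  filter_upwards [eventually_ge_atTop K] with L hL
  have h1 : ∀ (k : Fin L), ‖coordLp d p L k (v k).toLp‖ₑ ≤ ‖v k‖ₑ := fun k => by
    rw [show ‖v k‖ₑ = ‖(v k).toLp‖ₑ from rfl, enorm_le_iff_norm_le]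
    refine (ContinuousLinearMap.norm_compLp_le _ _).trans ?_
    rw [ContinuousLinearMap.norm_toSpanSingleton]
    simp
  calc ‖truncLp L v‖ₑ ≤ ∑ k : Fin L, ‖v k‖ₑ :=
        (enorm_sum_le _ _).trans (Finset.sum_le_sum fun k _ => h1 k)
    _ = ∑ k ∈ Finset.range L, ‖v k‖ₑ := (Finset.sum_range fun k => ‖v k‖ₑ).symm
    _ = ∑ k ∈ Finset.range K, ‖v k‖ₑ := by
        symm
        refine Finset.sum_subset (Finset.range_mono hL) fun k _ hk => ?_
        rw [hv k (by simpa using hk), enorm_zero]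

end L2Norm

section AbsNorm

variable {V W : Type*} [NormedAddCommGroup V] [NormedAddCommGroup W] {H T : ℝ}

theorem absNorm_le_const_mul {c : ℝ≥0∞} (hc : c ≠ ∞) {φ : ℝ → V} {ψ : ℝ → W}
    (h : ∀ s, ‖φ s‖ₑ ≤ c * ‖ψ s‖ₑ) : absNorm H T φ ≤ c * absNorm H T ψ := by
  unfold absNorm
  calc _ ≤ (∫⁻ t, ∫⁻ s, c ^ (2 : ℝ) * (‖ψ t‖ₑ * ‖ψ s‖ₑ * ENNReal.ofReal (kernelH H t s))
        ∂leb T ∂leb T) ^ (1 / 2 : ℝ) := by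
        refine ENNReal.rpow_le_rpow (lintegral_mono fun t => lintegral_mono fun s => ?_) (by norm_num)
        calc _ ≤ c * ‖ψ t‖ₑ * (c * ‖ψ s‖ₑ) * ENNReal.ofReal (kernelH H t s) := by
              gcongr
              exacts [h t, h s]
          _ = _ := by
              rw [ENNReal.rpow_two]
              ring
    _ = _ := by
        have h2 : c ^ (2 : ℝ) ≠ ∞ := ENNReal.rpow_ne_top_of_nonneg (by norm_num) hc
        simp_rw [lintegral_const_mul' _ _ h2]
        rw [ENNReal.mul_rpow_of_nonneg _ _ (by norm_num), ← ENNReal.rpow_mul]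
        norm_num

theorem absNorm2_le_const_mul {c : ℝ≥0∞} (hc : c ≠ ∞) {φ : ℝ → ℝ → V} {ψ : ℝ → ℝ → W}
    (h : ∀ θ s, ‖φ θ s‖ₑ ≤ c * ‖ψ θ s‖ₑ) : absNorm2 H T φ ≤ c * absNorm2 H T ψ := by
  unfold absNorm2
  calc _ ≤ (∫⁻ t, ∫⁻ θ, ∫⁻ s, ∫⁻ η, c ^ (2 : ℝ) * (‖ψ t θ‖ₑ * ‖ψ s η‖ₑ *
        ENNReal.ofReal (kernelH H t s) * ENNReal.ofReal (kernelH H θ η))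
        ∂leb T ∂leb T ∂leb T ∂leb T) ^ (1 / 2 : ℝ) := by
        refine ENNReal.rpow_le_rpow (lintegral_mono fun t => lintegral_mono fun θ =>
          lintegral_mono fun s => lintegral_mono fun η => ?_) (by norm_num)
        calc _ ≤ c * ‖ψ t θ‖ₑ * (c * ‖ψ s η‖ₑ) * ENNReal.ofReal (kernelH H t s) *
                ENNReal.ofReal (kernelH H θ η) := by
              gcongr
              exacts [h t θ, h s η]
          _ = _ := by
              rw [ENNReal.rpow_two]
              ring
    _ = _ := by
        have h2 : c ^ (2 : ℝ) ≠ ∞ := ENNReal.rpow_ne_top_of_nonneg (by norm_num) hc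
        simp_rw [lintegral_const_mul' _ _ h2]
        rw [ENNReal.mul_rpow_of_nonneg _ _ (by norm_num), ← ENNReal.rpow_mul]
        norm_num

theorem absNorm_congr_norm {φ : ℝ → V} {ψ : ℝ → W} (h : ∀ s, ‖φ s‖ₑ = ‖ψ s‖ₑ) :
    absNorm H T φ = absNorm H T ψ := by
  simp only [absNorm, h]

theorem absNorm2_congr_norm {φ : ℝ → ℝ → V} {ψ : ℝ → ℝ → W} (h : ∀ θ s, ‖φ θ s‖ₑ = ‖ψ θ s‖ₑ) :
    absNorm2 H T φ = absNorm2 H T ψ := by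
  simp only [absNorm2, h]

theorem absNorm_zero : absNorm H T (fun _ => (0 : V)) = 0 := by
  simp [absNorm]

theorem absNorm2_zero : absNorm2 H T (fun _ _ => (0 : V)) = 0 := by
  simp [absNorm2]

end AbsNorm

section Grids

variable {T : ℝ} (π : Grid T)

theorem Grid.eq_of_mem {i j : Fin π.m} {s : ℝ} (hi : s ∈ Ioc (π.t i.castSucc) (π.t i.succ))
    (hj : s ∈ Ioc (π.t j.castSucc) (π.t j.succ)) : i = j := by
  by_contra hne
  rcases lt_or_gt_of_ne hne with h | h
  · have : π.t i.succ ≤ π.t j.castSucc := π.strictMono.monotone (by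
      rw [Fin.le_def]; simpa using h)
    linarith [hi.2, hj.1]
  · have : π.t j.succ ≤ π.t i.castSucc := π.strictMono.monotone (by
      rw [Fin.le_def]; simpa using h)
    linarith [hj.2, hi.1]

theorem Grid.sum_ind {V : Type*} [AddCommGroup V] [Module ℝ V] (a : Fin π.m → ℝ) (x : Fin π.m → V)
    {s : ℝ} {i : Fin π.m} (hi : s ∈ Ioc (π.t i.castSucc) (π.t i.succ)) :
    ∑ j, (a j * π.ind j s) • x j = a i • x i := by
  rw [Finset.sum_eq_single i]
  · simp [Grid.ind, indicator_of_mem hi]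
  · intro j _ hj
    have : s ∉ Ioc (π.t j.castSucc) (π.t j.succ) := fun h => hj (π.eq_of_mem h hi)
    simp [Grid.ind, indicator_of_notMem this]
  · simp

theorem Grid.enorm_sum_ind_le {V W : Type*} [NormedAddCommGroup V] [NormedSpace ℝ V]
    [NormedAddCommGroup W] [NormedSpace ℝ W] (a : Fin π.m → ℝ) {x : Fin π.m → V}
    {y : Fin π.m → W} {c : ℝ≥0∞} (h : ∀ i, ‖x i‖ₑ ≤ c * ‖y i‖ₑ) (s : ℝ) :
    ‖∑ i, (a i * π.ind i s) • x i‖ₑ ≤ c * ‖∑ i, (a i * π.ind i s) • y i‖ₑ := by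
  by_cases hs : ∃ i : Fin π.m, s ∈ Ioc (π.t i.castSucc) (π.t i.succ)
  · obtain ⟨i, hi⟩ := hs
    rw [π.sum_ind a x hi, π.sum_ind a y hi, enorm_smul, enorm_smul, mul_left_comm]
    gcongr
    exact h i
  · push Not at hs
    rw [Finset.sum_eq_zero, enorm_zero]
    · exact zero_le
    · intro i _
      simp [Grid.ind, indicator_of_notMem (hs i)]

theorem Grid.measurable_ind (i : Fin π.m) : Measurable (π.ind i) :=
  measurable_const.indicator measurableSet_Ioc

end Grids

section Malliavin

variable {Ω : Type*} [MeasurableSpace Ω] {H T : ℝ} {P : Measure Ω} {β : ℝ → Ω → ℝ}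
variable {V W : Type*} [NormedAddCommGroup V] [NormedSpace ℝ V]
  [NormedAddCommGroup W] [NormedSpace ℝ W]

theorem Cyl.aemeasurable_X (F : Cyl H T P β) : AEMeasurable (fun ω i => F.X i ω) P :=
  aemeasurable_pi_iff.2 fun i => (F.wiener i).2.2.1.aestronglyMeasurable.aemeasurable

theorem Cyl.aestronglyMeasurable_val (F : Cyl H T P β) : AEStronglyMeasurable F.val P :=
  (F.smooth.continuous.measurable.comp_aemeasurable F.aemeasurable_X).aestronglyMeasurable

theorem Cyl.continuous_fderiv (F : Cyl H T P β) (v : Fin F.n → ℝ) :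
    Continuous fun x => fderiv ℝ F.f x v :=
  (F.smooth.continuous_fderiv (by simp)).clm_apply continuous_const

theorem Cyl.aestronglyMeasurable_deriv [SFinite P] (F : Cyl H T P β) :
    AEStronglyMeasurable (fun z : Ω × ℝ => F.deriv z.1 z.2) (P.prod (leb T)) := by
  refine Finset.aestronglyMeasurable_fun_sum _ fun i _ => AEStronglyMeasurable.mul ?_ ?_
  · exact ((F.continuous_fderiv _).measurable.comp_aemeasurable
      F.aemeasurable_X).aestronglyMeasurable.comp_fst
  · exact (F.wiener i).1.comp_snd

/-- The elementary process with the vectors of `G` replaced by those of `w`. -/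
def SmoothElem.withVec {C : Set V} (G : SmoothElem H T P β C) {D : Set W} (w : Fin G.π.m → W)
    (hw : ∀ i, w i ∈ D) : SmoothElem H T P β D := ⟨G.π, G.F, w, hw⟩

theorem SmoothElem.withVec_val {C : Set V} (G : SmoothElem H T P β C) {D : Set W}
    (w : Fin G.π.m → W) (hw : ∀ i, w i ∈ D) (ω : Ω) (s : ℝ) :
    (G.withVec w hw).val ω s = ∑ i, ((G.F i).val ω * G.π.ind i s) • w i := rfl

theorem SmoothElem.withVec_deriv {C : Set V} (G : SmoothElem H T P β C) {D : Set W}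
    (w : Fin G.π.m → W) (hw : ∀ i, w i ∈ D) (ω : Ω) (θ s : ℝ) :
    (G.withVec w hw).deriv ω θ s = ∑ i, ((G.F i).deriv ω θ * G.π.ind i s) • w i := rfl

theorem SmoothElem.aestronglyMeasurable_val [SFinite P] {C : Set V} (G : SmoothElem H T P β C) :
    AEStronglyMeasurable (fun z : Ω × ℝ => G.val z.1 z.2) (P.prod (leb T)) := by
  refine Finset.aestronglyMeasurable_fun_sum _ fun i _ => AEStronglyMeasurable.smul_const ?_ _
  exact (G.F i).aestronglyMeasurable_val.comp_fst.mul
    (G.π.measurable_ind i).aestronglyMeasurable.comp_snd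

theorem SmoothElem.aestronglyMeasurable_deriv [SFinite P] {C : Set V}
    (G : SmoothElem H T P β C) :
    AEStronglyMeasurable (fun z : Ω × ℝ × ℝ => G.deriv z.1 z.2.1 z.2.2)
      (P.prod ((leb T).prod (leb T))) := by
  refine Finset.aestronglyMeasurable_fun_sum _ fun i _ => AEStronglyMeasurable.smul_const ?_ _
  refine AEStronglyMeasurable.mul ?_
    ((G.π.measurable_ind i).comp (measurable_snd.comp measurable_snd)).aestronglyMeasurable
  have hmp : MeasurePreserving (fun z : (Ω × ℝ) × ℝ => (z.1.1, z.1.2, z.2))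
      ((P.prod (leb T)).prod (leb T)) (P.prod ((leb T).prod (leb T))) :=
    measurePreserving_prodAssoc P (leb T) (leb T)
  have := ((G.F i).aestronglyMeasurable_deriv.comp_fst (ν := leb T))
  have h2 := (hmp.aestronglyMeasurable_comp_iff
    (MeasurableEquiv.prodAssoc (α := Ω) (β := ℝ) (γ := ℝ)).measurableEmbedding
    (g := fun z : Ω × ℝ × ℝ => (G.F i).deriv z.1 z.2.1)).1 this
  exact h2

theorem SmoothElem.isMalliavinDeriv [SFinite P] {p : ℝ≥0∞} (hp : 0 < p.toReal) {C : Set V}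
    (G : SmoothElem H T P β C) (h1 : ∫⁻ ω, absNorm H T (G.val ω) ^ p.toReal ∂P < ∞)
    (h2 : ∫⁻ ω, absNorm2 H T (G.deriv ω) ^ p.toReal ∂P < ∞) :
    IsMalliavinDeriv H T P β p G.val G.deriv := by
  refine ⟨G.aestronglyMeasurable_val, G.aestronglyMeasurable_deriv, h1, h2,
    fun _ => G.withVec G.v fun _ => mem_univ _, ?_, ?_⟩
  · have : ∀ ω s, G.val ω s - (G.withVec (D := univ) G.v fun _ => mem_univ _).val ω s = 0 :=
      fun ω s => sub_self _
    simp [this, absNorm_zero, hp]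
  · have : ∀ ω θ s, G.deriv ω θ s -
      (G.withVec (D := univ) G.v fun _ => mem_univ _).deriv ω θ s = 0 := fun ω θ s => sub_self _
    simp [this, absNorm2_zero, hp]

theorem SmoothElem.map_val {C : Set V} (G : SmoothElem H T P β C) (e : V ≃ₗᵢ[ℝ] W) {D : Set W}
    (hw : ∀ i, e (G.v i) ∈ D) (ω : Ω) (s : ℝ) :
    (G.withVec (fun i => e (G.v i)) hw).val ω s = e (G.val ω s) := by
  rw [SmoothElem.withVec_val, SmoothElem.val, map_sum]
  simp only [map_smul]

theorem SmoothElem.map_deriv {C : Set V} (G : SmoothElem H T P β C) (e : V ≃ₗᵢ[ℝ] W) {D : Set W}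
    (hw : ∀ i, e (G.v i) ∈ D) (ω : Ω) (θ s : ℝ) :
    (G.withVec (fun i => e (G.v i)) hw).deriv ω θ s = e (G.deriv ω θ s) := by
  rw [SmoothElem.withVec_deriv, SmoothElem.deriv, map_sum]
  simp only [map_smul]

theorem SmoothElem.enorm_val_withVec_sub_le {C : Set V} (G : SmoothElem H T P β C)
    (e : V ≃ₗᵢ[ℝ] W) {D : Set W} (w : Fin G.π.m → W) (hw : ∀ i, w i ∈ D) {c : ℝ≥0∞}
    (h : ∀ i, ‖w i - e (G.v i)‖ₑ ≤ c * ‖G.v i‖ₑ) (ω : Ω) (s : ℝ) :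
    ‖(G.withVec w hw).val ω s - e (G.val ω s)‖ₑ ≤ c * ‖G.val ω s‖ₑ := by
  rw [← SmoothElem.map_val (D := univ) _ _ (fun _ => mem_univ _)]
  rw [SmoothElem.withVec_val, SmoothElem.withVec_val, ← Finset.sum_sub_distrib]
  simp only [← smul_sub]
  exact G.π.enorm_sum_ind_le _ h s

theorem SmoothElem.enorm_deriv_withVec_sub_le {C : Set V} (G : SmoothElem H T P β C)
    (e : V ≃ₗᵢ[ℝ] W) {D : Set W} (w : Fin G.π.m → W) (hw : ∀ i, w i ∈ D) {c : ℝ≥0∞}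
    (h : ∀ i, ‖w i - e (G.v i)‖ₑ ≤ c * ‖G.v i‖ₑ) (ω : Ω) (θ s : ℝ) :
    ‖(G.withVec w hw).deriv ω θ s - e (G.deriv ω θ s)‖ₑ ≤ c * ‖G.deriv ω θ s‖ₑ := by
  rw [← SmoothElem.map_deriv (D := univ) _ _ (fun _ => mem_univ _)]
  rw [SmoothElem.withVec_deriv, SmoothElem.withVec_deriv, ← Finset.sum_sub_distrib]
  simp only [← smul_sub]
  exact G.π.enorm_sum_ind_le _ h s

theorem IsMalliavinDeriv.map {p : ℝ≥0∞} {g : Ω → ℝ → V} {h : Ω → ℝ → ℝ → V}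
    (hgh : IsMalliavinDeriv H T P β p g h) (e : V ≃ₗᵢ[ℝ] W) :
    IsMalliavinDeriv H T P β p (fun ω s => e (g ω s)) (fun ω θ s => e (h ω θ s)) := by
  obtain ⟨m1, m2, h1, h2, G, l1, l2⟩ := hgh
  refine ⟨e.continuous.comp_aestronglyMeasurable m1, e.continuous.comp_aestronglyMeasurable m2,
    ?_, ?_, fun j => (G j).withVec (fun i => e ((G j).v i)) fun _ => mem_univ _, ?_, ?_⟩
  · convert h1 using 4 with ω
    exact absNorm_congr_norm fun s => e.enorm_map _
  · convert h2 using 4 with ω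
    exact absNorm2_congr_norm fun θ s => e.enorm_map _
  · convert l1 using 6 with j ω
    exact absNorm_congr_norm fun s => by rw [SmoothElem.map_val, ← map_sub, e.enorm_map]
  · convert l2 using 6 with j ω
    exact absNorm2_congr_norm fun θ s => by rw [SmoothElem.map_deriv, ← map_sub, e.enorm_map]

end Malliavin

section Transport

variable {Ω : Type*} [MeasurableSpace Ω] {H T : ℝ} {P : Measure Ω} {β : ℕ → ℝ → Ω → ℝ}
variable {d : ℕ} {p : ℝ≥0∞} [Fact (1 ≤ p)] {n n' m : ℝ}

theorem LNormWith_eq (g : ℕ → Ω → ℝ → Sob d p n) (h : ℕ → Ω → ℝ → ℝ → Sob d p n) :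
    LNormWith H T P g h = mixNorm H T P p.toReal (fun ω s => l2Norm d p fun k => g k ω s)
      (fun ω θ s => l2Norm d p fun k => h k ω θ s) := rfl

theorem LNormWith_besselIso (hnm : n' = n - m) (g : ℕ → Ω → ℝ → Sob d p n)
    (h : ℕ → Ω → ℝ → ℝ → Sob d p n) :
    LNormWith H T P (fun k ω s => Sob.besselIso m hnm (g k ω s))
      (fun k ω θ s => Sob.besselIso m hnm (h k ω θ s)) = LNormWith H T P g h := by
  simp only [LNormWith_eq, l2Norm_besselIso]

theorem LNorm_besselIso_le (hnm : n' = n - m) (g : ℕ → Ω → ℝ → Sob d p n) :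
    LNorm H T P β (fun k ω s => Sob.besselIso m hnm (g k ω s)) ≤ LNorm H T P β g := by
  refine le_iInf₂ fun h hh => ?_
  rw [← LNormWith_besselIso hnm]
  exact iInf₂_le _ fun k => (hh k).map _

theorem LNorm_besselIso (hnm : n' = n - m) (g : ℕ → Ω → ℝ → Sob d p n) :
    LNorm H T P β (fun k ω s => Sob.besselIso m hnm (g k ω s)) = LNorm H T P β g := by
  refine (LNorm_besselIso_le hnm g).antisymm ?_
  have h := LNorm_besselIso_le (H := H) (T := T) (P := P) (β := β) (m := -m) (n' := n)
    (by linarith) (fun k ω s => Sob.besselIso m hnm (g k ω s))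
  simpa only [Sob.besselIso_besselIso] using h

theorem MemLWith.map (hnm : n' = n - m) {g : ℕ → Ω → ℝ → Sob d p n}
    {h : ℕ → Ω → ℝ → ℝ → Sob d p n} (hgh : MemLWith H T P β g h) :
    MemLWith H T P β (fun k ω s => Sob.besselIso m hnm (g k ω s))
      (fun k ω θ s => Sob.besselIso m hnm (h k ω θ s)) :=
  ⟨fun k => (hgh.1 k).map _, by rw [LNormWith_besselIso]; exact hgh.2⟩

theorem toReal_one_le (hp' : p ≠ ∞) : 1 ≤ p.toReal := by
  have := ENNReal.toReal_mono hp' (Fact.out : 1 ≤ p)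
  simpa using this

theorem LNormWith_add_le [SFinite P] (hH : 0 < H) (hH' : H < 1) (hp' : p ≠ ∞)
    {g g' : ℕ → Ω → ℝ → Sob d p n} {h h' : ℕ → Ω → ℝ → ℝ → Sob d p n}
    (hg : ∀ k, AEStronglyMeasurable (fun z : Ω × ℝ => g k z.1 z.2) (P.prod (leb T)))
    (hh : ∀ k, AEStronglyMeasurable (fun z : Ω × ℝ × ℝ => h k z.1 z.2.1 z.2.2)
      (P.prod ((leb T).prod (leb T)))) :
    LNormWith H T P (g + g') (h + h') ≤ 8 * (LNormWith H T P g h + LNormWith H T P g' h') := by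
  have h1 := toReal_one_le (p := p) hp'
  rw [LNormWith_eq, LNormWith_eq, LNormWith_eq]
  refine le_trans ?_ (mixNorm_add_le hH hH' h1 (aemeasurable_l2Norm hp' hg)
    (aemeasurable_l2Norm hp' hh))
  exact mixNorm_mono hH (by linarith) (fun ω s => l2Norm_add_le hp' _ _)
    (fun ω θ s => l2Norm_add_le hp' _ _)

theorem LNormWith_le_const_mul (hH : 0 < H) (hp' : p ≠ ∞) {c : ℝ≥0∞} (hc : c ≠ ∞) {K : ℕ}
    {g g' : ℕ → Ω → ℝ → Sob d p n} {h h' : ℕ → Ω → ℝ → ℝ → Sob d p n}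
    (h0 : ∀ k, K ≤ k → g k = 0) (h0' : ∀ k, K ≤ k → h k = 0)
    (hg : ∀ k ω s, ‖g k ω s‖ₑ ≤ c * ‖g' k ω s‖ₑ)
    (hh : ∀ k ω θ s, ‖h k ω θ s‖ₑ ≤ c * ‖h' k ω θ s‖ₑ) :
    LNormWith H T P g h ≤ K * c * LNormWith H T P g' h' := by
  have h1 := toReal_one_le (p := p) hp'
  have key : ∀ v v' : ℕ → Sob d p n, (∀ k, K ≤ k → v k = 0) → (∀ k, ‖v k‖ₑ ≤ c * ‖v' k‖ₑ) →
      l2Norm d p v ≤ K * c * l2Norm d p v' := fun v v' hv hvv' => by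
    refine (l2Norm_le_sum hp' v hv).trans ?_
    calc _ ≤ ∑ k ∈ Finset.range K, c * l2Norm d p v' := Finset.sum_le_sum fun k _ =>
          (hvv' k).trans (mul_le_mul_right (enorm_le_l2Norm v' k) c)
      _ = _ := by simp [mul_assoc]
  rw [LNormWith_eq, LNormWith_eq, ← mixNorm_const_mul hH (by linarith)
    (ENNReal.mul_ne_top (by simp) hc)]
  exact mixNorm_mono hH (by linarith)
    (fun ω s => key _ _ (fun k hk => by rw [h0 k hk]; rfl) fun k => hg k ω s)
    (fun ω θ s => key _ _ (fun k hk => by rw [h0' k hk]; rfl) fun k => hh k ω θ s)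

set_option maxHeartbeats 800000 in
theorem tildeL_besselIso [SFinite P] (hH : 0 < H) (hH' : H < 1) (hp' : p ≠ ∞) (hnm : n' = n - m)
    {g : ℕ → Ω → ℝ → Sob d p n} (hg : g ∈ tildeL H T P β d p n) :
    (fun k ω s => Sob.besselIso m hnm (g k ω s)) ∈ tildeL H T P β d p n' := by
  obtain ⟨h, hgh, K, G, gj, hj, egj, ehj, hmem, hlim⟩ := hg
  have hp1 := toReal_one_le (p := p) hp'
  let e := Sob.besselIso (d := d) (p := p) m hnm
  -- the tolerance
  let R : ℕ → ℝ := fun j => (LNormWith H T P (gj j) (hj j)).toReal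
  let ε : ℕ → ℝ := fun j => ((j + 1) * (K j + 1) * (R j + 1))⁻¹
  have hR : ∀ j, 0 ≤ R j := fun j => ENNReal.toReal_nonneg
  have hε : ∀ j, 0 < ε j := fun j => by have := hR j; positivity
  choose w hwmem hw using fun (j k : ℕ) (i : Fin (G j k).π.m) =>
    Sob.exists_testSob_approx m hnm ((G j k).mem i) (hε j)
  have hwe : ∀ j k i, ‖w j k i - e ((G j k).v i)‖ₑ ≤ ENNReal.ofReal (ε j) * ‖(G j k).v i‖ₑ := by
    intro j k i
    rw [← ofReal_norm, ← ofReal_norm, ← ENNReal.ofReal_mul (hε j).le]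
    refine ENNReal.ofReal_le_ofReal ((hw j k i).trans_eq ?_)
    rw [LinearIsometryEquiv.norm_map]
  let G' : ∀ _j k : ℕ, SmoothElem H T P (β k) (testSob d p n') :=
    fun j k => (G j k).withVec (w j k) (hwmem j k)
  let gj' : ℕ → ℕ → Ω → ℝ → Sob d p n' := fun j k => if k < K j then (G' j k).val else 0
  let hj' : ℕ → ℕ → Ω → ℝ → ℝ → Sob d p n' := fun j k => if k < K j then (G' j k).deriv else 0
  have dval : ∀ j k ω s, ‖gj' j k ω s - e (gj j k ω s)‖ₑ ≤
      ENNReal.ofReal (ε j) * ‖gj j k ω s‖ₑ := by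
    intro j k ω s
    rw [egj]
    by_cases hk : k < K j
    · have e1 : gj' j k = (G' j k).val := if_pos hk
      rw [e1, if_pos hk]
      exact (G j k).enorm_val_withVec_sub_le e (w j k) (hwmem j k) (hwe j k) ω s
    · simp [gj', hk]
  have dder : ∀ j k ω θ s, ‖hj' j k ω θ s - e (hj j k ω θ s)‖ₑ ≤
      ENNReal.ofReal (ε j) * ‖hj j k ω θ s‖ₑ := by
    intro j k ω θ s
    rw [ehj]
    by_cases hk : k < K j
    · have e1 : hj' j k = (G' j k).deriv := if_pos hk
      rw [e1, if_pos hk]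
      exact (G j k).enorm_deriv_withVec_sub_le e (w j k) (hwmem j k) (hwe j k) ω θ s
    · simp [hj', hk]
  have hbd : ∀ {x y : Sob d p n'} {x' : Sob d p n} {δ : ℝ≥0∞}, ‖x - y‖ₑ ≤ δ * ‖x'‖ₑ →
      ‖y‖ₑ = ‖x'‖ₑ → ‖x‖ₑ ≤ (1 + δ) * ‖x'‖ₑ := fun {x y x' δ} h1 h2 => by
    calc ‖x‖ₑ = ‖y + (x - y)‖ₑ := by rw [add_sub_cancel]
      _ ≤ ‖y‖ₑ + ‖x - y‖ₑ := enorm_add_le _ _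
      _ ≤ _ := by rw [add_mul, one_mul, h2]; gcongr
  have hc1 : ∀ j, 1 + ENNReal.ofReal (ε j) ≠ ∞ := fun j => by simp
  have hMD : ∀ j k, IsMalliavinDeriv H T P (β k) p (gj' j k) (hj' j k) := by
    intro j k
    by_cases hk : k < K j
    · have hM := (hmem j).1 k
      have e1 : gj' j k = (G' j k).val := by simp [gj', hk]
      have e2 : hj' j k = (G' j k).deriv := by simp [hj', hk]
      rw [e1, e2]
      have hfin : ∀ {a b : Ω → ℝ≥0∞} {c : ℝ≥0∞}, c ≠ ∞ → (∀ ω, a ω ≤ c * b ω) →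
          ∫⁻ ω, b ω ^ p.toReal ∂P < ∞ → ∫⁻ ω, a ω ^ p.toReal ∂P < ∞ := fun {a b c} hc hab hb => by
        have hc' : c ^ p.toReal ≠ ∞ := ENNReal.rpow_ne_top_of_nonneg (by linarith) hc
        calc ∫⁻ ω, a ω ^ p.toReal ∂P ≤ ∫⁻ ω, c ^ p.toReal * b ω ^ p.toReal ∂P := by
              refine lintegral_mono fun ω => ?_
              rw [← ENNReal.mul_rpow_of_nonneg _ _ (by linarith)]
              exact ENNReal.rpow_le_rpow (hab ω) (by linarith)
          _ < ∞ := by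
              rw [lintegral_const_mul' _ _ hc']
              exact ENNReal.mul_lt_top hc'.lt_top hb
      refine SmoothElem.isMalliavinDeriv (by linarith) _ ?_ ?_
      · refine hfin (hc1 j) (fun ω => ?_) hM.2.2.1
        refine absNorm_le_const_mul (hc1 j) fun s => ?_
        rw [← e1]
        exact hbd (dval j k ω s) (e.enorm_map _)
      · refine hfin (hc1 j) (fun ω => ?_) hM.2.2.2.1
        refine absNorm2_le_const_mul (hc1 j) fun θ s => ?_
        rw [← e2]
        exact hbd (dder j k ω θ s) (e.enorm_map _)
    · have hM := ((hmem j).1 k).map e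
      have e1 : gj' j k = fun ω s => e (gj j k ω s) := by
        funext ω s
        simp [gj', hk, egj]
      have e2 : hj' j k = fun ω θ s => e (hj j k ω θ s) := by
        funext ω θ s
        simp [hj', hk, ehj]
      rw [e1, e2]
      exact hM
  let eg : (ℕ → Ω → ℝ → Sob d p n) → ℕ → Ω → ℝ → Sob d p n' := fun g k ω s => e (g k ω s)
  let eh : (ℕ → Ω → ℝ → ℝ → Sob d p n) → ℕ → Ω → ℝ → ℝ → Sob d p n' :=
    fun h k ω θ s => e (h k ω θ s)
  have hdiff : ∀ j, LNormWith H T P (gj' j - eg (gj j)) (hj' j - eh (hj j)) ≤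
      ENNReal.ofReal ((j + 1 : ℝ)⁻¹) := by
    intro j
    have h1 : LNormWith H T P (gj' j - eg (gj j)) (hj' j - eh (hj j)) ≤
        K j * ENNReal.ofReal (ε j) * LNormWith H T P (eg (gj j)) (eh (hj j)) := by
      refine LNormWith_le_const_mul hH hp' ENNReal.ofReal_ne_top ?_ ?_ ?_ ?_
      · intro k hk
        funext ω s
        simp [gj', eg, egj, hk.not_gt]
      · intro k hk
        funext ω θ s
        simp [hj', eh, ehj, hk.not_gt]
      · intro k ω s
        simpa [eg] using dval j k ω s
      · intro k ω θ s
        simpa [eh] using dder j k ω θ s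
    rw [LNormWith_besselIso] at h1
    refine h1.trans ?_
    rw [← ENNReal.ofReal_toReal (hmem j).2.ne, ← ENNReal.ofReal_natCast,
      ← ENNReal.ofReal_mul (by positivity), ← ENNReal.ofReal_mul (by have := hε j; positivity)]
    refine ENNReal.ofReal_le_ofReal ?_
    change (K j : ℝ) * ε j * R j ≤ _
    have := hR j
    simp only [ε, mul_inv]
    calc (K j : ℝ) * ((j + 1 : ℝ)⁻¹ * (K j + 1 : ℝ)⁻¹ * (R j + 1)⁻¹) * R j
        = (j + 1 : ℝ)⁻¹ * (K j / (K j + 1)) * (R j / (R j + 1)) := by ring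
      _ ≤ (j + 1 : ℝ)⁻¹ * 1 * 1 := by
          gcongr
          · rw [div_le_one (by positivity)]; linarith
          · rw [div_le_one (by positivity)]; linarith
      _ = _ := by ring
  have hms := fun j k => ((hMD j k).1.sub ((hmem j).map hnm |>.1 k).1)
  have hms2 := fun j k => ((hMD j k).2.1.sub ((hmem j).map hnm |>.1 k).2.1)
  have htri : ∀ j g₂ h₂, LNormWith H T P (gj' j - g₂) (hj' j - h₂) ≤
      8 * (ENNReal.ofReal ((j + 1 : ℝ)⁻¹) +
        LNormWith H T P (eg (gj j) - g₂) (eh (hj j) - h₂)) := by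
    intro j g₂ h₂
    have := LNormWith_add_le (g := gj' j - eg (gj j)) (h := hj' j - eh (hj j))
      (g' := eg (gj j) - g₂) (h' := eh (hj j) - h₂) hH hH' hp' (hms j) (hms2 j)
    have a1 : gj' j - eg (gj j) + (eg (gj j) - g₂) = gj' j - g₂ := by abel
    have a2 : hj' j - eh (hj j) + (eh (hj j) - h₂) = hj' j - h₂ := by abel
    rw [← a1, ← a2]
    refine this.trans ?_
    gcongr
    exact hdiff j
  refine ⟨eh h, hgh.map hnm, K, G', gj', hj', fun _ _ => rfl, fun _ _ => rfl,
    fun j => ⟨hMD j, ?_⟩, ?_⟩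
  · have := htri j 0 0
    rw [sub_zero, sub_zero, sub_zero, sub_zero, LNormWith_besselIso] at this
    refine this.trans_lt (ENNReal.mul_lt_top (by simp) (ENNReal.add_lt_top.2 ⟨by simp, (hmem j).2⟩))
  · have hz : Tendsto (fun j : ℕ => 8 * (ENNReal.ofReal ((j + 1 : ℝ)⁻¹) +
        LNormWith H T P (gj j - g) (hj j - h))) atTop (𝓝 0) := by
      have l1 : Tendsto (fun j : ℕ => ENNReal.ofReal ((j + 1 : ℝ)⁻¹)) atTop (𝓝 0) := by
        have := ENNReal.tendsto_ofReal (tendsto_one_div_add_atTop_nhds_zero_nat (𝕜 := ℝ))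
        simpa using this
      have := ENNReal.Tendsto.const_mul (a := 8) (l1.add hlim) (Or.inr (by simp))
      simpa using this
    refine tendsto_of_tendsto_of_tendsto_of_le_of_le tendsto_const_nhds hz
      (fun _ => zero_le) fun j => ?_
    refine (htri j _ _).trans_eq ?_
    congr 2
    rw [← LNormWith_besselIso (m := m) hnm]
    congr 1

theorem bijOn_tildeL [SFinite P] (hH : 0 < H) (hH' : H < 1) (hp' : p ≠ ∞) (n m : ℝ) :
    BijOn (fun (g : ℕ → Ω → ℝ → Sob d p n) k ω s => (g k ω s).besselSob m)
      (tildeL H T P β d p n) (tildeL H T P β d p (n - m)) := by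
  refine BijOn.mk (fun g hg => tildeL_besselIso hH hH' hp' rfl hg) ?_ ?_
  · intro g _ g' _ h
    funext k ω s
    have := congrFun (congrFun (congrFun h k) ω) s
    exact (Sob.besselIso (d := d) (p := p) (n := n) m rfl).injective this
  · intro g hg
    refine ⟨fun k ω s => Sob.besselIso (-m) (by ring) (g k ω s),
      tildeL_besselIso hH hH' hp' (by ring) hg, ?_⟩
    funext k ω s
    exact Sob.besselIso_besselIso (-m) m (by ring) rfl (g k ω s)

end Transport

section Singular

theorem lintegral_rpow_Ioc {γ L : ℝ} (hγ : γ < 1) (hL : 0 ≤ L) :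
    ∫⁻ x in Ioc 0 L, ENNReal.ofReal (x ^ (-γ)) = ENNReal.ofReal (L ^ (1 - γ) / (1 - γ)) := by
  have hi : IntervalIntegrable (fun x : ℝ => x ^ (-γ)) volume 0 L :=
    intervalIntegral.intervalIntegrable_rpow' (by linarith)
  rw [intervalIntegrable_iff_integrableOn_Ioc_of_le hL] at hi
  rw [← ofReal_integral_eq_lintegral_ofReal hi, ← intervalIntegral.integral_of_le hL,
    integral_rpow (Or.inl (by linarith)), Real.zero_rpow (by linarith)]
  · congr 2 <;> ring_nf
  · exact (ae_restrict_mem measurableSet_Ioc).mono fun x hx => Real.rpow_nonneg hx.1.le _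

theorem measurable_ofReal_abs_rpow (γ : ℝ) :
    Measurable fun x : ℝ => ENNReal.ofReal (|x| ^ (-γ)) := by fun_prop

theorem lintegral_abs_rpow_Icc_le {γ L : ℝ} (hγ : γ < 1) (hL : 0 ≤ L) :
    ∫⁻ x in Icc (-L) L, ENNReal.ofReal (|x| ^ (-γ)) ≤
      ENNReal.ofReal (2 / (1 - γ) * L ^ (1 - γ)) := by
  have hsub : Icc (-L) L ⊆ Icc (-L) 0 ∪ Icc 0 L := fun x hx => by
    rcases le_total x 0 with h | h
    · exact Or.inl ⟨hx.1, h⟩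
    · exact Or.inr ⟨h, hx.2⟩
  have h1 : ∫⁻ x in Icc 0 L, ENNReal.ofReal (|x| ^ (-γ)) =
      ENNReal.ofReal (L ^ (1 - γ) / (1 - γ)) := by
    rw [← lintegral_rpow_Ioc hγ hL, ← setLIntegral_congr Ioc_ae_eq_Icc]
    exact setLIntegral_congr_fun measurableSet_Ioc fun x hx => by
      rw [abs_of_pos hx.1]
  have h2 : ∫⁻ x in Icc (-L) 0, ENNReal.ofReal (|x| ^ (-γ)) =
      ∫⁻ x in Icc 0 L, ENNReal.ofReal (|x| ^ (-γ)) := by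
    rw [← lintegral_indicator measurableSet_Icc, ← lintegral_indicator measurableSet_Icc,
      ← lintegral_neg_eq_self]
    congr 1
    funext x
    have : -x ∈ Icc (-L) 0 ↔ x ∈ Icc 0 L := by
      simp only [mem_Icc]
      constructor <;> rintro ⟨a, b⟩ <;> constructor <;> linarith
    by_cases hx : x ∈ Icc 0 L
    · rw [indicator_of_mem hx, indicator_of_mem (this.2 hx), abs_neg]
    · rw [indicator_of_notMem hx, indicator_of_notMem (fun h => hx (this.1 h))]
  calc _ ≤ _ := lintegral_mono_set hsub
    _ ≤ _ := lintegral_union_le _ _ _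
    _ = _ := by
      have : 0 ≤ L ^ (1 - γ) / (1 - γ) := div_nonneg (Real.rpow_nonneg hL _) (by linarith)
      rw [h2, h1, ← ENNReal.ofReal_add this this]
      congr 1
      ring

theorem lintegral_abs_sub_rpow_le {γ : ℝ} (h0 : 0 ≤ γ) (hγ : γ < 1) {a b : ℝ} (hab : a ≤ b)
    (s : ℝ) : ∫⁻ r in Ioc a b, ENNReal.ofReal (|s - r| ^ (-γ)) ≤
      ENNReal.ofReal (3 / (1 - γ) * (b - a) ^ (1 - γ)) := by
  rcases hab.eq_or_lt with rfl | hlt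
  · simp
  have hL : 0 < b - a := by linarith
  set L := b - a
  let g : ℝ → ℝ≥0∞ := (Icc (-L) L).indicator fun x => ENNReal.ofReal (|x| ^ (-γ))
  have hpt : ∀ r, ENNReal.ofReal (|s - r| ^ (-γ)) ≤ g (s - r) + ENNReal.ofReal (L ^ (-γ)) := by
    intro r
    by_cases hr : s - r ∈ Icc (-L) L
    · simp only [g, indicator_of_mem hr]
      exact le_self_add
    · refine le_add_of_nonneg_of_le zero_le (ENNReal.ofReal_le_ofReal ?_)
      have : L ≤ |s - r| := by
        by_contra hlt
        exact hr (abs_le.1 (not_le.1 hlt).le)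
      exact Real.rpow_le_rpow_of_nonpos hL this (by linarith)
  have hg : Measurable g := (measurable_ofReal_abs_rpow γ).indicator measurableSet_Icc
  calc _ ≤ ∫⁻ r in Ioc a b, (g (s - r) + ENNReal.ofReal (L ^ (-γ))) := lintegral_mono hpt
    _ = (∫⁻ r in Ioc a b, g (s - r)) + ENNReal.ofReal (L ^ (-γ)) * ENNReal.ofReal L := by
        rw [lintegral_add_right _ measurable_const]
        simp [L]
    _ ≤ (∫⁻ r, g (s - r)) + ENNReal.ofReal (L ^ (-γ)) * ENNReal.ofReal L := by
        gcongr
        exact Measure.restrict_le_self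
    _ = (∫⁻ r in Icc (-L) L, ENNReal.ofReal (|r| ^ (-γ))) +
          ENNReal.ofReal (L ^ (-γ)) * ENNReal.ofReal L := by
        rw [lintegral_sub_left_eq_self g s, lintegral_indicator measurableSet_Icc]
    _ ≤ ENNReal.ofReal (2 / (1 - γ) * L ^ (1 - γ)) + ENNReal.ofReal (L ^ (1 - γ)) := by
        gcongr
        · exact lintegral_abs_rpow_Icc_le hγ hL.le
        · rw [← ENNReal.ofReal_mul (by positivity), ← Real.rpow_add_one hL.ne']
          exact le_of_eq (by ring_nf)
    _ ≤ _ := by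
        have h1 : 0 < 1 - γ := by linarith
        rw [← ENNReal.ofReal_add (by positivity) (by positivity)]
        refine ENNReal.ofReal_le_ofReal ?_
        have h2 : 0 ≤ L ^ (1 - γ) := by positivity
        have h3 : 1 ≤ 1 / (1 - γ) := by rw [le_div_iff₀ h1]; linarith
        calc 2 / (1 - γ) * L ^ (1 - γ) + L ^ (1 - γ)
            ≤ 2 / (1 - γ) * L ^ (1 - γ) + 1 / (1 - γ) * L ^ (1 - γ) := by
              gcongr
              exact le_mul_of_one_le_left h2 h3
          _ = _ := by ring

end Singular

section Kernel

variable {H T : ℝ}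

theorem measurable_kernelH (H : ℝ) : Measurable fun z : ℝ × ℝ => kernelH H z.1 z.2 := by
  unfold kernelH
  fun_prop

theorem measurable_ofReal_kernelH (H : ℝ) :
    Measurable fun z : ℝ × ℝ => ENNReal.ofReal (kernelH H z.1 z.2) :=
  (measurable_kernelH H).ennreal_ofReal

theorem measurable_ofReal_kernelH_left (H s : ℝ) :
    Measurable fun r : ℝ => ENNReal.ofReal (kernelH H s r) := by
  unfold kernelH
  fun_prop

theorem measurable_ofReal_kernelH_right (H s : ℝ) :
    Measurable fun r : ℝ => ENNReal.ofReal (kernelH H r s) := by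
  unfold kernelH
  fun_prop

theorem measurable_ofReal_kernelH_swap (H : ℝ) :
    Measurable fun z : ℝ × ℝ => ENNReal.ofReal (kernelH H z.2 z.1) := by
  unfold kernelH
  fun_prop

theorem kernelH_comm (H t s : ℝ) : kernelH H t s = kernelH H s t := by
  unfold kernelH
  rw [abs_sub_comm]

theorem kernelH_nonneg (hH : 1 / 2 < H) (t s : ℝ) : 0 ≤ kernelH H t s := by
  unfold kernelH
  have : 0 < 2 * H - 1 := by linarith
  positivity

theorem lintegral_kernelH_rpow_le (hH : 1 / 2 < H) {q : ℝ} (hq : 0 < q)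
    (hH' : H < 1) (hq' : q * (2 - 2 * H) < 1) :
    ∃ C : ℝ≥0∞, C ≠ ∞ ∧ ∀ s a b, a ≤ b → ∫⁻ r in Ioc a b, ENNReal.ofReal (kernelH H s r) ^ q ≤
      C * ENNReal.ofReal ((b - a) ^ (1 - q * (2 - 2 * H))) := by
  have hα : 0 < H * (2 * H - 1) := by nlinarith
  refine ⟨ENNReal.ofReal ((H * (2 * H - 1)) ^ q * (3 / (1 - q * (2 - 2 * H)))),
    ENNReal.ofReal_ne_top, fun s a b hab => ?_⟩
  have h1 : ∀ r, ENNReal.ofReal (kernelH H s r) ^ q =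
      ENNReal.ofReal ((H * (2 * H - 1)) ^ q) * ENNReal.ofReal (|s - r| ^ (-(q * (2 - 2 * H)))) := by
    intro r
    rw [ENNReal.ofReal_rpow_of_nonneg (kernelH_nonneg hH _ _) hq.le,
      ← ENNReal.ofReal_mul (by positivity), kernelH, Real.mul_rpow hα.le (by positivity),
      ← Real.rpow_mul (abs_nonneg _)]
    congr 3
    ring
  simp_rw [h1]
  rw [lintegral_const_mul' _ _ ENNReal.ofReal_ne_top, ENNReal.ofReal_mul (by positivity), mul_assoc]
  gcongr
  have h2 : 0 < 1 - q * (2 - 2 * H) := by linarith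
  rw [← ENNReal.ofReal_mul (by positivity)]
  exact lintegral_abs_sub_rpow_le (by nlinarith) hq' hab s

theorem leb_eq_Ioc (T : ℝ) : leb T = volume.restrict (Ioc 0 T) :=
  (Measure.restrict_congr_set Ioc_ae_eq_Icc).symm

theorem leb_restrict_Ioc {a b : ℝ} (ha : 0 ≤ a) (hb : b ≤ T) :
    (leb T).restrict (Ioc a b) = volume.restrict (Ioc a b) := by
  rw [leb, Measure.restrict_restrict measurableSet_Ioc, inter_eq_left.2]
  exact fun x hx => ⟨ha.trans hx.1.le, hx.2.trans hb⟩

/-- Schur's test for the kernel on an interval. -/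
theorem lintegral_kernelH_schur (hH : 1 / 2 < H) (hH' : H < 1) :
    ∃ C : ℝ≥0∞, C ≠ ∞ ∧ ∀ a b, a ≤ b → ∀ f : ℝ → ℝ≥0∞,
      AEMeasurable f (volume.restrict (Ioc a b)) →
      ∫⁻ s in Ioc a b, ∫⁻ r in Ioc a b, f s * f r * ENNReal.ofReal (kernelH H s r) ≤
        C * ENNReal.ofReal ((b - a) ^ (2 * H - 1)) * ∫⁻ s in Ioc a b, f s ^ (2 : ℝ) := by
  obtain ⟨C, hC, hk⟩ := lintegral_kernelH_rpow_le hH one_pos hH' (by linarith)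
  simp only [ENNReal.rpow_one] at hk
  refine ⟨2 * C, ENNReal.mul_ne_top (by simp) hC, fun a b hab f hf => ?_⟩
  set μ := volume.restrict (Ioc a b)
  have hkm := measurable_ofReal_kernelH H
  have hpt : ∀ s r, f s * f r * ENNReal.ofReal (kernelH H s r) ≤
      f s ^ (2 : ℝ) * ENNReal.ofReal (kernelH H s r) +
        f r ^ (2 : ℝ) * ENNReal.ofReal (kernelH H s r) := by
    intro s r
    rw [← add_mul]
    gcongr
    rw [ENNReal.rpow_two, ENNReal.rpow_two]
    rcases le_total (f s) (f r) with h | h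
    · calc f s * f r ≤ f r * f r := by gcongr
        _ ≤ _ := by rw [sq, sq]; exact le_add_self
    · calc f s * f r ≤ f s * f s := by gcongr
        _ ≤ _ := by rw [sq, sq]; exact le_self_add
  have h2 : 1 - 1 * (2 - 2 * H) = 2 * H - 1 := by ring
  have hone : ∫⁻ s, ∫⁻ r, f s ^ (2 : ℝ) * ENNReal.ofReal (kernelH H s r) ∂μ ∂μ ≤
      C * ENNReal.ofReal ((b - a) ^ (2 * H - 1)) * ∫⁻ s, f s ^ (2 : ℝ) ∂μ := by
    rw [mul_comm _ (∫⁻ s, f s ^ (2 : ℝ) ∂μ), ← lintegral_mul_const' _ _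
      (ENNReal.mul_ne_top hC ENNReal.ofReal_ne_top)]
    refine lintegral_mono fun s => ?_
    dsimp only
    rw [lintegral_const_mul _ (measurable_ofReal_kernelH_left H s)]
    gcongr
    have := hk s a b hab
    rwa [h2] at this
  have htwo : ∫⁻ s, ∫⁻ r, f r ^ (2 : ℝ) * ENNReal.ofReal (kernelH H s r) ∂μ ∂μ =
      ∫⁻ s, ∫⁻ r, f s ^ (2 : ℝ) * ENNReal.ofReal (kernelH H s r) ∂μ ∂μ := by
    rw [lintegral_lintegral_swap]
    · simp_rw [kernelH_comm H]
    · exact (hf.pow_const _).comp_snd.mul hkm.aemeasurable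
  calc _ ≤ ∫⁻ s, ∫⁻ r, (f s ^ (2 : ℝ) * ENNReal.ofReal (kernelH H s r) +
        f r ^ (2 : ℝ) * ENNReal.ofReal (kernelH H s r)) ∂μ ∂μ :=
        lintegral_mono fun s => lintegral_mono fun r => hpt s r
    _ = ∫⁻ s, ∫⁻ r, f s ^ (2 : ℝ) * ENNReal.ofReal (kernelH H s r) ∂μ ∂μ +
        ∫⁻ s, ∫⁻ r, f r ^ (2 : ℝ) * ENNReal.ofReal (kernelH H s r) ∂μ ∂μ := by
        rw [← lintegral_add_left']
        · refine lintegral_congr fun s => ?_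
          exact lintegral_add_left ((measurable_ofReal_kernelH_left H s).const_mul _) _
        · exact AEMeasurable.lintegral_prod_right' (f := fun z : ℝ × ℝ => f z.1 ^ (2 : ℝ) *
            ENNReal.ofReal (kernelH H z.1 z.2)) ((hf.pow_const _).comp_fst.mul hkm.aemeasurable)
    _ ≤ _ := by
        rw [htwo, ← two_mul, mul_assoc, mul_assoc]
        gcongr
        rw [← mul_assoc]
        exact hone

theorem sq_lintegral_mul_le_young {α : Type*} [MeasurableSpace α] {μ : Measure α}
    (hH : 1 / 2 < H) (hH' : H < 1) {f k : α → ℝ≥0∞} (hf : AEMeasurable f μ)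
    (hkr : AEMeasurable k μ) {q : ℝ} (hq : q = 2 / (3 - 2 * H)) {D : ℝ≥0∞}
    (hD : ∫⁻ θ, k θ ^ q ∂μ ≤ D) :
    (∫⁻ θ, f θ * k θ ∂μ) ^ (2 : ℝ) ≤ (∫⁻ θ, f θ ^ (1 / H) * k θ ^ q ∂μ) *
      ((∫⁻ θ, f θ ^ (1 / H) ∂μ) ^ (2 * H - 1) * D ^ (2 - 2 * H)) := by
  have hH0 : 0 < H := by linarith
  have h32 : 0 < 3 - 2 * H := by linarith
  have hq0 : 0 < q := by rw [hq]; positivity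
  have hq2 : q < 2 := by rw [hq, div_lt_iff₀ h32]; linarith
  have h1 : 1 / (2 * H) ≤ 1 := by rw [div_le_one (by linarith)]; linarith
  have e1 : ∀ θ, f θ * k θ = (f θ ^ (1 / (2 * H)) * k θ ^ (q / 2)) *
      (f θ ^ (1 - 1 / (2 * H)) * k θ ^ (1 - q / 2)) := by
    intro θ
    have a1 : f θ = f θ ^ (1 / (2 * H)) * f θ ^ (1 - 1 / (2 * H)) := by
      rw [← ENNReal.rpow_add_of_nonneg _ _ (by positivity) (by linarith), add_sub_cancel,
        ENNReal.rpow_one]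
    have a2 : k θ = k θ ^ (q / 2) * k θ ^ (1 - q / 2) := by
      rw [← ENNReal.rpow_add_of_nonneg _ _ (by positivity) (by linarith), add_sub_cancel,
        ENNReal.rpow_one]
    rw [mul_mul_mul_comm, ← a1, ← a2]
  have cs := ENNReal.lintegral_mul_le_Lp_mul_Lq μ (Real.HolderConjugate.two_two)
    (f := fun θ => f θ ^ (1 / (2 * H)) * k θ ^ (q / 2))
    (g := fun θ => f θ ^ (1 - 1 / (2 * H)) * k θ ^ (1 - q / 2))
    ((hf.pow_const _).mul (hkr.pow_const _)) ((hf.pow_const _).mul (hkr.pow_const _))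
  have s1 : ∀ θ, (f θ ^ (1 / (2 * H)) * k θ ^ (q / 2)) ^ (2 : ℝ) = f θ ^ (1 / H) * k θ ^ q := by
    intro θ
    rw [ENNReal.mul_rpow_of_nonneg _ _ (by norm_num), ← ENNReal.rpow_mul, ← ENNReal.rpow_mul]
    congr 2 <;> field_simp
  have s2 : ∀ θ, (f θ ^ (1 - 1 / (2 * H)) * k θ ^ (1 - q / 2)) ^ (2 : ℝ) =
      f θ ^ (2 - 1 / H) * k θ ^ (2 - q) := by
    intro θ
    rw [ENNReal.mul_rpow_of_nonneg _ _ (by norm_num), ← ENNReal.rpow_mul, ← ENNReal.rpow_mul]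
    congr 2 <;> field_simp
  have hold : ∫⁻ θ, f θ ^ (2 - 1 / H) * k θ ^ (2 - q) ∂μ ≤
      (∫⁻ θ, f θ ^ (1 / H) ∂μ) ^ (2 * H - 1) * D ^ (2 - 2 * H) := by
    have hconj : (1 / (2 * H - 1)).HolderConjugate (1 / (2 - 2 * H)) := by
      rw [Real.holderConjugate_iff]
      refine ⟨?_, ?_⟩
      · rw [lt_div_iff₀ (by linarith)]; linarith
      · simp only [one_div, inv_inv]; ring
    have h := ENNReal.lintegral_mul_le_Lp_mul_Lq μ hconj
      (f := fun θ => f θ ^ (2 - 1 / H)) (g := fun θ => k θ ^ (2 - q))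
      (hf.pow_const _) (hkr.pow_const _)
    refine h.trans ?_
    have b1 : ∀ θ, (f θ ^ (2 - 1 / H)) ^ (1 / (2 * H - 1)) = f θ ^ (1 / H) := by
      intro θ
      rw [← ENNReal.rpow_mul]
      congr 1
      have : 2 * H - 1 ≠ 0 := by linarith
      field_simp
    have b2 : ∀ θ, (k θ ^ (2 - q)) ^ (1 / (2 - 2 * H)) = k θ ^ q := by
      intro θ
      rw [← ENNReal.rpow_mul]
      congr 1
      have : 1 - H ≠ 0 := by linarith
      rw [hq, show 2 - 2 * H = 2 * (1 - H) by ring]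
      field_simp
      ring
    simp only [b1, b2, one_div_one_div]
    exact mul_le_mul_right (ENNReal.rpow_le_rpow hD (by linarith)) _
  simp only [s1, s2] at cs
  calc (∫⁻ θ, f θ * k θ ∂μ) ^ (2 : ℝ)
      ≤ ((∫⁻ θ, f θ ^ (1 / H) * k θ ^ q ∂μ) ^ (1 / 2 : ℝ) *
        (∫⁻ θ, f θ ^ (2 - 1 / H) * k θ ^ (2 - q) ∂μ) ^ (1 / 2 : ℝ)) ^ (2 : ℝ) := by
        refine ENNReal.rpow_le_rpow (le_trans (le_of_eq ?_) cs) (by norm_num)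
        exact lintegral_congr e1
    _ = (∫⁻ θ, f θ ^ (1 / H) * k θ ^ q ∂μ) *
        (∫⁻ θ, f θ ^ (2 - 1 / H) * k θ ^ (2 - q) ∂μ) := by
        rw [ENNReal.mul_rpow_of_nonneg _ _ (by norm_num), ← ENNReal.rpow_mul, ← ENNReal.rpow_mul]
        norm_num
    _ ≤ _ := mul_le_mul_right hold _

/-- Young's inequality for the kernel, on an interval. -/
theorem lintegral_kernelH_young (hH : 1 / 2 < H) (hH' : H < 1) (hT : 0 ≤ T) :
    ∃ C : ℝ≥0∞, C ≠ ∞ ∧ ∃ ε : ℝ, 0 < ε ∧ ∀ a b, a ≤ b → ∀ f : ℝ → ℝ≥0∞, AEMeasurable f (leb T) →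
      ∫⁻ r in Ioc a b, (∫⁻ θ, f θ * ENNReal.ofReal (kernelH H θ r) ∂leb T) ^ (2 : ℝ) ≤
        C * ENNReal.ofReal ((b - a) ^ ε) * (∫⁻ θ, f θ ^ (1 / H) ∂leb T) ^ (2 * H) := by
  have hH0 : 0 < H := by linarith
  have h32 : 0 < 3 - 2 * H := by linarith
  set q : ℝ := 2 / (3 - 2 * H) with hq
  have hq0 : 0 < q := by positivity
  have hq2 : q < 2 := by rw [hq, div_lt_iff₀ h32]; linarith
  have hq1 : q * (2 - 2 * H) < 1 := by
    rw [hq, div_mul_eq_mul_div, div_lt_one h32]; linarith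
  obtain ⟨C, hC, hk⟩ := lintegral_kernelH_rpow_le hH hq0 hH' hq1
  set ε := 1 - q * (2 - 2 * H) with hε
  have hε0 : 0 < ε := by linarith
  set D : ℝ≥0∞ := C * ENNReal.ofReal (T ^ ε) with hD
  have hDtop : D ≠ ∞ := ENNReal.mul_ne_top hC ENNReal.ofReal_ne_top
  refine ⟨C * D ^ (2 - 2 * H), ENNReal.mul_ne_top hC (ENNReal.rpow_ne_top_of_nonneg (by linarith)
    hDtop), ε, hε0, fun a b hab f hf => ?_⟩
  have hkm := measurable_ofReal_kernelH H
  set S := ∫⁻ θ, f θ ^ (1 / H) ∂leb T with hS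
  have hkm' := measurable_ofReal_kernelH_right H
  have hpt : ∀ r, (∫⁻ θ, f θ * ENNReal.ofReal (kernelH H θ r) ∂leb T) ^ (2 : ℝ) ≤
      (∫⁻ θ, f θ ^ (1 / H) * ENNReal.ofReal (kernelH H θ r) ^ q ∂leb T) *
        (S ^ (2 * H - 1) * D ^ (2 - 2 * H)) := by
    intro r
    refine sq_lintegral_mul_le_young hH hH' hf (hkm' r).aemeasurable hq ?_
    have := hk r 0 T hT
    rw [sub_zero] at this
    rw [leb_eq_Ioc]
    simpa only [kernelH_comm H _ r] using this
  have hfin : ∫⁻ r in Ioc a b, ∫⁻ θ, f θ ^ (1 / H) * ENNReal.ofReal (kernelH H θ r) ^ q ∂leb T ≤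
      S * (C * ENNReal.ofReal ((b - a) ^ ε)) := by
    rw [lintegral_lintegral_swap]
    · rw [hS, ← lintegral_mul_const' _ _ (ENNReal.mul_ne_top hC ENNReal.ofReal_ne_top)]
      refine lintegral_mono fun θ => ?_
      dsimp only
      rw [lintegral_const_mul _ ((measurable_ofReal_kernelH_left H θ).pow_const q)]
      gcongr
      exact hk θ a b hab
    · refine (hf.pow_const _).comp_snd.mul ?_
      exact ((measurable_ofReal_kernelH_swap H).pow_const q).aemeasurable
  calc _ ≤ ∫⁻ r in Ioc a b, (∫⁻ θ, f θ ^ (1 / H) * ENNReal.ofReal (kernelH H θ r) ^ q ∂leb T) *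
        (S ^ (2 * H - 1) * D ^ (2 - 2 * H)) := lintegral_mono hpt
    _ = (∫⁻ r in Ioc a b, ∫⁻ θ, f θ ^ (1 / H) * ENNReal.ofReal (kernelH H θ r) ^ q ∂leb T) *
        (S ^ (2 * H - 1) * D ^ (2 - 2 * H)) := by
        refine lintegral_mul_const'' _ ?_
        refine AEMeasurable.lintegral_prod_right' (f := fun z : ℝ × ℝ => f z.2 ^ (1 / H) *
          ENNReal.ofReal (kernelH H z.2 z.1) ^ q) ?_
        exact (hf.pow_const _).comp_snd.mul
          ((measurable_ofReal_kernelH_swap H).pow_const q).aemeasurable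
    _ ≤ S * (C * ENNReal.ofReal ((b - a) ^ ε)) * (S ^ (2 * H - 1) * D ^ (2 - 2 * H)) := by
        gcongr
    _ = C * D ^ (2 - 2 * H) * ENNReal.ofReal ((b - a) ^ ε) * (S * S ^ (2 * H - 1)) := by ring
    _ = _ := by
        congr 1
        conv_lhs => rw [← ENNReal.rpow_one S, ← ENNReal.rpow_mul, ← ENNReal.rpow_add_of_nonneg _ _
          (by norm_num) (by linarith)]
        congr 1
        ring

end Kernel

section Minkowski

/-- Minkowski's inequality for integrals with values in `l_2`. -/
theorem sum_sq_lintegral_le {α ι : Type*} [MeasurableSpace α] {μ : Measure α} (s : Finset ι)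
    {f : ι → α → ℝ≥0∞} (hf : ∀ i ∈ s, AEMeasurable (f i) μ) :
    ∑ i ∈ s, (∫⁻ a, f i a ∂μ) ^ (2 : ℝ) ≤
      (∫⁻ a, (∑ i ∈ s, f i a ^ (2 : ℝ)) ^ (1 / 2 : ℝ) ∂μ) ^ (2 : ℝ) := by
  set c : ι → ℝ≥0∞ := fun i => ∫⁻ a, f i a ∂μ with hc
  set M := ∫⁻ a, (∑ i ∈ s, f i a ^ (2 : ℝ)) ^ (1 / 2 : ℝ) ∂μ with hM
  have hle : ∀ i ∈ s, c i ≤ M := fun i hi => by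
    refine lintegral_mono fun a => ?_
    calc f i a = (f i a ^ (2 : ℝ)) ^ (1 / 2 : ℝ) := by rw [← ENNReal.rpow_mul]; norm_num
      _ ≤ _ := by
        gcongr
        exact Finset.single_le_sum (f := fun i => f i a ^ (2 : ℝ)) (fun _ _ => zero_le) hi
  by_cases hMt : M = ∞
  · rw [hMt]; simp
  have hct : ∀ i ∈ s, c i ≠ ∞ := fun i hi => ((hle i hi).trans_lt (lt_top_iff_ne_top.2 hMt)).ne
  set S := ∑ i ∈ s, c i ^ (2 : ℝ) with hS
  have hSt : S ≠ ∞ := (ENNReal.sum_lt_top.2 fun i hi =>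
    (ENNReal.rpow_ne_top_of_nonneg (by norm_num) (hct i hi)).lt_top).ne
  have h1 : S ≤ S ^ (1 / 2 : ℝ) * M := by
    calc S = ∑ i ∈ s, ∫⁻ a, c i * f i a ∂μ := by
          refine Finset.sum_congr rfl fun i hi => ?_
          rw [lintegral_const_mul' _ _ (hct i hi), ENNReal.rpow_two, sq]
      _ = ∫⁻ a, ∑ i ∈ s, c i * f i a ∂μ :=
          (lintegral_finsetSum' _ fun i hi => (hf i hi).const_mul _).symm
      _ ≤ ∫⁻ a, S ^ (1 / 2 : ℝ) * (∑ i ∈ s, f i a ^ (2 : ℝ)) ^ (1 / 2 : ℝ) ∂μ :=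
          lintegral_mono fun a => ENNReal.inner_le_Lp_mul_Lq s c (fun i => f i a)
            Real.HolderConjugate.two_two
      _ = S ^ (1 / 2 : ℝ) * M :=
          lintegral_const_mul' _ _ (ENNReal.rpow_ne_top_of_nonneg (by norm_num) hSt)
  by_cases hS0 : S = 0
  · rw [hS0]; exact zero_le
  have hSS : S = S ^ (1 / 2 : ℝ) * S ^ (1 / 2 : ℝ) := by
    rw [← ENNReal.rpow_add _ _ hS0 hSt]
    norm_num
  have h2 : S ^ (1 / 2 : ℝ) ≤ M := by
    have hne : S ^ (1 / 2 : ℝ) ≠ 0 := by simp [hS0]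
    have hnt : S ^ (1 / 2 : ℝ) ≠ ∞ := ENNReal.rpow_ne_top_of_nonneg (by norm_num) hSt
    have h3 : S ^ (1 / 2 : ℝ) * S ^ (1 / 2 : ℝ) ≤ S ^ (1 / 2 : ℝ) * M := by
      rw [← hSS]; exact h1
    exact (ENNReal.mul_le_mul_iff_right hne hnt).1 h3
  calc S = S ^ (1 / 2 : ℝ) * S ^ (1 / 2 : ℝ) := hSS
    _ ≤ M * M := by gcongr
    _ = M ^ (2 : ℝ) := by rw [ENNReal.rpow_two, sq]

end Minkowski

section PosDef

variable {H T : ℝ}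

theorem lintegral_overlap {b : ℝ} (hb : 0 < b) {x : ℝ} (hx : 0 < x) :
    ∫⁻ ρ in Ioi (0 : ℝ), ENNReal.ofReal (ρ ^ (-b - 2)) * ENNReal.ofReal (2 * ρ - x) =
      ENNReal.ofReal (2 ^ b * (2 / b - 2 / (b + 1)) * x ^ (-b)) := by
  have hx2 : 0 < x / 2 := by positivity
  have i1 := integrableOn_Ioi_rpow_of_lt (show -b - 1 < -1 by linarith) hx2
  have i2 := integrableOn_Ioi_rpow_of_lt (show -b - 2 < -1 by linarith) hx2
  have e1 : ∫⁻ ρ in Ioi (0 : ℝ), ENNReal.ofReal (ρ ^ (-b - 2)) * ENNReal.ofReal (2 * ρ - x) =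
      ∫⁻ ρ in Ioi (x / 2), ENNReal.ofReal (2 * ρ ^ (-b - 1) - x * ρ ^ (-b - 2)) := by
    rw [← lintegral_indicator measurableSet_Ioi, ← lintegral_indicator measurableSet_Ioi]
    congr 1
    funext ρ
    by_cases h1 : x / 2 < ρ
    · have h0 : 0 < ρ := hx2.trans h1
      rw [indicator_of_mem (mem_Ioi.2 h0), indicator_of_mem (mem_Ioi.2 h1),
        ← ENNReal.ofReal_mul (by positivity)]
      congr 1
      rw [show -b - 1 = -b - 2 + 1 by ring, Real.rpow_add_one h0.ne']
      ring
    · rw [indicator_of_notMem (s := Ioi (x / 2)) h1]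
      refine indicator_apply_eq_zero.2 fun _ => ?_
      rw [ENNReal.ofReal_of_nonpos (p := 2 * ρ - x) (by linarith), mul_zero]
  have hi : Integrable (fun ρ : ℝ => 2 * ρ ^ (-b - 1) - x * ρ ^ (-b - 2))
      (volume.restrict (Ioi (x / 2))) := (i1.const_mul 2).sub (i2.const_mul x)
  rw [e1, ← ofReal_integral_eq_lintegral_ofReal hi]
  · rw [integral_sub (i1.const_mul 2) (i2.const_mul x), integral_const_mul, integral_const_mul,
      integral_Ioi_rpow_of_lt (by linarith) hx2, integral_Ioi_rpow_of_lt (by linarith) hx2]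
    congr 1
    have h3 : (x / 2) ^ (-b - 2 + 1) = (x / 2) ^ (-b) / (x / 2) := by
      rw [← Real.rpow_sub_one hx2.ne']
      ring_nf
    rw [h3, show -b - 1 + 1 = -b by ring, Real.div_rpow hx.le (by norm_num),
      Real.rpow_neg (by norm_num : (0 : ℝ) ≤ 2)]
    have hb1 : -b - 2 + 1 ≠ 0 := by linarith
    have hb2 : b + 1 ≠ 0 := by linarith
    have : -b - 2 + 1 = -(b + 1) := by ring
    rw [this]
    field_simp
  · filter_upwards [ae_restrict_mem measurableSet_Ioi] with ρ hρ
    have h0 : 0 < ρ := hx2.trans hρ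
    have : 2 * ρ ^ (-b - 1) - x * ρ ^ (-b - 2) = (2 * ρ - x) * ρ ^ (-b - 2) := by
      rw [show -b - 1 = -b - 2 + 1 by ring, Real.rpow_add_one h0.ne']
      ring
    rw [this]
    have h4 : 0 ≤ 2 * ρ - x := by
      have := mem_Ioi.1 hρ
      linarith
    exact mul_nonneg h4 (Real.rpow_nonneg h0.le _)

/-- The factor of the kernel: `|t - s|^{-b}` is an integral over balls `B(y, ρ)` of
`1_B(t) 1_B(s)`. -/
def ballWeight (H : ℝ) (t : ℝ) (z : ℝ × ℝ) : ℝ≥0∞ :=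
  {z : ℝ × ℝ | |t - z.2| < z.1}.indicator (fun z => ENNReal.ofReal (z.1 ^ (-(4 - 2 * H) / 2))) z

theorem measurable_ballWeight (H : ℝ) :
    Measurable fun x : ℝ × ℝ × ℝ => ballWeight H x.1 x.2 := by
  have hs : MeasurableSet {x : ℝ × ℝ × ℝ | |x.1 - x.2.2| < x.2.1} :=
    measurableSet_lt (by fun_prop) (by fun_prop)
  have hf : Measurable fun x : ℝ × ℝ × ℝ => ENNReal.ofReal (x.2.1 ^ (-(4 - 2 * H) / 2)) := by
    fun_prop
  exact hf.indicator hs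

theorem kernelH_repr (hH : 1 / 2 < H) (hH' : H < 1) : ∃ c : ℝ≥0∞, c ≠ ∞ ∧ ∀ t s : ℝ, t ≠ s →
    ENNReal.ofReal (kernelH H t s) =
      c * ∫⁻ z, ballWeight H t z * ballWeight H s z ∂((volume.restrict (Ioi 0)).prod volume) := by
  set b := 2 - 2 * H with hb
  have hb0 : 0 < b := by linarith
  have hα : 0 < H * (2 * H - 1) := by nlinarith
  set C : ℝ := 2 ^ b * (2 / b - 2 / (b + 1)) with hC
  have hC0 : 0 < C := by
    have : 2 / (b + 1) < 2 / b := by gcongr; linarith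
    have : 0 < 2 / b - 2 / (b + 1) := by linarith
    positivity
  refine ⟨ENNReal.ofReal (H * (2 * H - 1) / C), ENNReal.ofReal_ne_top, fun t s hts => ?_⟩
  have hx : 0 < |t - s| := abs_pos.2 (sub_ne_zero.2 hts)
  have e : ∫⁻ z, ballWeight H t z * ballWeight H s z ∂((volume.restrict (Ioi 0)).prod volume) =
      ENNReal.ofReal (C * |t - s| ^ (-b)) := by
    rw [hC, ← lintegral_overlap hb0 hx, lintegral_prod]
    · refine setLIntegral_congr_fun measurableSet_Ioi fun ρ hρ => ?_
      have hρ0 : 0 < ρ := hρ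
      have e2 : ∀ y, ballWeight H t (ρ, y) * ballWeight H s (ρ, y) =
          (Ioo (t - ρ) (t + ρ) ∩ Ioo (s - ρ) (s + ρ)).indicator
            (fun _ => ENNReal.ofReal (ρ ^ (-b - 2))) y := by
        intro y
        have hm : ∀ t : ℝ, y ∈ Ioo (t - ρ) (t + ρ) ↔ |t - y| < ρ := fun t => by
          rw [abs_lt, mem_Ioo]
          constructor <;> rintro ⟨h1, h2⟩ <;> constructor <;> linarith
        simp only [ballWeight, indicator_apply, mem_ofPred_eq, mem_inter_iff, hm]
        by_cases h1 : |t - y| < ρ <;> by_cases h2 : |s - y| < ρ <;> simp only [h1, h2, and_self,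
          and_false, and_true, if_true, if_false, mul_zero, zero_mul]
        rw [← ENNReal.ofReal_mul (by positivity), ← Real.rpow_add hρ0]
        congr 2
        rw [hb]
        ring
      simp only [e2]
      rw [lintegral_indicator (measurableSet_Ioo.inter measurableSet_Ioo), setLIntegral_const,
        Ioo_inter_Ioo, Real.volume_Ioo]
      congr 2
      rcases le_total t s with h | h
      · rw [abs_of_nonpos (by linarith), min_eq_left (by linarith), max_eq_right (by linarith)]
        ring
      · rw [abs_of_nonneg (by linarith), min_eq_right (by linarith), max_eq_left (by linarith)]
        ring
    · exact (((measurable_ballWeight H).comp measurable_prodMk_left).mul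
        ((measurable_ballWeight H).comp measurable_prodMk_left)).aemeasurable
  rw [e, ← ENNReal.ofReal_mul (by positivity), kernelH]
  congr 1
  rw [show 2 * H - 2 = -b by rw [hb]; ring]
  field_simp

instance : NullSingletonClass (leb T) := by
  unfold leb
  infer_instance

theorem lintegral_kernelH_eq_repr (hH : 1 / 2 < H) (hH' : H < 1) : ∃ c : ℝ≥0∞, c ≠ ∞ ∧
    ∀ f g : ℝ → ℝ≥0∞, AEMeasurable f (leb T) → AEMeasurable g (leb T) →
    ∫⁻ t, ∫⁻ s, f t * g s * ENNReal.ofReal (kernelH H t s) ∂leb T ∂leb T =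
      c * ∫⁻ z, (∫⁻ t, f t * ballWeight H t z ∂leb T) * (∫⁻ s, g s * ballWeight H s z ∂leb T)
        ∂((volume.restrict (Ioi 0)).prod volume) := by
  obtain ⟨c, hc, hk⟩ := kernelH_repr hH hH'
  refine ⟨c, hc, fun f g hf hg => ?_⟩
  set ν := (volume.restrict (Ioi (0 : ℝ))).prod (volume : Measure ℝ)
  have hw := measurable_ballWeight H
  have hwl : ∀ t, Measurable (ballWeight H t) := fun t => hw.comp measurable_prodMk_left
  have hwr : ∀ z, Measurable fun t => ballWeight H t z := fun z =>
    hw.comp (measurable_id.prodMk measurable_const)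
  have h1 : ∀ t, ∫⁻ s, f t * g s * ENNReal.ofReal (kernelH H t s) ∂leb T =
      ∫⁻ s, c * ∫⁻ z, (f t * ballWeight H t z) * (g s * ballWeight H s z) ∂ν ∂leb T := by
    intro t
    have hne : ∀ᵐ s ∂leb T, s ≠ t := Measure.ae_ne _ t
    apply lintegral_congr_ae
    filter_upwards [hne] with s hs
    rw [hk t s hs.symm, ← mul_left_comm c]
    congr 1
    rw [← lintegral_const_mul (f := fun z => ballWeight H t z * ballWeight H s z) _
      ((hwl t).mul (hwl s))]
    refine lintegral_congr fun z => ?_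
    ring
  have hfw : AEMeasurable (fun x : ℝ × ℝ × ℝ => f x.1 * ballWeight H x.1 x.2)
      ((leb T).prod ν) := hf.comp_fst.mul hw.aemeasurable
  have hgw : AEMeasurable (fun x : ℝ × ℝ × ℝ => g x.1 * ballWeight H x.1 x.2)
      ((leb T).prod ν) := hg.comp_fst.mul hw.aemeasurable
  have hgz : AEMeasurable (fun z => ∫⁻ s, g s * ballWeight H s z ∂leb T) ν :=
    hgw.lintegral_prod_left' (ν := ν)
  simp_rw [h1, lintegral_const_mul' _ _ hc]
  congr 1
  have h2 : ∀ t, ∫⁻ s, ∫⁻ z, (f t * ballWeight H t z) * (g s * ballWeight H s z) ∂ν ∂leb T =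
      ∫⁻ z, (f t * ballWeight H t z) * ∫⁻ s, g s * ballWeight H s z ∂leb T ∂ν := by
    intro t
    rw [lintegral_lintegral_swap]
    · refine lintegral_congr fun z => ?_
      exact lintegral_const_mul'' _ (hg.mul (hwr z).aemeasurable)
    · exact (((hwl t).const_mul (f t)).aemeasurable.comp_snd).mul hgw
  simp_rw [h2]
  rw [lintegral_lintegral_swap]
  · refine lintegral_congr fun z => ?_
    exact lintegral_mul_const'' _ (hf.mul (hwr z).aemeasurable)
  · exact hfw.mul hgz.comp_snd

/-- The Cauchy–Schwarz inequality for the positive definite kernel `|t - s|^{2H-2}`. -/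
theorem lintegral_kernelH_cauchySchwarz (hH : 1 / 2 < H) (hH' : H < 1) {V W : Type*}
    [NormedAddCommGroup V] [NormedAddCommGroup W] {φ : ℝ → V} {ψ : ℝ → W}
    (hφ : AEStronglyMeasurable φ (leb T)) (hψ : AEStronglyMeasurable ψ (leb T)) :
    ∫⁻ t, ∫⁻ s, ‖φ t‖ₑ * ‖ψ s‖ₑ * ENNReal.ofReal (kernelH H t s) ∂leb T ∂leb T ≤
      absNorm H T φ * absNorm H T ψ := by
  obtain ⟨c, hc, hr⟩ := lintegral_kernelH_eq_repr (T := T) hH hH'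
  unfold absNorm
  rw [hr _ _ hφ.enorm hψ.enorm, hr _ _ hφ.enorm hφ.enorm, hr _ _ hψ.enorm hψ.enorm]
  set ν := (volume.restrict (Ioi (0 : ℝ))).prod (volume : Measure ℝ)
  have hm : ∀ {f : ℝ → ℝ≥0∞}, AEMeasurable f (leb T) →
      AEMeasurable (fun z => ∫⁻ t, f t * ballWeight H t z ∂leb T) ν := fun {f} hf =>
    AEMeasurable.lintegral_prod_left' (ν := ν)
      (f := fun x : ℝ × ℝ × ℝ => f x.1 * ballWeight H x.1 x.2)
      (hf.comp_fst.mul (measurable_ballWeight H).aemeasurable)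
  set F : ℝ × ℝ → ℝ≥0∞ := fun z => ∫⁻ t, ‖φ t‖ₑ * ballWeight H t z ∂leb T
  set G : ℝ × ℝ → ℝ≥0∞ := fun z => ∫⁻ t, ‖ψ t‖ₑ * ballWeight H t z ∂leb T
  have cs := ENNReal.lintegral_mul_le_Lp_mul_Lq ν Real.HolderConjugate.two_two
    (hm hφ.enorm) (hm hψ.enorm)
  simp only [ENNReal.rpow_two, sq] at cs
  rw [ENNReal.mul_rpow_of_nonneg _ _ (by norm_num), ENNReal.mul_rpow_of_nonneg _ _ (by norm_num),
    mul_mul_mul_comm, ← ENNReal.rpow_add_of_nonneg _ _ (by norm_num) (by norm_num), add_halves,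
    ENNReal.rpow_one]
  exact mul_le_mul_right cs c

end PosDef

section GaussianIBP

open scoped NNReal

/-- Gaussian integration by parts in one dimension. -/
theorem gaussianReal_integral_mul {v : ℝ≥0} {g g' : ℝ → ℝ} (hg : ∀ x, HasDerivAt g (g' x) x)
    (h0 : Integrable g (gaussianReal 0 v)) (h1 : Integrable (fun x => x * g x) (gaussianReal 0 v))
    (h2 : Integrable g' (gaussianReal 0 v)) :
    ∫ x, x * g x ∂gaussianReal 0 v = v * ∫ x, g' x ∂gaussianReal 0 v := by
  by_cases hv : v = 0
  · subst hv
    simp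
  have hint : ∀ {f : ℝ → ℝ}, Integrable f (gaussianReal 0 v) →
      Integrable (fun x => f x * gaussianPDFReal 0 v x) := by
    intro f hf
    rw [gaussianReal_of_var_ne_zero 0 hv] at hf
    have := (integrable_withDensity_iff (measurable_gaussianPDF 0 v)
      (ae_of_all _ fun x => gaussianPDF_lt_top)).1 hf
    simpa only [toReal_gaussianPDF] using this
  have hρ : ∀ x, HasDerivAt (gaussianPDFReal 0 v) (-(x / v) * gaussianPDFReal 0 v x) x := by
    intro x
    have hv' : (v : ℝ) ≠ 0 := by exact_mod_cast hv
    have h1 : HasDerivAt (fun y : ℝ => -(y - 0) ^ 2 / (2 * (v : ℝ))) (-(x / v)) x := by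
      have := ((((hasDerivAt_id' x).sub_const 0).fun_pow 2).fun_neg).div_const (2 * (v : ℝ))
      refine this.congr_deriv ?_
      push_cast
      field_simp
      ring
    have h2 : HasDerivAt (gaussianPDFReal 0 v) _ x := h1.exp.const_mul (√(2 * Real.pi * v))⁻¹
    refine h2.congr_deriv ?_
    rw [gaussianPDFReal]
    ring
  rw [integral_gaussianReal_eq_integral_smul hv, integral_gaussianReal_eq_integral_smul hv]
  have hv' : (v : ℝ) ≠ 0 := by exact_mod_cast hv
  have hu : Integrable (fun x => g x * (-(x / v) * gaussianPDFReal 0 v x)) := by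
    have := (hint h1).const_mul (-(v : ℝ)⁻¹)
    refine this.congr (ae_of_all _ fun x => ?_)
    simp only
    field_simp
  have key := integral_mul_deriv_eq_deriv_mul_of_integrable (u := g) (u' := g')
    (v := gaussianPDFReal 0 v) (v' := fun x => -(x / v) * gaussianPDFReal 0 v x)
    (fun x _ => hg x) (fun x _ => hρ x) hu (hint h2) (hint h0)
  have e1 : ∫ x, gaussianPDFReal 0 v x • (x * g x) =
      -(v : ℝ) * ∫ x, g x * (-(x / v) * gaussianPDFReal 0 v x) := by
    rw [← integral_const_mul]
    congr 1
    funext x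
    simp only [smul_eq_mul]
    field_simp
  rw [e1, key, neg_mul_neg]
  congr 2
  funext x
  rw [smul_eq_mul, mul_comm]

variable {Ω : Type*} [MeasurableSpace Ω] {P : Measure Ω}
variable {E : Type*} [NormedAddCommGroup E] [NormedSpace ℝ E] [MeasurableSpace E] [BorelSpace E]
  [SecondCountableTopology E] [CompleteSpace E]

/-- Gaussian integration by parts: `E[Z f(X)] = E[∂_c f(X)]`, where `c = Cov(X, Z)`. -/
theorem integral_gaussian_mul {X : Ω → E} {Z : Ω → ℝ}
    (hXZ : HasGaussianLaw (fun ω => (X ω, Z ω)) P) (hZ : ∫ ω, Z ω ∂P = 0) {c : E}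
    (hc : ∀ L : StrongDual ℝ E, cov[L ∘ X, Z; P] = L c) {f : E → ℝ} (hf : ContDiff ℝ 1 f)
    (h0 : Integrable (fun ω => f (X ω)) P) (h1 : Integrable (fun ω => Z ω * f (X ω)) P)
    (h2 : Integrable (fun ω => fderiv ℝ f (X ω) c) P) :
    ∫ ω, Z ω * f (X ω) ∂P = ∫ ω, fderiv ℝ f (X ω) c ∂P := by
  have := hXZ.isProbabilityMeasure
  have hZg : HasGaussianLaw Z P := hXZ.snd
  have hZ2 : MemLp Z 2 P := hZg.memLp_two
  have hlaw := hZg.map_eq_gaussianReal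
  rw [hZ] at hlaw
  set v : ℝ≥0 := Var[Z; P].toNNReal with hv
  have hvc : (v : ℝ) = Var[Z; P] := Real.coe_toNNReal _ (variance_nonneg _ _)
  by_cases hv0 : Var[Z; P] = 0
  · have hZ0 : Z =ᵐ[P] fun _ => 0 := by
      have := ae_eq_integral_of_variance_eq_zero hZ2 hv0
      rwa [hZ] at this
    have hc0 : c = 0 := by
      refine SeparatingDual.eq_zero_of_forall_dual_eq_zero (R := ℝ) fun L => ?_
      rw [← hc L, covariance]
      refine integral_eq_zero_of_ae ?_
      filter_upwards [hZ0] with ω hω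
      simp [hω, hZ]
    rw [integral_congr_ae (g := fun _ => 0)]
    · simp [hc0]
    · filter_upwards [hZ0] with ω hω
      rw [hω, zero_mul]
  set a : E := (Var[Z; P])⁻¹ • c with ha
  set W : Ω → E := fun ω => X ω - Z ω • a with hW
  have hWZ : HasGaussianLaw (fun ω => (Z ω, W ω)) P := by
    have := hXZ.map_fun ((ContinuousLinearMap.snd ℝ E ℝ).prod (ContinuousLinearMap.fst ℝ E ℝ -
      (ContinuousLinearMap.snd ℝ E ℝ).smulRight a))
    exact this
  have hind : IndepFun Z W P := by
    refine hWZ.indepFun_of_covariance_strongDual fun L₁ L₂ => ?_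
    have e1 : L₁ ∘ Z = fun ω => L₁ 1 * Z ω := by
      funext ω
      rw [Function.comp_apply, ← mul_one (Z ω), ← smul_eq_mul (Z ω), map_smul, smul_eq_mul,
        smul_eq_mul]
      ring
    have e2 : L₂ ∘ W = (L₂ ∘ X) - fun ω => L₂ a * Z ω := by
      funext ω
      simp [hW, mul_comm]
    rw [e1, covariance_const_mul_left, e2, covariance_comm,
      covariance_sub_left (hXZ.fst.map L₂).memLp_two (hZ2.const_mul _) hZ2, hc,
      covariance_const_mul_left, covariance_self hZg.aemeasurable, ha, map_smul, smul_eq_mul]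
    field_simp
    ring
  have hmap := (indepFun_iff_map_prod_eq_prod_map_map hZg.aemeasurable
    hWZ.snd.aemeasurable).1 hind
  rw [hlaw] at hmap
  set ν := P.map W
  have : IsProbabilityMeasure ν := Measure.isProbabilityMeasure_map hWZ.snd.aemeasurable
  have hcv : c = Var[Z; P] • a := by
    rw [ha, smul_smul, mul_inv_cancel₀ hv0, one_smul]
  have hXW : ∀ ω, X ω = Z ω • a + W ω := fun ω => by simp [hW]
  have hcf : Continuous fun z : ℝ × E => z.1 • a + z.2 := by fun_prop
  have hf0 : Continuous fun z : ℝ × E => f (z.1 • a + z.2) := hf.continuous.comp hcf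
  have hf1 : Continuous fun z : ℝ × E => z.1 * f (z.1 • a + z.2) := continuous_fst.mul hf0
  have hdf : Continuous fun z : ℝ × E => fderiv ℝ f (z.1 • a + z.2) a :=
    ((hf.continuous_fderiv (by norm_num)).comp hcf).clm_apply continuous_const
  have tr : ∀ {G : ℝ × E → ℝ}, Continuous G → (Integrable (fun ω => G (Z ω, W ω)) P →
      Integrable G ((gaussianReal 0 v).prod ν)) ∧
      ∫ ω, G (Z ω, W ω) ∂P = ∫ z, G z ∂(gaussianReal 0 v).prod ν := by
    intro G hG
    rw [← hmap]
    refine ⟨fun h => (integrable_map_measure hG.aestronglyMeasurable hWZ.aemeasurable).2 h, ?_⟩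
    exact (integral_map hWZ.aemeasurable hG.aestronglyMeasurable).symm
  have hca : ∀ x, fderiv ℝ f x a = (Var[Z; P])⁻¹ * fderiv ℝ f x c := fun x => by
    rw [ha, map_smul, smul_eq_mul]
  have i0 := (tr hf0).1 (by simpa only [← hXW] using h0)
  have i1 := (tr hf1).1 (by simpa only [← hXW] using h1)
  have i2 := (tr hdf).1 (by
    have := h2.const_mul (Var[Z; P])⁻¹
    simpa only [← hXW, hca] using this)
  have e1 := (tr hf1).2
  have e2 := (tr hdf).2
  simp only [← hXW] at e1 e2
  have e3 : ∫ ω, fderiv ℝ f (X ω) c ∂P = Var[Z; P] * ∫ ω, fderiv ℝ f (X ω) a ∂P := by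
    rw [← integral_const_mul]
    congr 1
    funext ω
    conv_lhs => rw [hcv]
    rw [map_smul, smul_eq_mul]
  rw [e1, e3, e2, integral_prod_symm _ i1, integral_prod_symm _ i2, ← integral_const_mul]
  apply integral_congr_ae
  filter_upwards [i0.prod_left_ae, i1.prod_left_ae, i2.prod_left_ae] with w w0 w1 w2
  rw [← hvc]
  refine gaussianReal_integral_mul (g := fun z => f (z • a + w)) (fun z => ?_) w0 w1 w2
  have hd : HasFDerivAt f (fderiv ℝ f (z • a + w)) (z • a + w) :=
    (hf.differentiable (by norm_num) _).hasFDerivAt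
  have hl : HasDerivAt (fun z : ℝ => z • a + w) a z := by
    simpa using ((hasDerivAt_id z).smul_const a).add_const w
  exact hd.comp_hasDerivAt z hl

theorem hasTemperateGrowth_fderiv_apply {E : Type*} [NormedAddCommGroup E] [NormedSpace ℝ E]
    {f : E → ℝ} (hf : f.HasTemperateGrowth) (c : E) :
    (fun x => fderiv ℝ f x c).HasTemperateGrowth := by
  have h : (fderiv ℝ f).HasTemperateGrowth := by
    refine ⟨hf.1.fderiv_right (by simp), fun n => ?_⟩
    obtain ⟨k, C, h⟩ := hf.2 (n + 1)
    exact ⟨k, C, fun x => by rw [norm_iteratedFDeriv_fderiv]; exact h x⟩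
  exact (ContinuousLinearMap.apply ℝ ℝ c).hasTemperateGrowth.comp h

theorem memLp_temperate {X : Ω → E} (hX : HasGaussianLaw X P) {f : E → ℝ}
    (hf : f.HasTemperateGrowth) {q : ℝ≥0∞} (hq : q ≠ ∞) : MemLp (fun ω => f (X ω)) q P := by
  have := hX.isProbabilityMeasure
  obtain ⟨k, C, h⟩ := hf.2 0
  have hXq : MemLp (fun ω => ‖X ω‖) (q * k) P :=
    (hX.memLp (ENNReal.mul_ne_top hq (ENNReal.natCast_ne_top k))).norm
  have hX' : MemLp (fun ω => (1 + ‖X ω‖)) (q * k) P := (memLp_const (1 : ℝ)).add hXq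
  have h1 : MemLp (fun ω => C * (1 + ‖X ω‖) ^ k) q P := by
    refine MemLp.const_mul ?_ C
    by_cases hk : k = 0
    · subst hk
      simp only [pow_zero]
      exact memLp_const 1
    have hk' : (k : ℝ≥0∞) ≠ 0 := by exact_mod_cast hk
    have h2 := hX'.norm_rpow_div (k : ℝ≥0∞)
    rw [ENNReal.mul_div_cancel_right hk' (ENNReal.natCast_ne_top k)] at h2
    refine h2.ae_eq (ae_of_all _ fun ω => ?_)
    have h3 : 0 ≤ 1 + ‖X ω‖ := by positivity
    simp only [Real.norm_of_nonneg h3, ENNReal.toReal_natCast, Real.rpow_natCast]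
  refine h1.mono (hf.1.continuous.comp_aestronglyMeasurable
    hX.aemeasurable.aestronglyMeasurable) (ae_of_all _ fun ω => ?_)
  have := h (X ω)
  rw [norm_iteratedFDeriv_zero] at this
  exact this.trans (le_abs_self _)

theorem integral_gaussian_mul_temperate {X : Ω → E} {Z : Ω → ℝ}
    (hXZ : HasGaussianLaw (fun ω => (X ω, Z ω)) P) (hZ : ∫ ω, Z ω ∂P = 0) {c : E}
    (hc : ∀ L : StrongDual ℝ E, cov[L ∘ X, Z; P] = L c) {f : E → ℝ} (hf : f.HasTemperateGrowth) :
    ∫ ω, Z ω * f (X ω) ∂P = ∫ ω, fderiv ℝ f (X ω) c ∂P := by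
  have := hXZ.isProbabilityMeasure
  refine integral_gaussian_mul hXZ hZ hc (hf.1.of_le (by simp)) ?_ ?_ ?_
  · exact (memLp_temperate hXZ.fst hf (q := 1) (by simp)).integrable le_rfl
  · exact hXZ.snd.memLp_two.integrable_mul (memLp_temperate hXZ.fst hf (q := 2) (by simp))
  · exact (memLp_temperate hXZ.fst (hasTemperateGrowth_fderiv_apply hf c) (q := 1)
      (by simp)).integrable le_rfl

/-- The isometry for elementary divergences `δ_c f = Z f(X) - ∂_c f(X)`, `c = Cov(X, Z)`. -/
theorem integral_gaussian_divergence_mul {X : Ω → E} {Z Z' : Ω → ℝ}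
    (hXZ : HasGaussianLaw (fun ω => ((X ω, Z' ω), Z ω)) P) (hZ : ∫ ω, Z ω ∂P = 0)
    (hZ' : ∫ ω, Z' ω ∂P = 0) {c c' : E}
    (hc : ∀ L : StrongDual ℝ E, cov[L ∘ X, Z; P] = L c)
    (hc' : ∀ L : StrongDual ℝ E, cov[L ∘ X, Z'; P] = L c')
    {f g : E → ℝ} (hf : f.HasTemperateGrowth) (hg : g.HasTemperateGrowth) :
    ∫ ω, (Z ω * f (X ω) - fderiv ℝ f (X ω) c) * (Z' ω * g (X ω) - fderiv ℝ g (X ω) c') ∂P =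
      cov[Z', Z; P] * (∫ ω, f (X ω) * g (X ω) ∂P) +
        ∫ ω, fderiv ℝ f (X ω) c' * fderiv ℝ g (X ω) c ∂P := by
  have := hXZ.isProbabilityMeasure
  have hXZ' : HasGaussianLaw (fun ω => (X ω, Z' ω)) P := hXZ.fst
  have hX : HasGaussianLaw X P := hXZ'.fst
  have hfc := hasTemperateGrowth_fderiv_apply hf c
  have hfc' := hasTemperateGrowth_fderiv_apply hf c'
  have hgc := hasTemperateGrowth_fderiv_apply hg c
  have hgc' := hasTemperateGrowth_fderiv_apply hg c'
  have hgcc := hasTemperateGrowth_fderiv_apply hgc' c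
  have dt : ∀ {h : E → ℝ}, h.HasTemperateGrowth → Differentiable ℝ h := fun h =>
    h.1.differentiable (by simp)
  have m2 : ∀ {h : E → ℝ}, h.HasTemperateGrowth → MemLp (fun ω => h (X ω)) 2 P := fun hh =>
    memLp_temperate hX hh (by simp)
  have mm : ∀ {h k : E → ℝ}, h.HasTemperateGrowth → k.HasTemperateGrowth →
      Integrable (fun ω => h (X ω) * k (X ω)) P := fun hh hk => (m2 hh).integrable_mul (m2 hk)
  -- the second divergence as a function of `(X, Z')`
  set B : E × ℝ → ℝ := fun z => z.2 * g z.1 - fderiv ℝ g z.1 c' with hB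
  have t1 : (fun z : E × ℝ => z.1).HasTemperateGrowth :=
    (ContinuousLinearMap.fst ℝ E ℝ).hasTemperateGrowth
  have t2 : (fun z : E × ℝ => z.2).HasTemperateGrowth :=
    (ContinuousLinearMap.snd ℝ E ℝ).hasTemperateGrowth
  have hBt : B.HasTemperateGrowth := (t2.mul (hg.comp t1)).sub (hgc'.comp t1)
  have hft : (fun z : E × ℝ => f z.1).HasTemperateGrowth := hf.comp t1
  have hc2 : ∀ L : StrongDual ℝ (E × ℝ), cov[L ∘ (fun ω => (X ω, Z' ω)), Z; P] =
      L (c, cov[Z', Z; P]) := by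
    intro L
    have e : L ∘ (fun ω => (X ω, Z' ω)) = (L.comp (ContinuousLinearMap.inl ℝ E ℝ)) ∘ X +
        fun ω => L (0, 1) * Z' ω := by
      funext ω
      have : (X ω, Z' ω) = (X ω, (0 : ℝ)) + Z' ω • ((0 : E), (1 : ℝ)) := by simp
      simp only [Function.comp_apply, Pi.add_apply]
      rw [this, map_add, map_smul, smul_eq_mul, mul_comm]
      rfl
    rw [e, covariance_add_left (hX.map _).memLp_two (hXZ'.snd.memLp_two.const_mul _)
      hXZ.snd.memLp_two, hc, covariance_const_mul_left]
    have : (c, cov[Z', Z; P]) = (c, (0 : ℝ)) + cov[Z', Z; P] • ((0 : E), (1 : ℝ)) := by simp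
    rw [this, map_add, map_smul, smul_eq_mul, mul_comm]
    rfl
  have ibp := integral_gaussian_mul_temperate hXZ hZ hc2 (hft.mul hBt)
  have ibp' := integral_gaussian_mul_temperate hXZ' hZ' hc' (hf.mul hgc)
  have dB : ∀ x z', fderiv ℝ ((fun z : E × ℝ => f z.1) * B) (x, z') (c, cov[Z', Z; P]) =
      fderiv ℝ f x c * B (x, z') + f x * (cov[Z', Z; P] * g x + z' * fderiv ℝ g x c -
        fderiv ℝ (fun y => fderiv ℝ g y c') x c) := by
    intro x z'
    have h1 : HasFDerivAt (fun z : E × ℝ => z.1) (ContinuousLinearMap.fst ℝ E ℝ) (x, z') :=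
      hasFDerivAt_fst
    have h2 : HasFDerivAt (fun z : E × ℝ => z.2) (ContinuousLinearMap.snd ℝ E ℝ) (x, z') :=
      hasFDerivAt_snd
    have f1 := ((dt hf x).hasFDerivAt).comp (x, z') h1
    have g1 := ((dt hg x).hasFDerivAt).comp (x, z') h1
    have g2 := ((dt hgc' x).hasFDerivAt).comp (x, z') h1
    have := f1.mul ((h2.mul g1).sub g2)
    rw [show fderiv ℝ ((fun z : E × ℝ => f z.1) * B) (x, z') = _ from this.fderiv]
    simp [hB]
    ring
  have dF : ∀ x, fderiv ℝ (f * fun y => fderiv ℝ g y c) x c' =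
      fderiv ℝ f x c' * fderiv ℝ g x c + f x * fderiv ℝ (fun y => fderiv ℝ g y c) x c' := by
    intro x
    rw [((dt hf x).hasFDerivAt.mul (dt hgc x).hasFDerivAt).fderiv]
    simp
    ring
  have sym : ∀ x, fderiv ℝ (fun y => fderiv ℝ g y c') x c =
      fderiv ℝ (fun y => fderiv ℝ g y c) x c' := by
    intro x
    have h1 : DifferentiableAt ℝ (fderiv ℝ g) x :=
      (hg.1.fderiv_right (m := ((⊤ : ℕ∞) : WithTop ℕ∞)) (by simp)).differentiable (by simp) x
    rw [fderiv_clm_apply h1 (differentiableAt_const _),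
      fderiv_clm_apply h1 (differentiableAt_const _)]
    simp
    have h2 : ContDiffAt ℝ ((⊤ : ℕ∞) : WithTop ℕ∞) g x := hg.1.contDiffAt
    have h3 : minSmoothness ℝ 2 ≤ ((⊤ : ℕ∞) : WithTop ℕ∞) := by
      rw [minSmoothness_of_isRCLikeNormedField]
      exact WithTop.coe_le_coe.2 le_top
    exact (h2.isSymmSndFDerivAt h3).eq _ _
  have tB : ∀ {h k : E × ℝ → ℝ}, h.HasTemperateGrowth → k.HasTemperateGrowth →
      Integrable (fun ω => h (X ω, Z' ω) * k (X ω, Z' ω)) P := fun hh hk =>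
    (memLp_temperate hXZ' hh (q := 2) (by simp)).integrable_mul
      (memLp_temperate hXZ' hk (q := 2) (by simp))
  have j1 : Integrable (fun ω => Z ω * (f (X ω) * B (X ω, Z' ω))) P :=
    hXZ.snd.memLp_two.integrable_mul (memLp_temperate hXZ' (hft.mul hBt) (q := 2) (by simp))
  have j2 : Integrable (fun ω => fderiv ℝ f (X ω) c * B (X ω, Z' ω)) P := tB (hfc.comp t1) hBt
  have j3 := mm hf hg
  have j4 : Integrable (fun ω => Z' ω * (f (X ω) * fderiv ℝ g (X ω) c)) P :=
    hXZ'.snd.memLp_two.integrable_mul (m2 (hf.mul hgc))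
  have j5 := mm hf hgcc
  have j6 := mm hfc' hgc
  have ibp1 : ∫ ω, Z ω * (f (X ω) * B (X ω, Z' ω)) ∂P =
      ∫ ω, fderiv ℝ f (X ω) c * B (X ω, Z' ω) + (cov[Z', Z; P] * (f (X ω) * g (X ω)) +
        Z' ω * (f (X ω) * fderiv ℝ g (X ω) c) -
        f (X ω) * fderiv ℝ (fun y => fderiv ℝ g y c') (X ω) c) ∂P := by
    refine ibp.trans (integral_congr_ae (ae_of_all _ fun ω => ?_))
    simp only [dB]
    ring
  have ibp2 : ∫ ω, Z' ω * (f (X ω) * fderiv ℝ g (X ω) c) ∂P =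
      ∫ ω, fderiv ℝ f (X ω) c' * fderiv ℝ g (X ω) c +
        f (X ω) * fderiv ℝ (fun y => fderiv ℝ g y c') (X ω) c ∂P := by
    refine ibp'.trans (integral_congr_ae (ae_of_all _ fun ω => ?_))
    simp only [dF, sym]
  have j3' := j3.const_mul cov[Z', Z; P]
  have j34 : Integrable (fun ω => cov[Z', Z; P] * (f (X ω) * g (X ω)) +
      Z' ω * (f (X ω) * fderiv ℝ g (X ω) c)) P := j3'.add j4
  have j345 : Integrable (fun ω => cov[Z', Z; P] * (f (X ω) * g (X ω)) +
      Z' ω * (f (X ω) * fderiv ℝ g (X ω) c) -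
      f (X ω) * fderiv ℝ (fun y => fderiv ℝ g y c') (X ω) c) P := j34.sub j5
  rw [integral_add j2 j345, integral_sub j34 j5, integral_add j3' j4, integral_const_mul, ibp2,
    integral_add j6 j5] at ibp1
  calc _ = ∫ ω, Z ω * (f (X ω) * B (X ω, Z' ω)) - fderiv ℝ f (X ω) c * B (X ω, Z' ω) ∂P := by
        refine integral_congr_ae (ae_of_all _ fun ω => ?_)
        simp only [hB]
        ring
    _ = _ := by
        rw [integral_sub j1 j2, ibp1]
        ring

end GaussianIBP

section LTwo

variable {Ω : Type*} [MeasurableSpace Ω] {P : Measure Ω}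

theorem tendsto_integral_mul_of_eLpNorm {α : Type*} {l : Filter α} {f g : Ω → ℝ}
    {F G : α → Ω → ℝ} (hf : MemLp f 2 P) (hg : MemLp g 2 P) (hF : ∀ j, MemLp (F j) 2 P)
    (hG : ∀ j, MemLp (G j) 2 P) (h1 : Tendsto (fun j => eLpNorm (F j - f) 2 P) l (𝓝 0))
    (h2 : Tendsto (fun j => eLpNorm (G j - g) 2 P) l (𝓝 0)) :
    Tendsto (fun j => ∫ ω, F j ω * G j ω ∂P) l (𝓝 (∫ ω, f ω * g ω ∂P)) := by
  have key : ∀ {u v : Ω → ℝ} (hu : MemLp u 2 P) (hv : MemLp v 2 P),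
      ∫ ω, u ω * v ω ∂P = inner ℝ (hv.toLp v) (hu.toLp u) := by
    intro u v hu hv
    rw [L2.inner_def]
    apply integral_congr_ae
    filter_upwards [hu.coeFn_toLp, hv.coeFn_toLp] with ω h1 h2
    rw [h1, h2]
    rfl
  simp_rw [key (hF _) (hG _), key hf hg]
  exact ((Lp.tendsto_Lp_iff_tendsto_eLpNorm'' G hG g hg).2 h2).inner
    ((Lp.tendsto_Lp_iff_tendsto_eLpNorm'' F hF f hf).2 h1)

theorem tendsto_integral_of_eLpNorm [IsProbabilityMeasure P] {α : Type*} {l : Filter α}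
    {f : Ω → ℝ} {F : α → Ω → ℝ} (hf : MemLp f 2 P) (hF : ∀ j, MemLp (F j) 2 P)
    (h1 : Tendsto (fun j => eLpNorm (F j - f) 2 P) l (𝓝 0)) :
    Tendsto (fun j => ∫ ω, F j ω ∂P) l (𝓝 (∫ ω, f ω ∂P)) := by
  have := tendsto_integral_mul_of_eLpNorm (G := fun _ _ => 1) hf (memLp_const (1 : ℝ)) hF
    (fun _ => memLp_const 1) h1 (by simpa using tendsto_const_nhds)
  simpa using this

/-- Gaussian vectors are closed under limits in `L_2`. -/
theorem hasGaussianLaw_of_tendsto [IsProbabilityMeasure P] {ι : Type*} [Fintype ι]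
    {X : ι → Ω → ℝ} {Y : ℕ → ι → Ω → ℝ} (hY : ∀ j, HasGaussianLaw (fun ω i => Y j i ω) P)
    (hX : ∀ i, MemLp (X i) 2 P)
    (hlim : ∀ i, Tendsto (fun j => eLpNorm (Y j i - X i) 2 P) atTop (𝓝 0)) :
    HasGaussianLaw (fun ω i => X i ω) P := by
  classical
  have hXm : AEMeasurable (fun ω i => X i ω) P :=
    aemeasurable_pi_lambda _ fun i => (hX i).1.aemeasurable
  refine (hasGaussianLaw_iff_charFunDual_map_eq hXm).2 fun L => ?_
  have hLsum : ∀ x : ι → ℝ, L x = ∑ i, L (Pi.single i 1) * x i := by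
    intro x
    conv_lhs => rw [← Finset.univ_sum_single x, map_sum]
    refine Finset.sum_congr rfl fun i _ => ?_
    have : (Pi.single i (x i) : ι → ℝ) = x i • Pi.single i 1 := by
      rw [← Pi.single_smul', smul_eq_mul, mul_one]
    rw [this, map_smul, smul_eq_mul, mul_comm]
  set U : Ω → ℝ := L ∘ fun ω i => X i ω with hU
  set V : ℕ → Ω → ℝ := fun j => L ∘ fun ω i => Y j i ω with hV
  have hYm : ∀ j i, MemLp (Y j i) 2 P := fun j i => ((hY j).eval i).memLp_two
  have hUm : MemLp U 2 P := by
    have : U = fun ω => ∑ i, L (Pi.single i 1) * X i ω := by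
      funext ω
      exact hLsum _
    rw [this]
    exact memLp_finsetSum _ fun i _ => (hX i).const_mul _
  have hVm : ∀ j, MemLp (V j) 2 P := fun j => ((hY j).map L).memLp_two
  have hVU : Tendsto (fun j => eLpNorm (V j - U) 2 P) atTop (𝓝 0) := by
    have hle : ∀ j, eLpNorm (V j - U) 2 P ≤
        ∑ i, ‖L (Pi.single i 1)‖ₑ * eLpNorm (Y j i - X i) 2 P := by
      intro j
      have : V j - U = ∑ i, L (Pi.single i 1) • (Y j i - X i) := by
        funext ω
        simp only [hU, hV, Pi.sub_apply, Function.comp_apply, hLsum (fun i => Y j i ω),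
          hLsum (fun i => X i ω), Finset.sum_apply, Pi.smul_apply, smul_eq_mul, mul_sub,
          Finset.sum_sub_distrib]
      rw [this]
      refine (eLpNorm_sum_le (fun i _ => (((hYm j i).sub (hX i)).const_smul _).1)
        (by norm_num)).trans (Finset.sum_le_sum fun i _ => ?_)
      rw [eLpNorm_const_smul]
    refine tendsto_of_tendsto_of_tendsto_of_le_of_le tendsto_const_nhds ?_ (fun _ => zero_le) hle
    rw [show (0 : ℝ≥0∞) = ∑ i : ι, ‖L (Pi.single i 1)‖ₑ * 0 by simp]
    exact tendsto_finsetSum _ fun i _ =>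
      ENNReal.Tendsto.const_mul (hlim i) (Or.inr enorm_ne_top)
  have hE : Tendsto (fun j => ∫ ω, V j ω ∂P) atTop (𝓝 (∫ ω, U ω ∂P)) :=
    tendsto_integral_of_eLpNorm hUm hVm hVU
  have hE2 := tendsto_integral_mul_of_eLpNorm hUm hUm hVm hVm hVU hVU
  have hVar : Tendsto (fun j => Var[V j; P]) atTop (𝓝 Var[U; P]) := by
    have e : ∀ {W : Ω → ℝ}, MemLp W 2 P → Var[W; P] = ∫ ω, W ω * W ω ∂P - (∫ ω, W ω ∂P) ^ 2 := by
      intro W hW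
      rw [variance_eq_sub hW]
      simp only [Pi.pow_apply, sq]
    rw [e hUm]
    simp_rw [e (hVm _)]
    exact hE2.sub (hE.pow 2)
  have hch : ∀ {W : Ω → ι → ℝ}, AEMeasurable W P →
      charFunDual (P.map W) L = ∫ ω, Complex.exp (L (W ω) * Complex.I) ∂P := by
    intro W hW
    rw [charFunDual_apply, integral_map hW (by fun_prop)]
  have hcf : Tendsto (fun j => ∫ ω, Complex.exp (V j ω * Complex.I) ∂P) atTop
      (𝓝 (∫ ω, Complex.exp (U ω * Complex.I) ∂P)) := by
    have hint : ∀ {W : Ω → ℝ}, MemLp W 2 P →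
        Integrable (fun ω => Complex.exp (W ω * Complex.I)) P := by
      intro W hW
      refine Integrable.of_bound (C := 1) ?_ (ae_of_all _ fun ω => ?_)
      · have h := hW.1.aemeasurable
        exact (Complex.measurable_exp.comp_aemeasurable
          ((Complex.measurable_ofReal.comp_aemeasurable h).mul_const _)).aestronglyMeasurable
      · rw [Complex.norm_exp_ofReal_mul_I]
    have habs : Tendsto (fun j => ∫ ω, |V j ω - U ω| ∂P) atTop (𝓝 0) := by
      have := tendsto_integral_of_eLpNorm (P := P) (f := fun _ => 0)
        (F := fun j ω => |V j ω - U ω|) (l := atTop) (memLp_const 0)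
        (fun j => ((hVm j).sub hUm).norm) (by
          refine hVU.congr fun j => ?_
          refine (eLpNorm_norm (V j - U)).symm.trans (congrArg (eLpNorm · 2 P) ?_)
          funext ω
          simp)
      simpa using this
    rw [tendsto_iff_norm_sub_tendsto_zero]
    refine squeeze_zero (fun _ => norm_nonneg _) (fun j => ?_) habs
    rw [← integral_sub (hint (hVm j)) (hint hUm)]
    refine norm_integral_le_of_norm_le
      (((hVm j).sub hUm).integrable (by norm_num)).abs (ae_of_all _ fun ω => ?_)
    have h1 := Real.norm_exp_I_mul_ofReal_sub_one_le (x := V j ω - U ω)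
    have h2 : Complex.exp (V j ω * Complex.I) - Complex.exp (U ω * Complex.I) =
        Complex.exp (U ω * Complex.I) *
          (Complex.exp (Complex.I * ((V j ω - U ω : ℝ) : ℂ)) - 1) := by
      rw [mul_sub, mul_one, ← Complex.exp_add]
      congr 2
      push_cast
      ring
    rw [h2, norm_mul, Complex.norm_exp_ofReal_mul_I, one_mul]
    exact h1
  rw [hch hXm]
  refine tendsto_nhds_unique hcf ?_
  have e3 : ∀ j, ∫ ω, Complex.exp (V j ω * Complex.I) ∂P =
      Complex.exp ((∫ ω, V j ω ∂P : ℝ) * Complex.I - Var[V j; P] / 2) := by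
    intro j
    rw [← (hY j).charFunDual_map_eq L, hch (hY j).aemeasurable]
    rfl
  simp_rw [e3]
  refine (Complex.continuous_exp.tendsto _).comp ?_
  refine ((Complex.continuous_ofReal.tendsto _).comp hE).mul_const _ |>.sub ?_
  exact ((Complex.continuous_ofReal.tendsto _).comp hVar).div_const 2

end LTwo

section InnerH

variable {H T : ℝ} {φ ψ : ℝ → ℝ}

/-- Membership in `|𝓗|`. -/
def MemH (H T : ℝ) (φ : ℝ → ℝ) : Prop :=
  AEStronglyMeasurable φ (leb T) ∧ absNorm H T φ < ∞

instance : SFinite (leb T) := inferInstance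

theorem integrable_kernelH_mul (hH : 1 / 2 < H) (hH' : H < 1) (hφ : MemH H T φ)
    (hψ : MemH H T ψ) :
    Integrable (fun z : ℝ × ℝ => φ z.1 * ψ z.2 * kernelH H z.1 z.2) ((leb T).prod (leb T)) := by
  have hm : AEStronglyMeasurable (fun z : ℝ × ℝ => φ z.1 * ψ z.2 * kernelH H z.1 z.2)
      ((leb T).prod (leb T)) :=
    (hφ.1.comp_fst.mul hψ.1.comp_snd).mul (measurable_kernelH H).aestronglyMeasurable
  refine ⟨hm, ?_⟩
  rw [hasFiniteIntegral_iff_enorm, lintegral_prod _ hm.enorm]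
  refine lt_of_le_of_lt ?_ (ENNReal.mul_lt_top hφ.2 hψ.2)
  refine le_trans (le_of_eq ?_) (lintegral_kernelH_cauchySchwarz hH hH' hφ.1 hψ.1)
  refine lintegral_congr fun t => lintegral_congr fun s => ?_
  rw [enorm_mul, enorm_mul, Real.enorm_of_nonneg (kernelH_nonneg hH t s)]

theorem innerH_eq_integral_prod (hH : 1 / 2 < H) (hH' : H < 1) (hφ : MemH H T φ)
    (hψ : MemH H T ψ) :
    innerH H T φ ψ = ∫ z : ℝ × ℝ, φ z.1 * ψ z.2 * kernelH H z.1 z.2 ∂(leb T).prod (leb T) :=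
  (integral_prod _ (integrable_kernelH_mul hH hH' hφ hψ)).symm

theorem enorm_innerH_le (hH : 1 / 2 < H) (hH' : H < 1) (hφ : AEStronglyMeasurable φ (leb T))
    (hψ : AEStronglyMeasurable ψ (leb T)) :
    ‖innerH H T φ ψ‖ₑ ≤ absNorm H T φ * absNorm H T ψ := by
  refine le_trans ?_ (lintegral_kernelH_cauchySchwarz hH hH' hφ hψ)
  refine (enorm_integral_le_lintegral_enorm _).trans (lintegral_mono fun t => ?_)
  refine (enorm_integral_le_lintegral_enorm _).trans (lintegral_mono fun s => ?_)
  rw [enorm_mul, enorm_mul, Real.enorm_of_nonneg (kernelH_nonneg hH t s)]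

theorem innerH_comm (hH : 1 / 2 < H) (hH' : H < 1) (hφ : MemH H T φ) (hψ : MemH H T ψ) :
    innerH H T φ ψ = innerH H T ψ φ := by
  rw [innerH_eq_integral_prod hH hH' hφ hψ, innerH_eq_integral_prod hH hH' hψ hφ,
    ← integral_prod_swap]
  refine integral_congr_ae (ae_of_all _ fun z => ?_)
  simp only [Prod.fst_swap, Prod.snd_swap]
  rw [kernelH_comm, mul_comm (φ _)]

theorem absNorm_add_le (hH : 1 / 2 < H) (hH' : H < 1) {V : Type*} [NormedAddCommGroup V]
    {φ ψ : ℝ → V} (hφ : AEStronglyMeasurable φ (leb T)) (hψ : AEStronglyMeasurable ψ (leb T)) :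
    absNorm H T (fun s => φ s + ψ s) ≤ absNorm H T φ + absNorm H T ψ := by
  have hsq : ∀ χ : ℝ → V, ∫⁻ t, ∫⁻ s, ‖χ t‖ₑ * ‖χ s‖ₑ * ENNReal.ofReal (kernelH H t s) ∂leb T ∂leb T
      = absNorm H T χ ^ (2 : ℝ) := fun χ => by
    rw [absNorm, ← ENNReal.rpow_mul]
    norm_num
  have h : absNorm H T (fun s => φ s + ψ s) ^ (2 : ℝ) ≤
      (absNorm H T φ + absNorm H T ψ) ^ (2 : ℝ) := by
    rw [← hsq]
    have hk := measurable_ofReal_kernelH H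
    have hm : ∀ {α β : ℝ → V}, AEStronglyMeasurable α (leb T) → AEStronglyMeasurable β (leb T) →
        AEMeasurable (fun z : ℝ × ℝ => ‖α z.1‖ₑ * ‖β z.2‖ₑ * ENNReal.ofReal (kernelH H z.1 z.2))
          ((leb T).prod (leb T)) := fun ha hb =>
      (ha.enorm.comp_fst.mul hb.enorm.comp_snd).mul hk.aemeasurable
    have hm2 : ∀ {χ : ℝ → V}, AEStronglyMeasurable χ (leb T) →
        AEMeasurable (fun z : ℝ × ℝ => ‖χ z.1‖ₑ * ‖φ z.2‖ₑ * ENNReal.ofReal (kernelH H z.1 z.2) +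
          ‖χ z.1‖ₑ * ‖ψ z.2‖ₑ * ENNReal.ofReal (kernelH H z.1 z.2)) ((leb T).prod (leb T)) :=
      fun hχ => (hm hχ hφ).add (hm hχ hψ)
    calc _ ≤ ∫⁻ t, ∫⁻ s, ((‖φ t‖ₑ * ‖φ s‖ₑ * ENNReal.ofReal (kernelH H t s) +
            ‖φ t‖ₑ * ‖ψ s‖ₑ * ENNReal.ofReal (kernelH H t s)) +
            (‖ψ t‖ₑ * ‖φ s‖ₑ * ENNReal.ofReal (kernelH H t s) +
            ‖ψ t‖ₑ * ‖ψ s‖ₑ * ENNReal.ofReal (kernelH H t s))) ∂leb T ∂leb T := by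
          refine lintegral_mono fun t => lintegral_mono fun s => ?_
          calc _ ≤ (‖φ t‖ₑ + ‖ψ t‖ₑ) * (‖φ s‖ₑ + ‖ψ s‖ₑ) * ENNReal.ofReal (kernelH H t s) := by
                gcongr <;> exact enorm_add_le _ _
            _ = _ := by ring
      _ = (absNorm H T φ ^ (2 : ℝ) + ∫⁻ t, ∫⁻ s, ‖φ t‖ₑ * ‖ψ s‖ₑ *
            ENNReal.ofReal (kernelH H t s) ∂leb T ∂leb T) + ((∫⁻ t, ∫⁻ s, ‖ψ t‖ₑ * ‖φ s‖ₑ *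
            ENNReal.ofReal (kernelH H t s) ∂leb T ∂leb T) + absNorm H T ψ ^ (2 : ℝ)) := by
          rw [← hsq φ, ← hsq ψ, lintegral_lintegral ((hm2 hφ).add (hm2 hψ)), lintegral_lintegral (hm hφ hφ),
            lintegral_lintegral (hm hφ hψ), lintegral_lintegral (hm hψ hφ),
            lintegral_lintegral (hm hψ hψ), lintegral_add_left' (hm2 hφ),
            lintegral_add_left' (hm hφ hφ), lintegral_add_left' (hm hψ hφ)]
      _ ≤ (absNorm H T φ ^ (2 : ℝ) + absNorm H T φ * absNorm H T ψ) +
            (absNorm H T ψ * absNorm H T φ + absNorm H T ψ ^ (2 : ℝ)) := by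
          gcongr
          · exact lintegral_kernelH_cauchySchwarz hH hH' hφ hψ
          · exact lintegral_kernelH_cauchySchwarz hH hH' hψ hφ
      _ = _ := by
          simp only [ENNReal.rpow_two]
          ring
  exact (ENNReal.rpow_le_rpow_iff (by norm_num)).1 h

theorem MemH.add (hH : 1 / 2 < H) (hH' : H < 1) (hφ : MemH H T φ) (hψ : MemH H T ψ) :
    MemH H T fun s => φ s + ψ s :=
  ⟨hφ.1.add hψ.1, (absNorm_add_le hH hH' hφ.1 hψ.1).trans_lt (ENNReal.add_lt_top.2 ⟨hφ.2, hψ.2⟩)⟩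

theorem MemH.const_mul (hφ : MemH H T φ) (c : ℝ) : MemH H T fun s => c * φ s := by
  refine ⟨hφ.1.const_mul c, ?_⟩
  have : absNorm H T (fun s => c * φ s) ≤ ‖c‖ₑ * absNorm H T φ :=
    absNorm_le_const_mul enorm_ne_top fun s => by rw [enorm_mul]
  exact this.trans_lt (ENNReal.mul_lt_top enorm_lt_top hφ.2)

theorem MemH.sub (hH : 1 / 2 < H) (hH' : H < 1) (hφ : MemH H T φ) (hψ : MemH H T ψ) :
    MemH H T fun s => φ s - ψ s := by
  have := hφ.add hH hH' (hψ.const_mul (-1))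
  simpa only [neg_mul, one_mul, ← sub_eq_add_neg] using this

theorem MemH.zero : MemH H T fun _ => (0 : ℝ) :=
  ⟨aestronglyMeasurable_const, by simp [absNorm_zero]⟩

theorem MemH.sum (hH : 1 / 2 < H) (hH' : H < 1) {ι : Type*} {s : Finset ι} {φ : ι → ℝ → ℝ}
    (h : ∀ i ∈ s, MemH H T (φ i)) : MemH H T fun t => ∑ i ∈ s, φ i t := by
  classical
  induction s using Finset.induction_on with
  | empty => simpa using MemH.zero
  | insert i s hi ih =>
    simp only [Finset.sum_insert hi]
    exact (h i (Finset.mem_insert_self i s)).add hH hH'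
      (ih fun j hj => h j (Finset.mem_insert_of_mem hj))

theorem innerH_sum_left (hH : 1 / 2 < H) (hH' : H < 1) {ι : Type*} (s : Finset ι) (c : ι → ℝ)
    {φ : ι → ℝ → ℝ} (h : ∀ i ∈ s, MemH H T (φ i)) (hψ : MemH H T ψ) :
    innerH H T (fun t => ∑ i ∈ s, c i * φ i t) ψ = ∑ i ∈ s, c i * innerH H T (φ i) ψ := by
  rw [innerH_eq_integral_prod hH hH' (MemH.sum hH hH' fun i hi => (h i hi).const_mul (c i)) hψ]
  have e : ∀ i ∈ s, c i * innerH H T (φ i) ψ =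
      ∫ z : ℝ × ℝ, c i * (φ i z.1 * ψ z.2 * kernelH H z.1 z.2) ∂(leb T).prod (leb T) := by
    intro i hi
    rw [innerH_eq_integral_prod hH hH' (h i hi) hψ, integral_const_mul]
  rw [Finset.sum_congr rfl e, ← integral_finsetSum _ fun i hi =>
    (integrable_kernelH_mul hH hH' (h i hi) hψ).const_mul (c i)]
  refine integral_congr_ae (ae_of_all _ fun z => ?_)
  simp only [Finset.sum_mul, mul_assoc]

theorem innerH_sum_right (hH : 1 / 2 < H) (hH' : H < 1) {ι : Type*} (s : Finset ι) (c : ι → ℝ)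
    {φ : ι → ℝ → ℝ} (h : ∀ i ∈ s, MemH H T (φ i)) (hψ : MemH H T ψ) :
    innerH H T ψ (fun t => ∑ i ∈ s, c i * φ i t) = ∑ i ∈ s, c i * innerH H T ψ (φ i) := by
  rw [innerH_comm hH hH' hψ (MemH.sum hH hH' fun i hi => (h i hi).const_mul (c i)),
    innerH_sum_left hH hH' s c h hψ]
  exact Finset.sum_congr rfl fun i hi => by rw [innerH_comm hH hH' (h i hi) hψ]

theorem innerH_sub_left (hH : 1 / 2 < H) (hH' : H < 1) {φ' : ℝ → ℝ} (hφ : MemH H T φ)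
    (hφ' : MemH H T φ') (hψ : MemH H T ψ) :
    innerH H T (fun t => φ t - φ' t) ψ = innerH H T φ ψ - innerH H T φ' ψ := by
  rw [innerH_eq_integral_prod hH hH' (hφ.sub hH hH' hφ') hψ, innerH_eq_integral_prod hH hH' hφ hψ,
    innerH_eq_integral_prod hH hH' hφ' hψ,
    ← integral_sub (integrable_kernelH_mul hH hH' hφ hψ) (integrable_kernelH_mul hH hH' hφ' hψ)]
  refine integral_congr_ae (ae_of_all _ fun z => ?_)
  simp only
  ring

theorem innerH_sub_right (hH : 1 / 2 < H) (hH' : H < 1) {φ' : ℝ → ℝ} (hφ : MemH H T φ)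
    (hφ' : MemH H T φ') (hψ : MemH H T ψ) :
    innerH H T ψ (fun t => φ t - φ' t) = innerH H T ψ φ - innerH H T ψ φ' := by
  rw [innerH_comm hH hH' hψ (hφ.sub hH hH' hφ'), innerH_sub_left hH hH' hφ hφ' hψ,
    innerH_comm hH hH' hψ hφ, innerH_comm hH hH' hψ hφ']

/-- The norm of `|𝓗|` of a function on an interval is bounded by its norm in `L_2`. -/
theorem absNorm_indicator_sq_le (hH : 1 / 2 < H) (hH' : H < 1) : ∃ C : ℝ≥0∞, C ≠ ∞ ∧
    ∀ {V : Type} [NormedAddCommGroup V] (T a b : ℝ) (u : ℝ → V), 0 ≤ a → a ≤ b → b ≤ T →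
      AEStronglyMeasurable u (leb T) →
      absNorm H T ((Ioc a b).indicator u) ^ (2 : ℝ) ≤
        C * ENNReal.ofReal ((b - a) ^ (2 * H - 1)) * ∫⁻ s in Ioc a b, ‖u s‖ₑ ^ (2 : ℝ) := by
  obtain ⟨C, hC, h⟩ := lintegral_kernelH_schur hH hH'
  refine ⟨C, hC, fun {V} _ T a b u ha hab hb hu => ?_⟩
  refine le_trans (le_of_eq ?_) (h a b hab (fun s => ‖u s‖ₑ)
    (by rw [← leb_restrict_Ioc ha hb]; exact hu.enorm.restrict))
  rw [absNorm, ← ENNReal.rpow_mul, one_div, inv_mul_cancel₀ (by norm_num), ENNReal.rpow_one,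
    ← leb_restrict_Ioc ha hb, ← lintegral_indicator measurableSet_Ioc]
  refine lintegral_congr fun t => ?_
  by_cases ht : t ∈ Ioc a b
  · rw [indicator_of_mem ht, indicator_of_mem ht, ← lintegral_indicator measurableSet_Ioc]
    refine lintegral_congr fun s => ?_
    by_cases hs : s ∈ Ioc a b
    · rw [indicator_of_mem hs, indicator_of_mem hs]
    · simp [indicator_of_notMem hs]
  · simp [indicator_of_notMem ht]

theorem memH_indicator (hH : 1 / 2 < H) (hH' : H < 1) {a b : ℝ} (ha : 0 ≤ a) (hab : a ≤ b)
    (hb : b ≤ T) : MemH H T ((Ioc a b).indicator fun _ => (1 : ℝ)) := by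
  refine ⟨(measurable_const.indicator measurableSet_Ioc).aestronglyMeasurable, ?_⟩
  obtain ⟨C, hC, h⟩ := absNorm_indicator_sq_le hH hH'
  have h1 := h T a b (fun _ => (1 : ℝ)) ha hab hb aestronglyMeasurable_const
  have h2 : absNorm H T ((Ioc a b).indicator fun _ => (1 : ℝ)) ^ (2 : ℝ) < ∞ := by
    refine h1.trans_lt ?_
    simp only [enorm_one, ENNReal.one_rpow, lintegral_const, one_mul, Measure.restrict_apply_univ,
      Real.volume_Ioc]
    exact ENNReal.mul_lt_top (ENNReal.mul_lt_top hC.lt_top ENNReal.ofReal_lt_top)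
      ENNReal.ofReal_lt_top
  by_contra hne
  rw [not_lt, top_le_iff] at hne
  rw [hne] at h2
  simp at h2

theorem innerH_indicator (hH : 1 / 2 < H) (hH' : H < 1) {a b c d : ℝ} (ha : 0 ≤ a) (hab : a ≤ b)
    (hb : b ≤ T) (hc : 0 ≤ c) (hcd : c ≤ d) (hd : d ≤ T) :
    innerH H T ((Ioc a b).indicator fun _ => 1) ((Ioc c d).indicator fun _ => 1) =
      (|b - c| ^ (2 * H) + |a - d| ^ (2 * H) - |b - d| ^ (2 * H) - |a - c| ^ (2 * H)) / 2 := by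
  have h2H : 1 < 2 * H := by linarith
  set G : ℝ → ℝ := fun x => H * |x| ^ (2 * H - 2) * x with hG
  have hK : ∀ x, HasDerivAt (fun x => |x| ^ (2 * H) / 2) (G x) x := fun x => by
    refine ((hasDerivAt_abs_rpow x h2H).div_const 2).congr_deriv ?_
    rw [hG]
    ring
  have hGc : Continuous G := by
    have h1 : ContDiff ℝ 1 (fun x : ℝ => ‖x‖ ^ (2 * H) / 2) := (contDiff_norm_rpow h2H).div_const 2
    have h2 := h1.continuous_deriv le_rfl
    have : deriv (fun x : ℝ => ‖x‖ ^ (2 * H) / 2) = G := funext fun x => (hK x).deriv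
    rwa [this] at h2
  have hG' : ∀ x, x ≠ 0 → HasDerivAt G (H * (2 * H - 1) * |x| ^ (2 * H - 2)) x := by
    intro x hx
    have hx0 : 0 < |x| := abs_pos.2 hx
    have h1 := (((hasDerivAt_abs hx).rpow_const (p := 2 * H - 2) (Or.inl hx0.ne')).const_mul
      H).mul (hasDerivAt_id x)
    refine h1.congr_deriv ?_
    have e : (SignType.sign x : ℝ) * x = |x| := sign_mul_self x
    have e2 : |x| ^ (2 * H - 2) = |x| ^ (2 * H - 2 - 1) * |x| := by
      rw [← Real.rpow_add_one hx0.ne']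
      ring_nf
    simp only [id, mul_one]
    calc _ = H * (2 * H - 2) * |x| ^ (2 * H - 2 - 1) * (SignType.sign x * x) +
          H * |x| ^ (2 * H - 2) := by ring
      _ = _ := by
        rw [e, e2]
        ring
  have hin : ∀ t, ∫ s in c..d, kernelH H t s = G (t - c) - G (t - d) := by
    intro t
    have hi : IntervalIntegrable (kernelH H t) volume c d := by
      rw [intervalIntegrable_iff_integrableOn_Ioc_of_le hcd]
      refine ⟨((measurable_kernelH H).comp measurable_prodMk_left).aestronglyMeasurable, ?_⟩
      obtain ⟨C, hC, hk⟩ := lintegral_kernelH_rpow_le hH one_pos hH' (by linarith)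
      have := hk t c d hcd
      simp only [ENNReal.rpow_one] at this
      rw [hasFiniteIntegral_iff_enorm]
      simp_rw [Real.enorm_of_nonneg (kernelH_nonneg hH t _)]
      exact this.trans_lt (ENNReal.mul_lt_top hC.lt_top ENNReal.ofReal_lt_top)
    have := integral_eq_of_hasDerivAt_off_countable (fun s => -G (t - s)) (kernelH H t)
      (countable_singleton t) (a := c) (b := d)
      (hGc.comp (continuous_const.sub continuous_id)).neg.continuousOn (fun s hs => ?_) hi
    · rw [this]
      ring
    · have hts : t - s ≠ 0 := sub_ne_zero.2 fun h => hs.2 h.symm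
      have h1 := ((hG' (t - s) hts).comp s ((hasDerivAt_id s).const_sub t)).neg
      refine h1.congr_deriv ?_
      rw [kernelH]
      ring
  have hout : ∫ t in a..b, (G (t - c) - G (t - d)) =
      (|b - c| ^ (2 * H) + |a - d| ^ (2 * H) - |b - d| ^ (2 * H) - |a - c| ^ (2 * H)) / 2 := by
    have hcont : Continuous fun t => G (t - c) - G (t - d) := by fun_prop
    rw [intervalIntegral.integral_eq_sub_of_hasDerivAt
      (f := fun t => |t - c| ^ (2 * H) / 2 - |t - d| ^ (2 * H) / 2) (fun t _ => ?_)
      (hcont.intervalIntegrable a b)]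
    · ring
    · have h1 := (hK (t - c)).comp t ((hasDerivAt_id t).sub_const c)
      have h2 := (hK (t - d)).comp t ((hasDerivAt_id t).sub_const d)
      refine (h1.sub h2).congr_deriv ?_
      ring
  rw [← hout, intervalIntegral.integral_of_le hab, ← leb_restrict_Ioc ha hb,
    ← integral_indicator measurableSet_Ioc, innerH]
  congr 1
  funext t
  by_cases ht : t ∈ Ioc a b
  · rw [indicator_of_mem ht fun t => G (t - c) - G (t - d), ← hin t, intervalIntegral.integral_of_le hcd, ← leb_restrict_Ioc hc hd,
      ← integral_indicator measurableSet_Ioc]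
    congr 1
    funext s
    by_cases hs : s ∈ Ioc c d
    · simp [indicator_of_mem ht, indicator_of_mem hs]
    · simp [indicator_of_notMem hs]
  · simp [indicator_of_notMem ht]

end InnerH

section Wiener

set_option linter.unusedSectionVars false

variable {Ω : Type*} [MeasurableSpace Ω] {P : Measure Ω} {H T : ℝ} {β : ℝ → Ω → ℝ}

theorem IsWienerIntegral.memH {φ : ℝ → ℝ} {X : Ω → ℝ} (h : IsWienerIntegral H T P β φ X) :
    MemH H T φ := ⟨h.1, h.2.1⟩

theorem hasGaussianLaw_pi {ι : Type*} [Fintype ι] {Y : ι → Ω → ℝ} (h : IsGaussianProcess Y P) :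
    HasGaussianLaw (fun ω i => Y i ω) P := by
  have h1 := h.hasGaussianLaw Finset.univ
  exact h1.map_fun (ContinuousLinearMap.pi fun i : ι =>
    ContinuousLinearMap.proj (R := ℝ) (φ := fun _ : (Finset.univ : Finset ι) => ℝ)
      ⟨i, Finset.mem_univ i⟩)

/-- The step function with values `c` on the grid `π`. -/
def Grid.step (π : Grid T) (c : Fin π.m → ℝ) (s : ℝ) : ℝ := ∑ i, c i * π.ind i s

/-- The integral of a step function. -/
def Grid.stepInt (π : Grid T) (c : Fin π.m → ℝ) (β : ℝ → Ω → ℝ) (ω : Ω) : ℝ :=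
  ∑ i, c i * (β (π.t i.succ) ω - β (π.t i.castSucc) ω)

theorem IsFBM.isGaussianProcess_stepInt (hβ : IsFBM H T P β) :
    IsGaussianProcess (fun (z : Σ π : Grid T, (Fin π.m → ℝ)) ω => z.1.stepInt z.2 β ω) P := by
  classical
  refine hβ.gaussian.of_isGaussianProcess fun z => ?_
  set τ : Fin (z.1.m + 1) → Icc (0 : ℝ) T := fun i => ⟨z.1.t i, z.1.mem i⟩
  refine ⟨Finset.univ.image τ, ∑ i, z.2 i • (ContinuousLinearMap.proj (R := ℝ)
      (φ := fun _ : Finset.univ.image τ => ℝ)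
      ⟨τ i.succ, Finset.mem_image_of_mem _ (Finset.mem_univ _)⟩ - ContinuousLinearMap.proj (R := ℝ)
      (φ := fun _ : Finset.univ.image τ => ℝ)
      ⟨τ i.castSucc, Finset.mem_image_of_mem _ (Finset.mem_univ _)⟩), fun ω => ?_⟩
  simp [Grid.stepInt, Finset.restrict_def, τ]

variable [IsProbabilityMeasure P]

theorem IsFBM.memLp (hβ : IsFBM H T P β) {t : ℝ} (ht : t ∈ Icc 0 T) : MemLp (β t) 2 P :=
  (hβ.gaussian.hasGaussianLaw_eval ⟨t, ht⟩).memLp_two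

theorem IsFBM.memLp_stepInt (hβ : IsFBM H T P β) (π : Grid T) (c : Fin π.m → ℝ) :
    MemLp (π.stepInt c β) 2 P :=
  memLp_finsetSum _ fun i _ => ((hβ.memLp (π.mem _)).sub (hβ.memLp (π.mem _))).const_mul _

theorem IsFBM.integral_stepInt (hβ : IsFBM H T P β) (π : Grid T) (c : Fin π.m → ℝ) :
    ∫ ω, π.stepInt c β ω ∂P = 0 := by
  have hi : ∀ i, Integrable (β (π.t i)) P := fun i => (hβ.memLp (π.mem i)).integrable (by norm_num)
  have hi2 : ∀ i : Fin π.m,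
      Integrable (fun ω => c i * (β (π.t i.succ) ω - β (π.t i.castSucc) ω)) P := fun i =>
    ((hi _).sub (hi _)).const_mul _
  unfold Grid.stepInt
  rw [integral_finsetSum _ fun i _ => hi2 i]
  refine Finset.sum_eq_zero fun i _ => ?_
  rw [integral_const_mul, integral_sub (hi _) (hi _), hβ.centered _ (π.mem _),
    hβ.centered _ (π.mem _), sub_zero, mul_zero]

theorem IsFBM.integral_inc_mul_inc (hβ : IsFBM H T P β) (hH : 1 / 2 < H) (hH' : H < 1)
    {a b c d : ℝ} (ha : 0 ≤ a) (hab : a ≤ b) (hb : b ≤ T) (hc : 0 ≤ c) (hcd : c ≤ d)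
    (hd : d ≤ T) :
    ∫ ω, (β b ω - β a ω) * (β d ω - β c ω) ∂P =
      innerH H T ((Ioc a b).indicator fun _ => 1) ((Ioc c d).indicator fun _ => 1) := by
  have ma : a ∈ Icc 0 T := ⟨ha, hab.trans hb⟩
  have mb : b ∈ Icc 0 T := ⟨ha.trans hab, hb⟩
  have mc : c ∈ Icc 0 T := ⟨hc, hcd.trans hd⟩
  have md : d ∈ Icc 0 T := ⟨hc.trans hcd, hd⟩
  have hi : ∀ {s t}, s ∈ Icc 0 T → t ∈ Icc 0 T → Integrable (fun ω => β s ω * β t ω) P :=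
    fun hs ht => (hβ.memLp hs).integrable_mul (hβ.memLp ht)
  have e : ∀ ω, (β b ω - β a ω) * (β d ω - β c ω) =
      β b ω * β d ω - β b ω * β c ω - (β a ω * β d ω - β a ω * β c ω) := fun ω => by ring
  have i1 : Integrable (fun ω => β b ω * β d ω - β b ω * β c ω) P := (hi mb md).sub (hi mb mc)
  have i2 : Integrable (fun ω => β a ω * β d ω - β a ω * β c ω) P := (hi ma md).sub (hi ma mc)
  simp_rw [e]
  rw [integral_sub i1 i2, integral_sub (hi mb md) (hi mb mc), integral_sub (hi ma md) (hi ma mc),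
    hβ.covariance _ mb _ md, hβ.covariance _ mb _ mc, hβ.covariance _ ma _ md,
    hβ.covariance _ ma _ mc, innerH_indicator hH hH' ha hab hb hc hcd hd]
  ring

theorem Grid.memH_ind (hH : 1 / 2 < H) (hH' : H < 1) (π : Grid T) (i : Fin π.m) :
    MemH H T (π.ind i) :=
  memH_indicator hH hH' (π.mem _).1 (π.strictMono.monotone i.castSucc_lt_succ.le) (π.mem _).2

theorem Grid.memH_step (hH : 1 / 2 < H) (hH' : H < 1) (π : Grid T) (c : Fin π.m → ℝ) :
    MemH H T (π.step c) :=
  MemH.sum hH hH' fun i _ => (π.memH_ind hH hH' i).const_mul _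

theorem IsFBM.integral_stepInt_mul (hβ : IsFBM H T P β) (hH : 1 / 2 < H) (hH' : H < 1)
    (π π' : Grid T) (c : Fin π.m → ℝ) (c' : Fin π'.m → ℝ) :
    ∫ ω, π.stepInt c β ω * π'.stepInt c' β ω ∂P = innerH H T (π.step c) (π'.step c') := by
  have hm : ∀ (π : Grid T) (i : Fin π.m),
      MemLp (fun ω => β (π.t i.succ) ω - β (π.t i.castSucc) ω) 2 P := fun π i =>
    (hβ.memLp (π.mem _)).sub (hβ.memLp (π.mem _))
  have h1 : innerH H T (π.step c) (π'.step c') = _ :=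
    innerH_sum_left hH hH' Finset.univ c (fun i _ => π.memH_ind hH hH' i) (π'.memH_step hH hH' c')
  have h2 : ∀ ω, π.stepInt c β ω * π'.stepInt c' β ω =
      ∑ i, c i * (β (π.t i.succ) ω - β (π.t i.castSucc) ω) * π'.stepInt c' β ω := fun ω =>
    Finset.sum_mul ..
  have h3 : ∀ i : Fin π.m, Integrable (fun ω => c i * (β (π.t i.succ) ω - β (π.t i.castSucc) ω) *
      π'.stepInt c' β ω) P := fun i =>
    ((hm π i).const_mul _).integrable_mul (hβ.memLp_stepInt π' c')
  simp_rw [h1, h2]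
  rw [integral_finsetSum _ fun i _ => h3 i]
  refine Finset.sum_congr rfl fun i _ => ?_
  have h4 : innerH H T (π.ind i) (π'.step c') = _ :=
    innerH_sum_right hH hH' Finset.univ c' (fun i _ => π'.memH_ind hH hH' i) (π.memH_ind hH hH' i)
  rw [h4]
  simp_rw [mul_assoc, Grid.stepInt, Finset.mul_sum]
  rw [integral_finsetSum]
  · refine Finset.sum_congr rfl fun j _ => ?_
    have := hβ.integral_inc_mul_inc hH hH' (π.mem _).1
      (π.strictMono.monotone i.castSucc_lt_succ.le) (π.mem _).2 (π'.mem _).1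
      (π'.strictMono.monotone j.castSucc_lt_succ.le) (π'.mem _).2
    unfold Grid.ind
    rw [← this, ← integral_const_mul, ← integral_const_mul]
    refine integral_congr_ae (ae_of_all _ fun ω => ?_)
    simp only
    ring
  · intro j _
    have := ((hm π i).integrable_mul (hm π' j)).const_mul (c i * c' j)
    refine this.congr (ae_of_all _ fun ω => ?_)
    simp only [Pi.mul_apply]
    ring

theorem IsWienerIntegral.exists_step {φ : ℝ → ℝ} {X : Ω → ℝ} (h : IsWienerIntegral H T P β φ X) :
    ∃ (π : ℕ → Grid T) (c : ∀ j, Fin (π j).m → ℝ),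
      Tendsto (fun j => absNorm H T fun s => φ s - (π j).step (c j) s) atTop (𝓝 0) ∧
      Tendsto (fun j => eLpNorm ((π j).stepInt (c j) β - X) 2 P) atTop (𝓝 0) := by
  obtain ⟨-, -, -, π, c, h1, h2⟩ := h
  refine ⟨π, c, h1, ?_⟩
  simp_rw [eLpNorm_sub_comm _ X]
  exact h2

theorem hasGaussianLaw_wiener (hβ : IsFBM H T P β) {ι : Type*} [Fintype ι] {φ : ι → ℝ → ℝ}
    {X : ι → Ω → ℝ} (h : ∀ i, IsWienerIntegral H T P β (φ i) (X i)) :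
    HasGaussianLaw (fun ω i => X i ω) P := by
  choose π c h1 h2 using fun i => (h i).exists_step
  refine hasGaussianLaw_of_tendsto (Y := fun j i => (π i j).stepInt (c i j) β) (fun j => ?_)
    (fun i => (h i).2.2.1) h2
  exact hasGaussianLaw_pi (hβ.isGaussianProcess_stepInt.comp_right
    fun i : ι => (⟨π i j, c i j⟩ : Σ π : Grid T, (Fin π.m → ℝ)))

theorem integral_wiener (hβ : IsFBM H T P β) {φ : ℝ → ℝ} {X : Ω → ℝ}
    (h : IsWienerIntegral H T P β φ X) : ∫ ω, X ω ∂P = 0 := by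
  obtain ⟨π, c, -, h2⟩ := h.exists_step
  refine tendsto_nhds_unique (tendsto_integral_of_eLpNorm h.2.2.1
    (fun j => hβ.memLp_stepInt (π j) (c j)) h2) ?_
  simp_rw [hβ.integral_stepInt]
  exact tendsto_const_nhds

theorem tendsto_innerH (hH : 1 / 2 < H) (hH' : H < 1) {φ ψ : ℝ → ℝ} {φj ψj : ℕ → ℝ → ℝ}
    (hφ : MemH H T φ) (hψ : MemH H T ψ) (hφj : ∀ j, MemH H T (φj j)) (hψj : ∀ j, MemH H T (ψj j))
    (h1 : Tendsto (fun j => absNorm H T fun s => φ s - φj j s) atTop (𝓝 0))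
    (h2 : Tendsto (fun j => absNorm H T fun s => ψ s - ψj j s) atTop (𝓝 0)) :
    Tendsto (fun j => innerH H T (φj j) (ψj j)) atTop (𝓝 (innerH H T φ ψ)) := by
  have e : ∀ j, innerH H T (φj j) (ψj j) = innerH H T φ ψ -
      innerH H T φ (fun s => ψ s - ψj j s) - innerH H T (fun s => φ s - φj j s) ψ +
      innerH H T (fun s => φ s - φj j s) (fun s => ψ s - ψj j s) := by
    intro j
    rw [innerH_sub_right hH hH' hψ (hψj j) hφ, innerH_sub_left hH hH' hφ (hφj j) hψ,
      innerH_sub_left hH hH' hφ (hφj j) (hψ.sub hH hH' (hψj j)),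
      innerH_sub_right hH hH' hψ (hψj j) hφ, innerH_sub_right hH hH' hψ (hψj j) (hφj j)]
    ring
  have z : ∀ {u v : ℕ → ℝ → ℝ}, (∀ j, MemH H T (u j)) → (∀ j, MemH H T (v j)) →
      Tendsto (fun j => absNorm H T (u j) * absNorm H T (v j)) atTop (𝓝 0) →
      Tendsto (fun j => innerH H T (u j) (v j)) atTop (𝓝 0) := by
    intro u v hu hv h
    rw [tendsto_zero_iff_enorm_tendsto_zero]
    exact tendsto_of_tendsto_of_tendsto_of_le_of_le tendsto_const_nhds h (fun _ => zero_le)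
      fun j => enorm_innerH_le hH hH' (hu j).1 (hv j).1
  have t1 := z (fun _ => hφ) (fun j => hψ.sub hH hH' (hψj j)) (by
    simpa using ENNReal.Tendsto.const_mul h2 (Or.inr hφ.2.ne))
  have t2 := z (fun j => hφ.sub hH hH' (hφj j)) (fun _ => hψ) (by
    simpa using ENNReal.Tendsto.mul_const h1 (Or.inr hψ.2.ne))
  have t3 := z (fun j => hφ.sub hH hH' (hφj j)) (fun j => hψ.sub hH hH' (hψj j)) (by
    simpa using ENNReal.Tendsto.mul h1 (Or.inr ENNReal.zero_ne_top) h2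
      (Or.inr ENNReal.zero_ne_top))
  simp_rw [e]
  simpa using ((tendsto_const_nhds.sub t1).sub t2).add t3

theorem integral_wiener_mul (hβ : IsFBM H T P β) (hH : 1 / 2 < H) (hH' : H < 1) {φ ψ : ℝ → ℝ}
    {X Y : Ω → ℝ} (hX : IsWienerIntegral H T P β φ X) (hY : IsWienerIntegral H T P β ψ Y) :
    ∫ ω, X ω * Y ω ∂P = innerH H T φ ψ := by
  obtain ⟨π, c, h1, h2⟩ := hX.exists_step
  obtain ⟨π', c', h1', h2'⟩ := hY.exists_step
  refine tendsto_nhds_unique (tendsto_integral_mul_of_eLpNorm hX.2.2.1 hY.2.2.1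
    (fun j => hβ.memLp_stepInt (π j) (c j)) (fun j => hβ.memLp_stepInt (π' j) (c' j)) h2 h2') ?_
  simp_rw [hβ.integral_stepInt_mul hH hH']
  exact tendsto_innerH hH hH' hX.memH hY.memH (fun j => (π j).memH_step hH hH' _)
    (fun j => (π' j).memH_step hH hH' _) h1 h1'

theorem covariance_wiener (hβ : IsFBM H T P β) (hH : 1 / 2 < H) (hH' : H < 1) {φ ψ : ℝ → ℝ}
    {X Y : Ω → ℝ} (hX : IsWienerIntegral H T P β φ X) (hY : IsWienerIntegral H T P β ψ Y) :
    cov[X, Y; P] = innerH H T φ ψ := by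
  rw [covariance_eq_sub hX.2.2.1 hY.2.2.1, integral_wiener hβ hX, zero_mul, sub_zero]
  exact integral_wiener_mul hβ hH hH' hX hY

theorem IsFBM.isWienerIntegral_inc (hβ : IsFBM H T P β) (hH : 1 / 2 < H) (hH' : H < 1) {a b : ℝ}
    (ha : 0 ≤ a) (hab : a ≤ b) (hb : b ≤ T) :
    IsWienerIntegral H T P β ((Ioc a b).indicator fun _ => 1) fun ω => β b ω - β a ω := by
  have hm := memH_indicator hH hH' ha hab hb
  have ma : a ∈ Icc 0 T := ⟨ha, hab.trans hb⟩
  have mb : b ∈ Icc 0 T := ⟨ha.trans hab, hb⟩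
  refine ⟨hm.1, hm.2, (hβ.memLp mb).sub (hβ.memLp ma), ?_⟩
  rcases hab.eq_or_lt with rfl | hlt
  · refine ⟨fun _ => ⟨0, fun _ => a, fun i j hij => ?_, fun _ => ma⟩, fun _ _ => 0, ?_, ?_⟩
    · exact absurd hij (by fin_cases i; fin_cases j; exact lt_irrefl _)
    · simp [absNorm_zero]
    · simp
  · refine ⟨fun _ => ⟨1, ![a, b], ?_, ?_⟩, fun _ _ => 1, ?_, ?_⟩
    · intro i j hij
      fin_cases i <;> fin_cases j <;> simp_all
    · intro i
      fin_cases i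
      · exact ma
      · exact mb
    · simp [Grid.ind, absNorm_zero]
    · simp

theorem Cyl.hasTemperateGrowth (F : Cyl H T P β) : F.f.HasTemperateGrowth := by
  refine ⟨F.smooth, fun k => ?_⟩
  obtain ⟨C, hC⟩ := F.bounded k
  exact ⟨0, C, fun x => by simpa using hC x⟩

theorem Cyl.exists_val_le (F : Cyl H T P β) : ∃ C : ℝ, ∀ ω, ‖F.val ω‖ ≤ C := by
  obtain ⟨C, hC⟩ := F.bounded 0
  exact ⟨C, fun ω => by
    have h := hC fun i => F.X i ω
    rwa [norm_iteratedFDeriv_zero] at h⟩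

theorem Cyl.exists_fderiv_le (F : Cyl H T P β) : ∃ C : ℝ, 0 ≤ C ∧ ∀ x v,
    ‖fderiv ℝ F.f x v‖ ≤ C * ‖v‖ := by
  obtain ⟨C, hC⟩ := F.bounded 1
  have h : ∀ x, ‖fderiv ℝ F.f x‖ ≤ C := fun x => by simpa [norm_iteratedFDeriv_one] using hC x
  exact ⟨C, (norm_nonneg _).trans (h 0), fun x v =>
    (ContinuousLinearMap.le_opNorm _ _).trans (by gcongr; exact h x)⟩

theorem Cyl.memH_deriv (hH : 1 / 2 < H) (hH' : H < 1) (F : Cyl H T P β) (ω : Ω) :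
    MemH H T (F.deriv ω) :=
  MemH.sum hH hH' fun i _ => (F.wiener i).memH.const_mul _

theorem Cyl.exists_absNorm_deriv_le (hH : 1 / 2 < H) (hH' : H < 1) (F : Cyl H T P β) :
    ∃ C : ℝ≥0∞, C ≠ ∞ ∧ ∀ ω, absNorm H T (F.deriv ω) ≤ C := by
  obtain ⟨C, hC0, hC⟩ := F.exists_fderiv_le
  refine ⟨∑ i, ENNReal.ofReal C * absNorm H T (F.φ i), ?_, fun ω => ?_⟩
  · exact (ENNReal.sum_lt_top.2 fun i _ =>
      ENNReal.mul_lt_top ENNReal.ofReal_lt_top (F.wiener i).memH.2).ne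
  · have key : ∀ s : Finset (Fin F.n), absNorm H T (fun θ => ∑ i ∈ s,
        fderiv ℝ F.f (fun i => F.X i ω) (Pi.single i 1) * F.φ i θ) ≤
        ∑ i ∈ s, ENNReal.ofReal C * absNorm H T (F.φ i) := by
      intro s
      induction s using Finset.induction_on with
      | empty => simp [absNorm_zero]
      | insert i s hi ih =>
        simp only [Finset.sum_insert hi]
        refine (absNorm_add_le hH hH' ((F.wiener i).1.const_mul _)
          (MemH.sum hH hH' fun i _ => (F.wiener i).memH.const_mul _).1).trans ?_
        refine add_le_add (absNorm_le_const_mul ENNReal.ofReal_ne_top fun θ => ?_) ih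
        rw [enorm_mul]
        gcongr
        rw [← ofReal_norm]
        refine ENNReal.ofReal_le_ofReal ((hC _ _).trans ?_)
        rw [Pi.norm_single, norm_one, mul_one]
    exact key Finset.univ

theorem Cyl.innerH_deriv (hH : 1 / 2 < H) (hH' : H < 1) (F : Cyl H T P β) {ψ : ℝ → ℝ}
    (hψ : MemH H T ψ) (ω : Ω) : innerH H T (F.deriv ω) ψ =
      fderiv ℝ F.f (fun i => F.X i ω) fun i => innerH H T (F.φ i) ψ := by
  unfold Cyl.deriv
  rw [innerH_sum_left hH hH' _ _ (fun i _ => (F.wiener i).memH) hψ]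
  conv_rhs => rw [← Finset.univ_sum_single fun i => innerH H T (F.φ i) ψ, map_sum]
  refine Finset.sum_congr rfl fun i _ => ?_
  have : (Pi.single i (innerH H T (F.φ i) ψ) : Fin F.n → ℝ) =
      innerH H T (F.φ i) ψ • Pi.single i 1 := by
    rw [← Pi.single_smul', smul_eq_mul, mul_one]
  rw [this, map_smul, smul_eq_mul, mul_comm]

/-- The divergence `F β(ψ) - ⟨DF, ψ⟩` of the elementary process `F ψ`. -/
def Cyl.div (F : Cyl H T P β) (ψ : ℝ → ℝ) (Z : Ω → ℝ) (ω : Ω) : ℝ :=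
  Z ω * F.val ω - innerH H T (F.deriv ω) ψ

theorem Cyl.hasGaussianLaw_pair (hβ : IsFBM H T P β) (F G : Cyl H T P β) {ψ ψ' : ℝ → ℝ}
    {Z Z' : Ω → ℝ} (hZ : IsWienerIntegral H T P β ψ Z) (hZ' : IsWienerIntegral H T P β ψ' Z') :
    HasGaussianLaw (fun ω => (((fun i => F.X i ω, fun i => G.X i ω), Z' ω), Z ω)) P := by
  set φ : (Fin F.n ⊕ Fin G.n) ⊕ Bool → ℝ → ℝ :=
    Sum.elim (Sum.elim F.φ G.φ) fun b => if b then ψ else ψ'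
  set X : (Fin F.n ⊕ Fin G.n) ⊕ Bool → Ω → ℝ :=
    Sum.elim (Sum.elim F.X G.X) fun b => if b then Z else Z'
  have h : ∀ i, IsWienerIntegral H T P β (φ i) (X i) := by
    rintro ((i | i) | (_ | _))
    · exact F.wiener i
    · exact G.wiener i
    · exact hZ'
    · exact hZ
  let pr : ∀ i, ((Fin F.n ⊕ Fin G.n) ⊕ Bool → ℝ) →L[ℝ] ℝ := fun i =>
    ContinuousLinearMap.proj (R := ℝ) (φ := fun _ : (Fin F.n ⊕ Fin G.n) ⊕ Bool => ℝ) i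
  exact (hasGaussianLaw_wiener hβ h).map_fun
    (((((ContinuousLinearMap.pi fun i => pr (.inl (.inl i))).prod
      (ContinuousLinearMap.pi fun i => pr (.inl (.inr i)))).prod (pr (.inr false)))).prod
      (pr (.inr true)))

theorem Cyl.covariance_pair (hβ : IsFBM H T P β) (hH : 1 / 2 < H) (hH' : H < 1)
    (F G : Cyl H T P β) {ψ : ℝ → ℝ} {Z : Ω → ℝ} (hZ : IsWienerIntegral H T P β ψ Z)
    (L : StrongDual ℝ ((Fin F.n → ℝ) × (Fin G.n → ℝ))) :
    cov[L ∘ fun ω => ((fun i => F.X i ω), fun i => G.X i ω), Z; P] =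
      L (fun i => innerH H T (F.φ i) ψ, fun i => innerH H T (G.φ i) ψ) := by
  have hL : ∀ x y, L (x, y) = ∑ i, x i * L (Pi.single i 1, 0) + ∑ i, y i * L (0, Pi.single i 1) := by
    intro x y
    have e : (x, y) = ∑ i, x i • ((Pi.single i 1 : Fin F.n → ℝ), (0 : Fin G.n → ℝ)) +
        ∑ i, y i • ((0 : Fin F.n → ℝ), (Pi.single i 1 : Fin G.n → ℝ)) := by
      have h1 : ∀ {k : ℕ} (x : Fin k → ℝ) (i : Fin k),
          x i • (Pi.single i 1 : Fin k → ℝ) = Pi.single i (x i) := fun x i => by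
        rw [← Pi.single_smul', smul_eq_mul, mul_one]
      simp only [Prod.smul_mk, smul_zero, h1]
      refine Prod.ext ?_ ?_
      · simp only [Prod.fst_add, Prod.fst_sum, Finset.univ_sum_single, Finset.sum_const_zero,
          add_zero]
      · simp only [Prod.snd_add, Prod.snd_sum, Finset.univ_sum_single, Finset.sum_const_zero,
          zero_add]
    rw [e, map_add, map_sum, map_sum]
    simp only [map_smul, smul_eq_mul]
  have e : (L ∘ fun ω => ((fun i => F.X i ω), fun i => G.X i ω)) =
      (fun ω => ∑ i, L (Pi.single i 1, 0) * F.X i ω) +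
        fun ω => ∑ i, L (0, Pi.single i 1) * G.X i ω := by
    funext ω
    rw [Function.comp_apply, hL, Pi.add_apply]
    congr 1 <;> exact Finset.sum_congr rfl fun i _ => mul_comm _ _
  have mF : ∀ i, MemLp (fun ω => L (Pi.single i 1, 0) * F.X i ω) 2 P := fun i =>
    (F.wiener i).2.2.1.const_mul _
  have mG : ∀ i, MemLp (fun ω => L (0, Pi.single i 1) * G.X i ω) 2 P := fun i =>
    (G.wiener i).2.2.1.const_mul _
  rw [e, covariance_add_left (memLp_finsetSum _ fun i _ => mF i)
    (memLp_finsetSum _ fun i _ => mG i) hZ.2.2.1, covariance_fun_sum_left mF hZ.2.2.1,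
    covariance_fun_sum_left mG hZ.2.2.1, hL]
  congr 1
  · refine Finset.sum_congr rfl fun i _ => ?_
    rw [covariance_const_mul_left, covariance_wiener hβ hH hH' (F.wiener i) hZ, mul_comm]
  · refine Finset.sum_congr rfl fun i _ => ?_
    rw [covariance_const_mul_left, covariance_wiener hβ hH hH' (G.wiener i) hZ, mul_comm]

theorem hasTemperateGrowth_comp_fst {E F : Type*} [NormedAddCommGroup E] [NormedSpace ℝ E]
    [NormedAddCommGroup F] [NormedSpace ℝ F] {f : E → ℝ} (hf : f.HasTemperateGrowth) :
    (fun z : E × F => f z.1).HasTemperateGrowth :=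
  hf.comp (ContinuousLinearMap.fst ℝ E F).hasTemperateGrowth

theorem hasTemperateGrowth_comp_snd {E F : Type*} [NormedAddCommGroup E] [NormedSpace ℝ E]
    [NormedAddCommGroup F] [NormedSpace ℝ F] {f : F → ℝ} (hf : f.HasTemperateGrowth) :
    (fun z : E × F => f z.2).HasTemperateGrowth :=
  hf.comp (ContinuousLinearMap.snd ℝ E F).hasTemperateGrowth

theorem fderiv_comp_fst {E F : Type*} [NormedAddCommGroup E] [NormedSpace ℝ E]
    [NormedAddCommGroup F] [NormedSpace ℝ F] {f : E → ℝ} (hf : Differentiable ℝ f) (z v : E × F) :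
    fderiv ℝ (fun z : E × F => f z.1) z v = fderiv ℝ f z.1 v.1 := by
  rw [show fderiv ℝ (fun z : E × F => f z.1) z = _ from
    ((hf z.1).hasFDerivAt.comp z hasFDerivAt_fst).fderiv]
  rfl

theorem fderiv_comp_snd {E F : Type*} [NormedAddCommGroup E] [NormedSpace ℝ E]
    [NormedAddCommGroup F] [NormedSpace ℝ F] {f : F → ℝ} (hf : Differentiable ℝ f) (z v : E × F) :
    fderiv ℝ (fun z : E × F => f z.2) z v = fderiv ℝ f z.2 v.2 := by
  rw [show fderiv ℝ (fun z : E × F => f z.2) z = _ from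
    ((hf z.2).hasFDerivAt.comp z hasFDerivAt_snd).fderiv]
  rfl

/-- The isometry for divergences of elementary processes. -/
theorem Cyl.integral_div_mul_div (hβ : IsFBM H T P β) (hH : 1 / 2 < H) (hH' : H < 1)
    (F G : Cyl H T P β) {ψ ψ' : ℝ → ℝ} {Z Z' : Ω → ℝ} (hZ : IsWienerIntegral H T P β ψ Z)
    (hZ' : IsWienerIntegral H T P β ψ' Z') :
    ∫ ω, F.div ψ Z ω * G.div ψ' Z' ω ∂P = innerH H T ψ' ψ * ∫ ω, F.val ω * G.val ω ∂P +
      ∫ ω, innerH H T (F.deriv ω) ψ' * innerH H T (G.deriv ω) ψ ∂P := by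
  have dF : Differentiable ℝ F.f := F.smooth.differentiable (by simp)
  have dG : Differentiable ℝ G.f := G.smooth.differentiable (by simp)
  have := integral_gaussian_divergence_mul (F.hasGaussianLaw_pair hβ G hZ hZ')
    (integral_wiener hβ hZ) (integral_wiener hβ hZ') (F.covariance_pair hβ hH hH' G hZ)
    (F.covariance_pair hβ hH hH' G hZ') (hasTemperateGrowth_comp_fst F.hasTemperateGrowth)
    (hasTemperateGrowth_comp_snd G.hasTemperateGrowth)
  simp only [fderiv_comp_fst dF, fderiv_comp_snd dG, covariance_wiener hβ hH hH' hZ' hZ] at this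
  simp only [Cyl.div, F.innerH_deriv hH hH' hZ.memH, F.innerH_deriv hH hH' hZ'.memH,
    G.innerH_deriv hH hH' hZ.memH, G.innerH_deriv hH hH' hZ'.memH]
  exact this

/-- Duality of the divergence and the Malliavin derivative. -/
theorem Cyl.integral_mul_div (hβ : IsFBM H T P β) (hH : 1 / 2 < H) (hH' : H < 1)
    (F G : Cyl H T P β) {ψ : ℝ → ℝ} {Z : Ω → ℝ} (hZ : IsWienerIntegral H T P β ψ Z) :
    ∫ ω, G.val ω * F.div ψ Z ω ∂P = ∫ ω, F.val ω * innerH H T (G.deriv ω) ψ ∂P := by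
  have dF : Differentiable ℝ F.f := F.smooth.differentiable (by simp)
  have dG : Differentiable ℝ G.f := G.smooth.differentiable (by simp)
  have hlaw := F.hasGaussianLaw_pair hβ G hZ hZ
  have hX := hlaw.fst.fst
  have tF := hasTemperateGrowth_comp_fst (F := Fin G.n → ℝ) F.hasTemperateGrowth
  have tG := hasTemperateGrowth_comp_snd (E := Fin F.n → ℝ) G.hasTemperateGrowth
  have key := integral_gaussian_mul_temperate hlaw.fst (integral_wiener hβ hZ)
    (F.covariance_pair hβ hH hH' G hZ) (tF.mul tG)
  set c : (Fin F.n → ℝ) × (Fin G.n → ℝ) :=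
    (fun i => innerH H T (F.φ i) ψ, fun i => innerH H T (G.φ i) ψ)
  have hd : ∀ z, fderiv ℝ ((fun z : (Fin F.n → ℝ) × (Fin G.n → ℝ) => F.f z.1) *
      fun z => G.f z.2) z c = F.f z.1 * fderiv ℝ G.f z.2 c.2 + G.f z.2 * fderiv ℝ F.f z.1 c.1 := by
    intro z
    rw [show fderiv ℝ ((fun z : (Fin F.n → ℝ) × (Fin G.n → ℝ) => F.f z.1) *
      fun z => G.f z.2) z = _ from ((dF z.1).hasFDerivAt.comp z hasFDerivAt_fst |>.mul
      ((dG z.2).hasFDerivAt.comp z hasFDerivAt_snd)).fderiv]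
    simp
  have m2 : ∀ {h : (Fin F.n → ℝ) × (Fin G.n → ℝ) → ℝ}, h.HasTemperateGrowth →
      MemLp (fun ω => h (fun i => F.X i ω, fun i => G.X i ω)) 2 P := fun hh =>
    memLp_temperate hX hh (by simp)
  have tF' := hasTemperateGrowth_comp_fst (F := Fin G.n → ℝ)
    (hasTemperateGrowth_fderiv_apply F.hasTemperateGrowth c.1)
  have tG' := hasTemperateGrowth_comp_snd (E := Fin F.n → ℝ)
    (hasTemperateGrowth_fderiv_apply G.hasTemperateGrowth c.2)
  have j1 : Integrable (fun ω => Z ω * (F.val ω * G.val ω)) P :=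
    hZ.2.2.1.integrable_mul (m2 (tF.mul tG))
  have j2 : Integrable (fun ω => F.val ω * fderiv ℝ G.f (fun i => G.X i ω) c.2) P :=
    (m2 tF).integrable_mul (m2 tG')
  have j3 : Integrable (fun ω => G.val ω * fderiv ℝ F.f (fun i => F.X i ω) c.1) P :=
    (m2 tG).integrable_mul (m2 tF')
  simp only [hd, Pi.mul_apply] at key
  replace key := key.trans (integral_add j2 j3)
  simp only [Cyl.div, F.innerH_deriv hH hH' hZ.memH, G.innerH_deriv hH hH' hZ.memH]
  have e : ∀ ω, G.val ω * (Z ω * F.val ω - fderiv ℝ F.f (fun i => F.X i ω) c.1) =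
      Z ω * (F.val ω * G.val ω) - G.val ω * fderiv ℝ F.f (fun i => F.X i ω) c.1 := fun ω => by ring
  have e2 : ∫ ω, G.val ω * (Z ω * F.val ω - fderiv ℝ F.f (fun i => F.X i ω) c.1) ∂P =
      ∫ ω, F.val ω * fderiv ℝ G.f (fun i => G.X i ω) c.2 ∂P := by
    simp_rw [e]
    rw [integral_sub j1 j3]
    exact sub_eq_of_eq_add key
  exact e2

theorem Cyl.memLp_div (hβ : IsFBM H T P β) (hH : 1 / 2 < H) (hH' : H < 1) (F : Cyl H T P β)
    {ψ : ℝ → ℝ} {Z : Ω → ℝ} (hZ : IsWienerIntegral H T P β ψ Z) : MemLp (F.div ψ Z) 2 P := by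
  have hlaw := F.hasGaussianLaw_pair hβ F hZ hZ
  have h1 := memLp_temperate hlaw.fst (q := 2)
    ((ContinuousLinearMap.snd ℝ ((Fin F.n → ℝ) × (Fin F.n → ℝ)) ℝ).hasTemperateGrowth.mul
      (hasTemperateGrowth_comp_fst (hasTemperateGrowth_comp_fst F.hasTemperateGrowth)))
    (by simp)
  have h2 := memLp_temperate hlaw.fst.fst.fst (q := 2) (hasTemperateGrowth_fderiv_apply
    F.hasTemperateGrowth fun i => innerH H T (F.φ i) ψ) (by simp)
  have e : F.div ψ Z = fun ω => Z ω * F.val ω -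
      fderiv ℝ F.f (fun i => F.X i ω) fun i => innerH H T (F.φ i) ψ := by
    funext ω
    rw [Cyl.div, F.innerH_deriv hH hH' hZ.memH]
  rw [e]
  exact h1.sub h2

end Wiener

section Trace

variable {H T : ℝ}

theorem memH_one (hH : 1 / 2 < H) (hH' : H < 1) (hT : 0 ≤ T) : MemH H T fun _ => (1 : ℝ) := by
  refine ⟨aestronglyMeasurable_const, ?_⟩
  have h := memH_indicator hH hH' le_rfl hT (le_refl T)
  have e : absNorm H T (fun _ => (1 : ℝ)) = absNorm H T ((Ioc 0 T).indicator fun _ => (1 : ℝ)) := by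
    unfold absNorm
    rw [leb_eq_Ioc]
    congr 1
    refine setLIntegral_congr_fun measurableSet_Ioc fun t ht => ?_
    refine setLIntegral_congr_fun measurableSet_Ioc fun s hs => ?_
    simp only [indicator_of_mem ht, indicator_of_mem hs]
  rw [e]
  exact h.2

/-- The function `r ↦ ∫ φ(θ) k(θ, r) dθ`. -/
def kernelConv (H T : ℝ) (φ : ℝ → ℝ) (r : ℝ) : ℝ := ∫ θ, φ θ * kernelH H θ r ∂leb T

theorem integrable_mul_kernelH (hH : 1 / 2 < H) (hH' : H < 1) (hT : 0 ≤ T) {φ : ℝ → ℝ}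
    (hφ : MemH H T φ) :
    Integrable (fun z : ℝ × ℝ => φ z.1 * kernelH H z.1 z.2) ((leb T).prod (leb T)) := by
  simpa only [mul_one] using integrable_kernelH_mul hH hH' hφ (memH_one hH hH' hT)

theorem integrable_kernelConv (hH : 1 / 2 < H) (hH' : H < 1) (hT : 0 ≤ T) {φ : ℝ → ℝ}
    (hφ : MemH H T φ) : Integrable (kernelConv H T φ) (leb T) :=
  (integrable_mul_kernelH hH hH' hT hφ).integral_prod_right

theorem innerH_eq_integral_kernelConv (hH : 1 / 2 < H) (hH' : H < 1) {φ ψ : ℝ → ℝ}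
    (hφ : MemH H T φ) (hψ : MemH H T ψ) :
    innerH H T φ ψ = ∫ r, ψ r * kernelConv H T φ r ∂leb T := by
  rw [innerH_eq_integral_prod hH hH' hφ hψ, integral_prod_symm _
    (integrable_kernelH_mul hH hH' hφ hψ)]
  refine integral_congr_ae (ae_of_all _ fun r => ?_)
  simp only [kernelConv]
  rw [← integral_const_mul]
  refine integral_congr_ae (ae_of_all _ fun θ => ?_)
  simp only
  ring

theorem enorm_sum_innerH_mul_le (hH : 1 / 2 < H) (hH' : H < 1) {ι : Type*} [Fintype ι]
    {φ : ι → ℝ → ℝ} (hφ : ∀ i, MemH H T (φ i)) (c x y : ι → ℝ) {a b : ℝ} (ha : 0 ≤ a)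
    (hb : b ≤ T) (hx : ∀ i, a ≤ x i) (hxy : ∀ i, x i ≤ y i) (hy : ∀ i, y i ≤ b) :
    ‖∑ i, ∑ j, c i * c j * (innerH H T (φ i) ((Ioc (x j) (y j)).indicator fun _ => 1) *
        innerH H T (φ j) ((Ioc (x i) (y i)).indicator fun _ => 1))‖ₑ ≤
      2 * ∫⁻ s in Ioc a b, ∫⁻ r in Ioc a b,
        (∫⁻ θ, ‖∑ i, c i * φ i θ * (Ioc (x i) (y i)).indicator (fun _ => 1) s‖ₑ *
          ENNReal.ofReal (kernelH H θ r) ∂leb T) ^ (2 : ℝ) := by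
  classical
  rcases isEmpty_or_nonempty ι with hι | ⟨⟨i₀⟩⟩
  · simp
  have hT : 0 ≤ T := by linarith [hx i₀, hxy i₀, hy i₀]
  set ind : ι → ℝ → ℝ := fun i => (Ioc (x i) (y i)).indicator fun _ => 1 with hind
  have hindm : ∀ i, Measurable (ind i) := fun i => measurable_const.indicator measurableSet_Ioc
  have hm : ∀ i, MemH H T (ind i) := fun i =>
    memH_indicator hH hH' (ha.trans (hx i)) (hxy i) ((hy i).trans hb)
  set k : ι → ℝ → ℝ := fun i => kernelConv H T (φ i) with hk
  have hki : ∀ i, Integrable (k i) (leb T) := fun i => integrable_kernelConv hH hH' hT (hφ i)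
  have hik : ∀ i j, Integrable (fun r => ind j r * k i r) (leb T) := fun i j => by
    refine (hki i).bdd_mul (hindm j).aestronglyMeasurable (c := 1) (ae_of_all _ fun r => ?_)
    by_cases h : r ∈ Ioc (x j) (y j) <;> simp [hind, h]
  set D : ℝ → ℝ → ℝ := fun θ s => ∑ i, c i * φ i θ * ind i s with hD
  set A : ℝ → ℝ → ℝ≥0∞ := fun s r => ∫⁻ θ, ‖D θ s‖ₑ * ENNReal.ofReal (kernelH H θ r) ∂leb T with hA
  have e1 : ∑ i, ∑ j, c i * c j * (innerH H T (φ i) (ind j) * innerH H T (φ j) (ind i)) =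
      ∫ z : ℝ × ℝ, (∑ i, c i * ind i z.1 * k i z.2) * (∑ j, c j * ind j z.2 * k j z.1)
        ∂(leb T).prod (leb T) := by
    have e : ∀ z : ℝ × ℝ, (∑ i, c i * ind i z.1 * k i z.2) * (∑ j, c j * ind j z.2 * k j z.1) =
        ∑ i, ∑ j, c i * c j * ((ind i z.1 * k j z.1) * (ind j z.2 * k i z.2)) := by
      intro z
      rw [Finset.sum_mul_sum]
      refine Finset.sum_congr rfl fun i _ => Finset.sum_congr rfl fun j _ => ?_
      ring
    have hint : ∀ i j, Integrable (fun z : ℝ × ℝ => c i * c j *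
        ((ind i z.1 * k j z.1) * (ind j z.2 * k i z.2))) ((leb T).prod (leb T)) := fun i j =>
      ((hik j i).mul_prod (hik i j)).const_mul _
    simp_rw [e]
    rw [integral_finsetSum _ fun i _ => integrable_finsetSum _ fun j _ => hint i j]
    refine Finset.sum_congr rfl fun i _ => ?_
    rw [integral_finsetSum _ fun j _ => hint i j]
    refine Finset.sum_congr rfl fun j _ => ?_
    rw [integral_const_mul, integral_prod_mul (fun s => ind i s * k j s) fun r => ind j r * k i r,
      innerH_eq_integral_kernelConv hH hH' (hφ i) (hm j),
      innerH_eq_integral_kernelConv hH hH' (hφ j) (hm i), mul_comm (∫ r, ind j r * _ ∂leb T)]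
  have hae : ∀ᵐ r ∂leb T, ∀ i, Integrable (fun θ => φ i θ * kernelH H θ r) (leb T) :=
    ae_all_iff.2 fun i => (integrable_mul_kernelH hH hH' hT (hφ i)).prod_left_ae
  have hle : ∀ᵐ r ∂leb T, ∀ s, ‖∑ i, c i * ind i s * k i r‖ₑ ≤ A s r := by
    filter_upwards [hae] with r hr s
    have : ∑ i, c i * ind i s * k i r = ∫ θ, D θ s * kernelH H θ r ∂leb T := by
      simp only [hD, Finset.sum_mul]
      rw [integral_finsetSum]
      · refine Finset.sum_congr rfl fun i _ => ?_
        change c i * ind i s * (∫ θ, φ i θ * kernelH H θ r ∂leb T) = _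
        rw [← integral_const_mul]
        refine integral_congr_ae (ae_of_all _ fun θ => ?_)
        simp only
        ring
      · intro i _
        refine ((hr i).const_mul (c i * ind i s)).congr (ae_of_all _ fun θ => ?_)
        simp only
        ring
    rw [this]
    refine (enorm_integral_le_lintegral_enorm _).trans (lintegral_mono fun θ => ?_)
    rw [enorm_mul, Real.enorm_of_nonneg (kernelH_nonneg hH θ r)]
  have hA0 : ∀ s, s ∉ Ioc a b → ∀ r, A s r = 0 := by
    intro s hs r
    have : ∀ i, ind i s = 0 := fun i =>
      indicator_of_notMem (fun h => hs ⟨(hx i).trans_lt h.1, h.2.trans (hy i)⟩) _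
    simp [hA, hD, this]
  have hAm : AEMeasurable (fun z : ℝ × ℝ => A z.1 z.2) ((leb T).prod (leb T)) := by
    refine AEMeasurable.lintegral_prod_right' (ν := leb T)
      (f := fun w : (ℝ × ℝ) × ℝ => ‖D w.2 w.1.1‖ₑ * ENNReal.ofReal (kernelH H w.2 w.1.2)) ?_
    have h1 : AEMeasurable (fun w : (ℝ × ℝ) × ℝ => ‖D w.2 w.1.1‖ₑ)
        (((leb T).prod (leb T)).prod (leb T)) := by
      refine AEMeasurable.enorm (Finset.aemeasurable_fun_sum _ fun i _ => ?_)
      exact ((hφ i).1.aemeasurable.comp_snd.const_mul _).mul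
        ((hindm i).comp (measurable_fst.comp measurable_fst)).aemeasurable
    have h2 : Measurable (fun w : (ℝ × ℝ) × ℝ => ENNReal.ofReal (kernelH H w.2 w.1.2)) := by
      unfold kernelH
      fun_prop
    exact h1.mul h2.aemeasurable
  have hA2 : AEMeasurable (fun z : ℝ × ℝ => A z.1 z.2 ^ (2 : ℝ)) ((leb T).prod (leb T)) :=
    hAm.pow_const _
  have hA2' : AEMeasurable (fun z : ℝ × ℝ => (Ioc a b).indicator (fun r => A z.1 r ^ (2 : ℝ)) z.2)
      ((leb T).prod (leb T)) := by
    have := hA2.indicator (measurable_snd (measurableSet_Ioc (a := a) (b := b)))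
    exact this
  rw [e1]
  calc _ ≤ ∫⁻ z : ℝ × ℝ, A z.1 z.2 * A z.2 z.1 ∂(leb T).prod (leb T) := by
        refine (enorm_integral_le_lintegral_enorm _).trans (lintegral_mono_ae ?_)
        have h1 : ∀ᵐ z : ℝ × ℝ ∂(leb T).prod (leb T), ∀ s, ‖∑ i, c i * ind i s * k i z.2‖ₑ ≤ A s z.2 :=
          Measure.quasiMeasurePreserving_snd.ae hle
        have h2 : ∀ᵐ z : ℝ × ℝ ∂(leb T).prod (leb T), ∀ s, ‖∑ i, c i * ind i s * k i z.1‖ₑ ≤ A s z.1 :=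
          Measure.quasiMeasurePreserving_fst.ae hle
        filter_upwards [h1, h2] with z h1 h2
        rw [enorm_mul]
        exact mul_le_mul' (h1 _) (h2 _)
    _ ≤ ∫⁻ z : ℝ × ℝ, ((Ioc a b).indicator (fun r => A z.1 r ^ (2 : ℝ)) z.2 +
          (Ioc a b).indicator (fun r => A z.2 r ^ (2 : ℝ)) z.1) ∂(leb T).prod (leb T) := by
        refine lintegral_mono fun z => ?_
        by_cases h1 : z.1 ∈ Ioc a b
        · by_cases h2 : z.2 ∈ Ioc a b
          · simp only [indicator_of_mem h1, indicator_of_mem h2, ENNReal.rpow_two]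
            rcases le_total (A z.1 z.2) (A z.2 z.1) with h | h
            · exact (mul_le_mul_left h _).trans (by rw [← sq]; exact le_add_self)
            · exact (mul_le_mul_right h _).trans (by rw [← sq]; exact le_self_add)
          · simp [hA0 _ h2]
        · simp [hA0 _ h1]
    _ = 2 * ∫⁻ z : ℝ × ℝ, (Ioc a b).indicator (fun r => A z.1 r ^ (2 : ℝ)) z.2
          ∂(leb T).prod (leb T) := by
        rw [lintegral_add_left' hA2', two_mul]
        congr 1
        exact lintegral_prod_swap (fun z : ℝ × ℝ => (Ioc a b).indicator (fun r => A z.1 r ^ (2 : ℝ)) z.2)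
    _ ≤ _ := by
        gcongr 2 * ?_
        rw [lintegral_prod _ hA2', ← leb_restrict_Ioc ha hb,
          ← lintegral_indicator measurableSet_Ioc]
        refine lintegral_mono fun s => ?_
        by_cases hs : s ∈ Ioc a b
        · rw [indicator_of_mem hs]
          exact (lintegral_indicator measurableSet_Ioc fun r => A s r ^ (2 : ℝ)).le
        · rw [indicator_of_notMem hs]
          refine le_of_eq (lintegral_eq_zero_of_ae_eq_zero (ae_of_all _ fun r => ?_))
          refine indicator_apply_eq_zero.2 fun _ => ?_
          rw [hA0 s hs]
          simp

end Trace

section Elementary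

set_option linter.unusedSectionVars false

variable {Ω : Type*} [MeasurableSpace Ω] {P : Measure Ω} {H T : ℝ} {β : ℝ → Ω → ℝ}

/-- A real-valued elementary process `∑_i c_i F_i 1_{(a_i, b_i]}`, with arbitrary intervals. -/
structure Elem (H T : ℝ) (P : Measure Ω) (β : ℝ → Ω → ℝ) where
  ι : Type
  fintype : Fintype ι
  c : ι → ℝ
  F : ι → Cyl H T P β
  a : ι → ℝ
  b : ι → ℝ
  nonneg : ∀ i, 0 ≤ a i
  le : ∀ i, a i ≤ b i
  le_T : ∀ i, b i ≤ T

attribute [instance] Elem.fintype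

namespace Elem

/-- The indicator function of the `i`-th interval. -/
def ind (U : Elem H T P β) (i : U.ι) : ℝ → ℝ := (Ioc (U.a i) (U.b i)).indicator fun _ => 1

/-- The increment of the fractional Brownian motion on the `i`-th interval. -/
def inc (U : Elem H T P β) (i : U.ι) (ω : Ω) : ℝ := β (U.b i) ω - β (U.a i) ω

/-- The value at `(ω, s)`. -/
def val (U : Elem H T P β) (ω : Ω) (s : ℝ) : ℝ := ∑ i, U.c i * (U.F i).val ω * U.ind i s

/-- The Malliavin derivative at `(ω, θ, s)`. -/
def deriv (U : Elem H T P β) (ω : Ω) (θ s : ℝ) : ℝ :=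
  ∑ i, U.c i * (U.F i).deriv ω θ * U.ind i s

/-- The divergence. -/
def div (U : Elem H T P β) (ω : Ω) : ℝ := ∑ i, U.c i * (U.F i).div (U.ind i) (U.inc i) ω

variable [IsProbabilityMeasure P]

theorem memH_ind (hH : 1 / 2 < H) (hH' : H < 1) (U : Elem H T P β) (i : U.ι) :
    MemH H T (U.ind i) :=
  memH_indicator hH hH' (U.nonneg i) (U.le i) (U.le_T i)

theorem isWienerIntegral (hβ : IsFBM H T P β) (hH : 1 / 2 < H) (hH' : H < 1) (U : Elem H T P β)
    (i : U.ι) : IsWienerIntegral H T P β (U.ind i) (U.inc i) :=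
  hβ.isWienerIntegral_inc hH hH' (U.nonneg i) (U.le i) (U.le_T i)

theorem memLp_div (hβ : IsFBM H T P β) (hH : 1 / 2 < H) (hH' : H < 1) (U : Elem H T P β) :
    MemLp U.div 2 P :=
  memLp_finsetSum _ fun i _ => ((U.F i).memLp_div hβ hH hH'
    (U.isWienerIntegral hβ hH hH' i)).const_mul _

theorem memH_val (hH : 1 / 2 < H) (hH' : H < 1) (U : Elem H T P β) (ω : Ω) :
    MemH H T (U.val ω) :=
  MemH.sum hH hH' fun i _ => (U.memH_ind hH hH' i).const_mul _

theorem memLp_cyl_val {q : ℝ≥0∞} (F : Cyl H T P β) : MemLp F.val q P := by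
  obtain ⟨C, hC⟩ := F.exists_val_le
  exact MemLp.of_bound F.aestronglyMeasurable_val C (ae_of_all _ hC)

theorem memLp_cyl_innerH_deriv (hH : 1 / 2 < H) (hH' : H < 1) (F : Cyl H T P β) {ψ : ℝ → ℝ}
    (hψ : MemH H T ψ) {q : ℝ≥0∞} : MemLp (fun ω => innerH H T (F.deriv ω) ψ) q P := by
  obtain ⟨C, hC0, hC⟩ := F.exists_fderiv_le
  simp_rw [F.innerH_deriv hH hH' hψ]
  refine MemLp.of_bound ((F.continuous_fderiv _).measurable.comp_aemeasurable
    F.aemeasurable_X).aestronglyMeasurable _ (ae_of_all _ fun ω => hC _ _)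

/-- Duality of the divergence and the Malliavin derivative. -/
theorem integral_cyl_mul_div (hβ : IsFBM H T P β) (hH : 1 / 2 < H) (hH' : H < 1)
    (U : Elem H T P β) (G : Cyl H T P β) :
    ∫ ω, G.val ω * U.div ω ∂P = ∫ ω, innerH H T (G.deriv ω) (U.val ω) ∂P := by
  have hZ := U.isWienerIntegral hβ hH hH'
  have e1 : ∀ ω, G.val ω * U.div ω =
      ∑ i, U.c i * (G.val ω * (U.F i).div (U.ind i) (U.inc i) ω) := fun ω => by
    rw [div, Finset.mul_sum]
    exact Finset.sum_congr rfl fun i _ => by ring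
  have e2 : ∀ ω, innerH H T (G.deriv ω) (U.val ω) =
      ∑ i, U.c i * ((U.F i).val ω * innerH H T (G.deriv ω) (U.ind i)) := fun ω => by
    have := innerH_sum_right hH hH' Finset.univ (fun i => U.c i * (U.F i).val ω)
      (fun i _ => U.memH_ind hH hH' i) (G.memH_deriv hH hH' ω)
    refine Eq.trans this (Finset.sum_congr rfl fun i _ => by ring)
  simp_rw [e1, e2]
  have i1 : ∀ i, Integrable (fun ω => G.val ω * (U.F i).div (U.ind i) (U.inc i) ω) P := fun i =>
    (memLp_cyl_val (q := 2) G).integrable_mul ((U.F i).memLp_div hβ hH hH' (hZ i))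
  have i2 : ∀ i, Integrable (fun ω => (U.F i).val ω * innerH H T (G.deriv ω) (U.ind i)) P :=
    fun i => (memLp_cyl_val (q := 2) (U.F i)).integrable_mul
      (memLp_cyl_innerH_deriv (q := 2) hH hH' G (U.memH_ind hH hH' i))
  rw [integral_finsetSum _ fun i _ => (i1 i).const_mul _,
    integral_finsetSum _ fun i _ => (i2 i).const_mul _]
  refine Finset.sum_congr rfl fun i _ => ?_
  rw [integral_const_mul, integral_const_mul, (U.F i).integral_mul_div hβ hH hH' G (hZ i)]

theorem integral_div_mul_div (hβ : IsFBM H T P β) (hH : 1 / 2 < H) (hH' : H < 1)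
    (U : Elem H T P β) :
    ∫ ω, U.div ω * U.div ω ∂P = (∫ ω, innerH H T (U.val ω) (U.val ω) ∂P) +
      ∫ ω, ∑ i, ∑ j, U.c i * U.c j * (innerH H T ((U.F i).deriv ω) (U.ind j) *
        innerH H T ((U.F j).deriv ω) (U.ind i)) ∂P := by
  have hZ := U.isWienerIntegral hβ hH hH'
  have hm := U.memH_ind hH hH'
  have e1 : ∀ ω, U.div ω * U.div ω = ∑ i, ∑ j, U.c i * U.c j *
      ((U.F i).div (U.ind i) (U.inc i) ω * (U.F j).div (U.ind j) (U.inc j) ω) := fun ω => by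
    rw [div, Finset.sum_mul_sum]
    exact Finset.sum_congr rfl fun i _ => Finset.sum_congr rfl fun j _ => by ring
  have e2 : ∀ ω, innerH H T (U.val ω) (U.val ω) = ∑ i, ∑ j, U.c i * U.c j *
      (innerH H T (U.ind j) (U.ind i) * ((U.F i).val ω * (U.F j).val ω)) := fun ω => by
    have h1 := innerH_sum_left hH hH' Finset.univ (fun i => U.c i * (U.F i).val ω)
      (fun i _ => hm i) (U.memH_val hH hH' ω)
    refine Eq.trans h1 (Finset.sum_congr rfl fun i _ => ?_)
    have h2 := innerH_sum_right hH hH' Finset.univ (fun i => U.c i * (U.F i).val ω)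
      (fun i _ => hm i) (hm i)
    change _ * innerH H T (U.ind i) (fun s => ∑ i, U.c i * (U.F i).val ω * U.ind i s) = _
    rw [h2, Finset.mul_sum]
    refine Finset.sum_congr rfl fun j _ => ?_
    rw [innerH_comm hH hH' (hm i) (hm j)]
    ring
  simp_rw [e1, e2]
  have i1 : ∀ i j, Integrable (fun ω => U.c i * U.c j *
      ((U.F i).div (U.ind i) (U.inc i) ω * (U.F j).div (U.ind j) (U.inc j) ω)) P := fun i j =>
    (((U.F i).memLp_div hβ hH hH' (hZ i)).integrable_mul
      ((U.F j).memLp_div hβ hH hH' (hZ j))).const_mul _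
  have i2 : ∀ i j, Integrable (fun ω => U.c i * U.c j *
      (innerH H T (U.ind j) (U.ind i) * ((U.F i).val ω * (U.F j).val ω))) P := fun i j =>
    (((memLp_cyl_val (q := 2) (U.F i)).integrable_mul (memLp_cyl_val (q := 2) (U.F j))).const_mul
      _).const_mul _
  have i3 : ∀ i j, Integrable (fun ω => U.c i * U.c j *
      (innerH H T ((U.F i).deriv ω) (U.ind j) * innerH H T ((U.F j).deriv ω) (U.ind i))) P :=
    fun i j => ((memLp_cyl_innerH_deriv (q := 2) hH hH' (U.F i) (hm j)).integrable_mul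
      (memLp_cyl_innerH_deriv (q := 2) hH hH' (U.F j) (hm i))).const_mul _
  rw [integral_finsetSum _ fun i _ => integrable_finsetSum _ fun j _ => i1 i j,
    integral_finsetSum _ fun i _ => integrable_finsetSum _ fun j _ => i2 i j,
    integral_finsetSum _ fun i _ => integrable_finsetSum _ fun j _ => i3 i j,
    ← Finset.sum_add_distrib]
  refine Finset.sum_congr rfl fun i _ => ?_
  rw [integral_finsetSum _ fun j _ => i1 i j, integral_finsetSum _ fun j _ => i2 i j,
    integral_finsetSum _ fun j _ => i3 i j, ← Finset.sum_add_distrib]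
  refine Finset.sum_congr rfl fun j _ => ?_
  rw [integral_const_mul, integral_const_mul, integral_const_mul, integral_const_mul,
    (U.F i).integral_div_mul_div hβ hH hH' (U.F j) (hZ i) (hZ j)]
  ring

/-- The second moment of the divergence of an elementary process. -/
theorem lintegral_div_sq_le (hβ : IsFBM H T P β) (hH : 1 / 2 < H) (hH' : H < 1)
    (U : Elem H T P β) {a b : ℝ} (ha : 0 ≤ a) (hb : b ≤ T) (hx : ∀ i, a ≤ U.a i)
    (hy : ∀ i, U.b i ≤ b) :
    ∫⁻ ω, ‖U.div ω‖ₑ ^ (2 : ℝ) ∂P ≤ ∫⁻ ω, absNorm H T (U.val ω) ^ (2 : ℝ) ∂P +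
      2 * ∫⁻ ω, (∫⁻ s in Ioc a b, ∫⁻ r in Ioc a b,
        (∫⁻ θ, ‖U.deriv ω θ s‖ₑ * ENNReal.ofReal (kernelH H θ r) ∂leb T) ^ (2 : ℝ)) ∂P := by
  have h2 := U.memLp_div hβ hH hH'
  have e : ∫⁻ ω, ‖U.div ω‖ₑ ^ (2 : ℝ) ∂P = ‖∫ ω, U.div ω * U.div ω ∂P‖ₑ := by
    have hnn : ∀ ω, 0 ≤ U.div ω * U.div ω := fun ω => mul_self_nonneg _
    have hi : Integrable (fun ω => U.div ω * U.div ω) P := h2.integrable_mul h2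
    rw [Real.enorm_of_nonneg (integral_nonneg hnn),
      ofReal_integral_eq_lintegral_ofReal hi (ae_of_all _ hnn)]
    refine lintegral_congr fun ω => ?_
    rw [ENNReal.rpow_two, sq, ← enorm_mul, Real.enorm_of_nonneg (hnn ω)]
  rw [e, U.integral_div_mul_div hβ hH hH']
  refine (enorm_add_le _ _).trans (add_le_add ?_ ?_)
  · refine (enorm_integral_le_lintegral_enorm _).trans (lintegral_mono fun ω => ?_)
    refine (enorm_innerH_le hH hH' (U.memH_val hH hH' ω).1 (U.memH_val hH hH' ω).1).trans ?_
    rw [ENNReal.rpow_two, sq]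
  · refine (enorm_integral_le_lintegral_enorm _).trans ?_
    rw [← lintegral_const_mul' _ _ (by simp)]
    refine lintegral_mono fun ω => ?_
    exact enorm_sum_innerH_mul_le hH hH' (fun i => (U.F i).memH_deriv hH hH' ω) U.c U.a U.b ha hb
      hx U.le hy

end Elem

end Elementary

section SubSigma

set_option linter.unusedSectionVars false

variable {Ω : Type*} [m0 : MeasurableSpace Ω] {P : Measure Ω} {H T : ℝ} {β : ℝ → Ω → ℝ}

/-- The σ-algebra generated by `(β_t)_{t ∈ [0,T]}`. -/
abbrev pathSigma (T : ℝ) (β : ℝ → Ω → ℝ) : MeasurableSpace Ω :=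
  ⨆ t : Icc (0 : ℝ) T, MeasurableSpace.comap (β t) inferInstance

/-- The path `(β_t)_{t ∈ [0,T]}`. -/
def path (T : ℝ) (β : ℝ → Ω → ℝ) (ω : Ω) (t : Icc (0 : ℝ) T) : ℝ := β t ω

theorem pathSigma_eq_comap : pathSigma T β = MeasurableSpace.comap (path T β) inferInstance := by
  unfold pathSigma
  rw [MeasurableSpace.pi, MeasurableSpace.comap_iSup]
  refine iSup_congr fun t => ?_
  rw [MeasurableSpace.comap_comp]
  rfl

theorem IsFBM.pathSigma_le (hβ : IsFBM H T P β) : pathSigma T β ≤ m0 :=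
  iSup_le fun t => (hβ.measurable t t.2).comap_le

theorem measurable_path {t : ℝ} (ht : t ∈ Icc 0 T) : Measurable[pathSigma T β] (β t) :=
  (comap_measurable (β t)).mono (le_iSup (fun t : Icc (0 : ℝ) T =>
    MeasurableSpace.comap (β t) inferInstance) ⟨t, ht⟩) le_rfl

theorem aestronglyMeasurable_of_tendsto_eLpNorm {m : MeasurableSpace Ω} {f : ℕ → Ω → ℝ}
    {g : Ω → ℝ} (hm : m ≤ m0) (hf : ∀ j, AEStronglyMeasurable[m] (f j) P)
    (hf2 : ∀ j, MemLp (f j) 2 P) (hg : MemLp g 2 P)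
    (h : Tendsto (fun j => eLpNorm (f j - g) 2 P) atTop (𝓝 0)) :
    AEStronglyMeasurable[m] g P := by
  have : Fact ((1 : ℝ≥0∞) ≤ 2) := ⟨by norm_num⟩
  have hc := isClosed_aestronglyMeasurable (F := ℝ) (p := 2) (μ := P) hm
  have ht : Tendsto (fun j => (hf2 j).toLp (f j)) atTop (𝓝 (hg.toLp g)) :=
    (Lp.tendsto_Lp_iff_tendsto_eLpNorm'' f hf2 g hg).2 h
  have h1 := hc.mem_of_tendsto ht (.of_forall fun j => (hf j).congr (hf2 j).coeFn_toLp.symm)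
  exact AEStronglyMeasurable.congr h1 hg.coeFn_toLp

theorem aestronglyMeasurable_finsetSum {m : MeasurableSpace Ω} {ι : Type*} (s : Finset ι)
    {f : ι → Ω → ℝ} (hf : ∀ i ∈ s, AEStronglyMeasurable[m] (f i) P) :
    AEStronglyMeasurable[m] (fun ω => ∑ i ∈ s, f i ω) P := by
  classical
  induction s using Finset.induction_on with
  | empty => exact aestronglyMeasurable_const
  | insert i s hi ih =>
    simp_rw [Finset.sum_insert hi]
    exact AEStronglyMeasurable.add (hf i (Finset.mem_insert_self i s))
      (ih fun j hj => hf j (Finset.mem_insert_of_mem hj))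

variable [IsProbabilityMeasure P]

theorem IsWienerIntegral.aestronglyMeasurable (hβ : IsFBM H T P β) {φ : ℝ → ℝ} {X : Ω → ℝ}
    (h : IsWienerIntegral H T P β φ X) : AEStronglyMeasurable[pathSigma T β] X P := by
  obtain ⟨π, c, -, h2⟩ := h.exists_step
  refine aestronglyMeasurable_of_tendsto_eLpNorm hβ.pathSigma_le (fun j => ?_)
    (fun j => hβ.memLp_stepInt _ _) h.2.2.1 h2
  refine ⟨_, Measurable.stronglyMeasurable ?_, ae_eq_rfl⟩
  refine Finset.measurable_fun_sum _ fun i _ => ?_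
  exact ((measurable_path ((π j).mem _)).sub (measurable_path ((π j).mem _))).const_mul _

theorem Cyl.aestronglyMeasurable_comp (hβ : IsFBM H T P β) (F : Cyl H T P β)
    {f : (Fin F.n → ℝ) → ℝ} (hf : Continuous f) :
    AEStronglyMeasurable[pathSigma T β] (fun ω => f fun i => F.X i ω) P := by
  choose Y hY hXY using fun i => (F.wiener i).aestronglyMeasurable hβ
  refine ⟨fun ω => f fun i => Y i ω, ?_, ?_⟩
  · have : Measurable[pathSigma T β] fun ω i => Y i ω :=
      @measurable_pi_lambda _ _ _ (pathSigma T β) _ _ fun i => (hY i).measurable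
    exact (hf.measurable.comp this).stronglyMeasurable
  · filter_upwards [ae_all_iff.2 hXY] with ω hω
    simp [hω]

theorem Elem.aestronglyMeasurable_div (hβ : IsFBM H T P β) (hH : 1 / 2 < H) (hH' : H < 1)
    (U : Elem H T P β) : AEStronglyMeasurable[pathSigma T β] U.div P := by
  suffices h : ∀ i, AEStronglyMeasurable[pathSigma T β] ((U.F i).div (U.ind i) (U.inc i)) P from
    aestronglyMeasurable_finsetSum _ fun i _ => (h i).const_mul (U.c i)
  intro i
  have h1 := (U.isWienerIntegral hβ hH hH' i).aestronglyMeasurable hβ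
  have h2 := (U.F i).aestronglyMeasurable_comp hβ (U.F i).smooth.continuous
  have h3 : AEStronglyMeasurable[pathSigma T β]
      (fun ω => innerH H T ((U.F i).deriv ω) (U.ind i)) P := by
    simp_rw [(U.F i).innerH_deriv hH hH' (U.memH_ind hH hH' i)]
    exact (U.F i).aestronglyMeasurable_comp hβ ((U.F i).continuous_fderiv _)
  exact (h1.mul h2).sub h3

end SubSigma

section Uniqueness

set_option linter.unusedSectionVars false

variable {Ω : Type*} [m0 : MeasurableSpace Ω] {P : Measure Ω} [IsProbabilityMeasure P]
  {H T : ℝ} {β : ℝ → Ω → ℝ}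

theorem norm_iteratedFDeriv_comp_clm_le {E : Type*} [NormedAddCommGroup E] [NormedSpace ℝ E]
    {f : ℝ → ℝ} (hf : ContDiff ℝ (⊤ : ℕ∞) f) (hb : ∀ k x, |iteratedDeriv k f x| ≤ 1)
    (L : E →L[ℝ] ℝ) (k : ℕ) (x : E) : ‖iteratedFDeriv ℝ k (f ∘ L) x‖ ≤ ‖L‖ ^ k := by
  rw [L.iteratedFDeriv_comp_right hf x (i := k) (by exact_mod_cast le_top)]
  refine (ContinuousMultilinearMap.norm_compContinuousLinearMap_le _ _).trans ?_
  rw [norm_iteratedFDeriv_eq_norm_iteratedDeriv, Finset.prod_const, Finset.card_univ,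
    Fintype.card_fin]
  exact mul_le_of_le_one_left (by positivity) (hb k _)

theorem IsFBM.ae_zero (hβ : IsFBM H T P β) (hH : 1 / 2 < H) (hT : 0 ≤ T) : β 0 =ᵐ[P] 0 := by
  have h0 : (0 : ℝ) ∈ Icc 0 T := ⟨le_rfl, hT⟩
  have h1 := hβ.covariance 0 h0 0 h0
  have h2 : (0 : ℝ) ^ (2 * H) = 0 := Real.zero_rpow (by linarith)
  simp only [sub_self, abs_zero, h2, add_zero, zero_div] at h1
  have h3 : Integrable (fun ω => β 0 ω * β 0 ω) P := (hβ.memLp h0).integrable_mul (hβ.memLp h0)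
  have h4 := (integral_eq_zero_iff_of_nonneg (fun ω => mul_self_nonneg _) h3).1 h1
  filter_upwards [h4] with ω hω
  simpa using hω

/-- The cylindrical random variable `f(∑_i ξ_i β_{t_i})`. -/
def IsFBM.cylOfClm (hβ : IsFBM H T P β) (hH : 1 / 2 < H) (hH' : H < 1) {f : ℝ → ℝ}
    (hf : ContDiff ℝ (⊤ : ℕ∞) f) (hb : ∀ k x, |iteratedDeriv k f x| ≤ 1) {n : ℕ}
    (t : Fin n → Icc (0 : ℝ) T) (L : (Fin n → ℝ) →L[ℝ] ℝ) : Cyl H T P β where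
  n := n
  f := f ∘ L
  smooth := hf.comp L.contDiff
  bounded k := ⟨‖L‖ ^ k, norm_iteratedFDeriv_comp_clm_le hf hb L k⟩
  φ i := (Ioc 0 (t i : ℝ)).indicator fun _ => 1
  X i ω := β (t i) ω - β 0 ω
  wiener i := hβ.isWienerIntegral_inc hH hH' le_rfl (t i).2.1 (t i).2.2

theorem integral_withDensity_ofReal {D : Ω → ℝ} (hD : AEMeasurable D P) (g : Ω → ℝ) :
    ∫ ω, g ω ∂P.withDensity (fun ω => ENNReal.ofReal (D ω)) = ∫ ω, g ω * max (D ω) 0 ∂P := by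
  rw [integral_withDensity_eq_integral_toReal_smul₀ hD.ennreal_ofReal
    (ae_of_all _ fun _ => ENNReal.ofReal_lt_top)]
  refine integral_congr_ae (ae_of_all _ fun ω => ?_)
  simp only [ENNReal.toReal_ofReal', smul_eq_mul, mul_comm]

/-- A random variable that is measurable for the path and orthogonal to all smooth cylindrical
random variables vanishes. -/
theorem ae_eq_zero_of_integral_cyl (hβ : IsFBM H T P β) (hH : 1 / 2 < H) (hH' : H < 1)
    (hT : 0 ≤ T) {D : Ω → ℝ} (hD : Integrable D P)
    (hm : AEStronglyMeasurable[pathSigma T β] D P)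
    (h : ∀ F : Cyl H T P β, ∫ ω, F.val ω * D ω ∂P = 0) : D =ᵐ[P] 0 := by
  have hle := hβ.pathSigma_le
  have hΦ : Measurable (path T β) := measurable_pi_lambda _ fun t => hβ.measurable t t.2
  set μ : Measure Ω := P.withDensity fun ω => ENNReal.ofReal (D ω) with hμ
  set ν : Measure Ω := P.withDensity fun ω => ENNReal.ofReal (-D ω) with hν
  have hμf : IsFiniteMeasure μ := isFiniteMeasure_withDensity_ofReal hD.2
  have hνf : IsFiniteMeasure ν := isFiniteMeasure_withDensity_ofReal hD.neg.2
  have key : ∀ g : Ω → ℝ, Measurable g → (∀ ω, |g ω| ≤ 1) → (∫ ω, g ω * D ω ∂P = 0) →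
      ∫ ω, g ω ∂μ = ∫ ω, g ω ∂ν := by
    intro g hg hb h0
    rw [hμ, hν, integral_withDensity_ofReal hD.aemeasurable,
      integral_withDensity_ofReal hD.aemeasurable.fun_neg, ← sub_eq_zero]
    have i1 : Integrable (fun ω => g ω * max (D ω) 0) P :=
      hD.pos_part.bdd_mul hg.aestronglyMeasurable (ae_of_all _ hb)
    have i2 : Integrable (fun ω => g ω * max (-D ω) 0) P :=
      hD.neg_part.bdd_mul hg.aestronglyMeasurable (ae_of_all _ hb)
    rw [← integral_sub i1 i2]
    refine Eq.trans ?_ h0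
    refine integral_congr_ae (ae_of_all _ fun ω => ?_)
    simp only
    rw [← mul_sub]
    congr 1
    rcases le_total (D ω) 0 with h | h
    · rw [max_eq_right h, max_eq_left (by linarith)]; ring
    · rw [max_eq_left h, max_eq_right (by linarith)]; ring
  have hmap : ∀ I : Finset (Icc (0 : ℝ) T),
      (μ.map (path T β)).map I.restrict = (ν.map (path T β)).map I.restrict := by
    intro I
    have : IsFiniteMeasure (μ.map (path T β)) := Measure.isFiniteMeasure_map _ _
    have : IsFiniteMeasure (ν.map (path T β)) := Measure.isFiniteMeasure_map _ _
    have : IsFiniteMeasure ((μ.map (path T β)).map I.restrict) := Measure.isFiniteMeasure_map _ _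
    have : IsFiniteMeasure ((ν.map (path T β)).map I.restrict) := Measure.isFiniteMeasure_map _ _
    have hIm : Measurable (I.restrict (π := fun _ : Icc (0 : ℝ) T => ℝ)) :=
      Finset.measurable_restrict I
    refine Measure.ext_of_charFunDual (funext fun L => ?_)
    have hcy : ∀ f : ℝ → ℝ, ContDiff ℝ (⊤ : ℕ∞) f → (∀ k x, |iteratedDeriv k f x| ≤ 1) →
        ∫ ω, f (L (I.restrict (path T β ω))) ∂μ = ∫ ω, f (L (I.restrict (path T β ω))) ∂ν := by
      intro f hf hb
      refine key _ (hf.continuous.measurable.comp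
        (L.continuous.measurable.comp (hIm.comp hΦ))) (fun ω => by simpa using hb 0 _) ?_
      set e := I.equivFin
      set F := hβ.cylOfClm hH hH' hf hb (fun i => (e.symm i : Icc (0 : ℝ) T))
        (L.comp (ContinuousLinearMap.pi fun i : I =>
          ContinuousLinearMap.proj (R := ℝ) (φ := fun _ : Fin I.card => ℝ) (e i)))
      refine Eq.trans ?_ (h F)
      refine integral_congr_ae ?_
      filter_upwards [hβ.ae_zero hH hT] with ω hω
      have hr : F.val ω = f (L (I.restrict (path T β ω))) := by
        refine congrArg (fun y => f (L y)) (funext fun i => ?_)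
        change β (e.symm (e i) : Icc (0 : ℝ) T) ω - β 0 ω = β (i : Icc (0 : ℝ) T) ω
        rw [e.symm_apply_apply, hω, Pi.zero_apply, sub_zero]
      rw [hr]
    have hexp : ∀ ρ : Measure Ω, IsFiniteMeasure ρ →
        charFunDual ((ρ.map (path T β)).map I.restrict) L =
          ((∫ ω, Real.cos (L (I.restrict (path T β ω))) ∂ρ : ℝ) : ℂ) +
          ((∫ ω, Real.sin (L (I.restrict (path T β ω))) ∂ρ : ℝ) : ℂ) * Complex.I := by
      intro ρ _
      have hLm : Measurable fun ω => L (I.restrict (path T β ω)) :=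
        L.continuous.measurable.comp (hIm.comp hΦ)
      have hLc : Continuous fun v : I → ℝ => Complex.exp ((L v : ℂ) * Complex.I) := by fun_prop
      rw [charFunDual_apply, integral_map hIm.aemeasurable hLc.aestronglyMeasurable,
        integral_map (f := fun x => Complex.exp ((L (I.restrict x) : ℂ) * Complex.I)) hΦ.aemeasurable
          (hLc.measurable.comp hIm).aestronglyMeasurable]
      have j1 : Integrable (fun ω => ((Real.cos (L (I.restrict (path T β ω))) : ℝ) : ℂ)) ρ :=
        (Integrable.of_bound (Real.measurable_cos.comp hLm).aestronglyMeasurable 1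
          (ae_of_all _ fun ω => Real.abs_cos_le_one _)).ofReal
      have j2 : Integrable (fun ω => ((Real.sin (L (I.restrict (path T β ω))) : ℝ) : ℂ)) ρ :=
        (Integrable.of_bound (Real.measurable_sin.comp hLm).aestronglyMeasurable 1
          (ae_of_all _ fun ω => Real.abs_sin_le_one _)).ofReal
      rw [← integral_complex_ofReal, ← integral_complex_ofReal, ← integral_mul_const,
        ← integral_add j1 (j2.mul_const _)]
      refine integral_congr_ae (ae_of_all _ fun ω => ?_)
      simp only [Complex.exp_mul_I, Complex.ofReal_cos, Complex.ofReal_sin]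
    rw [hexp μ hμf, hexp ν hνf, hcy _ Real.contDiff_cos Real.abs_iteratedDeriv_cos_le_one,
      hcy _ Real.contDiff_sin Real.abs_iteratedDeriv_sin_le_one]
  have hfin : ∀ I : Finset (Icc (0 : ℝ) T),
      IsFiniteMeasure ((μ.map (path T β)).map (I.restrict (π := fun _ => ℝ))) := fun I =>
    inferInstance
  have hμν : μ.map (path T β) = ν.map (path T β) :=
    IsProjectiveLimit.unique (P := fun I : Finset (Icc (0 : ℝ) T) =>
      (μ.map (path T β)).map (I.restrict (π := fun _ => ℝ))) (fun _ => rfl)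
      fun I => (hmap I).symm
  have hs : ∀ s, MeasurableSet[pathSigma T β] s → ∫ ω in s, D ω ∂P = 0 := by
    intro s hs
    rw [pathSigma_eq_comap] at hs
    obtain ⟨B, hB, rfl⟩ := hs
    have h1 := congrArg (fun ρ => ρ B) hμν
    simp only [Measure.map_apply hΦ hB] at h1
    rw [hμ, hν, withDensity_apply _ (hΦ hB), withDensity_apply _ (hΦ hB)] at h1
    rw [integral_eq_lintegral_pos_part_sub_lintegral_neg_part hD.integrableOn, h1, sub_self]
  refine ae_eq_of_forall_setIntegral_eq_of_sigmaFinite' hle (fun s _ _ => hD.integrableOn)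
    (fun s _ _ => (integrable_zero Ω ℝ P).integrableOn) (fun s h1 _ => ?_) hm
    aestronglyMeasurable_zero
  rw [hs s h1]
  simp

theorem IsSkorohodIntegral.ae_eq (hβ : IsFBM H T P β) (hH : 1 / 2 < H) (hH' : H < 1) (hT : 0 ≤ T)
    {U : Ω → ℝ → ℝ} {X X' : Ω → ℝ} (h : IsSkorohodIntegral H T P β U X)
    (h' : IsSkorohodIntegral H T P β U X') : X =ᵐ[P] X' := by
  have h1 := h.2.2.1
  have h2 := h'.2.2.1
  have key : X - X' =ᵐ[P] 0 := by
    refine ae_eq_zero_of_integral_cyl hβ hH hH' hT ((h1.sub h2).integrable (by norm_num))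
      (h.2.2.2.1.sub h'.2.2.2.1) fun F => ?_
    have i1 : Integrable (fun ω => F.val ω * X ω) P :=
      (Elem.memLp_cyl_val (q := 2) F).integrable_mul h1
    have i2 : Integrable (fun ω => F.val ω * X' ω) P :=
      (Elem.memLp_cyl_val (q := 2) F).integrable_mul h2
    have := integral_sub i1 i2
    rw [h.2.2.2.2 F, h'.2.2.2.2 F, sub_self] at this
    rw [← this]
    refine integral_congr_ae (ae_of_all _ fun ω => ?_)
    simp only [Pi.sub_apply, mul_sub]
  filter_upwards [key] with ω hω
  simpa [sub_eq_zero] using hω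

theorem IsSkorohodIntegral.integral_eq_zero {U : Ω → ℝ → ℝ} {X : Ω → ℝ}
    (h : IsSkorohodIntegral H T P β U X) : ∫ ω, X ω ∂P = 0 := by
  have h1 := h.2.2.2.2 ⟨0, fun _ => 1, contDiff_const,
    fun k => ⟨‖iteratedFDeriv ℝ k (fun _ : Fin 0 → ℝ => (1 : ℝ)) 0‖, fun x => by
      rw [Subsingleton.elim x 0]⟩, fun i => i.elim0, fun i => i.elim0, fun i => i.elim0⟩
  simpa [Cyl.val, Cyl.deriv, innerH] using h1

theorem IsSkorohodIntegral.integral_mul_eq_zero {β : ℕ → ℝ → Ω → ℝ}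
    (hβ : ∀ k, IsFBM H T P (β k)) (hind : iIndepFun (fun k ω (t : Icc (0 : ℝ) T) => β k t ω) P)
    {k l : ℕ} (hkl : k ≠ l) {U U' : Ω → ℝ → ℝ} {X X' : Ω → ℝ}
    (h : IsSkorohodIntegral H T P (β k) U X) (h' : IsSkorohodIntegral H T P (β l) U' X') :
    ∫ ω, X ω * X' ω ∂P = 0 := by
  have hi : Indep (pathSigma T (β k)) (pathSigma T (β l)) P := by
    rw [pathSigma_eq_comap, pathSigma_eq_comap]
    exact (IndepFun_iff_Indep _ _ _).1 (hind.indepFun hkl)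
  obtain ⟨Y, hY, hXY⟩ := h.2.2.2.1
  obtain ⟨Y', hY', hXY'⟩ := h'.2.2.2.1
  have hYi : IndepFun Y Y' P := (IndepFun_iff_Indep _ _ _).2
    (indep_of_indep_of_le_left (indep_of_indep_of_le_right hi hY'.measurable.comap_le)
      hY.measurable.comap_le)
  have e : ∫ ω, X ω * X' ω ∂P = ∫ ω, (Y * Y') ω ∂P := by
    refine integral_congr_ae ?_
    filter_upwards [hXY, hXY'] with ω h1 h2
    rw [h1, h2, Pi.mul_apply]
  rw [e, hYi.integral_mul_eq_mul_integral (hY.mono (hβ k).pathSigma_le).aestronglyMeasurable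
    (hY'.mono (hβ l).pathSigma_le).aestronglyMeasurable, ← integral_congr_ae hXY,
    h.integral_eq_zero, zero_mul]

end Uniqueness

section Closure

set_option linter.unusedSectionVars false

variable {Ω : Type*} [m0 : MeasurableSpace Ω] {P : Measure Ω} [IsProbabilityMeasure P]
  {H T : ℝ} {β : ℝ → Ω → ℝ}

theorem aestronglyMeasurable_comp_fst_fst {V : Type*} [TopologicalSpace V] {U : Ω → ℝ → V}
    (hU : AEStronglyMeasurable (fun z : Ω × ℝ => U z.1 z.2) (P.prod (leb T))) :
    AEStronglyMeasurable (fun z : (Ω × ℝ) × ℝ => U z.1.1 z.1.2) ((P.prod (leb T)).prod (leb T)) :=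
  hU.comp_fst

theorem aestronglyMeasurable_comp_fst_snd {V : Type*} [TopologicalSpace V] {U : Ω → ℝ → V}
    (hU : AEStronglyMeasurable (fun z : Ω × ℝ => U z.1 z.2) (P.prod (leb T))) :
    AEStronglyMeasurable (fun z : (Ω × ℝ) × ℝ => U z.1.1 z.2) ((P.prod (leb T)).prod (leb T)) := by
  have h : Measure.QuasiMeasurePreserving (fun z : (Ω × ℝ) × ℝ => (z.1.1, z.2))
      ((P.prod (leb T)).prod (leb T)) (P.prod (leb T)) :=
    QuasiMeasurePreserving.prodMap Measure.quasiMeasurePreserving_fst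
      (Measure.QuasiMeasurePreserving.id (leb T))
  exact hU.comp_quasiMeasurePreserving h

theorem aemeasurable_absNorm {V : Type*} [NormedAddCommGroup V] {U : Ω → ℝ → V}
    (hU : AEStronglyMeasurable (fun z : Ω × ℝ => U z.1 z.2) (P.prod (leb T))) :
    AEMeasurable (fun ω => absNorm H T (U ω)) P := by
  have h1 : AEMeasurable (fun z : (Ω × ℝ) × ℝ => ‖U z.1.1 z.1.2‖ₑ * ‖U z.1.1 z.2‖ₑ *
      ENNReal.ofReal (kernelH H z.1.2 z.2)) ((P.prod (leb T)).prod (leb T)) := by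
    refine ((aestronglyMeasurable_comp_fst_fst hU).enorm.mul
      (aestronglyMeasurable_comp_fst_snd hU).enorm).mul ?_
    unfold kernelH
    fun_prop
  have h2 := AEMeasurable.lintegral_prod_right' (ν := leb T) h1
  exact (AEMeasurable.lintegral_prod_right' (ν := leb T) h2).pow_const _

theorem aestronglyMeasurable_innerH {U V : Ω → ℝ → ℝ}
    (hU : AEStronglyMeasurable (fun z : Ω × ℝ => U z.1 z.2) (P.prod (leb T)))
    (hV : AEStronglyMeasurable (fun z : Ω × ℝ => V z.1 z.2) (P.prod (leb T))) :
    AEStronglyMeasurable (fun ω => innerH H T (U ω) (V ω)) P := by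
  have h1 : AEStronglyMeasurable (fun z : (Ω × ℝ) × ℝ => U z.1.1 z.1.2 * V z.1.1 z.2 *
      kernelH H z.1.2 z.2) ((P.prod (leb T)).prod (leb T)) := by
    refine ((aestronglyMeasurable_comp_fst_fst hU).mul
      (aestronglyMeasurable_comp_fst_snd hV)).mul ?_
    unfold kernelH
    exact Measurable.aestronglyMeasurable (by fun_prop)
  have h2 := AEStronglyMeasurable.integral_prod_right' (ν := leb T) h1
  exact AEStronglyMeasurable.integral_prod_right' (ν := leb T) h2

theorem ae_memH {U : Ω → ℝ → ℝ}
    (hU : AEStronglyMeasurable (fun z : Ω × ℝ => U z.1 z.2) (P.prod (leb T)))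
    (hU2 : ∫⁻ ω, absNorm H T (U ω) ^ (2 : ℝ) ∂P ≠ ∞) : ∀ᵐ ω ∂P, MemH H T (U ω) := by
  filter_upwards [hU.prodMk_left,
    ae_lt_top' ((aemeasurable_absNorm (H := H) hU).pow_const (2 : ℝ)) hU2] with ω h1 h2
  exact ⟨h1, by_contra fun h => by simp [not_lt_top_iff.1 h] at h2⟩

theorem lintegral_absNorm_add_sq_le (hH : 1 / 2 < H) (hH' : H < 1) {V : Type*}
    [NormedAddCommGroup V] {U U' : Ω → ℝ → V}
    (hU : AEStronglyMeasurable (fun z : Ω × ℝ => U z.1 z.2) (P.prod (leb T)))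
    (hU' : AEStronglyMeasurable (fun z : Ω × ℝ => U' z.1 z.2) (P.prod (leb T))) :
    ∫⁻ ω, absNorm H T (fun s => U ω s + U' ω s) ^ (2 : ℝ) ∂P ≤
      2 * ∫⁻ ω, absNorm H T (U ω) ^ (2 : ℝ) ∂P + 2 * ∫⁻ ω, absNorm H T (U' ω) ^ (2 : ℝ) ∂P := by
  rw [← lintegral_const_mul' _ _ (by simp), ← lintegral_const_mul' _ _ (by simp),
    ← lintegral_add_left' (((aemeasurable_absNorm hU).pow_const _).const_mul _)]
  refine lintegral_mono_ae ?_
  filter_upwards [hU.prodMk_left, hU'.prodMk_left] with ω h1 h2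
  refine (ENNReal.rpow_le_rpow (absNorm_add_le hH hH' h1 h2) (by norm_num)).trans ?_
  have := ENNReal.rpow_add_le_mul_rpow_add_rpow (absNorm H T (U ω)) (absNorm H T (U' ω))
    (p := 2) (by norm_num)
  refine this.trans (le_of_eq ?_)
  norm_num [mul_add]

theorem integrable_innerH_cyl (hH : 1 / 2 < H) (hH' : H < 1) {U : Ω → ℝ → ℝ}
    (hU : AEStronglyMeasurable (fun z : Ω × ℝ => U z.1 z.2) (P.prod (leb T)))
    (hU2 : ∫⁻ ω, absNorm H T (U ω) ^ (2 : ℝ) ∂P ≠ ∞) (F : Cyl H T P β) :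
    Integrable (fun ω => innerH H T (F.deriv ω) (U ω)) P := by
  refine ⟨aestronglyMeasurable_innerH F.aestronglyMeasurable_deriv hU, ?_⟩
  obtain ⟨C, hC, hF⟩ := F.exists_absNorm_deriv_le hH hH'
  have : ∫⁻ ω, ‖innerH H T (F.deriv ω) (U ω)‖ₑ ∂P ≤
      C * (1 + ∫⁻ ω, absNorm H T (U ω) ^ (2 : ℝ) ∂P) := by
    have e : (1 : ℝ≥0∞) + ∫⁻ ω, absNorm H T (U ω) ^ (2 : ℝ) ∂P =
        ∫⁻ ω, (1 + absNorm H T (U ω) ^ (2 : ℝ)) ∂P := by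
      rw [lintegral_add_left measurable_const]
      simp
    rw [e, ← lintegral_const_mul' _ _ hC]
    refine lintegral_mono_ae ?_
    filter_upwards [hU.prodMk_left] with ω h1
    refine (enorm_innerH_le hH hH' (F.memH_deriv hH hH' ω).1 h1).trans (mul_le_mul' (hF ω) ?_)
    rcases le_total (absNorm H T (U ω)) 1 with h | h
    · exact h.trans le_self_add
    · refine le_add_left ?_
      rw [ENNReal.rpow_two, sq]
      exact le_mul_of_one_le_left' h
  exact this.trans_lt (ENNReal.mul_lt_top hC.lt_top
    (ENNReal.add_lt_top.2 ⟨ENNReal.one_lt_top, hU2.lt_top⟩))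

/-- The Skorohod integral is a closed operator. -/
theorem IsSkorohodIntegral.of_tendsto (hβ : IsFBM H T P β) (hH : 1 / 2 < H) (hH' : H < 1)
    {U : ℕ → Ω → ℝ → ℝ} {X : ℕ → Ω → ℝ} {V : Ω → ℝ → ℝ} {Y : Ω → ℝ}
    (h : ∀ j, IsSkorohodIntegral H T P β (U j) (X j))
    (hV : AEStronglyMeasurable (fun z : Ω × ℝ => V z.1 z.2) (P.prod (leb T)))
    (hV2 : ∫⁻ ω, absNorm H T (V ω) ^ (2 : ℝ) ∂P < ∞) (hY : MemLp Y 2 P)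
    (h1 : Tendsto (fun j => ∫⁻ ω, absNorm H T (fun s => U j ω s - V ω s) ^ (2 : ℝ) ∂P) atTop (𝓝 0))
    (h2 : Tendsto (fun j => eLpNorm (X j - Y) 2 P) atTop (𝓝 0)) :
    IsSkorohodIntegral H T P β V Y := by
  refine ⟨hV, hV2, hY, aestronglyMeasurable_of_tendsto_eLpNorm hβ.pathSigma_le
    (fun j => (h j).2.2.2.1) (fun j => (h j).2.2.1) hY h2, fun F => ?_⟩
  have t1 := tendsto_integral_mul_of_eLpNorm (F := fun _ : ℕ => F.val)
    (Elem.memLp_cyl_val (q := 2) F) hY (fun _ => Elem.memLp_cyl_val (q := 2) F)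
    (fun j => (h j).2.2.1) (by simp) h2
  simp_rw [(h _).2.2.2.2 F] at t1
  refine tendsto_nhds_unique t1 ?_
  obtain ⟨C, hC, hF⟩ := F.exists_absNorm_deriv_le hH hH'
  have i1 := fun j => integrable_innerH_cyl hH hH' (h j).1 (h j).2.1.ne F
  have i2 := integrable_innerH_cyl hH hH' hV hV2.ne F
  refine tendsto_integral_of_L1 _ i2.1 (.of_forall i1) ?_
  have hb : ∀ j, ∫⁻ ω, ‖innerH H T (F.deriv ω) (U j ω) - innerH H T (F.deriv ω) (V ω)‖ₑ ∂P ≤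
      C * (∫⁻ ω, absNorm H T (fun s => U j ω s - V ω s) ^ (2 : ℝ) ∂P) ^ (1 / 2 : ℝ) := by
    intro j
    have hm : AEMeasurable (fun ω => absNorm H T (fun s => U j ω s - V ω s)) P :=
      aemeasurable_absNorm ((h j).1.sub hV)
    have hcs := ENNReal.lintegral_mul_le_Lp_mul_Lq P (p := 2) (q := 2)
      Real.HolderConjugate.two_two hm (aemeasurable_const (b := (1 : ℝ≥0∞)))
    simp only [Pi.mul_apply, mul_one, ENNReal.one_rpow, lintegral_one, measure_univ] at hcs
    refine le_trans ?_ (mul_le_mul_right hcs C)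
    rw [← lintegral_const_mul' _ _ hC]
    refine lintegral_mono_ae ?_
    filter_upwards [ae_memH (h j).1 (h j).2.1.ne, ae_memH hV hV2.ne] with ω m1 m2
    rw [← innerH_sub_right hH hH' m1 m2 (F.memH_deriv hH hH' ω)]
    exact (enorm_innerH_le hH hH' (F.memH_deriv hH hH' ω).1 (m1.sub hH hH' m2).1).trans
      (mul_le_mul_left (hF ω) _)
  refine tendsto_of_tendsto_of_tendsto_of_le_of_le tendsto_const_nhds ?_ (fun _ => zero_le) hb
  have h3 := (ENNReal.continuous_rpow_const (y := (1 / 2 : ℝ))).continuousAt.tendsto.comp h1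
  have h4 := ENNReal.Tendsto.const_mul (a := C) h3 (Or.inr hC)
  simpa using h4

theorem IsSkorohodIntegral.add (hH : 1 / 2 < H) (hH' : H < 1) {U U' : Ω → ℝ → ℝ} {X X' : Ω → ℝ}
    (h : IsSkorohodIntegral H T P β U X) (h' : IsSkorohodIntegral H T P β U' X') :
    IsSkorohodIntegral H T P β (fun ω s => U ω s + U' ω s) fun ω => X ω + X' ω := by
  refine ⟨h.1.add h'.1, (lintegral_absNorm_add_sq_le hH hH' h.1 h'.1).trans_lt
    (ENNReal.add_lt_top.2 ⟨ENNReal.mul_lt_top (by simp) h.2.1,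
      ENNReal.mul_lt_top (by simp) h'.2.1⟩), h.2.2.1.add h'.2.2.1, h.2.2.2.1.add h'.2.2.2.1,
    fun F => ?_⟩
  have i1 : Integrable (fun ω => F.val ω * X ω) P :=
    (Elem.memLp_cyl_val (q := 2) F).integrable_mul h.2.2.1
  have i2 : Integrable (fun ω => F.val ω * X' ω) P :=
    (Elem.memLp_cyl_val (q := 2) F).integrable_mul h'.2.2.1
  simp_rw [mul_add]
  rw [integral_add i1 i2, h.2.2.2.2 F, h'.2.2.2.2 F,
    ← integral_add (integrable_innerH_cyl hH hH' h.1 h.2.1.ne F)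
      (integrable_innerH_cyl hH hH' h'.1 h'.2.1.ne F)]
  refine integral_congr_ae ?_
  filter_upwards [ae_memH h.1 h.2.1.ne, ae_memH h'.1 h'.2.1.ne] with ω m1 m2
  have e := innerH_sub_right hH hH' (m1.add hH hH' m2) m2 (F.memH_deriv hH hH' ω)
  simp only [add_sub_cancel_right] at e
  linarith

theorem IsSkorohodIntegral.const_mul {U : Ω → ℝ → ℝ} {X : Ω → ℝ} (c : ℝ)
    (h : IsSkorohodIntegral H T P β U X) :
    IsSkorohodIntegral H T P β (fun ω s => c * U ω s) fun ω => c * X ω := by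
  refine ⟨h.1.const_mul c, ?_, h.2.2.1.const_mul c, h.2.2.2.1.const_mul c, fun F => ?_⟩
  · have : ∫⁻ ω, absNorm H T (fun s => c * U ω s) ^ (2 : ℝ) ∂P ≤
        ‖c‖ₑ ^ (2 : ℝ) * ∫⁻ ω, absNorm H T (U ω) ^ (2 : ℝ) ∂P := by
      rw [← lintegral_const_mul' _ _ (by simp)]
      refine lintegral_mono fun ω => ?_
      rw [← ENNReal.mul_rpow_of_nonneg _ _ (by norm_num)]
      exact ENNReal.rpow_le_rpow (absNorm_le_const_mul enorm_ne_top fun s => by rw [enorm_mul])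
        (by norm_num)
    exact this.trans_lt (ENNReal.mul_lt_top (by simp) h.2.1)
  · have e : ∀ ω, innerH H T (F.deriv ω) (fun s => c * U ω s) =
        c * innerH H T (F.deriv ω) (U ω) := fun ω => by
      simp only [innerH, ← integral_const_mul]
      refine integral_congr_ae (ae_of_all _ fun t => integral_congr_ae (ae_of_all _ fun s => ?_))
      simp only
      ring
    simp_rw [e, mul_left_comm _ c]
    rw [integral_const_mul, integral_const_mul, h.2.2.2.2 F]

theorem IsSkorohodIntegral.sub (hH : 1 / 2 < H) (hH' : H < 1) {U U' : Ω → ℝ → ℝ} {X X' : Ω → ℝ}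
    (h : IsSkorohodIntegral H T P β U X) (h' : IsSkorohodIntegral H T P β U' X') :
    IsSkorohodIntegral H T P β (fun ω s => U ω s - U' ω s) fun ω => X ω - X' ω := by
  have := h.add hH hH' (h'.const_mul (-1))
  simpa only [neg_mul, one_mul, ← sub_eq_add_neg] using this

theorem Elem.aestronglyMeasurable_val (U : Elem H T P β) :
    AEStronglyMeasurable (fun z : Ω × ℝ => U.val z.1 z.2) (P.prod (leb T)) := by
  refine Finset.aestronglyMeasurable_fun_sum _ fun i _ => ?_
  exact ((U.F i).aestronglyMeasurable_val.comp_fst.const_mul _).mul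
    (measurable_const.indicator measurableSet_Ioc).aestronglyMeasurable.comp_snd

theorem Elem.exists_absNorm_val_le (hH : 1 / 2 < H) (hH' : H < 1) (U : Elem H T P β) :
    ∃ C : ℝ≥0∞, C ≠ ∞ ∧ ∀ ω, absNorm H T (U.val ω) ≤ C := by
  choose B hB using fun i => (U.F i).exists_val_le
  set ψ : ℝ → ℝ := fun s => ∑ i, |U.c i| * B i * U.ind i s
  have hψ : MemH H T ψ := MemH.sum hH hH' fun i _ => (U.memH_ind hH hH' i).const_mul _
  refine ⟨absNorm H T ψ, hψ.2.ne, fun ω => ?_⟩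
  have hind : ∀ i s, 0 ≤ U.ind i s := fun i s => indicator_nonneg (fun _ _ => zero_le_one) s
  have := absNorm_le_const_mul (H := H) (T := T) (c := 1) (φ := U.val ω) (ψ := ψ) (by simp)
    fun s => by
      rw [one_mul, enorm_le_iff_norm_le]
      refine (norm_sum_le _ _).trans ((Finset.sum_le_sum fun i _ => ?_).trans (le_abs_self _))
      rw [norm_mul, norm_mul, Real.norm_of_nonneg (hind i s), Real.norm_eq_abs]
      gcongr
      · exact hind i s
      · exact hB i ω
  simpa using this

theorem Elem.isSkorohodIntegral (hβ : IsFBM H T P β) (hH : 1 / 2 < H) (hH' : H < 1)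
    (U : Elem H T P β) : IsSkorohodIntegral H T P β U.val U.div := by
  refine ⟨U.aestronglyMeasurable_val, ?_, U.memLp_div hβ hH hH',
    U.aestronglyMeasurable_div hβ hH hH', U.integral_cyl_mul_div hβ hH hH'⟩
  obtain ⟨C, hC, h⟩ := U.exists_absNorm_val_le hH hH'
  calc _ ≤ ∫⁻ _, C ^ (2 : ℝ) ∂P := lintegral_mono fun ω => ENNReal.rpow_le_rpow (h ω) (by norm_num)
    _ < ∞ := by simp [hC.lt_top]

end Closure

section DualNorm

set_option linter.unusedSectionVars false

variable {d : ℕ} {p : ℝ≥0∞} [Fact (1 ≤ p)] {n : ℝ}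

/-- The norm of a Schwartz function in the dual of `H_p^n`. -/
def dualNorm (d : ℕ) (p : ℝ≥0∞) (n : ℝ) (χ : Schw d) : ℝ≥0∞ :=
  eLpNorm (besselSchw d (-n) χ) (1 - p⁻¹)⁻¹ (volume : Measure (Rd d))

theorem dualNorm_ne_top (χ : Schw d) : dualNorm d p n χ ≠ ∞ := by
  rw [dualNorm]
  exact ((besselSchw d (-n) χ).memLp _ volume).2.ne

theorem tendsto_dualNorm {ι : Type*} {l : Filter ι} {χ : ι → Schw d} (h : Tendsto χ l (𝓝 0)) :
    Tendsto (fun j => dualNorm d p n (χ j)) l (𝓝 0) := by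
  have hpq : ENNReal.HolderConjugate p (1 - p⁻¹)⁻¹ :=
    ENNReal.HolderConjugate.inv_one_sub_inv' (Fact.out : 1 ≤ p)
  have : Fact (1 ≤ (1 - p⁻¹)⁻¹) := ⟨ENNReal.HolderConjugate.one_le _ p⟩
  have hc : Continuous fun χ : Schw d => ‖SchwartzMap.toLpCLM ℝ ℝ (1 - p⁻¹)⁻¹
      (volume : Measure (Rd d)) (besselSchw d (-n) χ)‖ₑ := by fun_prop
  have h1 := (hc.tendsto 0).comp h
  rw [map_zero, map_zero, enorm_zero] at h1
  refine h1.congr fun j => ?_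
  rw [Function.comp_apply, SchwartzMap.toLpCLM_apply, Lp.enorm_def,
    eLpNorm_congr_ae (SchwartzMap.coeFn_toLp _ _ _), dualNorm]

theorem sum_toDist_sq_le (hp : 1 < p.toReal) (v : ℕ → Sob d p n) (χ : Schw d) (K : ℕ) :
    ∑ k ∈ Finset.range K, ‖(v k).toDist χ‖ₑ ^ (2 : ℝ) ≤
      (l2Norm d p v * dualNorm d p n χ) ^ (2 : ℝ) := by
  have hpq : ENNReal.HolderConjugate p (1 - p⁻¹)⁻¹ :=
    ENNReal.HolderConjugate.inv_one_sub_inv' (Fact.out : 1 ≤ p)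
  have hr : p.toReal.HolderConjugate ((1 - p⁻¹)⁻¹).toReal := ENNReal.HolderConjugate.toReal hp
  obtain ⟨hp0, hpt⟩ := ENNReal.toReal_pos_iff.1 hr.pos
  obtain ⟨hq0, hqt⟩ := ENNReal.toReal_pos_iff.1 hr.symm.pos
  set w : Rd d → ℝ≥0∞ := fun x => (∑' k, ‖(v k).toLp x‖ₑ ^ (2 : ℝ)) ^ (1 / 2 : ℝ) with hw
  have hm : ∀ k, AEMeasurable (fun x => ‖(v k).toLp x‖ₑ) (volume : Measure (Rd d)) := fun k =>
    (Lp.aestronglyMeasurable (v k).toLp).enorm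
  have hχ : AEMeasurable (fun x => ‖besselSchw d (-n) χ x‖ₑ) (volume : Measure (Rd d)) :=
    (besselSchw d (-n) χ).continuous.enorm.aemeasurable
  have hwm : AEMeasurable w (volume : Measure (Rd d)) :=
    (AEMeasurable.tsum fun k => (hm k).pow_const _).pow_const _
  calc ∑ k ∈ Finset.range K, ‖(v k).toDist χ‖ₑ ^ (2 : ℝ)
      ≤ ∑ k ∈ Finset.range K, (∫⁻ x, ‖(v k).toLp x‖ₑ * ‖besselSchw d (-n) χ x‖ₑ) ^ (2 : ℝ) := by
        refine Finset.sum_le_sum fun k _ => ENNReal.rpow_le_rpow ?_ (by norm_num)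
        rw [Sob.toDist_apply]
        refine (enorm_integral_le_lintegral_enorm _).trans (lintegral_mono fun x => ?_)
        rw [enorm_mul]
    _ ≤ (∫⁻ x, (∑ k ∈ Finset.range K,
          (‖(v k).toLp x‖ₑ * ‖besselSchw d (-n) χ x‖ₑ) ^ (2 : ℝ)) ^ (1 / 2 : ℝ)) ^ (2 : ℝ) :=
        sum_sq_lintegral_le _ fun k _ => (hm k).mul hχ
    _ ≤ (∫⁻ x, w x * ‖besselSchw d (-n) χ x‖ₑ) ^ (2 : ℝ) := by
        refine ENNReal.rpow_le_rpow (lintegral_mono fun x => ?_) (by norm_num)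
        simp_rw [ENNReal.mul_rpow_of_nonneg _ _ (zero_le_two (α := ℝ)), ← Finset.sum_mul]
        rw [ENNReal.mul_rpow_of_nonneg _ _ (by norm_num), ← ENNReal.rpow_mul ‖_‖ₑ]
        norm_num
        gcongr
        simpa only [ENNReal.rpow_two, hw] using ENNReal.rpow_le_rpow (z := 1 / 2)
          (ENNReal.sum_le_tsum (f := fun k => ‖(v k).toLp x‖ₑ ^ (2 : ℝ)) (Finset.range K))
          (by norm_num)
    _ ≤ _ := by
        refine ENNReal.rpow_le_rpow ?_ (by norm_num)
        refine (ENNReal.lintegral_mul_le_Lp_mul_Lq _ hr hwm hχ).trans (le_of_eq ?_)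
        rw [l2Norm, dualNorm, eLpNorm_eq_lintegral_rpow_enorm_toReal hp0.ne' hpt.ne,
          eLpNorm_eq_lintegral_rpow_enorm_toReal hq0.ne' hqt.ne]
        simp only [enorm_eq_self, hw]

theorem enorm_toDist_le (hp : 1 < p.toReal) (v : Sob d p n) (χ : Schw d) :
    ‖v.toDist χ‖ₑ ≤ ‖v‖ₑ * dualNorm d p n χ := by
  have hp' : p ≠ ∞ := fun h => by simp [h] at hp; linarith
  have h1 := sum_toDist_sq_le hp (Pi.single 0 v : ℕ → Sob d p n) χ 1
  have h2 := l2Norm_le_sum hp' (K := 1) (Pi.single 0 v : ℕ → Sob d p n) fun k hk =>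
    Pi.single_eq_of_ne (by omega) _
  rw [Finset.sum_range_one, Pi.single_eq_same] at h1 h2
  exact ((ENNReal.rpow_le_rpow_iff two_pos).1 h1).trans (mul_le_mul_left h2 _)

end DualNorm

section MixNorm

set_option linter.unusedSectionVars false

variable {Ω : Type*} [MeasurableSpace Ω] {P : Measure Ω} [IsProbabilityMeasure P] {H T : ℝ}

theorem mixNorm_two_sq (l : Ω → ℝ → ℝ≥0∞) (m : Ω → ℝ → ℝ → ℝ≥0∞) :
    mixNorm H T P 2 l m ^ (2 : ℝ) = ∫⁻ ω, ∫⁻ s, l ω s ^ (2 : ℝ) ∂leb T ∂P +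
      ∫⁻ ω, ∫⁻ s, (∫⁻ θ, m ω θ s ^ (1 / H) ∂leb T) ^ (2 * H) ∂leb T ∂P := by
  rw [mixNorm, ← ENNReal.rpow_mul]
  norm_num

theorem lintegral_rpow_le_lintegral_rpow {r : ℝ} (hr : 2 ≤ r) {l : Ω → ℝ → ℝ≥0∞}
    (hl : AEMeasurable (fun z : Ω × ℝ => l z.1 z.2) (P.prod (leb T))) :
    (∫⁻ ω, ∫⁻ s, l ω s ^ (2 : ℝ) ∂leb T ∂P) ^ (1 / 2 : ℝ) ≤
      (∫⁻ ω, ∫⁻ s, l ω s ^ r ∂leb T ∂P) ^ (1 / r) *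
        P.prod (leb T) univ ^ (1 / (2 : ℝ) - 1 / r) := by
  have := eLpNorm'_le_eLpNorm'_mul_rpow_measure_univ two_pos hr hl.aestronglyMeasurable
  simp only [eLpNorm', enorm_eq_self] at this
  rwa [lintegral_prod _ (hl.pow_const _), lintegral_prod _ (hl.pow_const _)] at this

theorem mixNorm_two_le {r : ℝ} (hr : 2 ≤ r) : ∃ c : ℝ≥0∞, c ≠ ∞ ∧
    ∀ (l : Ω → ℝ → ℝ≥0∞) (m : Ω → ℝ → ℝ → ℝ≥0∞),
      AEMeasurable (fun z : Ω × ℝ => l z.1 z.2) (P.prod (leb T)) →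
      AEMeasurable (fun z : Ω × ℝ × ℝ => m z.1 z.2.1 z.2.2) (P.prod ((leb T).prod (leb T))) →
      mixNorm H T P 2 l m ≤ c * mixNorm H T P r l m := by
  set c : ℝ≥0∞ := P.prod (leb T) univ ^ (1 / (2 : ℝ) - 1 / r) with hc
  have hr0 : 0 < r := by linarith
  have hc' : c ≠ ∞ := ENNReal.rpow_ne_top_of_nonneg
    (sub_nonneg.2 (one_div_le_one_div_of_le two_pos hr)) (measure_ne_top _ _)
  refine ⟨2 * c, ENNReal.mul_ne_top (by simp) hc', fun l m hl hm => ?_⟩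
  have hm' : AEMeasurable (fun z : Ω × ℝ => (∫⁻ θ, m z.1 θ z.2 ^ (1 / H) ∂leb T) ^ H)
      (P.prod (leb T)) :=
    (aemeasurable_inner_lintegral (m := fun ω θ s => m ω θ s ^ (1 / H)) (hm.pow_const _)).pow_const _
  have h1 := lintegral_rpow_le_lintegral_rpow hr hl
  have h2 := lintegral_rpow_le_lintegral_rpow hr (l := fun ω s =>
    (∫⁻ θ, m ω θ s ^ (1 / H) ∂leb T) ^ H) hm'
  simp only [← ENNReal.rpow_mul, mul_comm H] at h2
  have h3 : ∀ a b : ℝ≥0∞, (a + b) ^ (1 / 2 : ℝ) ≤ a ^ (1 / 2 : ℝ) + b ^ (1 / 2 : ℝ) := fun a b =>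
    ENNReal.rpow_add_le_add_rpow a b (by norm_num) (by norm_num)
  rw [mixNorm]
  refine (h3 _ _).trans ((add_le_add h1 h2).trans ?_)
  rw [← hc, two_mul, add_mul, mul_comm c]
  refine add_le_add (mul_le_mul_left ?_ _) (mul_le_mul_left ?_ _) <;>
    refine ENNReal.rpow_le_rpow ?_ (by positivity)
  · exact le_self_add
  · exact le_add_self

end MixNorm

section Bound

set_option linter.unusedSectionVars false

variable {Ω : Type*} [MeasurableSpace Ω] {P : Measure Ω} [IsProbabilityMeasure P] {H T : ℝ}
  {β : ℕ → ℝ → Ω → ℝ}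

theorem sum_lintegral_le {α ι : Type*} [MeasurableSpace α] {μ : Measure α} (s : Finset ι)
    (f : ι → α → ℝ≥0∞) : ∑ i ∈ s, ∫⁻ a, f i a ∂μ ≤ ∫⁻ a, ∑ i ∈ s, f i a ∂μ := by
  classical
  induction s using Finset.induction_on with
  | empty => simp
  | insert i s hi ih =>
    simp_rw [Finset.sum_insert hi]
    exact (add_le_add le_rfl ih).trans (le_lintegral_add _ _)

/-- The second moments of the divergences of elementary processes on a short interval. -/
theorem sum_lintegral_div_sq_le (hβ : ∀ k, IsFBM H T P (β k)) (hH : 1 / 2 < H) (hH' : H < 1)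
    (hT : 0 ≤ T) : ∃ C : ℝ≥0∞, C ≠ ∞ ∧ ∃ ε : ℝ, 0 < ε ∧ ∀ x y : ℝ, 0 ≤ x → x ≤ y → y ≤ T →
      ∀ (U : ∀ k, Elem H T P (β k)), (∀ k i, x ≤ (U k).a i) → (∀ k i, (U k).b i ≤ y) →
      ∀ (K : ℕ) (l : Ω → ℝ → ℝ≥0∞) (m : Ω → ℝ → ℝ → ℝ≥0∞),
      (∀ ω s, ∑ k ∈ Finset.range K, ‖(U k).val ω s‖ₑ ^ (2 : ℝ) ≤ l ω s ^ (2 : ℝ)) →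
      (∀ ω θ s, ∑ k ∈ Finset.range K, ‖(U k).deriv ω θ s‖ₑ ^ (2 : ℝ) ≤ m ω θ s ^ (2 : ℝ)) →
      ∑ k ∈ Finset.range K, ∫⁻ ω, ‖(U k).div ω‖ₑ ^ (2 : ℝ) ∂P ≤
        C * ENNReal.ofReal ((y - x) ^ ε) * mixNorm H T P 2 l m ^ (2 : ℝ) := by
  obtain ⟨C₁, hC₁, h₁⟩ := absNorm_indicator_sq_le hH hH'
  obtain ⟨C₂, hC₂, ε, hε, h₂⟩ := lintegral_kernelH_young hH hH' hT
  set δ : ℝ := min (2 * H - 1) ε with hδ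
  have hδ0 : 0 < δ := lt_min (by linarith) hε
  set D : ℝ → ℝ≥0∞ := fun e => ENNReal.ofReal (T ^ (e - δ)) with hD
  have hDle : ∀ e, δ ≤ e → ∀ x y : ℝ, 0 ≤ x → x ≤ y → y ≤ T →
      ENNReal.ofReal ((y - x) ^ e) ≤ D e * ENNReal.ofReal ((y - x) ^ δ) := by
    intro e he x y hx hxy hy
    rw [hD, ← ENNReal.ofReal_mul (Real.rpow_nonneg hT _)]
    refine ENNReal.ofReal_le_ofReal ?_
    have h0 : 0 ≤ y - x := sub_nonneg.2 hxy
    calc (y - x) ^ e = (y - x) ^ (e - δ) * (y - x) ^ δ := by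
          rw [← Real.rpow_add_of_nonneg h0 (by linarith) hδ0.le]; simp
      _ ≤ _ := mul_le_mul_of_nonneg_right (Real.rpow_le_rpow h0 (by linarith) (by linarith))
          (Real.rpow_nonneg h0 _)
  set C : ℝ≥0∞ := C₁ * D (2 * H - 1) + 2 * (C₂ * D ε) with hC
  refine ⟨C, by simp [hC, hD, ENNReal.mul_eq_top, hC₁, hC₂], δ, hδ0,
    fun x y hx hxy hy U ha hb K l m hl hm => ?_⟩
  set L : ℝ≥0∞ := ENNReal.ofReal ((y - x) ^ δ) with hL
  have hbound := fun k => (U k).lintegral_div_sq_le (hβ k) hH hH' hx hy (ha k) (hb k)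
  refine (Finset.sum_le_sum fun k _ => hbound k).trans ?_
  rw [Finset.sum_add_distrib, ← Finset.mul_sum, mixNorm_two_sq, mul_add]
  have hres := leb_restrict_Ioc (T := T) hx hy
  refine add_le_add ?_ ?_
  · calc ∑ k ∈ Finset.range K, ∫⁻ ω, absNorm H T ((U k).val ω) ^ (2 : ℝ) ∂P
        ≤ ∑ k ∈ Finset.range K, ∫⁻ ω, C₁ * (D (2 * H - 1) * L) *
            ∫⁻ s, ‖(U k).val ω s‖ₑ ^ (2 : ℝ) ∂leb T ∂P := by
          refine Finset.sum_le_sum fun k _ => lintegral_mono fun ω => ?_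
          have e : (U k).val ω = (Ioc x y).indicator ((U k).val ω) := by
            refine (indicator_eq_self.2 fun s hs => ?_).symm
            by_contra hn
            refine hs (Finset.sum_eq_zero fun i _ => ?_)
            rw [Elem.ind, indicator_of_notMem (fun h => hn ⟨(ha k i).trans_lt h.1,
              h.2.trans (hb k i)⟩), mul_zero]
          have h3 := h₁ T x y ((U k).val ω) hx hxy hy ((U k).memH_val hH hH' ω).1
          rw [← e] at h3
          refine h3.trans (mul_le_mul' (mul_le_mul_right (hDle _ (min_le_left _ _) _ _ hx hxy hy) _)
            ?_)
          rw [← hres]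
          exact setLIntegral_le_lintegral _ _
      _ ≤ ∫⁻ ω, ∑ k ∈ Finset.range K, C₁ * (D (2 * H - 1) * L) *
            ∫⁻ s, ‖(U k).val ω s‖ₑ ^ (2 : ℝ) ∂leb T ∂P := sum_lintegral_le _ _
      _ ≤ ∫⁻ ω, C₁ * (D (2 * H - 1) * L) * ∫⁻ s, l ω s ^ (2 : ℝ) ∂leb T ∂P := by
          refine lintegral_mono fun ω => ?_
          rw [← Finset.mul_sum]
          refine mul_le_mul_right ((sum_lintegral_le _ _).trans (lintegral_mono fun s => hl ω s)) _
      _ = C₁ * D (2 * H - 1) * L * ∫⁻ ω, ∫⁻ s, l ω s ^ (2 : ℝ) ∂leb T ∂P := by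
          rw [lintegral_const_mul' _ _ (by simp [hD, hL, ENNReal.mul_eq_top, hC₁])]
          ring
      _ ≤ _ := by
          gcongr
          exact le_self_add
  · set f : Ω → ℝ → ℝ → ℝ≥0∞ := fun ω s θ =>
      (∑ k ∈ Finset.range K, ‖(U k).deriv ω θ s‖ₑ ^ (2 : ℝ)) ^ (1 / 2 : ℝ) with hf
    have hfm : ∀ ω θ s, f ω s θ ≤ m ω θ s := fun ω θ s =>
      (ENNReal.rpow_le_rpow (hm ω θ s) (by norm_num)).trans_eq (by
        rw [← ENNReal.rpow_mul]; norm_num)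
    have hdm : ∀ k ω s, AEMeasurable (fun θ => ‖(U k).deriv ω θ s‖ₑ) (leb T) := fun k ω s =>
      AEMeasurable.enorm (Finset.aemeasurable_fun_sum _ fun i _ =>
        ((((U k).F i).memH_deriv hH hH' ω).1.aemeasurable.const_mul _).mul_const _)
    calc _ ≤ 2 * ∫⁻ ω, (∫⁻ s in Ioc x y, C₂ * (D ε * L) *
            (∫⁻ θ, m ω θ s ^ (1 / H) ∂leb T) ^ (2 * H)) ∂P := by
          gcongr
          refine (sum_lintegral_le _ _).trans (lintegral_mono fun ω => ?_)
          refine (sum_lintegral_le _ _).trans (lintegral_mono fun s => ?_)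
          refine (sum_lintegral_le _ _).trans ?_
          calc _ ≤ ∫⁻ r in Ioc x y,
                (∫⁻ θ, f ω s θ * ENNReal.ofReal (kernelH H θ r) ∂leb T) ^ (2 : ℝ) := by
                refine lintegral_mono fun r => ?_
                refine (sum_sq_lintegral_le (f := fun k θ => ‖(U k).deriv ω θ s‖ₑ *
                  ENNReal.ofReal (kernelH H θ r)) _ fun k _ => (hdm k ω s).mul
                  (measurable_ofReal_kernelH_right H r).aemeasurable).trans_eq ?_
                congr 1
                refine lintegral_congr fun θ => ?_
                simp_rw [ENNReal.mul_rpow_of_nonneg _ _ (zero_le_two (α := ℝ))]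
                rw [← Finset.sum_mul, ENNReal.mul_rpow_of_nonneg _ _ (by norm_num),
                  ← ENNReal.rpow_mul (ENNReal.ofReal _)]
                norm_num [hf]
            _ ≤ _ := by
                refine (h₂ x y hxy (f ω s) ?_).trans (mul_le_mul' (mul_le_mul_right
                  (hDle _ (min_le_right _ _) _ _ hx hxy hy) _) ?_)
                · exact (Finset.aemeasurable_fun_sum _ fun k _ =>
                    (hdm k ω s).pow_const _).pow_const _
                · gcongr with θ
                  exact hfm ω θ s
      _ ≤ 2 * ∫⁻ ω, C₂ * (D ε * L) *
            (∫⁻ s, (∫⁻ θ, m ω θ s ^ (1 / H) ∂leb T) ^ (2 * H) ∂leb T) ∂P := by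
          gcongr with ω
          rw [lintegral_const_mul' _ _ (by simp [hD, hL, ENNReal.mul_eq_top, hC₂]), ← hres]
          gcongr
          exact Measure.restrict_le_self
      _ = 2 * (C₂ * D ε) * L *
            ∫⁻ ω, ∫⁻ s, (∫⁻ θ, m ω θ s ^ (1 / H) ∂leb T) ^ (2 * H) ∂leb T ∂P := by
          rw [lintegral_const_mul' _ _ (by simp [hD, hL, ENNReal.mul_eq_top, hC₂])]
          ring
      _ ≤ _ := by
          gcongr
          exact le_add_self

end Bound

section Pairing

set_option linter.unusedSectionVars false

variable {Ω : Type*} [MeasurableSpace Ω] {P : Measure Ω} [IsProbabilityMeasure P] {H T : ℝ}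
  {β : ℝ → Ω → ℝ} {V : Type*} [NormedAddCommGroup V] [NormedSpace ℝ V]

/-- The real-valued elementary process `1_{(x,y]} (G, ℓ)`. -/
def SmoothElem.toElem {S : Set V} (G : SmoothElem H T P β S) (ℓ : V →ₗ[ℝ] ℝ) {x y : ℝ}
    (hx : 0 ≤ x) (hxy : x ≤ y) (hy : y ≤ T) : Elem H T P β where
  ι := Fin G.π.m
  fintype := inferInstance
  c i := ℓ (G.v i)
  F := G.F
  a i := min y (max x (G.π.t i.castSucc))
  b i := max (min y (max x (G.π.t i.castSucc))) (min y (G.π.t i.succ))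
  nonneg i := le_min (hx.trans hxy) (hx.trans (le_max_left _ _))
  le i := le_max_left _ _
  le_T i := max_le ((min_le_left _ _).trans hy) ((min_le_left _ _).trans hy)

theorem SmoothElem.toElem_ind {S : Set V} (G : SmoothElem H T P β S) (ℓ : V →ₗ[ℝ] ℝ) {x y : ℝ}
    (hx : 0 ≤ x) (hxy : x ≤ y) (hy : y ≤ T) (i : Fin G.π.m) (s : ℝ) :
    (G.toElem ℓ hx hxy hy).ind i s = (Ioc x y).indicator (G.π.ind i) s := by
  have h : s ∈ Ioc (min y (max x (G.π.t i.castSucc)))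
      (max (min y (max x (G.π.t i.castSucc))) (min y (G.π.t i.succ))) ↔
      s ∈ Ioc x y ∧ s ∈ Ioc (G.π.t i.castSucc) (G.π.t i.succ) := by
    simp only [mem_Ioc]
    grind
  by_cases h1 : s ∈ Ioc x y ∧ s ∈ Ioc (G.π.t i.castSucc) (G.π.t i.succ)
  · rw [indicator_of_mem h1.1, Grid.ind, indicator_of_mem h1.2]
    exact indicator_of_mem (h.2 h1) _
  · have h2 : (G.toElem ℓ hx hxy hy).ind i s = 0 := indicator_of_notMem (fun h' => h1 (h.1 h')) _
    rw [h2]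
    by_cases h3 : s ∈ Ioc x y
    · rw [indicator_of_mem h3, Grid.ind, indicator_of_notMem fun h4 => h1 ⟨h3, h4⟩]
    · rw [indicator_of_notMem h3]

theorem SmoothElem.toElem_val {S : Set V} (G : SmoothElem H T P β S) (ℓ : V →ₗ[ℝ] ℝ) {x y : ℝ}
    (hx : 0 ≤ x) (hxy : x ≤ y) (hy : y ≤ T) (ω : Ω) (s : ℝ) :
    (G.toElem ℓ hx hxy hy).val ω s = (Ioc x y).indicator (fun s => ℓ (G.val ω s)) s := by
  have e : (G.toElem ℓ hx hxy hy).val ω s = ∑ i : Fin G.π.m, ℓ (G.v i) * (G.F i).val ω *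
      (G.toElem ℓ hx hxy hy).ind i s := rfl
  simp_rw [e, toElem_ind]
  by_cases h : s ∈ Ioc x y
  · simp only [indicator_of_mem h, SmoothElem.val, map_sum, map_smul, smul_eq_mul]
    exact Finset.sum_congr rfl fun i _ => by ring
  · simp [indicator_of_notMem h]

theorem SmoothElem.toElem_deriv {S : Set V} (G : SmoothElem H T P β S) (ℓ : V →ₗ[ℝ] ℝ) {x y : ℝ}
    (hx : 0 ≤ x) (hxy : x ≤ y) (hy : y ≤ T) (ω : Ω) (θ s : ℝ) :
    (G.toElem ℓ hx hxy hy).deriv ω θ s = (Ioc x y).indicator (fun s => ℓ (G.deriv ω θ s)) s := by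
  have e : (G.toElem ℓ hx hxy hy).deriv ω θ s = ∑ i : Fin G.π.m, ℓ (G.v i) *
      (G.F i).deriv ω θ * (G.toElem ℓ hx hxy hy).ind i s := rfl
  simp_rw [e, toElem_ind]
  by_cases h : s ∈ Ioc x y
  · simp only [indicator_of_mem h, SmoothElem.deriv, map_sum, map_smul, smul_eq_mul]
    exact Finset.sum_congr rfl fun i _ => by ring
  · simp [indicator_of_notMem h]

/-- The elementary process `0`. -/
def Elem.zero (H T : ℝ) (P : Measure Ω) (β : ℝ → Ω → ℝ) : Elem H T P β :=
  ⟨Empty, inferInstance, Empty.elim, fun i => i.elim, Empty.elim, Empty.elim, fun i => i.elim,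
    fun i => i.elim, fun i => i.elim⟩

/-- The difference of two elementary processes. -/
def Elem.sub (U U' : Elem H T P β) : Elem H T P β where
  ι := U.ι ⊕ U'.ι
  fintype := inferInstance
  c := Sum.elim U.c fun i => -U'.c i
  F := Sum.elim U.F U'.F
  a := Sum.elim U.a U'.a
  b := Sum.elim U.b U'.b
  nonneg := by rintro (i | i); exacts [U.nonneg i, U'.nonneg i]
  le := by rintro (i | i); exacts [U.le i, U'.le i]
  le_T := by rintro (i | i); exacts [U.le_T i, U'.le_T i]

theorem Elem.sub_val (U U' : Elem H T P β) (ω : Ω) (s : ℝ) :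
    (U.sub U').val ω s = U.val ω s - U'.val ω s := by
  refine (Fintype.sum_sum_type _).trans ?_
  rw [sub_eq_add_neg, Elem.val, Elem.val, ← Finset.sum_neg_distrib]
  refine congrArg₂ _ rfl (Finset.sum_congr rfl fun i _ => ?_)
  rw [← neg_mul, ← neg_mul]
  rfl

theorem Elem.sub_deriv (U U' : Elem H T P β) (ω : Ω) (θ s : ℝ) :
    (U.sub U').deriv ω θ s = U.deriv ω θ s - U'.deriv ω θ s := by
  refine (Fintype.sum_sum_type _).trans ?_
  rw [sub_eq_add_neg, Elem.deriv, Elem.deriv, ← Finset.sum_neg_distrib]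
  refine congrArg₂ _ rfl (Finset.sum_congr rfl fun i _ => ?_)
  rw [← neg_mul, ← neg_mul]
  rfl

theorem Elem.sub_div (U U' : Elem H T P β) (ω : Ω) :
    (U.sub U').div ω = U.div ω - U'.div ω := by
  refine (Fintype.sum_sum_type _).trans ?_
  rw [sub_eq_add_neg, Elem.div, Elem.div, ← Finset.sum_neg_distrib]
  refine congrArg₂ _ rfl (Finset.sum_congr rfl fun i _ => ?_)
  rw [← neg_mul]
  rfl

end Pairing

section Pairing

set_option linter.unusedSectionVars false

variable {d : ℕ} {p : ℝ≥0∞} [Fact (1 ≤ p)] {n : ℝ}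

/-- The functional `v ↦ (v, χ)` on `H_p^n`. -/
def pairing (hp : 1 < p.toReal) (χ : Schw d) : Sob d p n →L[ℝ] ℝ :=
  LinearMap.mkContinuous
    { toFun := fun v => v.toDist χ
      map_add' := fun u v => by rw [map_add, add_apply]
      map_smul' := fun c v => by rw [map_smul, smul_apply, RingHom.id_apply] }
    (dualNorm d p n χ).toReal fun v => by
      have h := ENNReal.toReal_mono (ENNReal.mul_ne_top enorm_ne_top (dualNorm_ne_top χ))
        (enorm_toDist_le hp v χ)
      rw [ENNReal.toReal_mul, toReal_enorm, toReal_enorm, mul_comm] at h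
      exact h

theorem l2Norm_neg (v : ℕ → Sob d p n) : l2Norm d p (-v) = l2Norm d p v := by
  refine eLpNorm_congr_ae ?_
  have h : ∀ᵐ x, ∀ k, (-(v k)).toLp x = -(v k).toLp x := ae_all_iff.2 fun k => by
    rw [map_neg]
    exact Lp.coeFn_neg _
  filter_upwards [h] with x hx
  simp only [Pi.neg_apply, hx, enorm_neg]

end Pairing

section Limits

set_option linter.unusedSectionVars false

variable {Ω : Type*} [MeasurableSpace Ω] {P : Measure Ω} [IsProbabilityMeasure P] {H T : ℝ}

theorem eLpNorm_two_rpow (f : Ω → ℝ) :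
    eLpNorm f 2 P ^ (2 : ℝ) = ∫⁻ ω, ‖f ω‖ₑ ^ (2 : ℝ) ∂P := by
  rw [eLpNorm_eq_lintegral_rpow_enorm_toReal (by simp) (by simp), ← ENNReal.rpow_mul]
  norm_num

theorem exists_tendsto_eLpNorm {f : ℕ → Ω → ℝ} (hf : ∀ j, MemLp (f j) 2 P) {b : ℕ → ℝ≥0∞}
    (hb : Tendsto b atTop (𝓝 0)) (h : ∀ i j, eLpNorm (f i - f j) 2 P ≤ b i + b j) :
    ∃ Z : Ω → ℝ, MemLp Z 2 P ∧ Tendsto (fun j => eLpNorm (f j - Z) 2 P) atTop (𝓝 0) := by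
  have : Fact ((1 : ℝ≥0∞) ≤ 2) := ⟨by norm_num⟩
  have hc : CauchySeq fun j => (hf j).toLp (f j) := by
    rw [Lp.cauchySeq_Lp_iff_cauchySeq_eLpNorm]
    have hb2 : Tendsto (fun z : ℕ × ℕ => b z.1 + b z.2) atTop (𝓝 0) := by
      rw [← prod_atTop_atTop_eq]
      simpa using (hb.comp tendsto_fst).add (hb.comp tendsto_snd)
    refine tendsto_of_tendsto_of_tendsto_of_le_of_le tendsto_const_nhds hb2 (fun _ => zero_le)
      fun z => ?_
    refine le_trans (le_of_eq (eLpNorm_congr_ae ?_)) (h z.1 z.2)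
    exact (hf z.1).coeFn_toLp.sub (hf z.2).coeFn_toLp
  obtain ⟨Z, hZ⟩ := cauchySeq_tendsto_of_complete hc
  refine ⟨Z, Lp.memLp Z, ?_⟩
  refine (Lp.tendsto_Lp_iff_tendsto_eLpNorm'' f hf Z (Lp.memLp Z)).1 ?_
  rwa [Lp.toLp_coeFn]

variable {d : ℕ} {p : ℝ≥0∞} [Fact (1 ≤ p)] {n : ℝ}

theorem lintegral_absNorm_pairing_le (hH : 1 / 2 < H) (hH' : H < 1) (hp : 1 < p.toReal) :
    ∃ C : ℝ≥0∞, C ≠ ∞ ∧ ∀ x y : ℝ, 0 ≤ x → x ≤ y → y ≤ T → ∀ (χ : Schw d)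
      (w : Ω → ℝ → Sob d p n), AEStronglyMeasurable (fun z : Ω × ℝ => w z.1 z.2) (P.prod (leb T)) →
      ∀ (l : Ω → ℝ → ℝ≥0∞), (∀ ω s, ‖w ω s‖ₑ ≤ l ω s) →
      ∫⁻ ω, absNorm H T ((Ioc x y).indicator fun s => (w ω s).toDist χ) ^ (2 : ℝ) ∂P ≤
        C * ENNReal.ofReal ((y - x) ^ (2 * H - 1)) * dualNorm d p n χ ^ (2 : ℝ) *
          ∫⁻ ω, ∫⁻ s, l ω s ^ (2 : ℝ) ∂leb T ∂P := by
  obtain ⟨C, hC, h⟩ := absNorm_indicator_sq_le hH hH'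
  refine ⟨C, hC, fun x y hx hxy hy χ w hw l hl => ?_⟩
  have hN := dualNorm_ne_top (d := d) (p := p) (n := n) χ
  have hc : C * ENNReal.ofReal ((y - x) ^ (2 * H - 1)) * dualNorm d p n χ ^ (2 : ℝ) ≠ ∞ :=
    ENNReal.mul_ne_top (ENNReal.mul_ne_top hC ENNReal.ofReal_ne_top)
      (ENNReal.rpow_ne_top_of_nonneg (by norm_num) hN)
  rw [← lintegral_const_mul' _ _ hc]
  refine lintegral_mono_ae ?_
  filter_upwards [hw.prodMk_left] with ω hω
  refine (h T x y _ hx hxy hy ((pairing hp χ).continuous.comp_aestronglyMeasurable hω)).trans ?_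
  rw [mul_assoc _ (dualNorm d p n χ ^ (2 : ℝ))]
  refine mul_le_mul_right ?_ _
  rw [← leb_restrict_Ioc (T := T) hx hy, ← lintegral_const_mul' _ _
    (ENNReal.rpow_ne_top_of_nonneg (by norm_num) hN)]
  refine (setLIntegral_le_lintegral _ _).trans (lintegral_mono fun s => ?_)
  rw [← ENNReal.mul_rpow_of_nonneg _ _ (by norm_num), mul_comm]
  exact ENNReal.rpow_le_rpow ((enorm_toDist_le hp _ χ).trans (mul_le_mul_left (hl ω s) _))
    (by norm_num)

variable {β : ℕ → ℝ → Ω → ℝ}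

/-- The Skorohod integrals of `1_{(x,y]} (g^k, χ)`, for `g` in the space of coefficients. -/
theorem exists_isSkorohodIntegral_pairing (hβ : ∀ k, IsFBM H T P (β k)) (hH : 1 / 2 < H)
    (hH' : H < 1) (hT : 0 ≤ T) (hp : 2 ≤ p.toReal) {g : ℕ → Ω → ℝ → Sob d p n}
    (hg : g ∈ tildeL H T P β d p n) :
    ∃ ε : ℝ, 0 < ε ∧ ∃ ν : Measure ℝ, IsFiniteMeasure ν ∧ ∀ x y : ℝ, 0 ≤ x → x ≤ y → y ≤ T →
      ∀ χ : Schw d, ∃ Z : ℕ → Ω → ℝ,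
        (∀ k, IsSkorohodIntegral H T P (β k)
          (fun ω => (Ioc x y).indicator fun s => (g k ω s).toDist χ) (Z k)) ∧
        ∀ K, ∑ k ∈ Finset.range K, ∫⁻ ω, ‖Z k ω‖ₑ ^ (2 : ℝ) ∂P ≤
          ENNReal.ofReal ((y - x) ^ ε) * dualNorm d p n χ ^ (2 : ℝ) * ν (Ioc x y) := by
  have hH0 : 0 < H := by linarith
  have hp1 : 1 < p.toReal := by linarith
  have hp' : p ≠ ∞ := fun h => by simp [h] at hp; linarith
  obtain ⟨h, ⟨hD, hfin⟩, K, G, gj, hj, hgj, hhj, hmem, hlim⟩ := hg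
  obtain ⟨C, hC, ε, hε, hdiv⟩ := sum_lintegral_div_sq_le hβ hH hH' hT
  obtain ⟨C₁, hC₁, habs⟩ := lintegral_absNorm_pairing_le (P := P) (T := T) (d := d) (n := n) hH hH' hp1
  obtain ⟨c, hc, h2p⟩ := mixNorm_two_le (P := P) (H := H) (T := T) hp
  set l : Ω → ℝ → ℝ≥0∞ := fun ω s => l2Norm d p fun k => g k ω s with hl
  set m : Ω → ℝ → ℝ → ℝ≥0∞ := fun ω θ s => l2Norm d p fun k => h k ω θ s with hm
  set l' : ℕ → Ω → ℝ → ℝ≥0∞ := fun j ω s => l2Norm d p fun k => (gj j - g) k ω s with hl'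
  set m' : ℕ → Ω → ℝ → ℝ → ℝ≥0∞ := fun j ω θ s => l2Norm d p fun k => (hj j - h) k ω θ s with hm'
  have hlm : AEMeasurable (fun z : Ω × ℝ => l z.1 z.2) (P.prod (leb T)) :=
    aemeasurable_l2Norm hp' fun k => (hD k).1
  have hmm : AEMeasurable (fun z : Ω × ℝ × ℝ => m z.1 z.2.1 z.2.2)
      (P.prod ((leb T).prod (leb T))) := aemeasurable_l2Norm hp' fun k => (hD k).2.1
  have hgm : ∀ j k, AEStronglyMeasurable (fun z : Ω × ℝ => (gj j - g) k z.1 z.2)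
      (P.prod (leb T)) := fun j k => ((hmem j).1 k).1.sub (hD k).1
  have hlm' : ∀ j, AEMeasurable (fun z : Ω × ℝ => l' j z.1 z.2) (P.prod (leb T)) := fun j =>
    aemeasurable_l2Norm hp' (hgm j)
  have hmm' : ∀ j, AEMeasurable (fun z : Ω × ℝ × ℝ => m' j z.1 z.2.1 z.2.2)
      (P.prod ((leb T).prod (leb T))) := fun j =>
    aemeasurable_l2Norm (g := fun k (z : Ω × ℝ × ℝ) => (hj j - h) k z.1 z.2.1 z.2.2) hp'
      fun k => ((hmem j).1 k).2.1.sub (hD k).2.1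
  have hM : mixNorm H T P 2 l m ≠ ∞ :=
    ((h2p l m hlm hmm).trans_lt (ENNReal.mul_lt_top hc.lt_top hfin)).ne
  set E : ℕ → ℝ≥0∞ := fun j => mixNorm H T P 2 (l' j) (m' j) with hE
  have hE0 : Tendsto E atTop (𝓝 0) := by
    have h1 := ENNReal.Tendsto.const_mul (a := c) hlim (Or.inr hc)
    rw [mul_zero] at h1
    exact tendsto_of_tendsto_of_tendsto_of_le_of_le tendsto_const_nhds h1 (fun _ => zero_le)
      fun j => h2p _ _ (hlm' j) (hmm' j)
  set q : Ω → ℝ → ℝ≥0∞ := fun ω s =>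
    l ω s ^ (2 : ℝ) + (∫⁻ θ, m ω θ s ^ (1 / H) ∂leb T) ^ (2 * H) with hq
  have hqm : AEMeasurable (fun z : Ω × ℝ => q z.1 z.2) (P.prod (leb T)) :=
    (hlm.pow_const _).add ((aemeasurable_inner_lintegral (m := fun ω θ s => m ω θ s ^ (1 / H))
      (hmm.pow_const _)).pow_const _)
  have hqI : ∀ I : Set ℝ, MeasurableSet I →
      mixNorm H T P 2 (fun ω => I.indicator (l ω)) (fun ω θ => I.indicator (m ω θ)) ^ (2 : ℝ) =
      (((P.prod (leb T)).withDensity fun z => q z.1 z.2).map Prod.snd) I := by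
    intro I hI
    have hq2 : AEMeasurable (fun z : Ω × ℝ => I.indicator (q z.1) z.2) (P.prod (leb T)) := by
      have := hqm.indicator (measurable_snd hI)
      exact this
    rw [Measure.map_apply measurable_snd hI, withDensity_apply _ (measurable_snd hI),
      ← lintegral_indicator (measurable_snd hI)]
    change _ = ∫⁻ z, I.indicator (q z.1) z.2 ∂P.prod (leb T)
    have hl2 : AEMeasurable (fun z : Ω × ℝ => I.indicator (l z.1) z.2 ^ (2 : ℝ))
        (P.prod (leb T)) := by
      have := (hlm.indicator (measurable_snd hI)).pow_const (2 : ℝ)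
      exact this
    rw [lintegral_prod _ hq2, mixNorm_two_sq, ← lintegral_prod_add_le hl2]
    refine lintegral_congr fun ω => lintegral_congr fun s => ?_
    by_cases hs : s ∈ I
    · simp only [indicator_of_mem hs, hq]
    · simp [indicator_of_notMem hs, hH0]
  set ν : Measure ℝ := (128 * C) •
    ((P.prod (leb T)).withDensity fun z => q z.1 z.2).map Prod.snd with hν
  have hνf : IsFiniteMeasure ν := by
    refine ⟨?_⟩
    rw [hν, Measure.smul_apply, smul_eq_mul, ← hqI _ MeasurableSet.univ]
    simp only [indicator_univ]
    exact ENNReal.mul_lt_top (ENNReal.mul_lt_top (by simp) hC.lt_top)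
      (ENNReal.rpow_lt_top_of_nonneg (by norm_num) hM)
  refine ⟨ε, hε, ν, hνf, fun x y hx hxy hy χ => ?_⟩
  set N : ℝ≥0∞ := dualNorm d p n χ with hN
  have hNt : N ≠ ∞ := dualNorm_ne_top χ
  set L : ℝ≥0∞ := ENNReal.ofReal ((y - x) ^ ε) with hL
  set I : Set ℝ := Ioc x y with hI
  have hU : ∀ j k, ∃ U : Elem H T P (β k), (∀ i, x ≤ U.a i) ∧ (∀ i, U.b i ≤ y) ∧
      (∀ ω s, U.val ω s = I.indicator (fun s => (gj j k ω s).toDist χ) s) ∧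
      ∀ ω θ s, U.deriv ω θ s = I.indicator (fun s => (hj j k ω θ s).toDist χ) s := by
    intro j k
    rw [hgj, hhj]
    by_cases hk : k < K j
    · rw [if_pos hk, if_pos hk]
      exact ⟨(G j k).toElem (pairing (n := n) hp1 χ).toLinearMap hx hxy hy,
        fun i => le_min hxy (le_max_left _ _), fun i => max_le (min_le_left _ _) (min_le_left _ _),
        (G j k).toElem_val _ hx hxy hy, (G j k).toElem_deriv _ hx hxy hy⟩
    · rw [if_neg hk, if_neg hk]
      refine ⟨Elem.zero H T P (β k), fun i => i.elim, fun i => i.elim, fun ω s => ?_,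
        fun ω θ s => ?_⟩
      · exact (Finset.sum_eq_zero fun i _ => i.elim).trans (by simp)
      · exact (Finset.sum_eq_zero fun i _ => i.elim).trans (by simp)
  choose U hUa hUb hUv hUd using hU
  have hsk : ∀ j k, IsSkorohodIntegral H T P (β k) (U j k).val (U j k).div := fun j k =>
    (U j k).isSkorohodIntegral (hβ k) hH hH'
  have hsum : ∀ (v : ℕ → Sob d p n) (a : ℝ≥0∞), l2Norm d p v ≤ a → ∀ R,
      ∑ k ∈ Finset.range R, ‖(v k).toDist χ‖ₑ ^ (2 : ℝ) ≤ (N * a) ^ (2 : ℝ) := fun v a hv R =>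
    (sum_toDist_sq_le hp1 v χ R).trans (ENNReal.rpow_le_rpow
      (by rw [mul_comm N]; exact mul_le_mul_left hv _) (by norm_num))
  have htri : ∀ u v w : ℕ → Sob d p n, l2Norm d p (u - v) ≤ l2Norm d p (u - w) + l2Norm d p (v - w) :=
    fun u v w => by
      rw [← l2Norm_neg (v - w), neg_sub]
      convert l2Norm_add_le hp' (u - w) (w - v) using 2
      abel
  have hdiff : ∀ i j R, ∑ k ∈ Finset.range R, ∫⁻ ω, ‖((U i k).div - (U j k).div) ω‖ₑ ^ (2 : ℝ) ∂P ≤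
      C * L * (N * (8 * (E i + E j))) ^ (2 : ℝ) := by
    intro i j R
    have h1 := hdiv x y hx hxy hy (fun k => (U i k).sub (U j k))
      (fun k => by rintro (z | z); exacts [hUa i k z, hUa j k z])
      (fun k => by rintro (z | z); exacts [hUb i k z, hUb j k z]) R
      (fun ω s => N * (l' i ω s + l' j ω s)) (fun ω θ s => N * (m' i ω θ s + m' j ω θ s))
      (fun ω s => ?_) (fun ω θ s => ?_)
    · simp only [Elem.sub_div] at h1
      refine h1.trans (mul_le_mul_right (ENNReal.rpow_le_rpow ?_ (by norm_num)) _)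
      rw [mixNorm_const_mul hH0 two_pos hNt]
      exact mul_le_mul_right (mixNorm_add_le hH0 hH' one_le_two (hlm' i) (hmm' i)) _
    · simp only [Elem.sub_val, hUv]
      by_cases hs : s ∈ I
      · simp only [indicator_of_mem hs]
        have := hsum ((fun k => gj i k ω s) - fun k => gj j k ω s) _
          (htri _ _ fun k => g k ω s) R
        simp only [Pi.sub_apply, map_sub, sub_apply] at this
        exact this
      · simp [indicator_of_notMem hs]
    · simp only [Elem.sub_deriv, hUd]
      by_cases hs : s ∈ I
      · simp only [indicator_of_mem hs]
        have := hsum ((fun k => hj i k ω θ s) - fun k => hj j k ω θ s) _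
          (htri _ _ fun k => h k ω θ s) R
        simp only [Pi.sub_apply, map_sub, sub_apply] at this
        exact this
      · simp [indicator_of_notMem hs]
  have hCL : C * L ≠ ∞ := ENNReal.mul_ne_top hC ENNReal.ofReal_ne_top
  have hZ : ∀ k, ∃ Z : Ω → ℝ, MemLp Z 2 P ∧
      Tendsto (fun j => eLpNorm ((U j k).div - Z) 2 P) atTop (𝓝 0) := by
    intro k
    refine exists_tendsto_eLpNorm (fun j => (hsk j k).2.2.1)
      (b := fun j => (C * L) ^ (1 / 2 : ℝ) * (N * 8) * E j) ?_ fun i j => ?_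
    · have := ENNReal.Tendsto.const_mul (a := (C * L) ^ (1 / 2 : ℝ) * (N * 8)) hE0 (Or.inr
        (ENNReal.mul_ne_top (ENNReal.rpow_ne_top_of_nonneg (by norm_num) hCL)
          (ENNReal.mul_ne_top hNt (by simp))))
      rwa [mul_zero] at this
    · rw [← ENNReal.rpow_le_rpow_iff (two_pos (α := ℝ)), eLpNorm_two_rpow]
      refine le_trans ?_ ((hdiff i j (k + 1)).trans_eq ?_)
      · exact Finset.single_le_sum (f := fun k => ∫⁻ ω, ‖((U i k).div - (U j k).div) ω‖ₑ ^ (2 : ℝ) ∂P)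
          (fun _ _ => zero_le) (Finset.self_mem_range_succ k)
      · rw [← mul_add, mul_assoc ((C * L) ^ (1 / 2 : ℝ)), ENNReal.mul_rpow_of_nonneg
          ((C * L) ^ (1 / 2 : ℝ)) _ zero_le_two, ← ENNReal.rpow_mul (C * L), mul_assoc N]
        norm_num
  choose Z hZ2 hZt using hZ
  have hVm : ∀ k, AEStronglyMeasurable
      (fun z : Ω × ℝ => I.indicator (fun s => (g k z.1 s).toDist χ) z.2) (P.prod (leb T)) := by
    intro k
    have := ((pairing hp1 χ).continuous.comp_aestronglyMeasurable (hD k).1).indicator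
      (measurable_snd (measurableSet_Ioc (a := x) (b := y)))
    exact this
  have hll : ∫⁻ ω, ∫⁻ s, l ω s ^ (2 : ℝ) ∂leb T ∂P ≠ ∞ := by
    refine ((le_self_add.trans_eq (mixNorm_two_sq l m).symm).trans_lt
      (ENNReal.rpow_lt_top_of_nonneg (by norm_num) hM)).ne
  have hcst : C₁ * ENNReal.ofReal ((y - x) ^ (2 * H - 1)) * N ^ (2 : ℝ) ≠ ∞ :=
    ENNReal.mul_ne_top (ENNReal.mul_ne_top hC₁ ENNReal.ofReal_ne_top)
      (ENNReal.rpow_ne_top_of_nonneg (by norm_num) hNt)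
  refine ⟨Z, fun k => ?_, fun R => ?_⟩
  · refine IsSkorohodIntegral.of_tendsto (hβ k) hH hH' (fun j => hsk j k) (hVm k) ?_ (hZ2 k) ?_
      (hZt k)
    · exact (habs x y hx hxy hy χ (g k) (hD k).1 l fun ω s =>
        enorm_le_l2Norm (fun k => g k ω s) k).trans_lt (ENNReal.mul_lt_top hcst.lt_top hll.lt_top)
    · have hE2 : Tendsto (fun j => C₁ * ENNReal.ofReal ((y - x) ^ (2 * H - 1)) * N ^ (2 : ℝ) *
          E j ^ (2 : ℝ)) atTop (𝓝 0) := by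
        have h1 := (ENNReal.continuous_rpow_const (y := (2 : ℝ))).continuousAt.tendsto.comp hE0
        have h2 := ENNReal.Tendsto.const_mul (a := C₁ * ENNReal.ofReal ((y - x) ^ (2 * H - 1)) *
          N ^ (2 : ℝ)) h1 (Or.inr hcst)
        simpa using h2
      refine tendsto_of_tendsto_of_tendsto_of_le_of_le tendsto_const_nhds hE2 (fun _ => zero_le)
        fun j => ?_
      have h1 := habs x y hx hxy hy χ ((gj j - g) k) (hgm j k) (l' j) fun ω s =>
        enorm_le_l2Norm (fun k => (gj j - g) k ω s) k
      have e : ∀ ω, (fun s => (U j k).val ω s - I.indicator (fun s => (g k ω s).toDist χ) s) =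
          I.indicator fun s => ((gj j - g) k ω s).toDist χ := fun ω => by
        funext s
        rw [hUv]
        by_cases hs : s ∈ I
        · simp only [indicator_of_mem hs, Pi.sub_apply, map_sub, sub_apply]
        · simp only [indicator_of_notMem hs, sub_zero]
      simp only [e]
      refine h1.trans (mul_le_mul_right ?_ _)
      rw [hE, mixNorm_two_sq]
      exact le_self_add
  · set B : ℝ≥0∞ := mixNorm H T P 2 (fun ω => I.indicator (l ω)) (fun ω θ => I.indicator (m ω θ))
      with hB
    have hBt : B ≠ ∞ := (lt_of_le_of_lt (mixNorm_mono hH0 two_pos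
      (fun ω s => indicator_le_self' (fun _ _ => zero_le) s)
      (fun ω θ s => indicator_le_self' (fun _ _ => zero_le) s)) hM.lt_top).ne
    have hind : ∀ (u v : ℕ → Sob d p n), l2Norm d p u ≤ l2Norm d p (u - v) + l2Norm d p v :=
      fun u v => by
        convert l2Norm_add_le hp' (u - v) v using 2
        abel
    have hbd : ∀ j, ∑ k ∈ Finset.range R, ∫⁻ ω, ‖(U j k).div ω‖ₑ ^ (2 : ℝ) ∂P ≤
        C * L * (N * (8 * (E j + B))) ^ (2 : ℝ) := by
      intro j
      have h1 := hdiv x y hx hxy hy (U j) (hUa j) (hUb j) R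
        (fun ω s => N * (l' j ω s + I.indicator (l ω) s))
        (fun ω θ s => N * (m' j ω θ s + I.indicator (m ω θ) s))
        (fun ω s => ?_) (fun ω θ s => ?_)
      · refine h1.trans (mul_le_mul_right (ENNReal.rpow_le_rpow ?_ (by norm_num)) _)
        rw [mixNorm_const_mul hH0 two_pos hNt]
        exact mul_le_mul_right (mixNorm_add_le hH0 hH' one_le_two (hlm' j) (hmm' j)) _
      · simp only [hUv]
        by_cases hs : s ∈ I
        · simp only [indicator_of_mem hs]
          exact hsum (fun k => gj j k ω s) _ (hind _ fun k => g k ω s) R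
        · simp [indicator_of_notMem hs]
      · simp only [hUd]
        by_cases hs : s ∈ I
        · simp only [indicator_of_mem hs]
          exact hsum (fun k => hj j k ω θ s) _ (hind _ fun k => h k ω θ s) R
        · simp [indicator_of_notMem hs]
    have hle : ∀ j, ∑ k ∈ Finset.range R, ∫⁻ ω, ‖Z k ω‖ₑ ^ (2 : ℝ) ∂P ≤
        2 * (C * L * (N * (8 * (E j + B))) ^ (2 : ℝ)) +
          2 * ∑ k ∈ Finset.range R, eLpNorm ((U j k).div - Z k) 2 P ^ (2 : ℝ) := by
      intro j
      refine le_trans ?_ (add_le_add (mul_le_mul_right (hbd j) 2) le_rfl)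
      rw [← mul_add, ← Finset.sum_add_distrib, Finset.mul_sum]
      refine Finset.sum_le_sum fun k _ => ?_
      rw [← eLpNorm_two_rpow, ← eLpNorm_two_rpow]
      have h1 : eLpNorm (Z k) 2 P ≤ eLpNorm (U j k).div 2 P + eLpNorm ((U j k).div - Z k) 2 P := by
        rw [eLpNorm_sub_comm]
        have := eLpNorm_add_le (hsk j k).2.2.1.1 ((hZ2 k).1.sub (hsk j k).2.2.1.1)
          (p := 2) (by norm_num)
        rwa [add_sub_cancel] at this
      refine (ENNReal.rpow_le_rpow h1 (by norm_num)).trans ?_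
      have := ENNReal.rpow_add_le_mul_rpow_add_rpow (eLpNorm (U j k).div 2 P)
        (eLpNorm ((U j k).div - Z k) 2 P) (p := 2) (by norm_num)
      refine this.trans (le_of_eq ?_)
      norm_num
    have hlimR : Tendsto (fun j => 2 * (C * L * (N * (8 * (E j + B))) ^ (2 : ℝ)) +
          2 * ∑ k ∈ Finset.range R, eLpNorm ((U j k).div - Z k) 2 P ^ (2 : ℝ)) atTop
        (𝓝 (2 * (C * L * (N * (8 * (0 + B))) ^ (2 : ℝ)) + 2 * ∑ k ∈ Finset.range R, 0)) := by
      have hsq : Tendsto (fun z : ℝ≥0∞ => z ^ (2 : ℝ)) (𝓝 0) (𝓝 0) := by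
        simpa using (ENNReal.continuous_rpow_const (y := (2 : ℝ))).tendsto 0
      refine Tendsto.add (ENNReal.Tendsto.const_mul (ENNReal.Tendsto.const_mul ?_ (Or.inr hCL))
        (Or.inr (by simp))) (ENNReal.Tendsto.const_mul (tendsto_finsetSum _ fun k _ => ?_)
        (Or.inr (by simp)))
      · refine ((ENNReal.continuous_rpow_const (y := (2 : ℝ))).tendsto _).comp
          (ENNReal.Tendsto.const_mul (ENNReal.Tendsto.const_mul (hE0.add tendsto_const_nhds)
            (Or.inr (by simp))) (Or.inr hNt))
      · exact hsq.comp (hZt k)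
    refine (ge_of_tendsto' hlimR hle).trans (le_of_eq ?_)
    rw [hν, Measure.smul_apply, smul_eq_mul, ← hqI _ measurableSet_Ioc, ← hB,
      Finset.sum_const_zero, mul_zero, add_zero, zero_add,
      ENNReal.mul_rpow_of_nonneg _ _ (zero_le_two (α := ℝ)),
      ENNReal.mul_rpow_of_nonneg _ _ (zero_le_two (α := ℝ))]
    have : (8 : ℝ≥0∞) ^ (2 : ℝ) = 64 := by
      rw [ENNReal.rpow_two]; norm_num
    rw [this]
    ring

end Limits

section Chaining

theorem enorm_le_tsum_dyadic {x : ℝ → ℝ} {T : ℝ} (hT : 0 < T) (hc : ContinuousOn x (Icc 0 T))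
    (h0 : x 0 = 0) {t : ℝ} (ht : t ∈ Icc 0 T) :
    ‖x t‖ₑ ≤ ∑' n : ℕ, (∑ i ∈ Finset.range (2 ^ n),
      ‖x (T * ((i + 1 : ℕ) : ℝ) / 2 ^ n) - x (T * (i : ℝ) / 2 ^ n)‖ₑ ^ (2 : ℝ)) ^ (1 / 2 : ℝ) := by
  set a : ℕ → ℝ≥0∞ := fun n => (∑ i ∈ Finset.range (2 ^ n),
      ‖x (T * ((i + 1 : ℕ) : ℝ) / 2 ^ n) - x (T * (i : ℝ) / 2 ^ n)‖ₑ ^ (2 : ℝ)) ^ (1 / 2 : ℝ) with ha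
  have hinc : ∀ n i, i < 2 ^ n →
      ‖x (T * ((i + 1 : ℕ) : ℝ) / 2 ^ n) - x (T * (i : ℝ) / 2 ^ n)‖ₑ ≤ a n := by
    intro n i hi
    have h1 := Finset.single_le_sum (f := fun i : ℕ =>
      ‖x (T * ((i + 1 : ℕ) : ℝ) / 2 ^ n) - x (T * (i : ℝ) / 2 ^ n)‖ₑ ^ (2 : ℝ))
      (fun _ _ => zero_le) (Finset.mem_range.2 hi)
    have h2 := ENNReal.rpow_le_rpow h1 (z := 1 / 2) (by norm_num)
    rw [← ENNReal.rpow_mul] at h2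
    norm_num at h2
    simpa only [ha, ENNReal.rpow_two, Nat.cast_add, Nat.cast_one] using h2
  have key : ∀ n i : ℕ, i ≤ 2 ^ n →
      ‖x (T * (i : ℝ) / 2 ^ n)‖ₑ ≤ ∑ m ∈ Finset.range (n + 1), a m := by
    intro n
    induction n with
    | zero =>
      intro i hi
      rw [Finset.sum_range_one]
      have : i = 0 ∨ i = 1 := by
        rw [pow_zero] at hi
        omega
      rcases this with rfl | rfl
      · simp [h0]
      · have := hinc 0 0 (by norm_num)
        simpa [h0] using this
    | succ n ih =>
      intro i hi
      have hp : ∀ k : ℕ, T * ((2 * k : ℕ) : ℝ) / 2 ^ (n + 1) = T * (k : ℝ) / 2 ^ n := fun k => by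
        push_cast
        field_simp
        ring
      rw [pow_succ] at hi
      rw [Finset.sum_range_succ]
      rcases Nat.even_or_odd' i with ⟨k, rfl | rfl⟩
      · rw [hp]
        exact (ih k (by omega)).trans le_self_add
      · have h1 := hinc (n + 1) (2 * k) (by rw [pow_succ]; omega)
        rw [hp] at h1
        calc _ = ‖x (T * (k : ℝ) / 2 ^ n) +
              (x (T * ((2 * k + 1 : ℕ) : ℝ) / 2 ^ (n + 1)) - x (T * (k : ℝ) / 2 ^ n))‖ₑ := by
              rw [add_sub_cancel]
          _ ≤ _ := (enorm_add_le _ _).trans (add_le_add (ih k (by omega)) h1)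
  have hfl : ∀ n : ℕ, ⌊t / T * 2 ^ n⌋₊ ≤ 2 ^ n := fun n => by
    have h1 : t / T ≤ 1 := (div_le_one hT).2 ht.2
    have h2 : ⌊t / T * 2 ^ n⌋₊ ≤ ⌊((2 ^ n : ℕ) : ℝ)⌋₊ := Nat.floor_le_floor (by
      push_cast
      exact mul_le_of_le_one_left (by positivity) h1)
    rwa [Nat.floor_natCast] at h2
  have hlim : Tendsto (fun n : ℕ => T * (⌊t / T * 2 ^ n⌋₊ : ℝ) / 2 ^ n) atTop (𝓝 t) := by
    have h1 := (tendsto_nat_floor_mul_div_atTop (R := ℝ) (div_nonneg ht.1 hT.le)).comp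
      (tendsto_pow_atTop_atTop_of_one_lt (one_lt_two (α := ℝ)))
    have h2 := h1.const_mul T
    rw [mul_div_cancel₀ _ hT.ne'] at h2
    refine h2.congr fun n => ?_
    simp only [Function.comp_apply, mul_div_assoc]
  have hmem : ∀ n : ℕ, T * (⌊t / T * 2 ^ n⌋₊ : ℝ) / 2 ^ n ∈ Icc 0 T := fun n => by
    refine ⟨by positivity, ?_⟩
    rw [div_le_iff₀ (by positivity)]
    exact mul_le_mul_of_nonneg_left (by exact_mod_cast hfl n) hT.le
  have hx := ((hc t ht).tendsto.comp (tendsto_nhdsWithin_iff.2 ⟨hlim, .of_forall hmem⟩)).enorm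
  exact le_of_tendsto' hx fun n => (key n _ (hfl n)).trans (ENNReal.sum_le_tsum _)

variable {Ω : Type*} [MeasurableSpace Ω] {P : Measure Ω} [IsProbabilityMeasure P] {T : ℝ}

theorem lintegral_rpow_half_le {A : Ω → ℝ≥0∞} (hA : AEMeasurable A P) :
    ∫⁻ ω, A ω ^ (1 / 2 : ℝ) ∂P ≤ (∫⁻ ω, A ω ∂P) ^ (1 / 2 : ℝ) := by
  have h := ENNReal.lintegral_mul_le_Lp_mul_Lq P (p := 2) (q := 2) Real.HolderConjugate.two_two
    (hA.pow_const (1 / 2 : ℝ)) (aemeasurable_const (b := (1 : ℝ≥0∞)))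
  have e : ∀ ω, (A ω ^ (1 / 2 : ℝ)) ^ (2 : ℝ) = A ω := fun ω => by
    rw [← ENNReal.rpow_mul]
    norm_num
  simpa only [Pi.mul_apply, mul_one, ENNReal.one_rpow, lintegral_one, measure_univ, e] using h

theorem tsum_dyadic_ne_top {ε : ℝ} (hε : 0 < ε) (hT : 0 < T) {c : ℝ≥0∞} (hc : c ≠ ∞) :
    ∑' n : ℕ, (ENNReal.ofReal ((T / 2 ^ n) ^ ε) * c) ^ (1 / 2 : ℝ) ≠ ∞ := by
  set ρ : ℝ≥0∞ := ENNReal.ofReal ((1 / 2) ^ ε) ^ (1 / 2 : ℝ) with hρ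
  have hρ1 : ρ < 1 := by
    refine ENNReal.rpow_lt_one ?_ (by norm_num)
    rw [← ENNReal.ofReal_one]
    exact (ENNReal.ofReal_lt_ofReal_iff one_pos).2
      (Real.rpow_lt_one (by norm_num) (by norm_num) hε)
  have e : ∀ n : ℕ, (ENNReal.ofReal ((T / 2 ^ n) ^ ε) * c) ^ (1 / 2 : ℝ) =
      (ENNReal.ofReal (T ^ ε) * c) ^ (1 / 2 : ℝ) * ρ ^ n := fun n => by
    have h1 : (T / 2 ^ n) ^ ε = T ^ ε * ((1 / 2) ^ ε) ^ n := by
      rw [div_eq_mul_one_div, Real.mul_rpow hT.le (by positivity), ← one_div_pow,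
        ← Real.rpow_natCast, ← Real.rpow_natCast, ← Real.rpow_mul (by norm_num),
        ← Real.rpow_mul (by norm_num), mul_comm ε]
    rw [h1, ENNReal.ofReal_mul (by positivity), ENNReal.ofReal_pow (by positivity),
      mul_right_comm, ENNReal.mul_rpow_of_nonneg _ (_ ^ n) (by norm_num), hρ,
      ← ENNReal.rpow_natCast, ← ENNReal.rpow_natCast, ← ENNReal.rpow_mul, ← ENNReal.rpow_mul,
      mul_comm (n : ℝ)]
  simp_rw [e]
  rw [ENNReal.tsum_mul_left, ENNReal.tsum_geometric]
  refine ENNReal.mul_ne_top (ENNReal.rpow_ne_top_of_nonneg (by norm_num)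
    (ENNReal.mul_ne_top ENNReal.ofReal_ne_top hc)) ?_
  exact ENNReal.inv_ne_top.2 (tsub_pos_of_lt hρ1).ne'

/-- A maximal inequality for processes with small increments. -/
theorem exists_maximal_bound {ε : ℝ} (hε : 0 < ε) (hT : 0 < T) (ν : Measure ℝ)
    [IsFiniteMeasure ν] : ∃ C : ℝ≥0∞, C ≠ ∞ ∧ ∀ (D : ℝ → Ω → ℝ) (δ : ℝ≥0∞),
      (∀ t ∈ Icc 0 T, AEStronglyMeasurable (D t) P) →
      (∀ᵐ ω ∂P, ContinuousOn (fun t => D t ω) (Icc 0 T)) → (∀ᵐ ω ∂P, D 0 ω = 0) →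
      (∀ x y, 0 ≤ x → x ≤ y → y ≤ T → eLpNorm (fun ω => D y ω - D x ω) 2 P ≤
        (ENNReal.ofReal ((y - x) ^ ε) * ν (Ioc x y)) ^ (1 / 2 : ℝ) * δ) →
      ∃ S : Ω → ℝ≥0∞, AEMeasurable S P ∧ ∫⁻ ω, S ω ∂P ≤ C * δ ∧
        ∀ᵐ ω ∂P, ∀ t ∈ Icc 0 T, ‖D t ω‖ₑ ≤ S ω := by
  refine ⟨∑' n : ℕ, (ENNReal.ofReal ((T / 2 ^ n) ^ ε) * ν univ) ^ (1 / 2 : ℝ),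
    tsum_dyadic_ne_top hε hT (measure_ne_top _ _), fun D δ hDm hDc hD0 hD => ?_⟩
  set τ : ℕ → ℕ → ℝ := fun n i => T * (i : ℝ) / 2 ^ n with hτ
  have hτ0 : ∀ n i, 0 ≤ τ n i := fun n i => by positivity
  have hτT : ∀ n i, i ≤ 2 ^ n → τ n i ≤ T := fun n i hi => by
    rw [hτ]
    dsimp only
    rw [div_le_iff₀ (by positivity)]
    exact mul_le_mul_of_nonneg_left (by exact_mod_cast hi) hT.le
  have hτm : ∀ n, Monotone (τ n) := fun n i j hij => by
    simp only [hτ]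
    gcongr
  have hτs : ∀ n i, τ n (i + 1) - τ n i = T / 2 ^ n := fun n i => by
    simp only [hτ]
    push_cast
    ring
  set A : ℕ → Ω → ℝ≥0∞ := fun n ω => ∑ i ∈ Finset.range (2 ^ n),
    ‖D (τ n (i + 1)) ω - D (τ n i) ω‖ₑ ^ (2 : ℝ) with hA
  have hm : ∀ n, ∀ i ∈ Finset.range (2 ^ n),
      AEMeasurable (fun ω => ‖D (τ n (i + 1)) ω - D (τ n i) ω‖ₑ ^ (2 : ℝ)) P := by
    intro n i hi
    have hi := Finset.mem_range.1 hi
    exact ((hDm _ ⟨hτ0 _ _, hτT n _ hi⟩).sub (hDm _ ⟨hτ0 _ _, hτT n i hi.le⟩)).enorm.pow_const _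
  have hAm : ∀ n, AEMeasurable (A n) P := fun n => Finset.aemeasurable_fun_sum _ (hm n)
  refine ⟨fun ω => ∑' n, A n ω ^ (1 / 2 : ℝ), AEMeasurable.tsum fun n => (hAm n).pow_const _, ?_, ?_⟩
  · rw [lintegral_tsum fun n => (hAm n).pow_const _, ← ENNReal.tsum_mul_right]
    refine ENNReal.tsum_le_tsum fun n => ?_
    refine (lintegral_rpow_half_le (hAm n)).trans ?_
    have h1 : ∫⁻ ω, A n ω ∂P ≤ ENNReal.ofReal ((T / 2 ^ n) ^ ε) * ν univ * δ ^ (2 : ℝ) := by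
      rw [hA, lintegral_finsetSum' _ (hm n)]
      calc _ ≤ ∑ i ∈ Finset.range (2 ^ n), ENNReal.ofReal ((T / 2 ^ n) ^ ε) *
            ν (Ioc (τ n i) (τ n (i + 1))) * δ ^ (2 : ℝ) := by
            refine Finset.sum_le_sum fun i hi => ?_
            rw [← eLpNorm_two_rpow]
            refine (ENNReal.rpow_le_rpow (hD _ _ (hτ0 n i) (hτm n i.le_succ)
              (hτT n _ (Finset.mem_range.1 hi))) (by norm_num)).trans_eq ?_
            rw [ENNReal.mul_rpow_of_nonneg _ _ (by norm_num), ← ENNReal.rpow_mul, hτs]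
            norm_num
        _ = ENNReal.ofReal ((T / 2 ^ n) ^ ε) *
            (∑ i ∈ Finset.range (2 ^ n), ν (Ioc (τ n i) (τ n (i + 1)))) * δ ^ (2 : ℝ) := by
            rw [← Finset.sum_mul, Finset.mul_sum]
        _ ≤ _ := by
            gcongr
            refine sum_measure_le_measure_univ (fun i _ => measurableSet_Ioc.nullMeasurableSet) ?_
            intro i _ j _ hij
            exact ((hτm n).pairwise_disjoint_on_Ioc_succ hij).aedisjoint
    refine (ENNReal.rpow_le_rpow h1 (by norm_num)).trans_eq ?_
    rw [ENNReal.mul_rpow_of_nonneg _ _ (by norm_num), ← ENNReal.rpow_mul δ]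
    norm_num
  · filter_upwards [hDc, hD0] with ω h1 h2 t ht
    exact enorm_le_tsum_dyadic hT h1 h2 ht

end Chaining

section Series

set_option linter.unusedSectionVars false

variable {Ω : Type*} [MeasurableSpace Ω] {P : Measure Ω} [IsProbabilityMeasure P] {H T : ℝ}

theorem absNorm_congr_ae {V : Type*} [NormedAddCommGroup V] {φ ψ : ℝ → V}
    (h : φ =ᵐ[leb T] ψ) : absNorm H T φ = absNorm H T ψ := by
  unfold absNorm
  congr 1
  refine lintegral_congr_ae ?_
  filter_upwards [h] with t ht
  refine lintegral_congr_ae ?_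
  filter_upwards [h] with s hs
  rw [ht, hs]

theorem innerH_congr_right {φ ψ ψ' : ℝ → ℝ} (h : ψ =ᵐ[leb T] ψ') :
    innerH H T φ ψ = innerH H T φ ψ' := by
  refine integral_congr_ae (ae_of_all _ fun t => integral_congr_ae ?_)
  filter_upwards [h] with s hs
  rw [hs]

theorem IsSkorohodIntegral.congr_left {β : ℝ → Ω → ℝ} {U U' : Ω → ℝ → ℝ} {X : Ω → ℝ}
    (h : IsSkorohodIntegral H T P β U X) (a : ℝ) (hU : ∀ ω s, s ≠ a → U ω s = U' ω s) :
    IsSkorohodIntegral H T P β U' X := by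
  have ha : ∀ᵐ s ∂leb T, s ≠ a := by simp [ae_iff]
  have hae : ∀ ω, U ω =ᵐ[leb T] U' ω := fun ω => by
    filter_upwards [ha] with s hs using hU ω s hs
  refine ⟨h.1.congr ?_, ?_, h.2.2.1, h.2.2.2.1, fun F => ?_⟩
  · have : ∀ᵐ z : Ω × ℝ ∂P.prod (leb T), z.2 ≠ a := Measure.quasiMeasurePreserving_snd.ae ha
    filter_upwards [this] with z hz using hU z.1 z.2 hz
  · simp_rw [← absNorm_congr_ae (hae _)]
    exact h.2.1
  · simp_rw [← innerH_congr_right (hae _)]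
    exact h.2.2.2.2 F

theorem isSkorohodIntegral_Icc_iff {β : ℝ → Ω → ℝ} {U : Ω → ℝ → ℝ} {X : Ω → ℝ} {t : ℝ} :
    IsSkorohodIntegral H T P β (fun ω s => (Icc 0 t).indicator (U ω) s) X ↔
      IsSkorohodIntegral H T P β (fun ω => (Ioc 0 t).indicator (U ω)) X := by
  have h : ∀ ω s, s ≠ 0 → (Icc 0 t).indicator (U ω) s = (Ioc 0 t).indicator (U ω) s := by
    intro ω s hs
    have : s ∈ Icc 0 t ↔ s ∈ Ioc 0 t := by
      simp only [mem_Icc, mem_Ioc, lt_iff_le_and_ne, hs.symm, ne_eq, not_false_eq_true, and_true]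
    by_cases h1 : s ∈ Ioc 0 t
    · rw [indicator_of_mem h1, indicator_of_mem (this.2 h1)]
    · rw [indicator_of_notMem h1, indicator_of_notMem fun h2 => h1 (this.1 h2)]
  exact ⟨fun h' => h'.congr_left 0 h, fun h' => h'.congr_left 0 fun ω s hs => (h ω s hs).symm⟩

theorem lintegral_sq_eq_ofReal {f : Ω → ℝ} (hf : MemLp f 2 P) :
    ∫⁻ ω, ‖f ω‖ₑ ^ (2 : ℝ) ∂P = ENNReal.ofReal (∫ ω, f ω * f ω ∂P) := by
  have hnn : ∀ ω, 0 ≤ f ω * f ω := fun ω => mul_self_nonneg _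
  have hi : Integrable (fun ω => f ω * f ω) P := hf.integrable_mul hf
  rw [ofReal_integral_eq_lintegral_ofReal hi (ae_of_all _ hnn)]
  refine lintegral_congr fun ω => ?_
  rw [ENNReal.rpow_two, sq, ← enorm_mul, Real.enorm_of_nonneg (hnn ω)]

theorem lintegral_sum_sq_of_orthogonal {X : ℕ → Ω → ℝ} (hX : ∀ k, MemLp (X k) 2 P)
    (h : ∀ k l, k ≠ l → ∫ ω, X k ω * X l ω ∂P = 0) (K : ℕ) :
    ∫⁻ ω, ‖∑ k ∈ Finset.range K, X k ω‖ₑ ^ (2 : ℝ) ∂P =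
      ∑ k ∈ Finset.range K, ∫⁻ ω, ‖X k ω‖ₑ ^ (2 : ℝ) ∂P := by
  have hi : ∀ k l, Integrable (fun ω => X k ω * X l ω) P := fun k l => (hX k).integrable_mul (hX l)
  simp_rw [lintegral_sq_eq_ofReal (hX _)]
  rw [lintegral_sq_eq_ofReal (f := fun ω => ∑ k ∈ Finset.range K, X k ω)
    (memLp_finsetSum _ fun k _ => hX k), ← ENNReal.ofReal_sum_of_nonneg fun k _ =>
      integral_nonneg fun ω => mul_self_nonneg _]
  simp_rw [Finset.sum_mul_sum]
  rw [integral_finsetSum _ fun k _ => integrable_finsetSum _ fun l _ => hi k l]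
  congr 1
  refine Finset.sum_congr rfl fun k hk => ?_
  rw [integral_finsetSum _ fun l _ => hi k l, Finset.sum_eq_single_of_mem k hk fun l _ hl =>
    h k l hl.symm]

variable {β : ℕ → ℝ → Ω → ℝ} {d : ℕ} {p : ℝ≥0∞} [Fact (1 ≤ p)] {n : ℝ}

/-- The bound on Skorohod integrals established in `exists_isSkorohodIntegral_pairing`. -/
def HasSkorohodBound (H T : ℝ) (P : Measure Ω) (β : ℕ → ℝ → Ω → ℝ) (g : ℕ → Ω → ℝ → Sob d p n)
    (ε : ℝ) (ν : Measure ℝ) : Prop :=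
  ∀ x y : ℝ, 0 ≤ x → x ≤ y → y ≤ T → ∀ χ : Schw d, ∃ Z : ℕ → Ω → ℝ,
    (∀ k, IsSkorohodIntegral H T P (β k)
      (fun ω => (Ioc x y).indicator fun s => (g k ω s).toDist χ) (Z k)) ∧
    ∀ K, ∑ k ∈ Finset.range K, ∫⁻ ω, ‖Z k ω‖ₑ ^ (2 : ℝ) ∂P ≤
      ENNReal.ofReal ((y - x) ^ ε) * dualNorm d p n χ ^ (2 : ℝ) * ν (Ioc x y)

theorem HasSkorohodBound.eLpNorm_sum_le (hβ : ∀ k, IsFBM H T P (β k)) (hH : 1 / 2 < H)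
    (hH' : H < 1) (hT : 0 ≤ T)
    (hind : iIndepFun (fun k ω (t : Icc (0 : ℝ) T) => β k t ω) P) {g : ℕ → Ω → ℝ → Sob d p n}
    {ε : ℝ} {ν : Measure ℝ} (hB : HasSkorohodBound H T P β g ε ν) {x y : ℝ} (hx : 0 ≤ x)
    (hxy : x ≤ y) (hy : y ≤ T) {χ : Schw d} {W : ℕ → Ω → ℝ}
    (hW : ∀ k, IsSkorohodIntegral H T P (β k)
      (fun ω => (Ioc x y).indicator fun s => (g k ω s).toDist χ) (W k)) (K : ℕ) :
    eLpNorm (fun ω => ∑ k ∈ Finset.range K, W k ω) 2 P ≤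
      (ENNReal.ofReal ((y - x) ^ ε) * ν (Ioc x y)) ^ (1 / 2 : ℝ) * dualNorm d p n χ := by
  obtain ⟨Z, hZ, hZb⟩ := hB x y hx hxy hy χ
  rw [← ENNReal.rpow_le_rpow_iff (two_pos (α := ℝ)), eLpNorm_two_rpow,
    lintegral_sum_sq_of_orthogonal (fun k => (hW k).2.2.1)
      fun k l hkl => IsSkorohodIntegral.integral_mul_eq_zero hβ hind hkl (hW k) (hW l)]
  have e : ∀ k, ∫⁻ ω, ‖W k ω‖ₑ ^ (2 : ℝ) ∂P = ∫⁻ ω, ‖Z k ω‖ₑ ^ (2 : ℝ) ∂P := fun k => by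
    refine lintegral_congr_ae ?_
    filter_upwards [(hW k).ae_eq (hβ k) hH hH' hT (hZ k)] with ω hω
    rw [hω]
  simp_rw [e]
  refine (hZb K).trans_eq ?_
  rw [ENNReal.mul_rpow_of_nonneg _ (dualNorm d p n χ) zero_le_two, ← ENNReal.rpow_mul]
  norm_num
  ring

/-- The difference of two Skorohod series over an interval. -/
theorem HasSkorohodBound.eLpNorm_sub_le (hβ : ∀ k, IsFBM H T P (β k)) (hH : 1 / 2 < H)
    (hH' : H < 1) (hT : 0 ≤ T)
    (hind : iIndepFun (fun k ω (t : Icc (0 : ℝ) T) => β k t ω) P) {g : ℕ → Ω → ℝ → Sob d p n}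
    {ε : ℝ} {ν : Measure ℝ} (hB : HasSkorohodBound H T P β g ε ν) {x y : ℝ} (hx : 0 ≤ x)
    (hxy : x ≤ y) (hy : y ≤ T) {χ χ' : Schw d} {X X' : ℝ → Ω → ℝ}
    (hX : IsSkorohodSeries H T P β (fun k ω s => (g k ω s).toDist χ) X)
    (hX' : IsSkorohodSeries H T P β (fun k ω s => (g k ω s).toDist χ') X') :
    eLpNorm (fun ω => (X y ω - X' y ω) - (X x ω - X' x ω)) 2 P ≤
      (ENNReal.ofReal ((y - x) ^ ε) * ν (Ioc x y)) ^ (1 / 2 : ℝ) * dualNorm d p n (χ - χ') := by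
  have mx : x ∈ Icc 0 T := ⟨hx, hxy.trans hy⟩
  have my : y ∈ Icc 0 T := ⟨hx.trans hxy, hy⟩
  obtain ⟨m1, Y1, h1, t1⟩ := hX.2 y my
  obtain ⟨m2, Y2, h2, t2⟩ := hX.2 x mx
  obtain ⟨m3, Y3, h3, t3⟩ := hX'.2 y my
  obtain ⟨m4, Y4, h4, t4⟩ := hX'.2 x mx
  set W : ℕ → Ω → ℝ := fun k ω => (Y1 k ω - Y3 k ω) - (Y2 k ω - Y4 k ω) with hW
  have hWi : ∀ k, IsSkorohodIntegral H T P (β k)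
      (fun ω => (Ioc x y).indicator fun s => (g k ω s).toDist (χ - χ')) (W k) := by
    intro k
    have h5 := ((h1 k).sub hH hH' (h3 k)).sub hH hH' ((h2 k).sub hH hH' (h4 k))
    refine h5.congr_left 0 fun ω s _ => ?_
    rw [indicator_apply, indicator_apply, indicator_apply, indicator_apply, indicator_apply]
    simp only [map_sub, mem_Icc, mem_Ioc]
    by_cases a1 : s ≤ x
    · by_cases a2 : 0 ≤ s
      · simp [a1, a2, a1.trans hxy, not_lt.2 a1]
      · simp [a2, not_lt.2 a1]
    · have a2 : 0 ≤ s := hx.trans (not_le.1 a1).le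
      simp [a1, a2, not_le.1 a1]
      by_cases a3 : s ≤ y <;> simp [a3]
  have hm : ∀ (Y : ℕ → Ω → ℝ), (∀ k, MemLp (Y k) 2 P) → ∀ N,
      AEStronglyMeasurable (fun ω => ∑ k ∈ Finset.range N, Y k ω) P := fun Y hY N =>
    (memLp_finsetSum _ fun k _ => hY k).1
  have hlim : Tendsto (fun N => (ENNReal.ofReal ((y - x) ^ ε) * ν (Ioc x y)) ^ (1 / 2 : ℝ) *
      dualNorm d p n (χ - χ') +
      (eLpNorm (fun ω => X y ω - ∑ k ∈ Finset.range N, Y1 k ω) 2 P +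
        eLpNorm (fun ω => X' y ω - ∑ k ∈ Finset.range N, Y3 k ω) 2 P +
        (eLpNorm (fun ω => X x ω - ∑ k ∈ Finset.range N, Y2 k ω) 2 P +
        eLpNorm (fun ω => X' x ω - ∑ k ∈ Finset.range N, Y4 k ω) 2 P))) atTop
      (𝓝 ((ENNReal.ofReal ((y - x) ^ ε) * ν (Ioc x y)) ^ (1 / 2 : ℝ) *
        dualNorm d p n (χ - χ') + (0 + 0 + (0 + 0)))) :=
    tendsto_const_nhds.add ((t1.add t3).add (t2.add t4))
  rw [add_zero, add_zero, add_zero] at hlim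
  refine ge_of_tendsto' hlim fun N => ?_
  have n1 := m1.sub (hm Y1 (fun k => (h1 k).2.2.1) N)
  have n2 := m2.sub (hm Y2 (fun k => (h2 k).2.2.1) N)
  have n3 := m3.sub (hm Y3 (fun k => (h3 k).2.2.1) N)
  have n4 := m4.sub (hm Y4 (fun k => (h4 k).2.2.1) N)
  have e : (fun ω => (X y ω - X' y ω) - (X x ω - X' x ω)) =
      (fun ω => ∑ k ∈ Finset.range N, W k ω) +
      (((fun ω => X y ω - ∑ k ∈ Finset.range N, Y1 k ω) -
        (fun ω => X' y ω - ∑ k ∈ Finset.range N, Y3 k ω)) -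
      ((fun ω => X x ω - ∑ k ∈ Finset.range N, Y2 k ω) -
        fun ω => X' x ω - ∑ k ∈ Finset.range N, Y4 k ω)) := by
    funext ω
    simp only [hW, Pi.add_apply, Pi.sub_apply, Finset.sum_sub_distrib]
    ring
  rw [e]
  refine (eLpNorm_add_le (hm W (fun k => (hWi k).2.2.1) N) ((n1.sub n3).sub (n2.sub n4))
    (by norm_num)).trans (add_le_add (hB.eLpNorm_sum_le hβ hH hH' hT hind hx hxy hy hWi N) ?_)
  refine (MeasureTheory.eLpNorm_sub_le (n1.sub n3) (n2.sub n4) (by norm_num)).trans (add_le_add ?_ ?_)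
  · exact MeasureTheory.eLpNorm_sub_le n1 n3 (by norm_num)
  · exact MeasureTheory.eLpNorm_sub_le n2 n4 (by norm_num)

end Series

section Limit

set_option linter.unusedSectionVars false

variable {Ω : Type*} [m0 : MeasurableSpace Ω] {H T : ℝ} {P : Measure Ω} [IsProbabilityMeasure P]
variable {d : ℕ} {p : ℝ≥0∞} [Fact (1 ≤ p)] {n : ℝ}

theorem dualNorm_sub_le (χ χ' χ'' : Schw d) :
    dualNorm d p n (χ - χ') ≤ dualNorm d p n (χ - χ'') + dualNorm d p n (χ' - χ'') := by
  have hpq : ENNReal.HolderConjugate p (1 - p⁻¹)⁻¹ :=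
    ENNReal.HolderConjugate.inv_one_sub_inv' (Fact.out : 1 ≤ p)
  have e : besselSchw d (-n) (χ - χ') =
      besselSchw d (-n) (χ - χ'') - besselSchw d (-n) (χ' - χ'') := by
    simp only [map_sub]
    abel
  simp only [dualNorm, e]
  exact eLpNorm_sub_le (SchwartzMap.continuous _).aestronglyMeasurable
    (SchwartzMap.continuous _).aestronglyMeasurable (ENNReal.HolderConjugate.one_le _ p)

theorem continuousOn_of_tsum_enorm_sub {x : ℕ → ℝ → ℝ} {y : ℝ → ℝ} {s : ℕ → ℝ≥0∞} {I : Set ℝ}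
    (hs : ∑' j, s j ≠ ∞) (hc : ∀ j, ContinuousOn (x j) I)
    (hx : ∀ j, ∀ t ∈ I, ‖x (j + 1) t - x j t‖ₑ ≤ s j)
    (hy : ∀ t ∈ I, Tendsto (fun j => x j t) atTop (𝓝 (y t))) : ContinuousOn y I := by
  have hu : TendstoUniformlyOn x y atTop I := by
    rw [EMetric.tendstoUniformlyOn_iff]
    intro ε hε
    filter_upwards [(ENNReal.tendsto_sum_nat_add s hs).eventually (gt_mem_nhds hε)] with j hj t ht
    refine lt_of_le_of_lt ?_ hj
    rw [edist_comm]
    refine (edist_le_tsum_of_edist_le_of_tendsto s (fun i => ?_) (hy t ht) j).trans_eq ?_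
    · rw [edist_comm, edist_eq_enorm_sub]
      exact hx i t ht
    · simp_rw [add_comm]
  exact hu.continuousOn (Frequently.of_forall hc)

theorem HasSkorohodBound.isSkorohodSeries_of_le_pow {β : ℕ → ℝ → Ω → ℝ}
    (hβ : ∀ k, IsFBM H T P (β k)) (hH : 1 / 2 < H) (hH' : H < 1) (hT : 0 < T)
    (hind : iIndepFun (fun k ω (t : Icc (0 : ℝ) T) => β k t ω) P) {g : ℕ → Ω → ℝ → Sob d p n}
    {ε : ℝ} (hε : 0 < ε) {ν : Measure ℝ} [IsFiniteMeasure ν] (hB : HasSkorohodBound H T P β g ε ν)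
    {ψ : ℕ → Schw d} {χ : Schw d} (hψ : ∀ j, dualNorm d p n (ψ j - χ) ≤ 2⁻¹ ^ j)
    {X : ℕ → ℝ → Ω → ℝ} {Y : ℝ → Ω → ℝ}
    (hX : ∀ j, IsSkorohodSeries H T P β (fun k ω s => (g k ω s).toDist (ψ j)) (X j))
    (hX0 : ∀ j, ∀ᵐ ω ∂P, X j 0 ω = 0)
    (hXY : ∀ᵐ ω ∂P, ∀ t ∈ Icc 0 T, Tendsto (fun j => X j t ω) atTop (𝓝 (Y t ω))) :
    IsSkorohodSeries H T P β (fun k ω s => (g k ω s).toDist χ) Y := by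
  have hd : ∀ i j, j ≤ i → dualNorm d p n (ψ i - ψ j) ≤ 2 * 2⁻¹ ^ j := fun i j hij => by
    refine (dualNorm_sub_le _ _ χ).trans ((add_le_add (hψ i) (hψ j)).trans ?_)
    rw [two_mul]
    exact add_le_add (pow_le_pow_right_of_le_one' (by simp) hij) le_rfl
  refine ⟨?_, fun t ht => ?_⟩
  · obtain ⟨C, hC, hmax⟩ := exists_maximal_bound (P := P) hε hT ν
    have h1 : ∀ j, ∃ S : Ω → ℝ≥0∞, AEMeasurable S P ∧
        ∫⁻ ω, S ω ∂P ≤ C * dualNorm d p n (ψ (j + 1) - ψ j) ∧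
        ∀ᵐ ω ∂P, ∀ t ∈ Icc 0 T, ‖X (j + 1) t ω - X j t ω‖ₑ ≤ S ω := fun j => by
      refine hmax (fun t ω => X (j + 1) t ω - X j t ω) _ (fun t ht =>
        ((hX (j + 1)).2 t ht).1.sub ((hX j).2 t ht).1) ?_ ?_ fun x y hx hxy hy =>
        hB.eLpNorm_sub_le hβ hH hH' hT.le hind hx hxy hy (hX (j + 1)) (hX j)
      · filter_upwards [(hX (j + 1)).1, (hX j).1] with ω h1 h2 using h1.sub h2
      · filter_upwards [hX0 (j + 1), hX0 j] with ω h1 h2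
        rw [h1, h2, sub_zero]
    choose S hSm hSi hS using h1
    have h2 : ∫⁻ ω, ∑' j, S j ω ∂P ≠ ∞ := by
      rw [lintegral_tsum hSm]
      refine ne_top_of_le_ne_top ?_ (ENNReal.tsum_le_tsum fun j =>
        (hSi j).trans (mul_le_mul_right (hd (j + 1) j j.le_succ) C))
      rw [ENNReal.tsum_mul_left, ENNReal.tsum_mul_left, ENNReal.tsum_geometric]
      refine ENNReal.mul_ne_top hC (ENNReal.mul_ne_top (by simp) ?_)
      simp
    filter_upwards [ae_lt_top' (AEMeasurable.tsum hSm) h2, ae_all_iff.2 hS, hXY,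
      ae_all_iff.2 fun j => (hX j).1] with ω w1 w2 w3 w4
    exact continuousOn_of_tsum_enorm_sub w1.ne w4 w2 w3
  · have hXYt : ∀ᵐ ω ∂P, Tendsto (fun j => X j t ω) atTop (𝓝 (Y t ω)) := by
      filter_upwards [hXY] with ω h using h t ht
    have hYm : AEStronglyMeasurable (Y t) P :=
      aestronglyMeasurable_of_tendsto_ae atTop (fun j => ((hX j).2 t ht).1) hXYt
    have m0 : (0 : ℝ) ∈ Icc 0 T := ⟨le_rfl, hT.le⟩
    set c : ℝ≥0∞ := (ENNReal.ofReal ((t - 0) ^ ε) * ν (Ioc 0 t)) ^ (1 / 2 : ℝ) with hc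
    have hct : c ≠ ∞ := ENNReal.rpow_ne_top_of_nonneg (by norm_num)
      (ENNReal.mul_ne_top (by simp) (measure_ne_top _ _))
    obtain ⟨Z, hZ, -⟩ := hB 0 t le_rfl ht.1 ht.2 χ
    refine ⟨hYm, Z, fun k => isSkorohodIntegral_Icc_iff.2 (hZ k), ?_⟩
    have b1 : ∀ j, eLpNorm (fun ω => Y t ω - X j t ω) 2 P ≤ c * (2 * 2⁻¹ ^ j) := fun j => by
      refine Lp.eLpNorm_le_of_ae_tendsto (u := atTop) (f := fun i ω => X i t ω - X j t ω) ?_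
        (fun i => ((hX i).2 t ht).1.sub ((hX j).2 t ht).1) ?_
      · filter_upwards [eventually_ge_atTop j] with i hij
        refine le_trans (le_of_eq ?_) ((hB.eLpNorm_sub_le hβ hH hH' hT.le hind le_rfl ht.1 ht.2
          (hX i) (hX j)).trans (mul_le_mul_right (hd i j hij) c))
        refine eLpNorm_congr_ae ?_
        filter_upwards [hX0 i, hX0 j] with ω h1 h2
        rw [h1, h2, sub_zero, sub_zero]
      · filter_upwards [hXYt] with ω h using h.sub_const _
    have b2 : ∀ j, ∀ᶠ N in atTop, eLpNorm (fun ω => Y t ω - ∑ k ∈ Finset.range N, Z k ω) 2 P ≤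
        c * (2 * 2⁻¹ ^ j) + (2⁻¹ ^ j + c * 2⁻¹ ^ j) := fun j => by
      obtain ⟨mX, W, hW, hWt⟩ := (hX j).2 t ht
      have hp : (0 : ℝ≥0∞) < 2⁻¹ ^ j := ENNReal.pow_pos (by simp) j
      filter_upwards [hWt.eventually (ge_mem_nhds hp)] with N hN
      have hmW : AEStronglyMeasurable (fun ω => ∑ k ∈ Finset.range N, W k ω) P :=
        (memLp_finsetSum _ fun k _ => (hW k).2.2.1).1
      have hmD : AEStronglyMeasurable (fun ω => ∑ k ∈ Finset.range N, (W k ω - Z k ω)) P :=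
        (memLp_finsetSum _ fun k _ => (hW k).2.2.1.sub (hZ k).2.2.1).1
      have e : (fun ω => Y t ω - ∑ k ∈ Finset.range N, Z k ω) =
          (fun ω => Y t ω - X j t ω) + ((fun ω => X j t ω - ∑ k ∈ Finset.range N, W k ω) +
            fun ω => ∑ k ∈ Finset.range N, (W k ω - Z k ω)) := by
        funext ω
        simp only [Pi.add_apply, Finset.sum_sub_distrib]
        ring
      rw [e]
      refine (eLpNorm_add_le (hYm.sub mX) ((mX.sub hmW).add hmD) (by norm_num)).trans
        (add_le_add (b1 j) ((eLpNorm_add_le (mX.sub hmW) hmD (by norm_num)).trans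
        (add_le_add hN ?_)))
      refine (hB.eLpNorm_sum_le hβ hH hH' hT.le hind (χ := ψ j - χ) le_rfl ht.1 ht.2
        (fun k => ?_) N).trans (mul_le_mul_right (hψ j) c)
      refine ((isSkorohodIntegral_Icc_iff.1 (hW k)).sub hH hH' (hZ k)).congr_left 0 fun ω s _ => ?_
      simp only [map_sub]
      by_cases hs : s ∈ Ioc 0 t <;> simp [hs]
    have hlim : Tendsto (fun j : ℕ => c * (2 * 2⁻¹ ^ j) + (2⁻¹ ^ j + c * 2⁻¹ ^ j)) atTop
        (𝓝 (c * (2 * 0) + (0 + c * 0))) := by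
      have h0 : Tendsto (fun j : ℕ => (2⁻¹ : ℝ≥0∞) ^ j) atTop (𝓝 0) :=
        ENNReal.tendsto_pow_atTop_nhds_zero_of_lt_one (by simp)
      exact (ENNReal.Tendsto.const_mul (ENNReal.Tendsto.const_mul h0 (by simp)) (Or.inr hct)).add
        (h0.add (ENNReal.Tendsto.const_mul h0 (Or.inr hct)))
    rw [mul_zero, mul_zero, add_zero, add_zero] at hlim
    rw [ENNReal.tendsto_nhds_zero]
    intro δ hδ
    obtain ⟨j, hj⟩ := (hlim.eventually (ge_mem_nhds hδ)).exists
    filter_upwards [b2 j] with N hN using hN.trans hj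

/-- Passage to the limit in the test function of a Skorohod series. -/
theorem HasSkorohodBound.isSkorohodSeries_of_tendsto {β : ℕ → ℝ → Ω → ℝ}
    (hβ : ∀ k, IsFBM H T P (β k)) (hH : 1 / 2 < H) (hH' : H < 1) (hT : 0 < T)
    (hind : iIndepFun (fun k ω (t : Icc (0 : ℝ) T) => β k t ω) P) {g : ℕ → Ω → ℝ → Sob d p n}
    {ε : ℝ} (hε : 0 < ε) {ν : Measure ℝ} [IsFiniteMeasure ν] (hB : HasSkorohodBound H T P β g ε ν)
    {ψ : ℕ → Schw d} {χ : Schw d} (hψ : Tendsto ψ atTop (𝓝 χ))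
    {X : ℕ → ℝ → Ω → ℝ} {Y : ℝ → Ω → ℝ}
    (hX : ∀ j, IsSkorohodSeries H T P β (fun k ω s => (g k ω s).toDist (ψ j)) (X j))
    (hX0 : ∀ j, ∀ᵐ ω ∂P, X j 0 ω = 0)
    (hXY : ∀ᵐ ω ∂P, ∀ t ∈ Icc 0 T, Tendsto (fun j => X j t ω) atTop (𝓝 (Y t ω))) :
    IsSkorohodSeries H T P β (fun k ω s => (g k ω s).toDist χ) Y := by
  have h0 : Tendsto (fun j => ψ j - χ) atTop (𝓝 0) := by
    simpa using hψ.sub_const χ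
  obtain ⟨σ, hσ, hσd⟩ := extraction_forall_of_eventually (P := fun j i =>
    dualNorm d p n (ψ i - χ) ≤ 2⁻¹ ^ j) fun j =>
    (tendsto_dualNorm h0).eventually (ge_mem_nhds (ENNReal.pow_pos (by simp) j))
  refine hB.isSkorohodSeries_of_le_pow hβ hH hH' hT hind hε (ψ := fun j => ψ (σ j)) hσd
    (fun j => hX (σ j)) (fun j => hX0 (σ j)) ?_
  filter_upwards [hXY] with ω h t ht
  exact (h t ht).comp hσ.tendsto_atTop

end Limit

section SolutionSpace

set_option linter.unusedSectionVars false

variable {Ω : Type*} [m0 : MeasurableSpace Ω] {H T : ℝ} {P : Measure Ω} [IsProbabilityMeasure P]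
variable {β : ℕ → ℝ → Ω → ℝ} {d : ℕ} {p : ℝ≥0∞} [Fact (1 ≤ p)] {n n' a b : ℝ}

theorem intervalIntegrable_toDist (hp : 1 < p.toReal) {f : ℝ → Sob d p a}
    (hf : Integrable f (leb T)) {t : ℝ} (ht : t ∈ Icc 0 T) (χ : Schw d) :
    IntervalIntegrable (fun s => (f s).toDist χ) volume 0 t := by
  rw [intervalIntegrable_iff_integrableOn_Ioc_of_le ht.1]
  have h1 : IntegrableOn (fun s => pairing hp χ (f s)) (Icc 0 T) :=
    (pairing hp χ).integrable_comp hf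
  exact h1.mono_set fun s hs => ⟨hs.1.le, hs.2.trans ht.2⟩

theorem tendsto_intervalIntegral_toDist (hp : 1 < p.toReal) {f : ℝ → Sob d p a}
    (hf : Integrable f (leb T)) {t : ℝ} (ht : t ∈ Icc 0 T) {ψ : ℕ → Schw d} {χ : Schw d}
    (hψ : Tendsto ψ atTop (𝓝 χ)) :
    Tendsto (fun j => ∫ s in (0 : ℝ)..t, (f s).toDist (ψ j)) atTop
      (𝓝 (∫ s in (0 : ℝ)..t, (f s).toDist χ)) := by
  have h0 : Tendsto (fun j => ψ j - χ) atTop (𝓝 0) := by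
    simpa using hψ.sub_const χ
  have hsub : Ioc 0 t ⊆ Icc 0 T := fun s hs => ⟨hs.1.le, hs.2.trans ht.2⟩
  set B : ℝ≥0∞ := 1 + dualNorm d p a (0 - χ) with hB
  have hBt : B ≠ ∞ := by simp [hB, dualNorm_ne_top]
  refine intervalIntegral.tendsto_integral_filter_of_dominated_convergence
    (fun s => ‖f s‖ * B.toReal) (Eventually.of_forall fun j => ?_) ?_ ?_ ?_
  · rw [uIoc_of_le ht.1]
    exact ((intervalIntegrable_iff_integrableOn_Ioc_of_le ht.1).1
      (intervalIntegrable_toDist hp hf ht (ψ j))).1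
  · filter_upwards [(tendsto_dualNorm (p := p) (n := a) h0).eventually
      (ge_mem_nhds zero_lt_one)] with j hj
    refine Eventually.of_forall fun s _ => ?_
    have h1 : dualNorm d p a (ψ j) ≤ B := by
      have := dualNorm_sub_le (p := p) (n := a) (ψ j) 0 χ
      rw [sub_zero] at this
      exact this.trans (add_le_add hj le_rfl)
    have h2 := (enorm_toDist_le hp (f s) (ψ j)).trans (mul_le_mul_right h1 _)
    rw [← ENNReal.toReal_le_toReal enorm_ne_top (ENNReal.mul_ne_top enorm_ne_top hBt),
      ENNReal.toReal_mul, toReal_enorm, toReal_enorm] at h2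
    exact h2
  · rw [intervalIntegrable_iff_integrableOn_Ioc_of_le ht.1]
    have h1 : IntegrableOn (fun s => ‖f s‖ * B.toReal) (Icc 0 T) := hf.norm.mul_const _
    exact h1.mono_set hsub
  · exact Eventually.of_forall fun s _ => ((f s).toDist.continuous.tendsto χ).comp hψ

/-- The equation `du = f dt + ∑_k g^k δβ^k` holds for all Schwartz test functions. -/
theorem HasStochDiff.exists_isSkorohodSeries (hβ : ∀ k, IsFBM H T P (β k)) (hH : 1 / 2 < H)
    (hH' : H < 1) (hT : 0 < T) (hind : iIndepFun (fun k ω (t : Icc (0 : ℝ) T) => β k t ω) P)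
    (hp : 2 ≤ p.toReal) {u : ℝ → Ω → Dist d} {f : Ω → ℝ → Sob d p a} {g : ℕ → Ω → ℝ → Sob d p b}
    (hf : MemLp (fun z : Ω × ℝ => f z.1 z.2) p (P.prod (leb T))) (hg : g ∈ tildeL H T P β d p b)
    (hu : HasStochDiff H T P β u f g) (χ : Schw d) :
    ∃ X : ℝ → Ω → ℝ, IsSkorohodSeries H T P β (fun k ω s => (g k ω s).toDist χ) X ∧
      ∀ᵐ ω ∂P, ∀ t ∈ Icc 0 T,
        u t ω χ = u 0 ω χ + (∫ s in (0 : ℝ)..t, (f ω s).toDist χ) + X t ω := by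
  have hp1 : 1 < p.toReal := by linarith
  obtain ⟨ψ, hψc, hψ⟩ := exists_compactSupport_tendsto χ
  choose X hX hXe using fun j => hu (ψ j) (hψc j)
  obtain ⟨ε, hε, ν, hν, hB⟩ := exists_isSkorohodIntegral_pairing hβ hH hH' hT.le hp hg
  have hB' : HasSkorohodBound H T P β g ε ν := hB
  have hfi : ∀ᵐ ω ∂P, Integrable (f ω) (leb T) :=
    (hf.integrable Fact.out).prod_right_ae
  refine ⟨fun t ω => u t ω χ - u 0 ω χ - ∫ s in (0 : ℝ)..t, (f ω s).toDist χ,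
    hB'.isSkorohodSeries_of_tendsto hβ hH hH' hT hind hε hψ hX (fun j => ?_) ?_,
    Eventually.of_forall fun ω t _ => by ring⟩
  · filter_upwards [hXe j] with ω h
    have := h 0 ⟨le_rfl, hT.le⟩
    rw [intervalIntegral.integral_same] at this
    linarith
  · filter_upwards [ae_all_iff.2 hXe, hfi] with ω h hi t ht
    have h1 := ((((u t ω).continuous.tendsto χ).comp hψ).sub
      (((u 0 ω).continuous.tendsto χ).comp hψ)).sub
      (tendsto_intervalIntegral_toDist hp1 hi ht hψ)
    refine h1.congr fun j => ?_
    rw [Function.comp_apply, Function.comp_apply, h j t ht]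
    ring

theorem IsDS.bessel (hβ : ∀ k, IsFBM H T P (β k)) (hH : 1 / 2 < H)
    (hH' : H < 1) (hT : 0 < T) (hind : iIndepFun (fun k ω (t : Icc (0 : ℝ) T) => β k t ω) P)
    (hp' : p ≠ ∞) (hp : 2 ≤ p.toReal) {m : ℝ} (h2 : n' - 2 = n - 2 - m) (h1 : n' - 1 = n - 1 - m)
    {u : ℝ → Ω → Dist d} {f : Ω → ℝ → Sob d p (n - 2)} {g : ℕ → Ω → ℝ → Sob d p (n - 1)}
    (h : IsDS H T P β n u f g) :
    IsDS H T P β n' (fun t ω => FracHeat.bessel d m (u t ω))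
      (fun ω s => Sob.besselIso m h2 (f ω s)) (fun k ω s => Sob.besselIso m h1 (g k ω s)) := by
  obtain ⟨hf, hg, hu⟩ := h
  refine ⟨?_, tildeL_besselIso (by linarith) hH' hp' h1 hg, fun φ _ =>
    hu.exists_isSkorohodSeries hβ hH hH' hT hind hp hf hg (besselSchw d m φ)⟩
  exact (Sob.besselIso (d := d) (p := p) m
    h2).toContinuousLinearEquiv.toContinuousLinearMap.comp_memLp' hf

theorem calH_bessel (hβ : ∀ k, IsFBM H T P (β k)) (hH : 1 / 2 < H)
    (hH' : H < 1) (hT : 0 < T) (hind : iIndepFun (fun k ω (t : Icc (0 : ℝ) T) => β k t ω) P)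
    (hp' : p ≠ ∞) (hp : 2 ≤ p.toReal) {m : ℝ} (h : n' = n - m) {u : ℝ → Ω → Dist d}
    (hu : u ∈ calH H T P β d p n) :
    (fun t ω => bessel d m (u t ω)) ∈ calH H T P β d p n' := by
  obtain ⟨hm, h0, h1, h2, f, g, hfg⟩ := hu
  refine ⟨fun t ht φ _ => ?_, h0.bessel m (by linarith), h1.bessel m h, fun i j => ?_, _, _,
    hfg.bessel hβ hH hH' hT hind hp' hp (by linarith) (by linarith)⟩
  · obtain ⟨ψ, hψc, hψ⟩ := exists_compactSupport_tendsto (besselSchw d m φ)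
    exact measurable_of_tendsto_metrizable (fun j => hm t ht (ψ j) (hψc j))
      (tendsto_pi_nhds.2 fun ω => ((u t ω).continuous.tendsto _).comp hψ)
  · simp only [distDeriv2_bessel]
    exact (h2 i j).bessel m (by linarith)

theorem calHNorm_bessel_le (hβ : ∀ k, IsFBM H T P (β k)) (hH : 1 / 2 < H)
    (hH' : H < 1) (hT : 0 < T) (hind : iIndepFun (fun k ω (t : Icc (0 : ℝ) T) => β k t ω) P)
    (hp' : p ≠ ∞) (hp : 2 ≤ p.toReal) {m : ℝ} (h : n' = n - m) (u : ℝ → Ω → Dist d) :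
    calHNorm H T P β p n' (fun t ω => bessel d m (u t ω)) ≤ calHNorm H T P β p n u := by
  simp only [calHNorm, distDeriv2_bessel]
  refine add_le_add (add_le_add (lpSobNorm_bessel m (by linarith) _ _).le
    (Finset.sum_le_sum fun i _ => Finset.sum_le_sum fun j _ =>
      (lpSobNorm_bessel m (by linarith) _ _).le)) ?_
  refine le_iInf fun f => le_iInf₂ fun g hfg => ?_
  have e2 : n' - 2 = n - 2 - m := by linarith
  have e1 : n' - 1 = n - 1 - m := by linarith
  refine iInf_le_of_le (fun ω s => Sob.besselIso m e2 (f ω s)) (iInf₂_le_of_le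
    (fun k ω s => Sob.besselIso m e1 (g k ω s)) (hfg.bessel hβ hH hH' hT hind hp' hp e2 e1) ?_)
  rw [LNorm_besselIso]
  refine le_of_eq (congrArg (· + _) ?_)
  refine eLpNorm_congr_norm_ae (Eventually.of_forall fun z => ?_)
  exact LinearIsometryEquiv.norm_map _ _

theorem bessel_neg_bessel (m : ℝ) (u : Dist d) : bessel d (-m) (bessel d m u) = u := by
  rw [bessel_bessel, neg_add_cancel, bessel_zero]

theorem calHNorm_bessel (hβ : ∀ k, IsFBM H T P (β k)) (hH : 1 / 2 < H)
    (hH' : H < 1) (hT : 0 < T) (hind : iIndepFun (fun k ω (t : Icc (0 : ℝ) T) => β k t ω) P)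
    (hp' : p ≠ ∞) (hp : 2 ≤ p.toReal) {m : ℝ} (h : n' = n - m) (u : ℝ → Ω → Dist d) :
    calHNorm H T P β p n' (fun t ω => bessel d m (u t ω)) = calHNorm H T P β p n u := by
  refine (calHNorm_bessel_le hβ hH hH' hT hind hp' hp h u).antisymm ?_
  have := calHNorm_bessel_le hβ hH hH' hT hind hp' hp (m := -m) (n := n') (n' := n) (by linarith)
    fun t ω => bessel d m (u t ω)
  simpa only [bessel_neg_bessel] using this

theorem bijOn_calH (hβ : ∀ k, IsFBM H T P (β k)) (hH : 1 / 2 < H)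
    (hH' : H < 1) (hT : 0 < T) (hind : iIndepFun (fun k ω (t : Icc (0 : ℝ) T) => β k t ω) P)
    (hp' : p ≠ ∞) (hp : 2 ≤ p.toReal) (n m : ℝ) :
    BijOn (fun u t ω => bessel d m (u t ω)) (calH H T P β d p n) (calH H T P β d p (n - m)) := by
  refine BijOn.mk (fun u hu => calH_bessel hβ hH hH' hT hind hp' hp rfl hu) ?_ ?_
  · intro u _ u' _ h
    funext t ω
    have h1 := congrArg (bessel d (-m)) (congrFun (congrFun h t) ω)
    simpa only [bessel_neg_bessel] using h1
  · intro u hu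
    refine ⟨fun t ω => bessel d (-m) (u t ω),
      calH_bessel hβ hH hH' hT hind hp' hp (by linarith) hu, ?_⟩
    funext t ω
    simpa using bessel_neg_bessel (-m) (u t ω)

end SolutionSpace

end FracHeat

end

theorem mainTheorem9 {Ω : Type*} [MeasurableSpace Ω] (P : Measure Ω) [IsProbabilityMeasure P]
    (H T : ℝ) (hH : 1 / 2 < H) (hH' : H < 1) (hT : 0 < T)
    (β : ℕ → ℝ → Ω → ℝ) (hβ : ∀ k, FracHeat.IsFBM H T P (β k))
    (hind : iIndepFun (fun k ω (t : Icc (0 : ℝ) T) => β k t ω) P)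
    (d : ℕ) (p : ℝ≥0∞) [Fact (1 ≤ p)] (hp : 1 < p) (hp' : p ≠ ∞) (n m : ℝ) :
    (BijOn (fun g k ω s => (g k ω s).besselSob m)
        (FracHeat.tildeL H T P β d p n) (FracHeat.tildeL H T P β d p (n - m)) ∧
      (∀ g ∈ FracHeat.tildeL H T P β d p n,
        FracHeat.LNorm H T P β (fun k ω s => (g k ω s).besselSob m) =
          FracHeat.LNorm H T P β g) ∧
      (∀ g ∈ FracHeat.tildeL H T P β d p n, ∀ g' ∈ FracHeat.tildeL H T P β d p n,
        FracHeat.LNorm H T P β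
            (fun k ω s => (g k ω s).besselSob m - (g' k ω s).besselSob m) =
          FracHeat.LNorm H T P β (g - g'))) ∧
    (2 ≤ p →
      BijOn (fun u t ω => FracHeat.bessel d m (u t ω))
        (FracHeat.calH H T P β d p n) (FracHeat.calH H T P β d p (n - m)) ∧
      (∀ u ∈ FracHeat.calH H T P β d p n,
        FracHeat.calHNorm H T P β p (n - m) (fun t ω => FracHeat.bessel d m (u t ω)) =
          FracHeat.calHNorm H T P β p n u) ∧
      (∀ u ∈ FracHeat.calH H T P β d p n, ∀ u' ∈ FracHeat.calH H T P β d p n,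
        FracHeat.calHNorm H T P β p (n - m)
            (fun t ω => FracHeat.bessel d m (u t ω) - FracHeat.bessel d m (u' t ω)) =
          FracHeat.calHNorm H T P β p n (u - u'))) := by
  have hH0 : 0 < H := by linarith
  refine ⟨⟨FracHeat.bijOn_tildeL hH0 hH' hp' n m, fun g _ => FracHeat.LNorm_besselIso rfl g,
    fun g _ g' _ => ?_⟩, fun h2 => ?_⟩
  · rw [← FracHeat.LNorm_besselIso rfl (g - g')]
    congr 1
  · have hp2 : 2 ≤ p.toReal := by
      simpa using ENNReal.toReal_mono hp' h2
    refine ⟨FracHeat.bijOn_calH hβ hH hH' hT hind hp' hp2 n m,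
      fun u _ => FracHeat.calHNorm_bessel hβ hH hH' hT hind hp' hp2 rfl u, fun u _ u' _ => ?_⟩
    rw [← FracHeat.calHNorm_bessel hβ hH hH' hT hind hp' hp2 rfl (u - u')]
    congr 1
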